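/- Let $\alpha,\beta,\nu>0$. Let $\mathcal H^1_\alpha(\mathbb R^3)$ be the space of divergence-free vector fields $g\in H^1(\mathbb R^3;\mathbb R^3)$ with the norm $\|g\|_{\mathcal H^1_\alpha}^2=\|g\|_{L^2}^2+\alpha^2\|\nabla g\|_{L^2}^2$, let $(\varphi)_\alpha=(-\alpha^2\Delta+I)^{-1}\varphi$, and let $f\in\mathcal H^1_\alpha(\mathbb R^3)$ be a stationary (time-independent, divergence-free) force. Consider on $[0,+\infty)\times\mathbb R^3$ the damped Navier–Stokes–Bardina equations $$\partial_t u+\operatorname{div}\big((u\otimes u)_\alpha\big)-\nu\Delta u+\nabla p=f-\beta u,\qquad \operatorname{div}u=0,\qquad u(0,\cdot)=u_0 .$$ A weak solution is a pair $(u,p)$ with $u\in L^\infty([0,+\infty),\mathcal H^1_\alpha)\cap L^2_{loc}([0,+\infty),\dot H^2)$ and $p\in L^2_{loc}([0,+\infty),H^3)$ that satisfies the equations in the sense of distributions, with initial datum $u_0$ (test functions need not vanish at $t=0$). Then for every $u_0\in\mathcal H^1_\alpha(\mathbb R^3)$ there is a weak solution $(u,p)$, unique up to equality for almost every $t$, and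 $u$ has a representative in $C([0,+\infty),\mathcal H^1_\alpha)$. With this representative, the maps $S(t)u_0=u(t,\cdot)$, $t\ge 0$, satisfy $S(0)=I$ and $S(s+t)=S(s)S(t)$ for $s,t\ge0$. Moreover, the semigroup $(S(t))_{t\ge0}$ has a global attractor, that is, there is a set $\mathcal A_f\subset\mathcal H^1_\alpha(\mathbb R^3)$ such that 1. $\mathcal A_f$ is compact in $\mathcal H^1_\alpha(\mathbb R^3)$; 2. $S(t)\mathcal A_f=\mathcal A_f$ for all $t\ge 0$; 3. for every bounded set $B\subset\mathcal H^1_\alpha(\mathbb R^3)$ and every neighborhood $\mathcal V$ of $\mathcal A_f$ in $\mathcal H^1_\alpha(\mathbb R^3)$ there is $T>0$ such that $S(t)B\subset\mathcal V$ for all $t>T$. -/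

import Mathlib

open MeasureTheory Set Filter Topology
open scoped ENNReal ContDiff

noncomputable section

/-- Euclidean space `ℝ³`. -/
abbrev E3 : Type := EuclideanSpace ℝ (Fin 3)

/-- The Lebesgue space `L²(ℝ³; F)`. -/
abbrev L2 (F : Type*) [NormedAddCommGroup F] : Type _ := Lp F 2 (volume : Measure E3)

/-- Smooth compactly supported functions. -/
def IsTest {E F : Type*} [NormedAddCommGroup E] [NormedSpace ℝ E] [NormedAddCommGroup F]
    [NormedSpace ℝ F] (φ : E → F) : Prop :=
  ContDiff ℝ ∞ φ ∧ HasCompactSupport φ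

/-- The classical partial derivative `∂ᵢ φ` on `ℝ³`. -/
def pderiv3 {F : Type*} [NormedAddCommGroup F] [NormedSpace ℝ F] (i : Fin 3) (φ : E3 → F) :
    E3 → F :=
  fun x => fderiv ℝ φ x (EuclideanSpace.single i 1)

/-- `h = ∂ᵢ g` in the sense of distributions on `ℝ³`. -/
def IsWeakPartial {F : Type*} [NormedAddCommGroup F] [NormedSpace ℝ F] (i : Fin 3)
    (g h : E3 → F) : Prop :=
  ∀ φ : E3 → ℝ, IsTest φ → ∫ x, pderiv3 i φ x • g x = - ∫ x, φ x • h x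

/-- `div g = 0` in the sense of distributions on `ℝ³`. -/
def IsDivFree (g : E3 → E3) : Prop :=
  ∀ φ : E3 → ℝ, IsTest φ → ∫ x, ∑ i, pderiv3 i φ x * g x i = 0

/-! ### The energy space -/

theorem IsTest.memLp_two {φ : E3 → ℝ} (hφ : IsTest φ) : MemLp φ 2 volume :=
  hφ.1.continuous.memLp_of_hasCompactSupport hφ.2

theorem IsTest.partial_isTest {φ : E3 → ℝ} (hφ : IsTest φ) (i : Fin 3) : IsTest (pderiv3 i φ) :=
  ⟨(hφ.1.fderiv_right (m := ∞) (by simp)).clm_apply contDiff_const,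
    hφ.2.fderiv_apply ℝ _⟩

theorem IsTest.integrable_smul {F : Type*} [NormedAddCommGroup F] [NormedSpace ℝ F]
    {φ : E3 → ℝ} (hφ : IsTest φ) (g : L2 F) : Integrable (fun x => φ x • g x) volume :=
  memLp_one_iff_integrable.1 ((Lp.memLp g).smul hφ.memLp_two)

theorem IsWeakPartial.add {F : Type*} [NormedAddCommGroup F] [NormedSpace ℝ F] {i : Fin 3}
    {g h g' h' : L2 F} (H : IsWeakPartial i g h) (H' : IsWeakPartial i g' h') :
    IsWeakPartial i (g + g' : L2 F) (h + h' : L2 F) := by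
  intro φ hφ
  have e1 : ∫ x, pderiv3 i φ x • (g + g' : L2 F) x
      = ∫ x, (pderiv3 i φ x • g x + pderiv3 i φ x • g' x) := by
    refine integral_congr_ae ?_
    filter_upwards [Lp.coeFn_add g g'] with x hx
    rw [hx, Pi.add_apply, smul_add]
  have e2 : ∫ x, φ x • (h + h' : L2 F) x = ∫ x, (φ x • h x + φ x • h' x) := by
    refine integral_congr_ae ?_
    filter_upwards [Lp.coeFn_add h h'] with x hx
    rw [hx, Pi.add_apply, smul_add]
  rw [e1, e2, integral_add ((hφ.partial_isTest i).integrable_smul g) ((hφ.partial_isTest i).integrable_smul g'),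
    integral_add (hφ.integrable_smul h) (hφ.integrable_smul h'), H φ hφ, H' φ hφ, neg_add]

theorem IsWeakPartial.const_smul {F : Type*} [NormedAddCommGroup F] [NormedSpace ℝ F] {i : Fin 3}
    {g h : L2 F} (c : ℝ) (H : IsWeakPartial i g h) :
    IsWeakPartial i (c • g : L2 F) (c • h : L2 F) := by
  intro φ hφ
  have e1 : ∫ x, pderiv3 i φ x • (c • g : L2 F) x
      = ∫ x, c • (pderiv3 i φ x • g x) := by
    refine integral_congr_ae ?_
    filter_upwards [Lp.coeFn_smul c g] with x hx
    simp only [hx, Pi.smul_apply]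
    rw [smul_comm]
  have e2 : ∫ x, φ x • (c • h : L2 F) x = ∫ x, c • (φ x • h x) := by
    refine integral_congr_ae ?_
    filter_upwards [Lp.coeFn_smul c h] with x hx
    simp only [hx, Pi.smul_apply]
    rw [smul_comm]
  rw [e1, e2, integral_smul, integral_smul, H φ hφ, smul_neg]

theorem IsTest.integrable_div {φ : E3 → ℝ} (hφ : IsTest φ) (g : L2 E3) :
    Integrable (fun x => ∑ i, pderiv3 i φ x * g x i) volume := by
  refine integrable_finsetSum _ fun i _ => ?_
  simpa using (EuclideanSpace.proj (𝕜 := ℝ) i).integrable_comp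
    ((hφ.partial_isTest i).integrable_smul g)

theorem IsDivFree.add {g g' : L2 E3} (H : IsDivFree g) (H' : IsDivFree g') :
    IsDivFree (g + g' : L2 E3) := by
  intro φ hφ
  have e : ∫ x, ∑ i, pderiv3 i φ x * (g + g' : L2 E3) x i
      = ∫ x, ((∑ i, pderiv3 i φ x * g x i) + ∑ i, pderiv3 i φ x * g' x i) := by
    refine integral_congr_ae ?_
    filter_upwards [Lp.coeFn_add g g'] with x hx
    simp only [hx, Pi.add_apply, PiLp.add_apply, mul_add, Finset.sum_add_distrib]
  rw [e, integral_add (hφ.integrable_div g) (hφ.integrable_div g'), H φ hφ, H' φ hφ, add_zero]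

theorem IsDivFree.const_smul {g : L2 E3} (c : ℝ) (H : IsDivFree g) :
    IsDivFree (c • g : L2 E3) := by
  intro φ hφ
  have e : ∫ x, ∑ i, pderiv3 i φ x * (c • g : L2 E3) x i
      = ∫ x, c * ∑ i, pderiv3 i φ x * g x i := by
    refine integral_congr_ae ?_
    filter_upwards [Lp.coeFn_smul c g] with x hx
    simp only [hx, Pi.smul_apply, PiLp.smul_apply, smul_eq_mul, Finset.mul_sum]
    refine Finset.sum_congr rfl fun i _ => by ring
  rw [e, integral_const_mul, H φ hφ, mul_zero]

/-- The space of divergence free vector fields `g ∈ H¹(ℝ³)` with the norm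
`‖g‖² = ‖g‖²_{L²} + α² ∑ᵢ ‖∂ᵢ g‖²_{L²}`. A field `g` is represented by the pair `(g, α ∇g)`, so
that this norm is the one inherited from the `ℓ²`-product of copies of `L²(ℝ³; ℝ³)`; see
`energySpace_norm_sq`. -/
def energySpace (α : ℝ) :
    Submodule ℝ (WithLp 2 (L2 E3 × PiLp 2 (fun _ : Fin 3 => L2 E3))) where
  carrier := {w | (∀ i, ∃ G : L2 E3, IsWeakPartial i w.fst G ∧ w.snd i = α • G) ∧
    IsDivFree w.fst}
  zero_mem' := by
    refine ⟨fun i => ⟨0, fun φ _ => ?_, by simp⟩, fun φ _ => ?_⟩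
    · simp
    · simp
  add_mem' := by
    rintro a b ⟨ha, ha'⟩ ⟨hb, hb'⟩
    refine ⟨fun i => ?_, by simpa using ha'.add hb'⟩
    obtain ⟨G, hG, hG'⟩ := ha i
    obtain ⟨K, hK, hK'⟩ := hb i
    exact ⟨G + K, by simpa using hG.add hK, by simp [hG', hK']⟩
  smul_mem' := by
    rintro c a ⟨ha, ha'⟩
    refine ⟨fun i => ?_, by simpa using ha'.const_smul c⟩
    obtain ⟨G, hG, hG'⟩ := ha i
    exact ⟨c • G, by simpa using hG.const_smul c, by rw [WithLp.smul_snd, PiLp.smul_apply, hG', smul_comm]⟩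

/-- The vector field in `L²(ℝ³; ℝ³)` underlying an element of the energy space. -/
def vField {α : ℝ} (w : energySpace α) : L2 E3 :=
  w.1.fst

theorem energySpace_norm_sq {α : ℝ} (w : energySpace α) :
    ∃ G : Fin 3 → L2 E3, (∀ i, IsWeakPartial i (vField w) (G i)) ∧
      ‖w‖ ^ 2 = ‖vField w‖ ^ 2 + α ^ 2 * ∑ i, ‖G i‖ ^ 2 := by
  choose G hG hG' using w.2.1
  refine ⟨G, hG, ?_⟩
  have h := WithLp.prod_norm_sq_eq_of_L2 w.1
  rw [PiLp.norm_sq_eq_of_L2] at h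
  simp only [hG', norm_smul, mul_pow, Real.norm_eq_abs, sq_abs, ← Finset.mul_sum] at h
  exact h

/-! ### The filtering operator -/

/-- `w ∈ L²(ℝ³)` solves the Helmholtz equation `-α² Δ w + w = g` in the sense of distributions. -/
def IsHelmholtzSolution (α : ℝ) (g : E3 → ℝ) (w : L2 ℝ) : Prop :=
  ∀ φ : E3 → ℝ, IsTest φ →
    ∫ x, w x * (-(α ^ 2) * Laplacian.laplacian φ x + φ x) = ∫ x, g x * φ x

/-- The filtering operator `g ↦ (g)_α = (-α² Δ + I)⁻¹ g`: the (unique) solution in `L²(ℝ³)` of the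
Helmholtz equation `-α² Δ (g)_α + (g)_α = g`. -/
def helmholtzFilter (α : ℝ) (g : E3 → ℝ) : L2 ℝ :=
  Classical.epsilon (IsHelmholtzSolution α g)

/-! ### Weak solutions -/

/-- `w ∈ L²_loc([0, ∞); Hᵏ(ℝ³; F))`: all weak spatial derivatives of `w` of order at most `k`
belong to `L²([0, T]; L²(ℝ³; F))` for every `T`. -/
def MemL2LocSobolev {F : Type*} [NormedAddCommGroup F] [NormedSpace ℝ F] :
    ℕ → (ℝ → L2 F) → Prop
  | 0, w => ∀ T : ℝ, MemLp w 2 (volume.restrict (Ioc 0 T))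
  | k + 1, w => (∀ T : ℝ, MemLp w 2 (volume.restrict (Ioc 0 T))) ∧
      ∀ i : Fin 3, ∃ w' : ℝ → L2 F,
        (∀ᵐ t ∂volume.restrict (Ioi (0 : ℝ)), IsWeakPartial i (w t) (w' t)) ∧
          MemL2LocSobolev k w'

/-- `(u, p)` is a weak solution on `[0, ∞) × ℝ³` of the damped Navier-Stokes-Bardina equations
`∂ₜ u + div ((u ⊗ u)_α) - ν Δ u + ∇ p = f - β u`, `div u = 0`, `u(0, ·) = u₀`, with
`u ∈ L^∞([0, ∞); H¹) ∩ L²_loc([0, ∞); H²)` and `p ∈ L²_loc([0, ∞); H³)`. The constraint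
`div u = 0` is part of the energy space. The test functions need not vanish at `t = 0`, which
encodes the initial condition. -/
structure IsWeakSolution (α β ν : ℝ) (f u₀ : energySpace α) (u : ℝ → energySpace α)
    (p : ℝ → L2 ℝ) : Prop where
  bounded : MemLp u ∞ (volume.restrict (Ioi (0 : ℝ)))
  velocity : MemL2LocSobolev 2 (fun t => vField (u t))
  pressure : MemL2LocSobolev 3 p
  equation : ∀ φ : ℝ × E3 → E3, IsTest φ →
    ∫ t in Ioi (0 : ℝ), ∫ x,
      (- inner ℝ (vField (u t) x) (deriv (fun s => φ (s, x)) t)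
        - ∑ i, ∑ j, helmholtzFilter α (fun y => vField (u t) y i * vField (u t) y j) x
            * pderiv3 j (fun y => φ (t, y)) x i
        - ν * inner ℝ (vField (u t) x) (Laplacian.laplacian (fun y => φ (t, y)) x)
        - p t x * ∑ i, pderiv3 i (fun y => φ (t, y)) x i
        - inner ℝ (vField f x) (φ (t, x))
        + β * inner ℝ (vField (u t) x) (φ (t, x)))
      = ∫ x, inner ℝ (vField u₀ x) (φ (0, x))

open Classical in
/-- The solution operator `S(t) u₀ = u(t, ·)`, where `u` is the weak solution with initial datum
`u₀`, taken as a continuous function of `t ∈ [0, ∞)` with values in the energy space. -/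
def bardinaSemigroup (α β ν : ℝ) (f : energySpace α) (t : ℝ) (u₀ : energySpace α) :
    energySpace α :=
  if h : ∃ u : ℝ → energySpace α, ContinuousOn u (Ici 0) ∧
      ∃ p : ℝ → L2 ℝ, IsWeakSolution α β ν f u₀ u p
  then h.choose t else 0

/-! ### Global attractors -/

/-- `A` is a global attractor of the semigroup `(S(t))_{t ≥ 0}`: it is compact, strictly
invariant, and attracts all bounded sets. -/
structure IsGlobalAttractor {X : Type*} [PseudoMetricSpace X] (S : ℝ → X → X) (A : Set X) :
    Prop where
  compact : IsCompact A
  invariant : ∀ t : ℝ, 0 ≤ t → S t '' A = A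
  attracts : ∀ B : Set X, Bornology.IsBounded B → ∀ V ∈ 𝓝ˢ A,
    ∃ T : ℝ, 0 < T ∧ ∀ t : ℝ, T < t → S t '' B ⊆ V

end

noncomputable section

open scoped FourierTransform ComplexConjugate SchwartzMap LineDeriv NNReal BoundedContinuousFunction

/-! ### Fourier multipliers on real-valued square integrable functions -/

open scoped FourierTransform ComplexConjugate SchwartzMap

/-! The substitution u = (1 - α²Δ)^{-1/2} a is an isometry from a closed subspace `solenoidal α` of
L² onto the energy space (`toEnergy`). Applied to the equation for u, it gives, with the force
transformed in the same way, a' = -(β - νΔ) a + f - B(a, a), where B(a, b) is the Leray projection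
of (1 - α²Δ)^{-1/2} div(u ⊗ v). Half of the filter compensates the divergence; the other half
disappears into the H¹ norm. Since H¹ embeds in L⁴, the tensor u ⊗ v lies in L², so B is a bounded
bilinear map (`bilin`) and no derivative is lost. Because u is divergence free, B(a, a) is
orthogonal to a (`inner_bilin_self`). The structure `DampedSystem` keeps only these facts, together
with spectral truncations P N and A N that replace the unbounded operator β - νΔ by bounded ones.

Well-posedness. The nonlinearity is a locally Lipschitz perturbation of a contraction semigroup. A
fixed point for a radially truncated force (`exists_mild`) obeys ‖a(t)‖² ≤ e^{-βt}‖a(0)‖² + ‖f‖²/β²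
(`IsLinearSol.norm_sq_le`), so for a large enough radius the truncation is never active. Uniqueness
holds among bounded measurable solutions satisfying the truncated equations for almost every time
(`IsAESol.unique`). This class contains every weak solution (`IsWeakSolution.isAESol`): separated
test fields reduce the weak formulation to an evolution equation in L², and the Leray projection
removes the pressure. An L² pressure is recovered from its gradient (`gradV_injective`). Conversely
the mild solution is a weak solution (`isWeakSolution_bardinaSol`): the dissipation integral and
Fatou's lemma give a = (1 - α²Δ)^{-1/2} c with c locally square integrable in time, hence the H²
bound, and the Leibniz rule gives the H³ bound for the pressure.

Attractor. The bound above provides an absorbing ball, and the attractor is its omega-limit set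
(`exists_isGlobalAttractor`) once S(t)x, for x in the ball and t → ∞, is known to be relatively
compact. On the whole space no compact embedding gives this, and the energy method is used. The map
B is weakly continuous on bounded sets, because after a frequency cutoff weak convergence is locally
uniform (`tendsto_inner_besselMul`); hence S(t) is weakly continuous (`tendsto_inner_sol`).
Comparing the energy inequality with weight e^{2βt} along a family of trajectories with the energy
balance of their weak limit, the forcing terms converge and the dissipation is weakly lower
semicontinuous, so the only loss is the initial energy (`eventually_energy_le`). Started a time k in
the past, that loss is damped by e^{-2βk}; letting k grow shows that the norms do not exceed that of
the weak limit, which makes the convergence strong (`exists_tendsto_sol`).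

All distributional statements are reduced to bounded Fourier multipliers on real L². A test function
is φ = (1 - α²Δ)^{-1} h with h ranging over a dense set (`dense_helm`), so testing against φ amounts
to an identity in L² between multipliers (`isWeakPartial_iff`, `isHelmholtzSolution_iff`). -/

/-- The complex Lebesgue space `L²(ℝ³; ℂ)`. -/
abbrev CL2 : Type := Lp ℂ 2 (volume : Measure E3)

/-- Complexification `L²(ℝ³; ℝ) → L²(ℝ³; ℂ)`. -/
def toCL2 : L2 ℝ →L[ℝ] CL2 := Complex.ofRealCLM.compLpL 2 volume

theorem coeFn_toCL2 (g : L2 ℝ) : toCL2 g =ᵐ[volume] fun x => (g x : ℂ) :=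
  Complex.ofRealCLM.coeFn_compLpL g

/-- The Fourier transform of a real-valued square integrable function. -/
def ft : L2 ℝ →L[ℝ] CL2 :=
  ((Lp.fourierTransformₗᵢ E3 ℂ).toContinuousLinearEquiv.toContinuousLinearMap.restrictScalars ℝ) ∘L
    toCL2

theorem ft_apply (g : L2 ℝ) : ft g = 𝓕 (toCL2 g) := rfl

theorem inner_toCL2 (g h : L2 ℝ) : inner ℂ (toCL2 g) (toCL2 h) = ((inner ℝ g h : ℝ) : ℂ) := by
  rw [L2.inner_def, L2.inner_def, ← integral_complex_ofReal]
  refine integral_congr_ae ?_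
  filter_upwards [coeFn_toCL2 g, coeFn_toCL2 h] with x h1 h2
  rw [h1, h2]
  simp

theorem inner_ft (g h : L2 ℝ) : inner ℂ (ft g) (ft h) = ((inner ℝ g h : ℝ) : ℂ) := by
  rw [ft_apply, ft_apply, Lp.inner_fourier_eq, inner_toCL2]

theorem norm_ft (g : L2 ℝ) : ‖ft g‖ = ‖g‖ := by
  have h := inner_ft g g
  rw [inner_self_eq_norm_sq_to_K, real_inner_self_eq_norm_sq] at h
  have h' : ‖ft g‖ ^ 2 = ‖g‖ ^ 2 := Complex.ofReal_injective (by simpa using h)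
  exact (pow_left_inj₀ (norm_nonneg _) (norm_nonneg _) two_ne_zero).1 h'

theorem ft_injective : Function.Injective ft := by
  intro g h hgh
  have : ‖ft (g - h)‖ = 0 := by rw [map_sub, hgh, sub_self, norm_zero]
  rw [norm_ft] at this
  exact sub_eq_zero.1 (norm_eq_zero.1 this)

/-- The element of `L²` defined by a test function. -/
def IsTest.toL2 {φ : E3 → ℝ} (hφ : IsTest φ) : L2 ℝ := hφ.memLp_two.toLp φ

theorem IsTest.coeFn_toL2 {φ : E3 → ℝ} (hφ : IsTest φ) : hφ.toL2 =ᵐ[volume] φ :=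
  hφ.memLp_two.coeFn_toLp

theorem IsTest.inner_toL2 {φ : E3 → ℝ} (hφ : IsTest φ) (g : L2 ℝ) :
    inner ℝ hφ.toL2 g = ∫ x, φ x * g x := by
  rw [L2.inner_def]
  refine integral_congr_ae ?_
  filter_upwards [hφ.coeFn_toL2] with x hx
  rw [hx]
  simp [mul_comm]

theorem Lp.eq_zero_of_forall_test {g : L2 ℝ} (h : ∀ φ : E3 → ℝ, IsTest φ → ∫ x, φ x * g x = 0) :
    g = 0 := by
  have := ae_eq_zero_of_integral_contDiff_smul_eq_zero (μ := (volume : Measure E3))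
    ((Lp.memLp g).locallyIntegrable (by norm_num)) (fun φ h1 h2 => by simpa using h φ ⟨h1, h2⟩)
  rw [Lp.eq_zero_iff_ae_eq_zero]
  exact this

/-- Test functions are dense in `L²`. -/
theorem dense_test : Dense {g : L2 ℝ | ∃ (φ : E3 → ℝ) (hφ : IsTest φ), g = hφ.toL2} := by
  let K : Submodule ℝ (L2 ℝ) :=
    { carrier := {g : L2 ℝ | ∃ (φ : E3 → ℝ) (hφ : IsTest φ), g = hφ.toL2}
      zero_mem' := ⟨0, ⟨contDiff_const, HasCompactSupport.zero⟩, (MemLp.toLp_zero _).symm⟩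
      add_mem' := by
        rintro _ _ ⟨φ, hφ, rfl⟩ ⟨ψ, hψ, rfl⟩
        exact ⟨φ + ψ, ⟨hφ.1.add hψ.1, hφ.2.add hψ.2⟩, (MemLp.toLp_add _ _).symm⟩
      smul_mem' := by
        rintro c _ ⟨φ, hφ, rfl⟩
        exact ⟨c • φ, ⟨contDiff_const.smul hφ.1, hφ.2.smul_left⟩,
          (MemLp.toLp_const_smul c _).symm⟩ }
  have hK : K.topologicalClosure = ⊤ := by
    rw [Submodule.topologicalClosure_eq_top_iff, Submodule.eq_bot_iff]
    intro g hg
    refine Lp.eq_zero_of_forall_test fun φ hφ => ?_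
    rw [← hφ.inner_toL2]
    exact hg _ ⟨φ, hφ, rfl⟩
  exact Submodule.dense_iff_topologicalClosure_eq_top.2 hK

/-- The complex Schwartz function defined by a real test function. -/
def IsTest.toSchwartz {φ : E3 → ℝ} (hφ : IsTest φ) : 𝓢(E3, ℂ) :=
  HasCompactSupport.toSchwartzMap (f := fun x => (φ x : ℂ)) (hφ.2.comp_left Complex.ofReal_zero)
    (Complex.ofRealCLM.contDiff.comp hφ.1)

theorem IsTest.toSchwartz_apply {φ : E3 → ℝ} (hφ : IsTest φ) (x : E3) :
    hφ.toSchwartz x = (φ x : ℂ) := rfl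

theorem IsTest.toCL2_toL2 {φ : E3 → ℝ} (hφ : IsTest φ) :
    toCL2 hφ.toL2 = hφ.toSchwartz.toLp 2 := by
  ext1
  filter_upwards [coeFn_toCL2 hφ.toL2, hφ.coeFn_toL2, hφ.toSchwartz.coeFn_toLp 2 volume] with x h1 h2 h3
  rw [h1, h2, h3, hφ.toSchwartz_apply]

theorem IsTest.ft_toL2 {φ : E3 → ℝ} (hφ : IsTest φ) :
    ft hφ.toL2 = (𝓕 hφ.toSchwartz).toLp 2 := by
  rw [ft_apply, hφ.toCL2_toL2, SchwartzMap.toLp_fourier_eq]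

theorem measurePreserving_neg_E3 : MeasurePreserving (Neg.neg : E3 → E3) volume volume :=
  Measure.measurePreserving_neg volume

/-- Complex conjugation composed with the reflection `ξ ↦ -ξ`. -/
def conjReflect : CL2 →L[ℝ] CL2 :=
  (Complex.conjCLE.toContinuousLinearMap.compLpL 2 volume) ∘L
    (Lp.compMeasurePreservingₗᵢ ℝ _ measurePreserving_neg_E3).toContinuousLinearMap

theorem coeFn_conjReflect (h : CL2) : conjReflect h =ᵐ[volume] fun ξ => conj (h (-ξ)) := by
  have h1 := Complex.conjCLE.toContinuousLinearMap.coeFn_compLpL (p := 2) (μ := volume)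
    (Lp.compMeasurePreservingₗᵢ ℝ _ measurePreserving_neg_E3 h)
  have h2 := Lp.coeFn_compMeasurePreserving h measurePreserving_neg_E3
  filter_upwards [h1, h2] with x h1 h2
  refine h1.trans ?_
  change conj _ = _
  congr 1

/-- Hermitian symmetry is visible on the Fourier integral of a test function; density and continuity
extend it to L². -/
theorem conjReflect_ft (g : L2 ℝ) : conjReflect (ft g) = ft g := by
  have hc : IsClosed {g : L2 ℝ | conjReflect (ft g) = ft g} :=
    isClosed_eq (conjReflect.continuous.comp ft.continuous) ft.continuous
  refine hc.closure_subset_iff.2 ?_ (dense_test g)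
  rintro _ ⟨φ, hφ, rfl⟩
  change conjReflect (ft hφ.toL2) = ft hφ.toL2
  rw [hφ.ft_toL2]
  have h0 := (𝓕 hφ.toSchwartz).coeFn_toLp 2 volume
  have h0' := measurePreserving_neg_E3.quasiMeasurePreserving.ae_eq_comp h0
  ext1
  filter_upwards [coeFn_conjReflect ((𝓕 hφ.toSchwartz).toLp 2), h0, h0'] with ξ h1 h2 h3
  rw [h1, h2]
  simp only [Function.comp_apply] at h3
  rw [h3, SchwartzMap.fourier_coe, Real.fourier_eq, Real.fourier_eq, ← integral_conj]
  refine integral_congr_ae (Eventually.of_forall fun v => ?_)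
  simp only [hφ.toSchwartz_apply, Circle.smul_def, smul_eq_mul, map_mul, Complex.conj_ofReal,
    inner_neg_right, neg_neg, ← Circle.coe_inv_eq_conj, ← AddChar.map_neg_eq_inv]

/-- Split the inverse transform as a + ib with a, b real. The conjugated reflection fixes `ft a`
and, being conjugate linear, changes the sign of i `ft b`; invariance forces the second term to
vanish. -/
theorem exists_ft_eq {h : CL2} (hh : conjReflect h = h) : ∃ g : L2 ℝ, ft g = h := by
  set w : CL2 := 𝓕⁻ h with hw
  set a : L2 ℝ := Complex.reCLM.compLpL 2 volume w
  set b : L2 ℝ := Complex.imCLM.compLpL 2 volume w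
  have hab : w = toCL2 a + Complex.I • toCL2 b := by
    ext1
    filter_upwards [Lp.coeFn_add (toCL2 a) (Complex.I • toCL2 b),
      Lp.coeFn_smul Complex.I (toCL2 b), coeFn_toCL2 a, coeFn_toCL2 b,
      Complex.reCLM.coeFn_compLpL (p := 2) (μ := volume) w,
      Complex.imCLM.coeFn_compLpL (p := 2) (μ := volume) w] with x h1 h2 h3 h4 h5 h6
    rw [h1, Pi.add_apply, h2, Pi.smul_apply, h3, h4, h5, h6]
    simp [mul_comm Complex.I]
  have h1 : h = ft a + Complex.I • ft b := by
    have : h = 𝓕 w := by rw [hw, FourierTransform.fourier_fourierInv_eq]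
    rw [this, hab, FourierTransform.fourier_add, FourierTransform.fourier_smul]
    rfl
  have h2 : conjReflect (Complex.I • ft b) = -(Complex.I • ft b) := by
    have hn := measurePreserving_neg_E3.quasiMeasurePreserving.ae_eq_comp
      (Lp.coeFn_smul Complex.I (ft b))
    have hb := coeFn_conjReflect (ft b)
    rw [conjReflect_ft] at hb
    ext1
    filter_upwards [coeFn_conjReflect (Complex.I • ft b), hn, hb, Lp.coeFn_neg (Complex.I • ft b),
      Lp.coeFn_smul Complex.I (ft b)] with ξ h1 h2 h3 h4 h5
    simp only [Function.comp_apply] at h2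
    rw [h1, h2, h4, Pi.neg_apply, h5]
    simp [h3]
  rw [h1, map_add, conjReflect_ft, h2] at hh
  have h3 : Complex.I • ft b = 0 := by
    have : (2 : ℝ) • (Complex.I • ft b) = 0 := by
      rw [two_smul]
      have := add_left_cancel hh
      nth_rewrite 1 [← this]
      simp
    exact (smul_eq_zero.1 this).resolve_left two_ne_zero
  exact ⟨a, by rw [h1, h3, add_zero]⟩

/-- Bounded measurable symbols with Hermitian symmetry. -/
structure IsSymbol (m : E3 → ℂ) : Prop where
  measurable : Measurable m
  bounded : ∃ C : ℝ, ∀ ξ, ‖m ξ‖ ≤ C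
  hermitian : ∀ ξ, m (-ξ) = conj (m ξ)

theorem IsSymbol.memLp {m : E3 → ℂ} (hm : IsSymbol m) : MemLp m ∞ (volume : Measure E3) := by
  obtain ⟨C, hC⟩ := hm.bounded
  exact memLp_top_of_bound hm.measurable.aestronglyMeasurable C (Eventually.of_forall hC)

open Classical in
/-- Multiplication of a square integrable function by a symbol. -/
def symbolMul (m : E3 → ℂ) : CL2 →L[ℂ] CL2 :=
  if hm : IsSymbol m then
    (ContinuousLinearMap.mul ℂ ℂ).holderL volume ∞ 2 2 (hm.memLp.toLp m)
  -- The junk value makes `mult` total in the symbol, so identities between multipliers reduce to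
  -- equalities of functions.
  else 0

theorem coeFn_symbolMul {m : E3 → ℂ} (hm : IsSymbol m) (h : CL2) :
    symbolMul m h =ᵐ[volume] fun ξ => m ξ * h ξ := by
  rw [symbolMul, dif_pos hm]
  filter_upwards [ContinuousLinearMap.coeFn_holder (r := 2) (ContinuousLinearMap.mul ℂ ℂ)
    (hm.memLp.toLp m) h, hm.memLp.coeFn_toLp] with ξ h1 h2
  rw [ContinuousLinearMap.holderL_apply_apply, h1, h2]
  rfl

/-- The Fourier multiplier with symbol `m`. -/
def mult (m : E3 → ℂ) : L2 ℝ →L[ℝ] L2 ℝ :=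
  (Complex.reCLM.compLpL 2 volume) ∘L
    ((Lp.fourierTransformₗᵢ E3 ℂ).symm.toContinuousLinearEquiv.toContinuousLinearMap.restrictScalars
      ℝ) ∘L ((symbolMul m).restrictScalars ℝ) ∘L ft

/-- A Hermitian symbol preserves the symmetry of `ft g`, so the product is again the transform of a
real function and the real part taken in `mult` loses nothing. -/
theorem ft_mult_eq {m : E3 → ℂ} (hm : IsSymbol m) (g : L2 ℝ) :
    ft (mult m g) = symbolMul m (ft g) := by
  have h1 : conjReflect (symbolMul m (ft g)) = symbolMul m (ft g) := by
    have h0 := measurePreserving_neg_E3.quasiMeasurePreserving.ae_eq_comp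
      (coeFn_symbolMul hm (ft g))
    have hg := coeFn_conjReflect (ft g)
    rw [conjReflect_ft] at hg
    ext1
    filter_upwards [coeFn_conjReflect (symbolMul m (ft g)), h0, coeFn_symbolMul hm (ft g), hg]
      with ξ h1 h2 h3 h4
    simp only [Function.comp_apply] at h2
    rw [h1, h2, h3, hm.hermitian, map_mul, Complex.conj_conj, ← h4]
  obtain ⟨a, ha⟩ := exists_ft_eq h1
  have h2 : mult m g = a := by
    change Complex.reCLM.compLpL 2 volume (𝓕⁻ (symbolMul m (ft g))) = a
    rw [← ha, ft_apply, FourierTransform.fourierInv_fourier_eq]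
    ext1
    filter_upwards [Complex.reCLM.coeFn_compLpL (p := 2) (μ := volume) (toCL2 a), coeFn_toCL2 a]
      with x h1 h2
    rw [h1, h2]
    simp
  rw [h2, ha]

theorem ft_mult {m : E3 → ℂ} (hm : IsSymbol m) (g : L2 ℝ) :
    ft (mult m g) =ᵐ[volume] fun ξ => m ξ * ft g ξ := by
  rw [ft_mult_eq hm]
  exact coeFn_symbolMul hm _

open scoped FourierTransform ComplexConjugate SchwartzMap

/-! ### Algebra of bounded Hermitian symbols. -/

namespace IsSymbol

variable {m n : E3 → ℂ}

theorem mul (hm : IsSymbol m) (hn : IsSymbol n) : IsSymbol (fun ξ => m ξ * n ξ) := by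
  obtain ⟨C, hC⟩ := hm.bounded
  obtain ⟨D, hD⟩ := hn.bounded
  refine ⟨hm.measurable.mul hn.measurable, ⟨C * D, fun ξ => ?_⟩, fun ξ => ?_⟩
  · rw [norm_mul]
    exact mul_le_mul (hC ξ) (hD ξ) (norm_nonneg _) ((norm_nonneg _).trans (hC ξ))
  · rw [hm.hermitian, hn.hermitian, map_mul]

theorem add (hm : IsSymbol m) (hn : IsSymbol n) : IsSymbol (fun ξ => m ξ + n ξ) := by
  obtain ⟨C, hC⟩ := hm.bounded
  obtain ⟨D, hD⟩ := hn.bounded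
  refine ⟨hm.measurable.add hn.measurable, ⟨C + D, fun ξ => ?_⟩, fun ξ => ?_⟩
  · exact (norm_add_le _ _).trans (add_le_add (hC ξ) (hD ξ))
  · rw [hm.hermitian, hn.hermitian, map_add]

theorem neg (hm : IsSymbol m) : IsSymbol (fun ξ => -m ξ) := by
  obtain ⟨C, hC⟩ := hm.bounded
  exact ⟨hm.measurable.neg, ⟨C, fun ξ => by simpa using hC ξ⟩, fun ξ => by
    rw [hm.hermitian, map_neg]⟩

theorem sub (hm : IsSymbol m) (hn : IsSymbol n) : IsSymbol (fun ξ => m ξ - n ξ) := by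
  simpa only [sub_eq_add_neg] using hm.add hn.neg

theorem star (hm : IsSymbol m) : IsSymbol (fun ξ => conj (m ξ)) := by
  obtain ⟨C, hC⟩ := hm.bounded
  exact ⟨Complex.continuous_conj.measurable.comp hm.measurable, ⟨C, fun ξ => by simpa using hC ξ⟩,
    fun ξ => by rw [hm.hermitian]⟩

theorem ofReal {f : E3 → ℝ} (hf : Measurable f) {C : ℝ} (hC : ∀ ξ, |f ξ| ≤ C)
    (he : ∀ ξ, f (-ξ) = f ξ) : IsSymbol (fun ξ => (f ξ : ℂ)) :=
  ⟨Complex.measurable_ofReal.comp hf, ⟨C, fun ξ => by simpa using hC ξ⟩, fun ξ => by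
    rw [he, Complex.conj_ofReal]⟩

theorem const (c : ℝ) : IsSymbol (fun _ => (c : ℂ)) :=
  ofReal measurable_const (C := |c|) (fun _ => le_rfl) fun _ => rfl

theorem const_mul (c : ℝ) (hm : IsSymbol m) : IsSymbol (fun ξ => (c : ℂ) * m ξ) :=
  (const c).mul hm

theorem sum {ι : Type*} (s : Finset ι) {m : ι → E3 → ℂ} (hm : ∀ i, IsSymbol (m i)) :
    IsSymbol (fun ξ => ∑ i ∈ s, m i ξ) := by
  classical
  induction s using Finset.induction_on with
  | empty => simpa using const 0
  | insert i s hi ih => simpa only [Finset.sum_insert hi] using (hm i).add ih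

end IsSymbol

theorem L2.ext_ft {g h : L2 ℝ} (H : ft g =ᵐ[volume] ft h) : g = h :=
  ft_injective (Lp.ext H)

/-! ### Calculus of multipliers: composition, adjoints, norms, limits, injectivity. -/

section Multiplier

variable {m n : E3 → ℂ}

theorem mult_mult (hm : IsSymbol m) (hn : IsSymbol n) (g : L2 ℝ) :
    mult m (mult n g) = mult (fun ξ => m ξ * n ξ) g := by
  refine L2.ext_ft ?_
  filter_upwards [ft_mult hm (mult n g), ft_mult hn g, ft_mult (hm.mul hn) g] with ξ h1 h2 h3
  rw [h1, h2, h3, mul_assoc]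

theorem mult_comm (hm : IsSymbol m) (hn : IsSymbol n) (g : L2 ℝ) :
    mult m (mult n g) = mult n (mult m g) := by
  rw [mult_mult hm hn, mult_mult hn hm]
  simp only [mul_comm]

theorem mult_add (hm : IsSymbol m) (hn : IsSymbol n) (g : L2 ℝ) :
    mult (fun ξ => m ξ + n ξ) g = mult m g + mult n g := by
  refine L2.ext_ft ?_
  rw [map_add]
  filter_upwards [ft_mult hm g, ft_mult hn g, ft_mult (hm.add hn) g,
    Lp.coeFn_add (ft (mult m g)) (ft (mult n g))] with ξ h1 h2 h3 h4
  rw [h3, h4, Pi.add_apply, h1, h2, add_mul]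

theorem mult_const (c : ℝ) (g : L2 ℝ) : mult (fun _ => (c : ℂ)) g = c • g := by
  refine L2.ext_ft ?_
  rw [map_smul]
  filter_upwards [ft_mult (IsSymbol.const c) g, Lp.coeFn_smul c (ft g)] with ξ h1 h2
  rw [h1, h2]
  simp

theorem mult_one (g : L2 ℝ) : mult (fun _ => 1) g = g := by
  simpa using mult_const 1 g

theorem mult_const_mul (c : ℝ) (hm : IsSymbol m) (g : L2 ℝ) :
    mult (fun ξ => (c : ℂ) * m ξ) g = c • mult m g := by
  rw [← mult_mult (IsSymbol.const c) hm, mult_const]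

theorem mult_neg (hm : IsSymbol m) (g : L2 ℝ) : mult (fun ξ => -m ξ) g = -mult m g := by
  simpa using mult_const_mul (-1) hm g

theorem mult_sub (hm : IsSymbol m) (hn : IsSymbol n) (g : L2 ℝ) :
    mult (fun ξ => m ξ - n ξ) g = mult m g - mult n g := by
  simp only [sub_eq_add_neg]
  rw [mult_add hm hn.neg, mult_neg hn]

theorem mult_sum {ι : Type*} (s : Finset ι) {m : ι → E3 → ℂ} (hm : ∀ i, IsSymbol (m i))
    (g : L2 ℝ) : mult (fun ξ => ∑ i ∈ s, m i ξ) g = ∑ i ∈ s, mult (m i) g := by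
  classical
  induction s using Finset.induction_on with
  | empty => simpa using mult_const 0 g
  | insert i s hi ih =>
    simp only [Finset.sum_insert hi]
    rw [mult_add (hm i) (IsSymbol.sum s hm), ih]

theorem inner_mult_left (hm : IsSymbol m) (g h : L2 ℝ) :
    inner ℝ (mult m g) h = inner ℝ g (mult (fun ξ => conj (m ξ)) h) := by
  apply Complex.ofReal_injective
  rw [← inner_ft, ← inner_ft, L2.inner_def, L2.inner_def]
  refine integral_congr_ae ?_
  filter_upwards [ft_mult hm g, ft_mult hm.star h] with ξ h1 h2
  rw [h1, h2]
  simp only [RCLike.inner_apply, map_mul]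
  ring

/-- Multipliers with real symbols are symmetric. -/
theorem inner_mult_of_real (hm : IsSymbol m) (hr : ∀ ξ, conj (m ξ) = m ξ) (g h : L2 ℝ) :
    inner ℝ (mult m g) h = inner ℝ g (mult m h) := by
  rw [inner_mult_left hm]
  simp only [hr]

theorem norm_sq_mult (hm : IsSymbol m) (g : L2 ℝ) :
    ‖mult m g‖ ^ 2 = ∫ ξ, ‖m ξ‖ ^ 2 * ‖ft g ξ‖ ^ 2 := by
  have h := inner_ft (mult m g) (mult m g)
  rw [real_inner_self_eq_norm_sq, L2.inner_def] at h
  apply Complex.ofReal_injective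
  rw [← h, ← integral_complex_ofReal]
  refine integral_congr_ae ?_
  filter_upwards [ft_mult hm g] with ξ h1
  rw [h1, inner_self_eq_norm_sq_to_K, norm_mul, ← mul_pow]
  norm_cast

theorem integrable_norm_sq_ft (g : L2 ℝ) : Integrable (fun ξ => ‖ft g ξ‖ ^ 2) volume :=
  (memLp_two_iff_integrable_sq_norm (Lp.memLp (ft g)).1).1 (Lp.memLp (ft g))

theorem integrable_norm_sq_mul (hm : IsSymbol m) (g : L2 ℝ) :
    Integrable (fun ξ => ‖m ξ‖ ^ 2 * ‖ft g ξ‖ ^ 2) volume := by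
  obtain ⟨C, hC⟩ := hm.bounded
  refine (integrable_norm_sq_ft g).bdd_mul (c := C ^ 2)
    (hm.measurable.norm.pow_const 2).aestronglyMeasurable (Eventually.of_forall fun ξ => ?_)
  rw [norm_pow, norm_norm]
  exact pow_le_pow_left₀ (norm_nonneg _) (hC ξ) 2

/-- Plancherel turns a pointwise comparison of symbols into one of norms. Comparing two symbols, not
just a symbol and a constant, is what later shows that the truncated dissipation is monotone in the
cutoff. -/
theorem norm_mult_le_mul (hm : IsSymbol m) (hn : IsSymbol n) {C : ℝ} (hC : 0 ≤ C)
    (h : ∀ ξ, ‖m ξ‖ ≤ C * ‖n ξ‖) (g : L2 ℝ) : ‖mult m g‖ ≤ C * ‖mult n g‖ := by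
  refine (pow_le_pow_iff_left₀ (norm_nonneg _) (by positivity) two_ne_zero).1 ?_
  rw [mul_pow, norm_sq_mult hm, norm_sq_mult hn, ← integral_const_mul]
  refine integral_mono (integrable_norm_sq_mul hm g) ((integrable_norm_sq_mul hn g).const_mul _)
    fun ξ => ?_
  have := pow_le_pow_left₀ (norm_nonneg _) (h ξ) 2
  rw [mul_pow] at this
  calc ‖m ξ‖ ^ 2 * ‖ft g ξ‖ ^ 2 ≤ (C ^ 2 * ‖n ξ‖ ^ 2) * ‖ft g ξ‖ ^ 2 := by gcongr
    _ = _ := by ring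

theorem norm_mult_le (hm : IsSymbol m) {C : ℝ} (hC : ∀ ξ, ‖m ξ‖ ≤ C) (g : L2 ℝ) :
    ‖mult m g‖ ≤ C * ‖g‖ := by
  have h0 : 0 ≤ C := (norm_nonneg _).trans (hC 0)
  simpa [mult_one] using norm_mult_le_mul hm (IsSymbol.const 1) h0 (by simpa using hC) g

/-- Dominated convergence for multipliers. -/
theorem tendsto_mult {ι : Type*} {l : Filter ι} [l.IsCountablyGenerated] {M : ι → E3 → ℂ}
    (hM : ∀ i, IsSymbol (M i)) (hm : IsSymbol m) {C : ℝ} (hC : ∀ᶠ i in l, ∀ ξ, ‖M i ξ‖ ≤ C)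
    (hlim : ∀ ξ, Tendsto (fun i => M i ξ) l (𝓝 (m ξ))) (g : L2 ℝ) :
    Tendsto (fun i => mult (M i) g) l (𝓝 (mult m g)) := by
  obtain ⟨D, hD⟩ := hm.bounded
  rw [tendsto_iff_norm_sub_tendsto_zero]
  have key : Tendsto (fun i => ‖mult (M i) g - mult m g‖ ^ 2) l (𝓝 0) := by
    have h0 : (0 : ℝ) = ∫ ξ : E3, (0 : ℝ) := by simp
    rw [h0]
    have e : ∀ i, ‖mult (M i) g - mult m g‖ ^ 2
        = ∫ ξ, ‖M i ξ - m ξ‖ ^ 2 * ‖ft g ξ‖ ^ 2 := fun i => by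
      rw [← mult_sub (hM i) hm, norm_sq_mult ((hM i).sub hm)]
    simp only [e]
    refine tendsto_integral_filter_of_dominated_convergence
      (fun ξ => (C + D) ^ 2 * ‖ft g ξ‖ ^ 2) ?_ ?_ ((integrable_norm_sq_ft g).const_mul _) ?_
    · exact Eventually.of_forall fun i => (integrable_norm_sq_mul ((hM i).sub hm) g).1
    · filter_upwards [hC] with i hi
      refine Eventually.of_forall fun ξ => ?_
      rw [norm_mul, norm_pow, norm_pow, norm_norm, norm_norm]
      gcongr
      exact (norm_sub_le _ _).trans (add_le_add (hi ξ) (hD ξ))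
    · refine Eventually.of_forall fun ξ => ?_
      have h1 : Tendsto (fun i => ‖M i ξ - m ξ‖) l (𝓝 0) :=
        tendsto_iff_norm_sub_tendsto_zero.1 (hlim ξ)
      simpa using (h1.pow 2).mul_const (‖ft g ξ‖ ^ 2)
  have := key.sqrt
  simpa [Real.sqrt_sq (norm_nonneg _)] using this

theorem mult_injective (hm : IsSymbol m) (h0 : ∀ᵐ ξ ∂(volume : Measure E3), m ξ ≠ 0) :
    Function.Injective (mult m) := by
  intro g h hgh
  refine L2.ext_ft ?_
  have h1 := ft_mult hm g
  rw [hgh] at h1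
  filter_upwards [h1, ft_mult hm h, h0] with ξ h1 h2 h3
  exact mul_left_cancel₀ h3 (h1.symm.trans h2)

/-- Symmetric injective multipliers have dense range; more generally they map dense sets to dense
sets. -/
theorem dense_image_mult (hm : IsSymbol m) (h0 : ∀ᵐ ξ ∂(volume : Measure E3), m ξ ≠ 0)
    {s : Set (L2 ℝ)} (hs : Dense s) : Dense (mult m '' s) := by
  have hr : DenseRange (mult m) := by
    change Dense (Set.range (mult m))
    rw [← ContinuousLinearMap.coe_coe, ← LinearMap.coe_range,
      Submodule.dense_iff_topologicalClosure_eq_top, Submodule.topologicalClosure_eq_top_iff,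
      Submodule.eq_bot_iff]
    -- The complement of the range is the kernel of the adjoint, whose symbol `conj (m ξ)` is almost
    -- nowhere zero as well.
    intro g hg
    have h1 : mult (fun ξ => conj (m ξ)) g = 0 := by
      refine ext_inner_left ℝ fun v => ?_
      rw [inner_zero_right, ← inner_mult_left hm]
      exact hg _ ⟨v, rfl⟩
    refine mult_injective hm.star ?_ (h1.trans (map_zero _).symm)
    filter_upwards [h0] with ξ h
    simpa using h
  exact hr.dense_image (mult m).continuous hs

end Multiplier

/-! ### Test functions and the Helmholtz operator -/

/-- The symbol `2πi ξᵢ` of the partial derivative `∂ᵢ`. -/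
def dSym (i : Fin 3) (ξ : E3) : ℂ := 2 * Real.pi * Complex.I * (ξ i : ℂ)

/-- The symbol `|2πξ|²` of `-Δ`. -/
def lam (ξ : E3) : ℝ := (2 * Real.pi) ^ 2 * ‖ξ‖ ^ 2

theorem lam_nonneg (ξ : E3) : 0 ≤ lam ξ := by unfold lam; positivity

theorem lam_neg (ξ : E3) : lam (-ξ) = lam ξ := by simp [lam]

theorem continuous_lam : Continuous lam := by unfold lam; fun_prop

theorem continuous_dSym (i : Fin 3) : Continuous (dSym i) := by unfold dSym; fun_prop

theorem dSym_neg (i : Fin 3) (ξ : E3) : dSym i (-ξ) = conj (dSym i ξ) := by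
  simp [dSym, Complex.conj_ofReal, map_ofNat]

theorem conj_dSym (i : Fin 3) (ξ : E3) : conj (dSym i ξ) = -dSym i ξ := by
  simp [dSym, Complex.conj_ofReal, map_ofNat]

theorem sum_dSym_sq (ξ : E3) : ∑ i, dSym i ξ * dSym i ξ = -(lam ξ : ℂ) := by
  have h : ∀ i, dSym i ξ * dSym i ξ = -(((2 * Real.pi) ^ 2 * (ξ i) ^ 2 : ℝ) : ℂ) := fun i => by
    simp only [dSym]
    push_cast
    linear_combination (2 * (Real.pi : ℂ)) ^ 2 * (ξ i : ℂ) ^ 2 * Complex.I_mul_I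
  simp only [h, Finset.sum_neg_distrib, ← Complex.ofReal_sum, ← Finset.mul_sum]
  rw [lam, EuclideanSpace.real_norm_sq_eq]

theorem sum_norm_dSym_sq (ξ : E3) : ∑ i, ‖dSym i ξ‖ ^ 2 = lam ξ := by
  have h : ∀ i, ‖dSym i ξ‖ ^ 2 = (2 * Real.pi) ^ 2 * (ξ i) ^ 2 := fun i => by
    simp [dSym, mul_pow]
  simp only [h, ← Finset.mul_sum]
  rw [lam, EuclideanSpace.real_norm_sq_eq]

theorem norm_dSym_sq_le (i : Fin 3) (ξ : E3) : ‖dSym i ξ‖ ^ 2 ≤ lam ξ := by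
  rw [← sum_norm_dSym_sq]
  exact Finset.single_le_sum (f := fun i => ‖dSym i ξ‖ ^ 2) (fun _ _ => by positivity)
    (Finset.mem_univ i)

theorem two_le_infty : (2 : WithTop ℕ∞) ≤ (∞ : WithTop ℕ∞) := by
  exact WithTop.coe_le_coe.2 (le_top : (2 : ℕ∞) ≤ ⊤)

theorem laplacian_eq_sum_pderiv3 {F : Type*} [NormedAddCommGroup F] [NormedSpace ℝ F] {φ : E3 → F}
    (hφ : ContDiff ℝ 2 φ) (x : E3) :
    Laplacian.laplacian φ x = ∑ i, pderiv3 i (pderiv3 i φ) x := by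
  rw [InnerProductSpace.laplacian_eq_iteratedFDeriv_orthonormalBasis φ
    (EuclideanSpace.basisFun (Fin 3) ℝ)]
  refine Finset.sum_congr rfl fun i _ => ?_
  rw [iteratedFDeriv_two_apply]
  simp only [EuclideanSpace.basisFun_apply]
  have hd : DifferentiableAt ℝ (fderiv ℝ φ) x :=
    ((hφ.fderiv_right (m := 1) (by norm_num)).differentiable one_ne_zero) x
  have h := fderiv_clm_apply hd (differentiableAt_const (EuclideanSpace.single i (1 : ℝ)))
  change _ = fderiv ℝ (fun y => fderiv ℝ φ y (EuclideanSpace.single i 1)) x _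
  rw [h]
  simp

theorem norm_laplacian_le {φ : E3 → ℝ} (x : E3) :
    |Laplacian.laplacian φ x| ≤ 3 * ‖iteratedFDeriv ℝ 2 φ x‖ := by
  rw [InnerProductSpace.laplacian_eq_iteratedFDeriv_orthonormalBasis φ
    (EuclideanSpace.basisFun (Fin 3) ℝ)]
  refine (Finset.abs_sum_le_sum_abs _ _).trans ?_
  have : ∀ i : Fin 3, |iteratedFDeriv ℝ 2 φ x ![EuclideanSpace.basisFun (Fin 3) ℝ i,
      EuclideanSpace.basisFun (Fin 3) ℝ i]| ≤ ‖iteratedFDeriv ℝ 2 φ x‖ := fun i => by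
    have h := (iteratedFDeriv ℝ 2 φ x).le_opNorm ![EuclideanSpace.basisFun (Fin 3) ℝ i,
      EuclideanSpace.basisFun (Fin 3) ℝ i]
    simpa [Fin.prod_univ_two] using h
  refine (Finset.sum_le_sum fun i _ => this i).trans ?_
  simp

theorem IsTest.add {φ ψ : E3 → ℝ} (hφ : IsTest φ) (hψ : IsTest ψ) : IsTest (φ + ψ) :=
  ⟨hφ.1.add hψ.1, hφ.2.add hψ.2⟩

theorem IsTest.smul {φ : E3 → ℝ} (c : ℝ) (hφ : IsTest φ) : IsTest (fun x => c * φ x) :=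
  ⟨contDiff_const.mul hφ.1, hφ.2.mul_left⟩

theorem IsTest.mul {φ ψ : E3 → ℝ} (hφ : IsTest φ) (hψ : IsTest ψ) : IsTest (fun x => φ x * ψ x) :=
  ⟨hφ.1.mul hψ.1, hφ.2.mul_right⟩

theorem IsTest.sum {ι : Type*} (s : Finset ι) {φ : ι → E3 → ℝ} (hφ : ∀ i, IsTest (φ i)) :
    IsTest (fun x => ∑ i ∈ s, φ i x) := by
  classical
  induction s using Finset.induction_on with
  | empty =>
    simp only [Finset.sum_empty]
    exact ⟨contDiff_const, HasCompactSupport.zero⟩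
  | insert i s hi ih =>
    simp only [Finset.sum_insert hi]
    exact (hφ i).add ih

theorem IsTest.laplacian {φ : E3 → ℝ} (hφ : IsTest φ) : IsTest (Laplacian.laplacian φ) := by
  have h := IsTest.sum Finset.univ fun i : Fin 3 => (hφ.partial_isTest i).partial_isTest i
  convert h using 1
  funext x
  exact laplacian_eq_sum_pderiv3 (hφ.1.of_le two_le_infty) x

theorem IsTest.ft_partial {φ : E3 → ℝ} (hφ : IsTest φ) (i : Fin 3) :
    ft (hφ.partial_isTest i).toL2 =ᵐ[volume] fun ξ => dSym i ξ * ft hφ.toL2 ξ := by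
  have h : (hφ.partial_isTest i).toSchwartz = ∂_{EuclideanSpace.single i (1 : ℝ)} hφ.toSchwartz := by
    ext x
    rw [IsTest.toSchwartz_apply, SchwartzMap.lineDerivOp_apply_eq_fderiv]
    have hd : HasFDerivAt (fun y => (φ y : ℂ)) (Complex.ofRealCLM.comp (fderiv ℝ φ x)) x :=
      Complex.ofRealCLM.hasFDerivAt.comp x
        ((hφ.1.differentiable (by simp)) x).hasFDerivAt
    change _ = fderiv ℝ (fun y => (φ y : ℂ)) x _
    rw [hd.fderiv]
    rfl
  rw [hφ.ft_toL2, IsTest.ft_toL2, h, SchwartzMap.fourier_lineDerivOp_eq]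
  filter_upwards [SchwartzMap.coeFn_toLp (𝓕 hφ.toSchwartz) 2 volume, SchwartzMap.coeFn_toLp
    ((2 * Real.pi * Complex.I) • SchwartzMap.smulLeftCLM ℂ
      (fun ξ : E3 => inner ℝ ξ (EuclideanSpace.single i (1 : ℝ))) (𝓕 hφ.toSchwartz)) 2 volume]
    with ξ h1 h2
  rw [h1, h2, smul_apply, SchwartzMap.smulLeftCLM_apply_apply (by fun_prop)]
  simp [dSym, EuclideanSpace.inner_single_right, mul_assoc]

theorem IsTest.ft_laplacian {φ : E3 → ℝ} (hφ : IsTest φ) :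
    ft hφ.laplacian.toL2 =ᵐ[volume] fun ξ => -(lam ξ : ℂ) * ft hφ.toL2 ξ := by
  have h : hφ.laplacian.toL2
      = ∑ i, ((hφ.partial_isTest i).partial_isTest i).toL2 := by
    ext1
    have h1 : ∀ᵐ x ∂(volume : Measure E3), ∀ i : Fin 3,
        ((hφ.partial_isTest i).partial_isTest i).toL2 x = pderiv3 i (pderiv3 i φ) x :=
      ae_all_iff.2 fun i => ((hφ.partial_isTest i).partial_isTest i).coeFn_toL2
    rw [Fin.sum_univ_three]
    filter_upwards [hφ.laplacian.coeFn_toL2, h1,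
      Lp.coeFn_add (((hφ.partial_isTest 0).partial_isTest 0).toL2 +
        ((hφ.partial_isTest 1).partial_isTest 1).toL2)
        ((hφ.partial_isTest 2).partial_isTest 2).toL2,
      Lp.coeFn_add ((hφ.partial_isTest 0).partial_isTest 0).toL2
        ((hφ.partial_isTest 1).partial_isTest 1).toL2] with x h2 h1 h3 h4
    rw [h2, h3, Pi.add_apply, h4, Pi.add_apply, h1, h1, h1,
      laplacian_eq_sum_pderiv3 (hφ.1.of_le two_le_infty), Fin.sum_univ_three]
  rw [h, map_sum, Fin.sum_univ_three]
  have h1 : ∀ᵐ ξ ∂(volume : Measure E3), ∀ i : Fin 3,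
      ft ((hφ.partial_isTest i).partial_isTest i).toL2 ξ = dSym i ξ * (dSym i ξ * ft hφ.toL2 ξ) := by
    refine ae_all_iff.2 fun i => ?_
    filter_upwards [(hφ.partial_isTest i).ft_partial i, hφ.ft_partial i] with ξ h1 h2
    rw [h1, h2]
  filter_upwards [h1, Lp.coeFn_add (ft ((hφ.partial_isTest 0).partial_isTest 0).toL2 +
        ft ((hφ.partial_isTest 1).partial_isTest 1).toL2)
        (ft ((hφ.partial_isTest 2).partial_isTest 2).toL2),
      Lp.coeFn_add (ft ((hφ.partial_isTest 0).partial_isTest 0).toL2)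
        (ft ((hφ.partial_isTest 1).partial_isTest 1).toL2)] with ξ h1 h2 h3
  rw [h2, Pi.add_apply, h3, Pi.add_apply, h1, h1, h1]
  have := sum_dSym_sq ξ
  rw [Fin.sum_univ_three] at this
  linear_combination (ft hφ.toL2 ξ) * this

/-- The Helmholtz operator `φ ↦ -α² Δφ + φ`. -/
def helm (α : ℝ) (φ : E3 → ℝ) (x : E3) : ℝ := -(α ^ 2) * Laplacian.laplacian φ x + φ x

theorem IsTest.helm {φ : E3 → ℝ} (α : ℝ) (hφ : IsTest φ) : IsTest (helm α φ) :=
  (hφ.laplacian.smul _).add hφ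

theorem IsTest.toL2_helm {φ : E3 → ℝ} (α : ℝ) (hφ : IsTest φ) :
    (hφ.helm α).toL2 = -(α ^ 2) • hφ.laplacian.toL2 + hφ.toL2 := by
  ext1
  filter_upwards [(hφ.helm α).coeFn_toL2, hφ.coeFn_toL2, hφ.laplacian.coeFn_toL2,
    Lp.coeFn_add (-(α ^ 2) • hφ.laplacian.toL2) hφ.toL2,
    Lp.coeFn_smul (-(α ^ 2)) hφ.laplacian.toL2] with x h1 h2 h3 h4 h5
  rw [h1, h4, Pi.add_apply, h5, Pi.smul_apply, h2, h3]
  rfl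

theorem IsTest.ft_helm {φ : E3 → ℝ} (α : ℝ) (hφ : IsTest φ) :
    ft (hφ.helm α).toL2 =ᵐ[volume] fun ξ => ((1 + α ^ 2 * lam ξ : ℝ) : ℂ) * ft hφ.toL2 ξ := by
  rw [hφ.toL2_helm, map_add, map_smul]
  filter_upwards [hφ.ft_laplacian, Lp.coeFn_add (-(α ^ 2) • ft hφ.laplacian.toL2) (ft hφ.toL2),
    Lp.coeFn_smul (-(α ^ 2)) (ft hφ.laplacian.toL2)] with ξ h1 h2 h3
  rw [h2, Pi.add_apply, h3, Pi.smul_apply, h1, Complex.real_smul]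
  push_cast
  ring

/-! #### Density of the range of the Helmholtz operator -/

/-- The square is dominated by the supremum of the derivative times the derivative, which is
integrable. -/
theorem SchwartzMap.memLp_two_norm_iteratedFDeriv (h : 𝓢(E3, ℝ)) (k : ℕ) :
    MemLp (fun x => ‖iteratedFDeriv ℝ k h x‖) 2 volume := by
  have hc : Continuous fun x => ‖iteratedFDeriv ℝ k h x‖ :=
    (h.smooth'.continuous_iteratedFDeriv (m := k) (by exact_mod_cast le_top)).norm
  rw [memLp_two_iff_integrable_sq hc.aestronglyMeasurable]
  obtain ⟨C, hC⟩ := h.decay 0 k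
  have hi := h.integrable_pow_mul_iteratedFDeriv volume 0 k
  simp only [pow_zero, one_mul] at hi hC
  refine (hi.const_mul C).mono' (hc.pow 2).aestronglyMeasurable (Eventually.of_forall fun x => ?_)
  rw [Real.norm_eq_abs, abs_of_nonneg (by positivity), sq]
  exact mul_le_mul_of_nonneg_right (hC.2 x) (norm_nonneg _)

/-- A smooth cutoff function. -/
def cutoff (n : ℕ) (x : E3) : ℝ :=
  (⟨1, 2, one_pos, one_lt_two⟩ : ContDiffBump (0 : E3)) (((n : ℝ) + 1)⁻¹ • x)

theorem cutoff_contDiff (n : ℕ) : ContDiff ℝ ∞ (cutoff n) :=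
  (ContDiffBump.contDiff _).comp
    (((n : ℝ) + 1)⁻¹ • ContinuousLinearMap.id ℝ E3 : E3 →L[ℝ] E3).contDiff

theorem cutoff_hasCompactSupport (n : ℕ) : HasCompactSupport (cutoff n) :=
  (ContDiffBump.hasCompactSupport _).comp_homeomorph
    (Homeomorph.smulOfNeZero (((n : ℝ) + 1)⁻¹) (by positivity))

theorem cutoff_eventually (x : E3) : ∀ᶠ n in atTop, cutoff n =ᶠ[𝓝 x] fun _ => 1 := by
  filter_upwards [eventually_ge_atTop ⌈‖x‖⌉₊] with n hn
  have h : ‖x‖ < (n : ℝ) + 1 := (Nat.ceil_le.1 hn).trans_lt (lt_add_one _)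
  have h' : ∀ᶠ y : E3 in 𝓝 x, ‖y‖ < (n : ℝ) + 1 := continuous_norm.continuousAt.eventually_lt_const h
  filter_upwards [h'] with y hy
  refine ContDiffBump.one_of_mem_closedBall _ ?_
  rw [mem_closedBall_zero_iff, norm_smul, norm_inv, Real.norm_of_nonneg (by positivity)]
  change _ ≤ (1 : ℝ)
  rw [inv_mul_le_one₀ (by positivity)]
  exact hy.le

/-- The dilation by `(n + 1)⁻¹` has norm at most one, so the chain rule never increases derivatives
and the bound for the fixed bump serves for all n. -/
theorem exists_bound_cutoff (k : ℕ) : ∃ C : ℝ, ∀ n x, ‖iteratedFDeriv ℝ k (cutoff n) x‖ ≤ C := by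
  set χ : ContDiffBump (0 : E3) := ⟨1, 2, one_pos, one_lt_two⟩ with hχ
  have hs : ContDiff ℝ ∞ (χ : E3 → ℝ) := χ.contDiff
  obtain ⟨C, hC⟩ := (χ.hasCompactSupport.iteratedFDeriv (𝕜 := ℝ) k).exists_bound_of_continuous
    (hs.continuous_iteratedFDeriv (m := k) (by exact_mod_cast le_top))
  refine ⟨C, fun n x => ?_⟩
  set L : E3 →L[ℝ] E3 := ((n : ℝ) + 1)⁻¹ • ContinuousLinearMap.id ℝ E3 with hL
  have hL1 : ‖L‖ ≤ 1 := by
    rw [hL, norm_smul]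
    refine mul_le_one₀ ?_ (norm_nonneg _) ContinuousLinearMap.norm_id_le
    rw [norm_inv, Real.norm_of_nonneg (by positivity)]
    exact inv_le_one_of_one_le₀ (by linarith [Nat.cast_nonneg (α := ℝ) n])
  have he : cutoff n = χ ∘ L := rfl
  rw [he, L.iteratedFDeriv_comp_right hs x (i := k) (by exact_mod_cast le_top)]
  refine (ContinuousMultilinearMap.norm_compContinuousLinearMap_le _ _).trans ?_
  calc ‖iteratedFDeriv ℝ k χ (L x)‖ * ∏ _i : Fin k, ‖L‖
      ≤ ‖iteratedFDeriv ℝ k χ (L x)‖ * 1 := by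
        gcongr
        exact Finset.prod_le_one (fun _ _ => norm_nonneg _) fun _ _ => hL1
    _ ≤ C := by simpa using hC (L x)

/-- Multiplying by the cutoffs gives test functions that agree with h near each point eventually,
with derivatives dominated through Leibniz; dominated convergence applies. Schwartz functions are
needed because, unlike test functions, they are stable under the Fourier transform. -/
theorem integral_helm_schwartz {α : ℝ} {w : L2 ℝ}
    (hw : ∀ φ : E3 → ℝ, IsTest φ → ∫ x, w x * helm α φ x = 0) (h : 𝓢(E3, ℝ)) :
    ∫ x, w x * helm α h x = 0 := by
  have hs : ContDiff ℝ ∞ h := h.smooth'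
  set g : ℕ → E3 → ℝ := fun n x => cutoff n x * h x with hg
  have hgt : ∀ n, IsTest (g n) := fun n =>
    ⟨(cutoff_contDiff n).mul hs, (cutoff_hasCompactSupport n).mul_right⟩
  obtain ⟨C0, hC0⟩ := exists_bound_cutoff 0
  obtain ⟨C1, hC1⟩ := exists_bound_cutoff 1
  obtain ⟨C2, hC2⟩ := exists_bound_cutoff 2
  set D : ℕ → E3 → ℝ := fun k x => ‖iteratedFDeriv ℝ k h x‖ with hD
  have hlim : Tendsto (fun n => ∫ x, w x * helm α (g n) x) atTop (𝓝 (∫ x, w x * helm α h x)) := by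
    refine tendsto_integral_of_dominated_convergence
      (fun x => ‖w x‖ * (α ^ 2 * (3 * (C0 * D 2 x + 2 * C1 * D 1 x + C2 * D 0 x)) + C0 * D 0 x))
      (fun n => ?_) ?_ (fun n => Eventually.of_forall fun x => ?_) (Eventually.of_forall fun x => ?_)
    · exact (Lp.memLp w).1.mul ((hgt n).helm α).1.continuous.aestronglyMeasurable
    · have hm : MemLp (fun x => α ^ 2 * (3 * (C0 * D 2 x + 2 * C1 * D 1 x + C2 * D 0 x)) + C0 * D 0 x)
          2 volume :=
        ((((((h.memLp_two_norm_iteratedFDeriv 2).const_mul C0).add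
          ((h.memLp_two_norm_iteratedFDeriv 1).const_mul (2 * C1))).add
          ((h.memLp_two_norm_iteratedFDeriv 0).const_mul C2)).const_mul 3).const_mul (α ^ 2)).add
          ((h.memLp_two_norm_iteratedFDeriv 0).const_mul C0)
      exact memLp_one_iff_integrable.1 (hm.mul (Lp.memLp w).norm)
    · rw [norm_mul]
      refine mul_le_mul_of_nonneg_left ?_ (norm_nonneg _)
      have h0 : |g n x| ≤ C0 * D 0 x := by
        rw [hg, abs_mul]
        have := hC0 n x
        simp only [norm_iteratedFDeriv_zero, hD, Real.norm_eq_abs] at this ⊢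
        exact mul_le_mul_of_nonneg_right this (abs_nonneg _)
      have h2 : |Laplacian.laplacian (g n) x| ≤ 3 * (C0 * D 2 x + 2 * C1 * D 1 x + C2 * D 0 x) := by
        refine (norm_laplacian_le x).trans ?_
        refine mul_le_mul_of_nonneg_left ?_ (by norm_num)
        refine (norm_iteratedFDeriv_mul_le (n := 2) (cutoff_contDiff n) hs x
          two_le_infty).trans ?_
        simp only [Finset.sum_range_succ, Finset.range_zero, Finset.sum_empty, zero_add,
          Nat.choose_zero_right, Nat.choose_self, Nat.choose_one_right, Nat.cast_one, one_mul,
          Nat.sub_zero, Nat.cast_ofNat, Nat.reduceSub, Nat.reduceAdd]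
        have e1 := mul_le_mul_of_nonneg_right (hC0 n x) (norm_nonneg (iteratedFDeriv ℝ 2 h x))
        have e2 := mul_le_mul_of_nonneg_right (hC1 n x) (norm_nonneg (iteratedFDeriv ℝ 1 h x))
        have e3 := mul_le_mul_of_nonneg_right (hC2 n x) (norm_nonneg (iteratedFDeriv ℝ 0 h x))
        simp only [hD]
        norm_num at e1 e2 e3 ⊢
        linarith [e1, e2, e3]
      rw [helm, Real.norm_eq_abs]
      refine (abs_add_le _ _).trans (add_le_add ?_ h0)
      rw [abs_mul, abs_neg, abs_of_nonneg (sq_nonneg α)]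
      exact mul_le_mul_of_nonneg_left h2 (sq_nonneg α)
    · refine tendsto_const_nhds.congr' ?_
      filter_upwards [cutoff_eventually x] with n hn
      have hgh : g n =ᶠ[𝓝 x] h := by
        filter_upwards [hn] with y hy
        simp [hg, hy]
      rw [helm, helm, (InnerProductSpace.laplacian_congr_nhds hgh).eq_of_nhds, hgh.eq_of_nhds]
  refine tendsto_nhds_unique hlim ?_
  simp only [fun n => hw (g n) (hgt n)]
  exact tendsto_const_nhds

/-- Composition of a Schwartz function with a real-linear functional. -/
def schwartzComp (l : ℂ →L[ℝ] ℝ) (f : 𝓢(E3, ℂ)) : 𝓢(E3, ℝ) :=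
  SchwartzMap.bilinLeftCLM ((ContinuousLinearMap.lsmul ℝ ℝ).flip.comp l : ℂ →L[ℝ] ℝ →L[ℝ] ℝ)
    (g := fun _ : E3 => (1 : ℝ)) (by fun_prop) f

theorem schwartzComp_coe (l : ℂ →L[ℝ] ℝ) (f : 𝓢(E3, ℂ)) : (schwartzComp l f : E3 → ℝ) = l ∘ f := by
  funext x
  rw [schwartzComp, SchwartzMap.bilinLeftCLM_apply]
  simp

theorem integral_helm_schwartz_complex {α : ℝ} {w : L2 ℝ}
    (hw : ∀ φ : E3 → ℝ, IsTest φ → ∫ x, w x * helm α φ x = 0) (f : 𝓢(E3, ℂ)) :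
    ∫ x, (w x : ℂ) * (-(α ^ 2 : ℝ) * Laplacian.laplacian (f : E3 → ℂ) x + f x) = 0 := by
  have hl : ∀ l : ℂ →L[ℝ] ℝ,
      ∫ x, w x * (l (-(α ^ 2 : ℝ) * Laplacian.laplacian (f : E3 → ℂ) x + f x)) = 0 := fun l => by
    rw [← integral_helm_schwartz hw (schwartzComp l f)]
    refine integral_congr_ae (Eventually.of_forall fun x => ?_)
    simp only [helm, schwartzComp_coe]
    have hc := (((f.smooth ⊤).of_le two_le_infty : ContDiff ℝ 2 f).contDiffAt
      (x := x)).laplacian_CLM_comp_left (l := l)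
    change Laplacian.laplacian (l ∘ f) x = _ at hc
    rw [hc, map_add, Function.comp_apply, Function.comp_apply]
    have : ((-(α ^ 2 : ℝ) : ℂ)) * Laplacian.laplacian (f : E3 → ℂ) x
        = (-(α ^ 2)) • Laplacian.laplacian (f : E3 → ℂ) x := by simp
    rw [this, map_smul, smul_eq_mul]
  set F : E3 → ℂ := fun x => (w x : ℂ) * (-(α ^ 2 : ℝ) * Laplacian.laplacian (f : E3 → ℂ) x + f x)
    with hF
  by_cases hi : Integrable F volume
  · apply Complex.ext
    · have h := (Complex.reCLM.integral_comp_comm hi).symm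
      simp only [Complex.reCLM_apply] at h
      rw [h, Complex.zero_re, ← hl Complex.reCLM]
      simp only [hF, Complex.re_ofReal_mul, Complex.reCLM_apply]
    · have h := (Complex.imCLM.integral_comp_comm hi).symm
      simp only [Complex.imCLM_apply] at h
      rw [h, Complex.zero_im, ← hl Complex.imCLM]
      simp only [hF, Complex.im_ofReal_mul, Complex.imCLM_apply]
  · exact integral_undef hi

/-- Testing with inverse transforms of arbitrary Schwartz functions says that (1 + α²λ) times the
conjugate of `ft w` vanishes as a distribution; the factor is positive, so `ft w` vanishes. -/
theorem eq_zero_of_forall_helm {α : ℝ} {w : L2 ℝ}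
    (hw : ∀ φ : E3 → ℝ, IsTest φ → ∫ x, w x * helm α φ x = 0) : w = 0 := by
  have key : ∀ G : 𝓢(E3, ℂ),
      ∫ ξ, ((1 + α ^ 2 * lam ξ : ℝ) : ℂ) * conj (ft w ξ) * G ξ = 0 := fun G => by
    set f : 𝓢(E3, ℂ) := 𝓕⁻ G with hf
    have hFf : 𝓕 f = G := by rw [hf, FourierTransform.fourier_fourierInv_eq]
    set H : 𝓢(E3, ℂ) := (-(α ^ 2 : ℝ) : ℂ) • Laplacian.laplacian f + f with hH
    have h0 : inner ℂ (toCL2 w) (H.toLp 2) = 0 := by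
      rw [← integral_helm_schwartz_complex hw f, L2.inner_def]
      refine integral_congr_ae ?_
      filter_upwards [coeFn_toCL2 w, H.coeFn_toLp 2 volume] with x h1 h2
      rw [h1, h2, hH, add_apply, smul_apply, SchwartzMap.laplacian_apply]
      simp [mul_comm]
    rw [← Lp.inner_fourier_eq, ← ft_apply, SchwartzMap.toLp_fourier_eq, L2.inner_def] at h0
    rw [← h0]
    have hFH : ∀ ξ, 𝓕 H ξ = ((1 + α ^ 2 * lam ξ : ℝ) : ℂ) * G ξ := fun ξ => by
      rw [hH, FourierTransform.fourier_add, FourierTransform.fourier_smul,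
        SchwartzMap.laplacian_eq_fourierMultiplierCLM, FourierTransform.fourier_smul,
        SchwartzMap.fourierMultiplierCLM_apply, FourierTransform.fourier_fourierInv_eq, hFf,
        add_apply, smul_apply, smul_apply,
        SchwartzMap.smulLeftCLM_apply_apply (by fun_prop)]
      simp only [lam, Complex.real_smul, smul_eq_mul]
      push_cast
      ring
    refine integral_congr_ae ?_
    filter_upwards [(𝓕 H).coeFn_toLp 2 volume] with ξ h1
    rw [h1, hFH]
    simp only [RCLike.inner_apply]
    ring
  have hli : LocallyIntegrable (fun ξ => ((1 + α ^ 2 * lam ξ : ℝ) : ℂ) * conj (ft w ξ))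
      (volume : Measure E3) := by
    have h1 : LocallyIntegrable (fun ξ => conj (ft w ξ)) (volume : Measure E3) :=
      ((Lp.memLp (ft w)).star).locallyIntegrable (by norm_num)
    have hc : Continuous fun ξ : E3 => ((1 + α ^ 2 * lam ξ : ℝ) : ℂ) :=
      Complex.continuous_ofReal.comp (continuous_const.add (continuous_const.mul continuous_lam))
    rw [← locallyIntegrableOn_univ] at h1 ⊢
    exact h1.continuousOn_smul isOpen_univ.isLocallyClosed hc.continuousOn
  have h0 := ae_eq_zero_of_integral_contDiff_smul_eq_zero hli (fun φ h1 h2 => by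
    have hφ : IsTest φ := ⟨h1, h2⟩
    rw [← key hφ.toSchwartz]
    refine integral_congr_ae (Eventually.of_forall fun ξ => ?_)
    simp only [hφ.toSchwartz_apply, Complex.real_smul]
    ring)
  apply ft_injective
  rw [map_zero]
  rw [Lp.eq_zero_iff_ae_eq_zero]
  filter_upwards [h0] with ξ hξ
  have hpos : ((1 + α ^ 2 * lam ξ : ℝ) : ℂ) ≠ 0 := by
    have := lam_nonneg ξ
    exact_mod_cast (by positivity : (0 : ℝ) < 1 + α ^ 2 * lam ξ).ne'
  have := (mul_eq_zero.1 hξ).resolve_left hpos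
  simpa using this

/-- The functions `φ - α² Δφ`, for `φ` a test function, are dense in `L²`. -/
theorem dense_helm (α : ℝ) :
    Dense {g : L2 ℝ | ∃ (φ : E3 → ℝ) (hφ : IsTest φ), g = (hφ.helm α).toL2} := by
  let K : Submodule ℝ (L2 ℝ) :=
    { carrier := {g : L2 ℝ | ∃ (φ : E3 → ℝ) (hφ : IsTest φ), g = (hφ.helm α).toL2}
      zero_mem' := by
        have h0 : IsTest (0 : E3 → ℝ) := ⟨contDiff_const, HasCompactSupport.zero⟩
        refine ⟨0, h0, ?_⟩
        refine (L2.ext_ft ?_).symm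
        have hz : h0.toL2 = 0 := MemLp.toLp_zero _
        filter_upwards [h0.ft_helm α, Lp.coeFn_zero ℂ 2 (volume : Measure E3)] with ξ h1 h2
        rw [h1, hz, map_zero, h2]
        simp
      add_mem' := by
        rintro _ _ ⟨φ, hφ, rfl⟩ ⟨ψ, hψ, rfl⟩
        refine ⟨φ + ψ, hφ.add hψ, L2.ext_ft ?_⟩
        have ha : (hφ.add hψ).toL2 = hφ.toL2 + hψ.toL2 := MemLp.toLp_add _ _
        rw [map_add]
        filter_upwards [(hφ.add hψ).ft_helm α, hφ.ft_helm α, hψ.ft_helm α,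
          Lp.coeFn_add (ft (hφ.helm α).toL2) (ft (hψ.helm α).toL2),
          Lp.coeFn_add (ft hφ.toL2) (ft hψ.toL2)] with ξ h1 h2 h3 h4 h5
        rw [h1, h4, Pi.add_apply, h2, h3, ha, map_add, h5, Pi.add_apply]
        ring
      smul_mem' := by
        rintro c _ ⟨φ, hφ, rfl⟩
        refine ⟨_, hφ.smul c, L2.ext_ft ?_⟩
        have ha : (hφ.smul c).toL2 = c • hφ.toL2 := MemLp.toLp_const_smul c _
        rw [map_smul]
        filter_upwards [(hφ.smul c).ft_helm α, hφ.ft_helm α,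
          Lp.coeFn_smul c (ft (hφ.helm α).toL2), Lp.coeFn_smul c (ft hφ.toL2)] with ξ h1 h2 h3 h4
        rw [h1, h3, Pi.smul_apply, h2, ha, map_smul, h4, Pi.smul_apply]
        simp only [Complex.real_smul]
        ring }
  have hK : K.topologicalClosure = ⊤ := by
    rw [Submodule.topologicalClosure_eq_top_iff, Submodule.eq_bot_iff]
    intro g hg
    refine eq_zero_of_forall_helm (α := α) fun φ hφ => ?_
    have := hg _ ⟨φ, hφ, rfl⟩
    rw [(hφ.helm α).inner_toL2] at this
    simpa only [mul_comm] using this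
  exact Submodule.dense_iff_topologicalClosure_eq_top.2 hK

/-! ### Bessel potentials, weak derivatives and the filtering operator -/

/-- The symbol `(1 + α² |2πξ|²)⁻¹` of the filtering operator. -/
def rSym (α : ℝ) (ξ : E3) : ℂ := (((1 + α ^ 2 * lam ξ)⁻¹ : ℝ) : ℂ)

/-- The square root of the symbol of the filtering operator. -/
def sSym (α : ℝ) (ξ : E3) : ℂ := ((√((1 + α ^ 2 * lam ξ)⁻¹) : ℝ) : ℂ)

theorem one_add_pos (α : ℝ) (ξ : E3) : 0 < 1 + α ^ 2 * lam ξ := by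
  have := lam_nonneg ξ
  positivity

theorem continuous_one_add_inv (α : ℝ) : Continuous fun ξ => (1 + α ^ 2 * lam ξ)⁻¹ :=
  (continuous_const.add (continuous_const.mul continuous_lam)).inv₀ fun ξ => (one_add_pos α ξ).ne'

theorem one_add_inv_le_one (α : ℝ) (ξ : E3) : (1 + α ^ 2 * lam ξ)⁻¹ ≤ 1 :=
  inv_le_one_of_one_le₀ (by have := lam_nonneg ξ; nlinarith [mul_nonneg (sq_nonneg α) this])

theorem sSym_mul_self (α : ℝ) (ξ : E3) : sSym α ξ * sSym α ξ = rSym α ξ := by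
  rw [sSym, rSym, ← Complex.ofReal_mul, Real.mul_self_sqrt (inv_pos.2 (one_add_pos α ξ)).le]

theorem rSym_mul (α : ℝ) (ξ : E3) : rSym α ξ * (1 + (α : ℂ) ^ 2 * (lam ξ : ℂ)) = 1 := by
  rw [rSym]
  have := (one_add_pos α ξ).ne'
  exact_mod_cast inv_mul_cancel₀ this

theorem rSym_ne_zero (α : ℝ) (ξ : E3) : rSym α ξ ≠ 0 :=
  left_ne_zero_of_mul_eq_one (rSym_mul α ξ)

theorem sSym_ne_zero (α : ℝ) (ξ : E3) : sSym α ξ ≠ 0 :=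
  fun h => rSym_ne_zero α ξ (by rw [← sSym_mul_self, h, zero_mul])

theorem conj_sSym (α : ℝ) (ξ : E3) : conj (sSym α ξ) = sSym α ξ := Complex.conj_ofReal _

theorem conj_rSym (α : ℝ) (ξ : E3) : conj (rSym α ξ) = rSym α ξ := Complex.conj_ofReal _

theorem norm_sSym_sq (α : ℝ) (ξ : E3) : ‖sSym α ξ‖ ^ 2 = (1 + α ^ 2 * lam ξ)⁻¹ := by
  rw [sSym, Complex.norm_real, Real.norm_eq_abs, sq_abs,
    Real.sq_sqrt (inv_pos.2 (one_add_pos α ξ)).le]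

theorem norm_sSym_le (α : ℝ) (ξ : E3) : ‖sSym α ξ‖ ≤ 1 := by
  refine (pow_le_pow_iff_left₀ (norm_nonneg _) zero_le_one two_ne_zero).1 ?_
  rw [norm_sSym_sq, one_pow]
  exact one_add_inv_le_one α ξ

theorem isSymbol_sSym (α : ℝ) : IsSymbol (sSym α) :=
  ⟨(Complex.continuous_ofReal.comp (continuous_one_add_inv α).sqrt).measurable,
    ⟨1, norm_sSym_le α⟩, fun ξ => by simp only [sSym, lam_neg, Complex.conj_ofReal]⟩

theorem isSymbol_rSym (α : ℝ) : IsSymbol (rSym α) := by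
  simpa only [sSym_mul_self] using (isSymbol_sSym α).mul (isSymbol_sSym α)

theorem norm_dSym_mul_sSym_le {α : ℝ} (hα : 0 < α) (i : Fin 3) (ξ : E3) :
    ‖dSym i ξ * sSym α ξ‖ ≤ α⁻¹ := by
  refine (pow_le_pow_iff_left₀ (norm_nonneg _) (by positivity) two_ne_zero).1 ?_
  rw [norm_mul, mul_pow, norm_sSym_sq, inv_pow, ← div_eq_mul_inv, div_le_iff₀ (one_add_pos α ξ),
    mul_add, ← mul_assoc, inv_mul_cancel₀ (by positivity), one_mul]
  have := norm_dSym_sq_le i ξ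
  have : 0 < (α ^ 2)⁻¹ := by positivity
  linarith

theorem isSymbol_dSym_mul_sSym {α : ℝ} (hα : 0 < α) (i : Fin 3) :
    IsSymbol (fun ξ => dSym i ξ * sSym α ξ) :=
  ⟨(continuous_dSym i).measurable.mul (isSymbol_sSym α).measurable,
    ⟨α⁻¹, norm_dSym_mul_sSym_le hα i⟩, fun ξ => by
      rw [map_mul, dSym_neg, (isSymbol_sSym α).hermitian]⟩

theorem isSymbol_dSym_mul_rSym {α : ℝ} (hα : 0 < α) (i : Fin 3) :
    IsSymbol (fun ξ => dSym i ξ * rSym α ξ) := by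
  simpa only [mul_assoc, sSym_mul_self] using (isSymbol_dSym_mul_sSym hα i).mul (isSymbol_sSym α)

theorem isSymbol_dSym_mul_dSym_mul_rSym {α : ℝ} (hα : 0 < α) (i j : Fin 3) :
    IsSymbol (fun ξ => dSym i ξ * dSym j ξ * rSym α ξ) := by
  have h := (isSymbol_dSym_mul_sSym hα i).mul (isSymbol_dSym_mul_sSym hα j)
  convert h using 2 with ξ
  rw [← sSym_mul_self]
  ring

theorem isSymbol_lam_mul_rSym {α : ℝ} (hα : 0 < α) : IsSymbol (fun ξ => (lam ξ : ℂ) * rSym α ξ) := by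
  have h := (IsSymbol.sum Finset.univ fun i => isSymbol_dSym_mul_dSym_mul_rSym hα i i).neg
  convert h using 2 with ξ
  rw [← Finset.sum_mul, sum_dSym_sq]
  ring

theorem mult_rSym_injective (α : ℝ) : Function.Injective (mult (rSym α)) :=
  mult_injective (isSymbol_rSym α) (Eventually.of_forall (rSym_ne_zero α))

theorem mult_sSym_sSym (α : ℝ) (g : L2 ℝ) : mult (sSym α) (mult (sSym α) g) = mult (rSym α) g := by
  rw [mult_mult (isSymbol_sSym α) (isSymbol_sSym α)]
  simp only [sSym_mul_self]

section TestFunctions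

variable {φ : E3 → ℝ} {α : ℝ}

/-- This exhibits a test function as a bounded operator applied to a member of the dense set of
`dense_helm`, so that unbounded differential operators never have to be applied to L² elements. -/
theorem IsTest.toL2_eq (α : ℝ) (hφ : IsTest φ) : hφ.toL2 = mult (rSym α) (hφ.helm α).toL2 := by
  refine L2.ext_ft ?_
  filter_upwards [ft_mult (isSymbol_rSym α) (hφ.helm α).toL2, hφ.ft_helm α] with ξ h1 h2
  rw [h1, h2]
  have := rSym_mul α ξ
  push_cast
  linear_combination (-(ft hφ.toL2 ξ)) * this

theorem IsTest.toL2_partial_eq (hα : 0 < α) (hφ : IsTest φ) (i : Fin 3) :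
    (hφ.partial_isTest i).toL2 = mult (fun ξ => dSym i ξ * rSym α ξ) (hφ.helm α).toL2 := by
  refine L2.ext_ft ?_
  filter_upwards [ft_mult (isSymbol_dSym_mul_rSym hα i) (hφ.helm α).toL2, hφ.ft_helm α,
    hφ.ft_partial i] with ξ h1 h2 h3
  rw [h1, h2, h3]
  have := rSym_mul α ξ
  push_cast
  linear_combination (-(dSym i ξ * ft hφ.toL2 ξ)) * this

theorem IsTest.toL2_laplacian_eq (hα : 0 < α) (hφ : IsTest φ) :
    hφ.laplacian.toL2 = -mult (fun ξ => (lam ξ : ℂ) * rSym α ξ) (hφ.helm α).toL2 := by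
  rw [← mult_neg (isSymbol_lam_mul_rSym hα)]
  refine L2.ext_ft ?_
  filter_upwards [ft_mult (isSymbol_lam_mul_rSym hα).neg (hφ.helm α).toL2, hφ.ft_helm α,
    hφ.ft_laplacian] with ξ h1 h2 h3
  rw [h1, h2, h3]
  have := rSym_mul α ξ
  push_cast
  linear_combination ((lam ξ : ℂ) * ft hφ.toL2 ξ) * this

theorem ext_inner_helm {g h : L2 ℝ} (α : ℝ)
    (H : ∀ (φ : E3 → ℝ) (hφ : IsTest φ), inner ℝ (hφ.helm α).toL2 g = inner ℝ (hφ.helm α).toL2 h) :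
    g = h := by
  refine (dense_helm α).eq_of_inner_right ℝ ?_
  rintro _ ⟨φ, hφ, rfl⟩
  exact H φ hφ

end TestFunctions

section WeakDerivatives

variable {α : ℝ}

theorem inner_mult_dSym_mul_rSym (hα : 0 < α) (i : Fin 3) (g h : L2 ℝ) :
    inner ℝ (mult (fun ξ => dSym i ξ * rSym α ξ) g) h
      = -inner ℝ g (mult (fun ξ => dSym i ξ * rSym α ξ) h) := by
  rw [inner_mult_left (isSymbol_dSym_mul_rSym hα i), ← inner_neg_right,
    ← mult_neg (isSymbol_dSym_mul_rSym hα i)]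
  simp only [map_mul, conj_dSym, conj_rSym, neg_mul]

/-- Put φ = (1 - α²Δ)^{-1} h with h in a dense set and move the skew operator ∂ᵢ(1 - α²Δ)^{-1} onto
g. The smoothing by `rSym` on both sides keeps every operator bounded. -/
theorem isWeakPartial_iff (hα : 0 < α) {i : Fin 3} {g h : L2 ℝ} :
    IsWeakPartial i g h ↔ mult (rSym α) h = mult (fun ξ => dSym i ξ * rSym α ξ) g := by
  have key : ∀ (φ : E3 → ℝ) (hφ : IsTest φ), (∫ x, pderiv3 i φ x • g x = - ∫ x, φ x • h x) ↔
      inner ℝ (hφ.helm α).toL2 (mult (rSym α) h)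
        = inner ℝ (hφ.helm α).toL2 (mult (fun ξ => dSym i ξ * rSym α ξ) g) := fun φ hφ => by
    have e1 : ∫ x, pderiv3 i φ x • g x
        = -inner ℝ (hφ.helm α).toL2 (mult (fun ξ => dSym i ξ * rSym α ξ) g) := by
      rw [← inner_mult_dSym_mul_rSym hα, ← hφ.toL2_partial_eq hα i, IsTest.inner_toL2]
      rfl
    have e2 : ∫ x, φ x • h x = inner ℝ (hφ.helm α).toL2 (mult (rSym α) h) := by
      rw [← inner_mult_of_real (isSymbol_rSym α) (conj_rSym α), ← hφ.toL2_eq, IsTest.inner_toL2]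
      rfl
    rw [e1, e2, neg_inj]
    exact eq_comm
  constructor
  · intro H
    exact ext_inner_helm α fun φ hφ => (key φ hφ).1 (H φ hφ)
  · intro H φ hφ
    exact (key φ hφ).2 (by rw [H])

theorem isWeakPartial_mult (hα : 0 < α) {i : Fin 3} {m : E3 → ℂ} (hm : IsSymbol m)
    (hdm : IsSymbol (fun ξ => dSym i ξ * m ξ)) (g : L2 ℝ) :
    IsWeakPartial i (mult m g) (mult (fun ξ => dSym i ξ * m ξ) g) := by
  rw [isWeakPartial_iff hα, mult_mult (isSymbol_rSym α) hdm, mult_mult (isSymbol_dSym_mul_rSym hα i) hm]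
  congr 2
  funext ξ
  ring

/-- The same duality gives existence and uniqueness at once for square integrable data, so the
choice made in `helmholtzFilter` is forced. -/
theorem isHelmholtzSolution_iff {g : E3 → ℝ} {G w : L2 ℝ} (hG : g =ᵐ[volume] G) :
    IsHelmholtzSolution α g w ↔ w = mult (rSym α) G := by
  have key : ∀ (φ : E3 → ℝ) (hφ : IsTest φ),
      (∫ x, w x * (-(α ^ 2) * Laplacian.laplacian φ x + φ x) = ∫ x, g x * φ x) ↔
      inner ℝ (hφ.helm α).toL2 w = inner ℝ (hφ.helm α).toL2 (mult (rSym α) G) := fun φ hφ => by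
    have e1 : ∫ x, w x * (-(α ^ 2) * Laplacian.laplacian φ x + φ x)
        = inner ℝ (hφ.helm α).toL2 w := by
      rw [IsTest.inner_toL2]
      exact integral_congr_ae (Eventually.of_forall fun x => mul_comm _ _)
    have e2 : ∫ x, g x * φ x = inner ℝ (hφ.helm α).toL2 (mult (rSym α) G) := by
      rw [← inner_mult_of_real (isSymbol_rSym α) (conj_rSym α), ← hφ.toL2_eq, IsTest.inner_toL2]
      refine integral_congr_ae ?_
      filter_upwards [hG] with x hx
      rw [hx, mul_comm]
    rw [e1, e2]
  constructor
  · intro H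
    exact ext_inner_helm α fun φ hφ => (key φ hφ).1 (H φ hφ)
  · intro H φ hφ
    exact (key φ hφ).2 (by rw [H])

theorem helmholtzFilter_eq {g : E3 → ℝ} {G : L2 ℝ} (hG : g =ᵐ[volume] G) :
    helmholtzFilter α g = mult (rSym α) G :=
  (isHelmholtzSolution_iff hG).1 (Classical.epsilon_spec
    (p := IsHelmholtzSolution α g) ⟨_, (isHelmholtzSolution_iff hG).2 rfl⟩)

end WeakDerivatives

/-! ### Vector fields -/

/-- The components of a vector field. -/
def comp (k : Fin 3) : L2 E3 →L[ℝ] L2 ℝ :=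
  (EuclideanSpace.proj k : E3 →L[ℝ] ℝ).compLpL 2 volume

theorem coeFn_comp (k : Fin 3) (g : L2 E3) : comp k g =ᵐ[volume] fun x => g x k :=
  (EuclideanSpace.proj k : E3 →L[ℝ] ℝ).coeFn_compLpL g

/-- The vector field with only the `k`-th component nonzero. -/
def vecSingle (k : Fin 3) : L2 ℝ →L[ℝ] L2 E3 :=
  ((ContinuousLinearMap.id ℝ ℝ).smulRight (EuclideanSpace.single k (1 : ℝ))).compLpL 2 volume

theorem coeFn_vecSingle (k : Fin 3) (g : L2 ℝ) :
    vecSingle k g =ᵐ[volume] fun x => g x • EuclideanSpace.single k (1 : ℝ) :=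
  ((ContinuousLinearMap.id ℝ ℝ).smulRight (EuclideanSpace.single k (1 : ℝ))).coeFn_compLpL g

theorem comp_vecSingle (j k : Fin 3) (g : L2 ℝ) :
    comp j (vecSingle k g) = if j = k then g else 0 := by
  ext1
  filter_upwards [coeFn_comp j (vecSingle k g), coeFn_vecSingle k g,
    Lp.coeFn_zero ℝ 2 (volume : Measure E3)] with x h1 h2 h3
  rw [h1, h2]
  split_ifs with h
  · simp [h]
  · rw [h3]
    simp [h]

/-- The vector field with given components. -/
def vec : (Fin 3 → L2 ℝ) →L[ℝ] L2 E3 :=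
  ∑ k, (vecSingle k) ∘L ContinuousLinearMap.proj k

theorem vec_apply (a : Fin 3 → L2 ℝ) : vec a = ∑ k, vecSingle k (a k) := by
  simp [vec]

@[simp]
theorem comp_vec (j : Fin 3) (a : Fin 3 → L2 ℝ) : comp j (vec a) = a j := by
  simp [vec_apply, comp_vecSingle]

theorem L2.ext_comp {g h : L2 E3} (H : ∀ k, comp k g = comp k h) : g = h := by
  have h1 : ∀ᵐ x ∂(volume : Measure E3), ∀ k, g x k = h x k := by
    refine ae_all_iff.2 fun k => ?_
    filter_upwards [coeFn_comp k g, coeFn_comp k h] with x h1 h2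
    rw [← h1, ← h2, H]
  ext1
  filter_upwards [h1] with x hx
  ext k
  exact hx k

theorem inner_eq_sum_comp (g h : L2 E3) :
    inner ℝ g h = ∑ k, inner ℝ (comp k g) (comp k h) := by
  simp only [L2.inner_def]
  rw [← integral_finsetSum _ fun k _ => L2.integrable_inner (comp k g) (comp k h)]
  refine integral_congr_ae ?_
  have h1 : ∀ᵐ x ∂(volume : Measure E3), ∀ k, comp k g x = g x k :=
    ae_all_iff.2 fun k => coeFn_comp k g
  have h2 : ∀ᵐ x ∂(volume : Measure E3), ∀ k, comp k h x = h x k :=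
    ae_all_iff.2 fun k => coeFn_comp k h
  filter_upwards [h1, h2] with x h1 h2
  simp only [h1, h2]
  rfl

theorem norm_sq_eq_sum_comp (g : L2 E3) : ‖g‖ ^ 2 = ∑ k, ‖comp k g‖ ^ 2 := by
  simp only [← real_inner_self_eq_norm_sq]
  exact inner_eq_sum_comp g g

theorem isWeakPartial_comp {i : Fin 3} {g h : L2 E3} :
    IsWeakPartial i g h ↔ ∀ k, IsWeakPartial i (comp k g) (comp k h) := by
  have e : ∀ (g : L2 E3) (φ : E3 → ℝ), IsTest φ → ∀ k,
      (∫ x, φ x • g x) k = ∫ x, φ x • comp k g x := fun g φ hφ k => by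
    have := (EuclideanSpace.proj k : E3 →L[ℝ] ℝ).integral_comp_comm
      (hφ.integrable_smul g)
    refine this.symm.trans ?_
    refine integral_congr_ae ?_
    filter_upwards [coeFn_comp k g] with x hx
    rw [hx]
    simp
  constructor
  · intro H k φ hφ
    rw [← e g _ (hφ.partial_isTest i), ← e h _ hφ, H φ hφ]
    rfl
  · intro H φ hφ
    ext k
    rw [e g _ (hφ.partial_isTest i), H k φ hφ, ← e h _ hφ]
    rfl

theorem isDivFree_iff {α : ℝ} (hα : 0 < α) {g : L2 E3} :
    IsDivFree g ↔ ∑ i, mult (fun ξ => dSym i ξ * rSym α ξ) (comp i g) = 0 := by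
  have key : ∀ (φ : E3 → ℝ) (hφ : IsTest φ), ∫ x, ∑ i, pderiv3 i φ x * g x i
      = -inner ℝ (hφ.helm α).toL2 (∑ i, mult (fun ξ => dSym i ξ * rSym α ξ) (comp i g)) := by
    intro φ hφ
    rw [integral_finsetSum, inner_sum, ← Finset.sum_neg_distrib]
    · refine Finset.sum_congr rfl fun i _ => ?_
      rw [← inner_mult_dSym_mul_rSym hα, ← hφ.toL2_partial_eq hα i, IsTest.inner_toL2]
      refine integral_congr_ae ?_
      filter_upwards [coeFn_comp i g] with x hx
      rw [hx]
    · intro i _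
      simpa using (EuclideanSpace.proj (𝕜 := ℝ) i).integrable_comp
        ((hφ.partial_isTest i).integrable_smul g)
  constructor
  · intro H
    refine ext_inner_helm α fun φ hφ => ?_
    have := key φ hφ
    rw [H φ hφ] at this
    rw [inner_zero_right]
    linarith
  · intro H φ hφ
    rw [key φ hφ, H, inner_zero_right, neg_zero]

/-! ### Parametrization of the energy space -/

/-- Triples of square integrable functions. -/
abbrev V3 : Type := PiLp 2 (fun _ : Fin 3 => L2 ℝ)

/-- The triples `a` for which the vector field `(1 - α²Δ)^{-1/2} a` is divergence free. -/
def solenoidal (α : ℝ) : Submodule ℝ V3 :=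
  LinearMap.ker (∑ i, (mult (fun ξ => dSym i ξ * sSym α ξ)) ∘L
    (PiLp.proj (𝕜 := ℝ) 2 (fun _ : Fin 3 => L2 ℝ) i) : V3 →L[ℝ] L2 ℝ).toLinearMap

theorem mem_solenoidal {α : ℝ} {a : V3} :
    a ∈ solenoidal α ↔ ∑ i, mult (fun ξ => dSym i ξ * sSym α ξ) (a i) = 0 := by
  simp [solenoidal]

theorem isClosed_solenoidal (α : ℝ) : IsClosed (solenoidal α : Set V3) :=
  ContinuousLinearMap.isClosed_ker _

instance (α : ℝ) : CompleteSpace (solenoidal α) :=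
  (isClosed_solenoidal α).completeSpace_coe

/-- On the Fourier side this is s²(1 + α²λ) = 1; it is the reason why a ↦ (1 - α²Δ)^{-1/2} a is
isometric from L² into H¹ with the α-norm. -/
theorem sum_norm_sq_mult {α : ℝ} (hα : 0 < α) (g : L2 ℝ) :
    ‖mult (sSym α) g‖ ^ 2 + α ^ 2 * ∑ j, ‖mult (fun ξ => dSym j ξ * sSym α ξ) g‖ ^ 2
      = ‖g‖ ^ 2 := by
  have h1 : ‖mult (sSym α) g‖ ^ 2 = inner ℝ g (mult (rSym α) g) := by
    rw [← real_inner_self_eq_norm_sq, inner_mult_of_real (isSymbol_sSym α) (conj_sSym α),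
      mult_sSym_sSym]
  have h2 : ∀ j, ‖mult (fun ξ => dSym j ξ * sSym α ξ) g‖ ^ 2
      = -inner ℝ g (mult (fun ξ => dSym j ξ * dSym j ξ * rSym α ξ) g) := fun j => by
    rw [← real_inner_self_eq_norm_sq, inner_mult_left (isSymbol_dSym_mul_sSym hα j),
      mult_mult (isSymbol_dSym_mul_sSym hα j).star (isSymbol_dSym_mul_sSym hα j),
      ← inner_neg_right, ← mult_neg (isSymbol_dSym_mul_dSym_mul_rSym hα j j)]
    congr 3
    funext ξ
    rw [map_mul, conj_dSym, conj_sSym, ← sSym_mul_self]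
    ring
  simp only [h1, h2]
  rw [Finset.sum_neg_distrib, ← inner_sum,
    ← mult_sum _ fun j => isSymbol_dSym_mul_dSym_mul_rSym hα j j, ← inner_neg_right,
    ← mult_neg (IsSymbol.sum _ fun j => isSymbol_dSym_mul_dSym_mul_rSym hα j j),
    ← real_inner_smul_right,
    ← mult_const_mul _ (IsSymbol.sum _ fun j => isSymbol_dSym_mul_dSym_mul_rSym hα j j).neg,
    ← inner_add_right, ← mult_add (isSymbol_rSym α) (IsSymbol.const_mul _
      (IsSymbol.sum _ fun j => isSymbol_dSym_mul_dSym_mul_rSym hα j j).neg),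
    ← real_inner_self_eq_norm_sq]
  congr 1
  conv_rhs => rw [← mult_one g]
  congr 2
  funext ξ
  rw [← Finset.sum_mul, sum_dSym_sq]
  push_cast
  linear_combination rSym_mul α ξ

/-- The vector field `(1 - α²Δ)^{-1/2} a`. -/
def besselField (α : ℝ) : V3 →L[ℝ] L2 E3 :=
  ∑ k, (vecSingle k) ∘L (mult (sSym α)) ∘L (PiLp.proj (𝕜 := ℝ) 2 (fun _ : Fin 3 => L2 ℝ) k)

@[simp]
theorem comp_besselField (α : ℝ) (k : Fin 3) (a : V3) :
    comp k (besselField α a) = mult (sSym α) (a k) := by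
  simp [besselField, comp_vecSingle]

/-- The field `∂ⱼ (1 - α²Δ)^{-1/2} a`. -/
def besselGrad (α : ℝ) (j : Fin 3) : V3 →L[ℝ] L2 E3 :=
  ∑ k, (vecSingle k) ∘L (mult (fun ξ => dSym j ξ * sSym α ξ)) ∘L
    (PiLp.proj (𝕜 := ℝ) 2 (fun _ : Fin 3 => L2 ℝ) k)

@[simp]
theorem comp_besselGrad (α : ℝ) (j k : Fin 3) (a : V3) :
    comp k (besselGrad α j a) = mult (fun ξ => dSym j ξ * sSym α ξ) (a k) := by
  simp [besselGrad, comp_vecSingle]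

theorem isWeakPartial_besselField {α : ℝ} (hα : 0 < α) (j : Fin 3) (a : V3) :
    IsWeakPartial j (besselField α a) (besselGrad α j a) := by
  rw [isWeakPartial_comp]
  intro k
  rw [comp_besselField, comp_besselGrad]
  exact isWeakPartial_mult hα (isSymbol_sSym α) (isSymbol_dSym_mul_sSym hα j) (a k)

theorem isDivFree_besselField {α : ℝ} (hα : 0 < α) {a : V3} (ha : a ∈ solenoidal α) :
    IsDivFree (besselField α a) := by
  rw [isDivFree_iff hα]
  have h : ∀ i, mult (fun ξ => dSym i ξ * rSym α ξ) (comp i (besselField α a))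
      = mult (rSym α) (mult (fun ξ => dSym i ξ * sSym α ξ) (a i)) := fun i => by
    rw [comp_besselField, mult_mult (isSymbol_dSym_mul_rSym hα i) (isSymbol_sSym α),
      mult_mult (isSymbol_rSym α) (isSymbol_dSym_mul_sSym hα i)]
    congr 2
    funext ξ
    ring
  simp only [h, ← map_sum]
  rw [mem_solenoidal.1 ha, map_zero]

/-- The linear map `a ↦ (1 - α²Δ)^{-1/2} a` into the energy space. -/
def toEnergyₗ {α : ℝ} (hα : 0 < α) : solenoidal α →ₗ[ℝ] energySpace α where
  toFun a := ⟨WithLp.toLp 2 (besselField α a, WithLp.toLp 2 fun j => α • besselGrad α j a),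
    fun j => ⟨besselGrad α j a, isWeakPartial_besselField hα j a, rfl⟩,
    isDivFree_besselField hα a.2⟩
  map_add' a b := by
    apply Subtype.ext
    simp only [Submodule.coe_add, map_add, smul_add]
    rfl
  map_smul' c a := by
    apply Subtype.ext
    simp only [Submodule.coe_smul, map_smul, RingHom.id_apply, smul_comm α c]
    rfl

theorem norm_toEnergyₗ {α : ℝ} (hα : 0 < α) (a : solenoidal α) : ‖toEnergyₗ hα a‖ = ‖a‖ := by
  refine (pow_left_inj₀ (norm_nonneg _) (norm_nonneg _) two_ne_zero).1 ?_
  have h1 : ‖toEnergyₗ hα a‖ ^ 2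
      = ‖besselField α a‖ ^ 2 + ‖(WithLp.toLp 2 fun j => α • besselGrad α j a :
        PiLp 2 (fun _ : Fin 3 => L2 E3))‖ ^ 2 :=
    WithLp.prod_norm_sq_eq_of_L2 (toEnergyₗ hα a).1
  have h2 : ‖a‖ ^ 2 = ∑ k, ‖(a : V3) k‖ ^ 2 := PiLp.norm_sq_eq_of_L2 _ (a : V3)
  rw [h1, h2, PiLp.norm_sq_eq_of_L2, norm_sq_eq_sum_comp]
  simp only [norm_smul, mul_pow, norm_sq_eq_sum_comp (besselGrad _ _ _), comp_besselField,
    comp_besselGrad, Real.norm_eq_abs, sq_abs]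
  rw [← Finset.mul_sum, Finset.sum_comm, Finset.mul_sum, ← Finset.sum_add_distrib]
  exact Finset.sum_congr rfl fun k _ => sum_norm_sq_mult hα _

theorem toEnergyₗ_surjective {α : ℝ} (hα : 0 < α) : Function.Surjective (toEnergyₗ hα) := by
  intro w
  choose G hG hG' using w.2.1
  have hdiv := (isDivFree_iff hα).1 w.2.2
  set u : L2 E3 := w.1.fst with hu
  have hG1 : ∀ j k, mult (rSym α) (comp k (G j))
      = mult (fun ξ => dSym j ξ * rSym α ξ) (comp k u) := fun j k =>
    (isWeakPartial_iff hα).1 (isWeakPartial_comp.1 (hG j) k)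
  -- The preimage is (1 - α²Δ)^{1/2} u. As √(1 + α²λ) = s(1 + α²λ) and α²λ is -α² times the sum of
  -- the squared derivative symbols, it can be written with bounded multipliers acting on u and on
  -- its weak derivatives G.
  set a : V3 := WithLp.toLp 2 fun k => mult (sSym α) (comp k u)
    - α ^ 2 • ∑ j, mult (fun ξ => dSym j ξ * sSym α ξ) (comp k (G j)) with ha
  have hak : ∀ k, a k = mult (sSym α) (comp k u)
    - α ^ 2 • ∑ j, mult (fun ξ => dSym j ξ * sSym α ξ) (comp k (G j)) := fun k => rfl
  have hS : ∀ k, mult (sSym α) (a k) = comp k u := fun k => by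
    -- After applying this injective operator, `hG1` expresses everything through multipliers of u
    -- alone.
    apply mult_rSym_injective α
    have e1 : ∀ j, mult (rSym α) (mult (sSym α)
        (mult (fun ξ => dSym j ξ * sSym α ξ) (comp k (G j))))
        = mult (fun ξ => dSym j ξ * dSym j ξ * rSym α ξ) (mult (rSym α) (comp k u)) := fun j => by
      rw [mult_comm (isSymbol_sSym α) (isSymbol_dSym_mul_sSym hα j),
        mult_comm (isSymbol_rSym α) (isSymbol_dSym_mul_sSym hα j),
        mult_comm (isSymbol_rSym α) (isSymbol_sSym α), hG1,
        mult_mult (isSymbol_sSym α) (isSymbol_dSym_mul_rSym hα j),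
        mult_mult (isSymbol_dSym_mul_sSym hα j)
          ((isSymbol_sSym α).mul (isSymbol_dSym_mul_rSym hα j)),
        mult_mult (isSymbol_dSym_mul_dSym_mul_rSym hα j j) (isSymbol_rSym α)]
      congr 2
      funext ξ
      rw [← sSym_mul_self]
      ring
    rw [hak, map_sub, map_sub, map_smul, map_smul, map_sum, map_sum]
    simp only [e1]
    rw [← mult_sum _ fun j => isSymbol_dSym_mul_dSym_mul_rSym hα j j, mult_sSym_sSym,
      ← mult_const_mul _ (IsSymbol.sum _ fun j => isSymbol_dSym_mul_dSym_mul_rSym hα j j),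
      ← mult_sub (isSymbol_rSym α) (IsSymbol.const_mul _
        (IsSymbol.sum _ fun j => isSymbol_dSym_mul_dSym_mul_rSym hα j j))]
    conv_rhs => rw [← mult_one (mult (rSym α) (comp k u))]
    congr 2
    funext ξ
    rw [← Finset.sum_mul, sum_dSym_sq]
    push_cast
    linear_combination rSym_mul α ξ
  have hD : ∀ j k, mult (fun ξ => dSym j ξ * sSym α ξ) (a k) = comp k (G j) := fun j k => by
    apply mult_rSym_injective α
    rw [hG1, ← hS, mult_mult (isSymbol_rSym α) (isSymbol_dSym_mul_sSym hα j),
      mult_mult (isSymbol_dSym_mul_rSym hα j) (isSymbol_sSym α)]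
    congr 2
    funext ξ
    ring
  have hmem : a ∈ solenoidal α := by
    rw [mem_solenoidal]
    apply mult_rSym_injective α
    rw [map_zero, ← hdiv, map_sum]
    refine Finset.sum_congr rfl fun i _ => ?_
    rw [← hS, mult_mult (isSymbol_rSym α) (isSymbol_dSym_mul_sSym hα i),
      mult_mult (isSymbol_dSym_mul_rSym hα i) (isSymbol_sSym α)]
    congr 2
    funext ξ
    ring
  refine ⟨⟨a, hmem⟩, ?_⟩
  have h1 : besselField α a = w.1.fst := L2.ext_comp fun k => by rw [comp_besselField, hS]
  have h2 : ∀ j, α • besselGrad α j a = w.1.snd j := fun j => by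
    rw [hG' j]
    congr 1
    exact L2.ext_comp fun k => by rw [comp_besselGrad, hD]
  apply Subtype.ext
  change WithLp.toLp 2 (besselField α a, WithLp.toLp 2 fun j => α • besselGrad α j a) = w.1
  simp only [h1, h2]
  rfl

/-- The isometry `a ↦ (1 - α²Δ)^{-1/2} a` onto the energy space. -/
def toEnergy {α : ℝ} (hα : 0 < α) : solenoidal α ≃ₗᵢ[ℝ] energySpace α :=
  LinearIsometryEquiv.ofSurjective ⟨toEnergyₗ hα, norm_toEnergyₗ hα⟩ (toEnergyₗ_surjective hα)

theorem vField_toEnergy {α : ℝ} (hα : 0 < α) (a : solenoidal α) :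
    vField (toEnergy hα a) = besselField α a := rfl

/-! ### The product of two functions in `H¹` -/

theorem mult_dSym_mult_sSym {α : ℝ} (hα : 0 < α) (i : Fin 3) (g : L2 ℝ) :
    mult (fun ξ => dSym i ξ * sSym α ξ) (mult (sSym α) g)
      = mult (fun ξ => dSym i ξ * rSym α ξ) g := by
  rw [mult_mult (isSymbol_dSym_mul_sSym hα i) (isSymbol_sSym α)]
  simp only [mul_assoc, sSym_mul_self]

theorem norm_mult_sSym_le (α : ℝ) (g : L2 ℝ) : ‖mult (sSym α) g‖ ≤ ‖g‖ :=
  (norm_mult_le (isSymbol_sSym α) (norm_sSym_le α) g).trans_eq (one_mul _)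

theorem ContinuousLinearMap.eq_of_dense₂ {E F G : Type*} [NormedAddCommGroup E] [NormedSpace ℝ E]
    [NormedAddCommGroup F] [NormedSpace ℝ F] [NormedAddCommGroup G] [NormedSpace ℝ G]
    {B B' : E →L[ℝ] F →L[ℝ] G} {s : Set E} {t : Set F} (hs : Dense s) (ht : Dense t)
    (h : ∀ x ∈ s, ∀ y ∈ t, B x y = B' x y) (x : E) (y : F) : B x y = B' x y := by
  have h1 : ∀ x ∈ s, B x = B' x := fun x hx =>
    DFunLike.coe_injective ((B x).continuous.ext_on ht (B' x).continuous fun y hy => h x hx y hy)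
  have h2 : B = B' := DFunLike.coe_injective (B.continuous.ext_on hs B'.continuous h1)
  rw [h2]

/-- Hölder applied to |f|⁴ = |f| · |f|³ bounds the fourth power of the L⁴ norm by ‖f‖₂ ‖f‖₆³. -/
theorem eLpNorm_four_le {f : E3 → ℝ} (hf : AEStronglyMeasurable f volume) {M : ℝ≥0∞}
    (h2 : eLpNorm f 2 volume ≤ M) (h6 : eLpNorm f 6 volume ≤ M) : eLpNorm f 4 volume ≤ M := by
  have e : ∀ n : ℕ, n ≠ 0 → eLpNorm f n volume ^ n = ∫⁻ x, ‖f x‖ₑ ^ n := fun n hn => by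
    rw [eLpNorm_eq_lintegral_rpow_enorm_toReal (by exact_mod_cast hn) (ENNReal.natCast_ne_top n),
      ENNReal.toReal_natCast, ← ENNReal.rpow_natCast, ← ENNReal.rpow_mul,
      one_div_mul_cancel (by exact_mod_cast hn), ENNReal.rpow_one]
    simp only [ENNReal.rpow_natCast]
  have e2 := e 2 (by norm_num)
  have e4 := e 4 (by norm_num)
  have e6 := e 6 (by norm_num)
  norm_num at e2 e4 e6
  have hh := ENNReal.lintegral_mul_le_Lp_mul_Lq (volume : Measure E3) (p := 2) (q := 2)
    Real.HolderConjugate.two_two hf.enorm (hf.enorm.pow_const 3)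
  have h3 : ∫⁻ x, ‖f x‖ₑ ^ 4 ≤ M * M ^ 3 := by
    calc ∫⁻ x, ‖f x‖ₑ ^ 4 = ∫⁻ x, ((fun x => ‖f x‖ₑ) * fun x => ‖f x‖ₑ ^ 3) x := by
          refine lintegral_congr fun x => ?_
          simp only [Pi.mul_apply]
          ring
      _ ≤ _ := hh
      _ ≤ M * M ^ 3 := by
          refine mul_le_mul' ?_ ?_
          · have : ∫⁻ x, ‖f x‖ₑ ^ (2 : ℝ) = ∫⁻ x, ‖f x‖ₑ ^ 2 := by
              refine lintegral_congr fun x => ?_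
              exact_mod_cast ENNReal.rpow_natCast _ 2
            rw [this, ← e2, ← ENNReal.rpow_natCast, ← ENNReal.rpow_mul]
            norm_num
            exact h2
          · have : ∫⁻ x, (‖f x‖ₑ ^ 3) ^ (2 : ℝ) = ∫⁻ x, ‖f x‖ₑ ^ 6 := by
              refine lintegral_congr fun x => ?_
              rw [show (2 : ℝ) = ((2 : ℕ) : ℝ) by norm_num, ENNReal.rpow_natCast, ← pow_mul]
            rw [this, ← e6, ← ENNReal.rpow_natCast, ← ENNReal.rpow_mul]
            norm_num
            gcongr
  rw [← e4, ← pow_succ'] at h3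
  exact (ENNReal.pow_le_pow_left_iff (by norm_num)).1 h3

/-- A subsequence converges almost everywhere, and Fatou's lemma applies to it. -/
theorem eLpNorm_le_of_tendsto_L2 {p : ℝ≥0∞} {g : ℕ → L2 ℝ} {g' : L2 ℝ} {M : ℕ → ℝ≥0∞} {M' : ℝ≥0∞}
    (hg : Tendsto g atTop (𝓝 g')) (hM : Tendsto M atTop (𝓝 M'))
    (h : ∀ n, eLpNorm (g n) p volume ≤ M n) : eLpNorm g' p volume ≤ M' := by
  obtain ⟨ns, hns, hlim⟩ := (tendstoInMeasure_of_tendsto_Lp hg).exists_seq_tendsto_ae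
  refine (Lp.eLpNorm_lim_le_liminf_eLpNorm (fun n => (Lp.memLp (g (ns n))).1) _ hlim).trans ?_
  refine (liminf_le_liminf (Eventually.of_forall fun n => h (ns n))).trans ?_
  exact (hM.comp hns.tendsto_atTop).liminf_eq.le

theorem norm_fderiv_le_sum {φ : E3 → ℝ} (x : E3) :
    ‖fderiv ℝ φ x‖ ≤ ∑ i, |pderiv3 i φ x| := by
  refine ContinuousLinearMap.opNorm_le_bound _ (Finset.sum_nonneg fun _ _ => abs_nonneg _)
    fun v => ?_
  have hv : v = ∑ i, v i • EuclideanSpace.single i (1 : ℝ) := by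
    ext j
    simp [Fin.sum_univ_three]
    fin_cases j <;> simp
  have h1 : fderiv ℝ φ x v = ∑ i, v i * pderiv3 i φ x := by
    conv_lhs => rw [hv]
    simp [map_sum, pderiv3]
  rw [h1, Finset.sum_mul, Real.norm_eq_abs]
  refine (Finset.abs_sum_le_sum_abs _ _).trans (Finset.sum_le_sum fun i _ => ?_)
  rw [abs_mul, mul_comm]
  exact mul_le_mul_of_nonneg_left (PiLp.norm_apply_le v i) (abs_nonneg _)

theorem IsTest.eLpNorm_fderiv_le {φ : E3 → ℝ} (hφ : IsTest φ) {M : ℝ}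
    (hp : ∀ i, eLpNorm (pderiv3 i φ) 2 volume ≤ ENNReal.ofReal M) :
    eLpNorm (fderiv ℝ φ) 2 volume ≤ ENNReal.ofReal (3 * M) := by
  have hm : ∀ i : Fin 3, AEStronglyMeasurable (fun x => |pderiv3 i φ x|) volume := fun i =>
    (hφ.partial_isTest i).1.continuous.abs.aestronglyMeasurable
  have hn : ∀ i : Fin 3, eLpNorm (fun x => |pderiv3 i φ x|) 2 volume ≤ ENNReal.ofReal M :=
    fun i => (eLpNorm_norm (pderiv3 i φ)).trans_le (hp i)
  have h1 : eLpNorm (fderiv ℝ φ) 2 volume ≤ eLpNorm (∑ i, fun x => |pderiv3 i φ x|) 2 volume := by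
    refine eLpNorm_mono fun x => (norm_fderiv_le_sum x).trans ?_
    rw [Finset.sum_apply]
    exact Real.le_norm_self _
  have h2 : eLpNorm (∑ i, fun x => |pderiv3 i φ x|) 2 volume
      ≤ ∑ i, eLpNorm (fun x => |pderiv3 i φ x|) 2 volume :=
    eLpNorm_sum_le (fun i _ => hm i) one_le_two
  refine (h1.trans h2).trans ((Finset.sum_le_sum fun i _ => hn i).trans ?_)
  rw [Finset.sum_const, Finset.card_univ, Fintype.card_fin, nsmul_eq_mul,
    ENNReal.ofReal_mul (by norm_num : (0 : ℝ) ≤ 3)]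
  simp

/-- `L⁴` bound for test functions. -/
theorem exists_eLpNorm_four_test {α : ℝ} (hα : 0 < α) : ∃ C : ℝ, 0 ≤ C ∧
    ∀ (φ : E3 → ℝ) (hφ : IsTest φ),
      eLpNorm φ 4 volume ≤ ENNReal.ofReal (C * ‖mult (sSym α) (hφ.helm α).toL2‖) := by
  set K : ℝ := (MeasureTheory.SNormLESNormFDerivOfEqConst ℝ (volume : Measure E3) 2 : ℝ) with hK
  have hK0 : 0 ≤ K := NNReal.coe_nonneg _
  -- The 1 pays for the L² norm, the rest for the L⁶ norm: the Sobolev constant, three partial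
  -- derivatives, and the bound α⁻¹ for ∂ᵢ(1 - α²Δ)^{-1/2}.
  refine ⟨1 + K * (3 * α⁻¹), by positivity, fun φ hφ => ?_⟩
  set a := mult (sSym α) (hφ.helm α).toL2 with ha
  have hn : ∀ {θ : E3 → ℝ} (hθ : IsTest θ), eLpNorm θ 2 volume = ENNReal.ofReal ‖hθ.toL2‖ :=
    fun {θ} hθ => by
      rw [Lp.norm_def, ENNReal.ofReal_toReal (Lp.eLpNorm_ne_top _), eLpNorm_congr_ae hθ.coeFn_toL2]
  have e0 : hφ.toL2 = mult (sSym α) a := by rw [hφ.toL2_eq α, ha, mult_sSym_sSym]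
  have e1 : ∀ i, (hφ.partial_isTest i).toL2 = mult (fun ξ => dSym i ξ * sSym α ξ) a := fun i => by
    rw [ha, mult_dSym_mult_sSym hα, hφ.toL2_partial_eq hα]
  have h2 : eLpNorm φ 2 volume ≤ ENNReal.ofReal ‖a‖ := by
    rw [hn hφ, e0]
    exact ENNReal.ofReal_le_ofReal (norm_mult_sSym_le α a)
  have hp : ∀ i, eLpNorm (pderiv3 i φ) 2 volume ≤ ENNReal.ofReal (α⁻¹ * ‖a‖) := fun i => by
    rw [hn (hφ.partial_isTest i), e1]
    exact ENNReal.ofReal_le_ofReal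
      (norm_mult_le (isSymbol_dSym_mul_sSym hα i) (norm_dSym_mul_sSym_le hα i) a)
  have h3 : eLpNorm (fderiv ℝ φ) 2 volume ≤ ENNReal.ofReal (3 * (α⁻¹ * ‖a‖)) :=
    hφ.eLpNorm_fderiv_le hp
  have h6 : eLpNorm φ 6 volume ≤ ENNReal.ofReal (K * (3 * (α⁻¹ * ‖a‖))) := by
    -- Gagliardo–Nirenberg–Sobolev in dimension three: 1/6 = 1/2 - 1/3.
    have := eLpNorm_le_eLpNorm_fderiv_of_eq (volume : Measure E3) (u := φ) (p := 2) (p' := 6)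
      (hφ.1.of_le (by simp)) hφ.2 one_le_two (by simp) (by simp; norm_num)
    rw [ENNReal.ofReal_mul hK0, hK, ENNReal.ofReal_coe_nnreal]
    exact le_trans this (mul_le_mul_right h3 _)
  refine eLpNorm_four_le hφ.1.continuous.aestronglyMeasurable (h2.trans ?_) (h6.trans ?_)
  · refine ENNReal.ofReal_le_ofReal ?_
    have : 0 ≤ K * (3 * α⁻¹) * ‖a‖ := by positivity
    linarith
  · refine ENNReal.ofReal_le_ofReal ?_
    have := norm_nonneg a
    linarith

/-- Every `mult (sSym α) a` is an L² limit of test functions whose preimages converge to a, so the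
bound for test functions passes to the limit. -/
theorem exists_eLpNorm_four {α : ℝ} (hα : 0 < α) : ∃ C : ℝ, 0 ≤ C ∧
    ∀ a : L2 ℝ, eLpNorm (mult (sSym α) a) 4 volume ≤ ENNReal.ofReal (C * ‖a‖) := by
  obtain ⟨C, hC0, hC⟩ := exists_eLpNorm_four_test hα
  refine ⟨C, hC0, fun a => ?_⟩
  obtain ⟨x, hx, hxa⟩ := mem_closure_iff_seq_limit.1 (dense_image_mult (isSymbol_sSym α)
    (Eventually.of_forall (sSym_ne_zero α)) (dense_helm α) a)
  refine eLpNorm_le_of_tendsto_L2 (((mult (sSym α)).continuous.tendsto a).comp hxa)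
    (M := fun n => ENNReal.ofReal (C * ‖x n‖))
    (ENNReal.tendsto_ofReal (hxa.norm.const_mul C)) fun n => ?_
  obtain ⟨_, ⟨φ, hφ, rfl⟩, hn⟩ := hx n
  have h : eLpNorm (mult (sSym α) (x n)) 4 volume = eLpNorm φ 4 volume := by
    rw [← hn, mult_sSym_sSym, ← hφ.toL2_eq]
    exact eLpNorm_congr_ae hφ.coeFn_toL2
  refine h.trans_le ?_
  rw [← hn]
  exact hC φ hφ

instance : Fact ((1 : ℝ≥0∞) ≤ 4) := ⟨by norm_num⟩

instance : ENNReal.HolderTriple 4 4 2 := ⟨by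
  rw [← ENNReal.toReal_eq_toReal_iff' (by simp) (by simp), ENNReal.toReal_add (by simp) (by simp)]
  norm_num⟩

theorem memLp_four {α : ℝ} (hα : 0 < α) (a : L2 ℝ) : MemLp (mult (sSym α) a) 4 volume := by
  obtain ⟨C, _, hC⟩ := exists_eLpNorm_four hα
  exact ⟨(Lp.memLp _).1, (hC a).trans_lt ENNReal.ofReal_lt_top⟩

/-- The Sobolev embedding `a ↦ (1 - α²Δ)^{-1/2} a` into `L⁴`. -/
def besselFour {α : ℝ} (hα : 0 < α) : L2 ℝ →L[ℝ] Lp ℝ 4 (volume : Measure E3) :=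
  LinearMap.mkContinuousOfExistsBound
    { toFun := fun a => (memLp_four hα a).toLp _
      map_add' := fun a b => by
        rw [← MemLp.toLp_add]
        refine MemLp.toLp_congr _ _ ?_
        rw [map_add]
        exact Lp.coeFn_add _ _
      map_smul' := fun c a => by
        rw [RingHom.id_apply, ← MemLp.toLp_const_smul]
        refine MemLp.toLp_congr _ _ ?_
        rw [map_smul]
        exact Lp.coeFn_smul _ _ }
    (by
      obtain ⟨C, hC0, hC⟩ := exists_eLpNorm_four hα
      refine ⟨C, fun a => ?_⟩
      change ‖(memLp_four hα a).toLp _‖ ≤ _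
      rw [Lp.norm_toLp]
      exact ENNReal.toReal_le_of_le_ofReal (by positivity) (hC a))

theorem coeFn_besselFour {α : ℝ} (hα : 0 < α) (a : L2 ℝ) :
    besselFour hα a =ᵐ[volume] mult (sSym α) a :=
  (memLp_four hα a).coeFn_toLp

/-- The product `(a, b) ↦ (1 - α²Δ)^{-1/2} a · (1 - α²Δ)^{-1/2} b`. -/
def besselMul {α : ℝ} (hα : 0 < α) : L2 ℝ →L[ℝ] L2 ℝ →L[ℝ] L2 ℝ :=
  ((ContinuousLinearMap.mul ℝ ℝ).holderL volume 4 4 2).bilinearComp (besselFour hα) (besselFour hα)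

theorem coeFn_besselMul {α : ℝ} (hα : 0 < α) (a b : L2 ℝ) :
    besselMul hα a b =ᵐ[volume] fun x => mult (sSym α) a x * mult (sSym α) b x := by
  filter_upwards [ContinuousLinearMap.coeFn_holder (r := 2) (ContinuousLinearMap.mul ℝ ℝ)
    (besselFour hα a) (besselFour hα b), coeFn_besselFour hα a, coeFn_besselFour hα b]
    with x h1 h2 h3
  rw [← h2, ← h3]
  exact h1

theorem besselMul_comm {α : ℝ} (hα : 0 < α) (a b : L2 ℝ) :
    besselMul hα a b = besselMul hα b a := by
  ext1
  filter_upwards [coeFn_besselMul hα a b, coeFn_besselMul hα b a] with x h1 h2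
  rw [h1, h2, mul_comm]

theorem inner_besselMul {α : ℝ} (hα : 0 < α) (a b K : L2 ℝ) :
    inner ℝ (besselMul hα a b) K = ∫ x, mult (sSym α) a x * mult (sSym α) b x * K x := by
  rw [L2.inner_def]
  refine integral_congr_ae ?_
  filter_upwards [coeFn_besselMul hα a b] with x h1
  rw [h1]
  simp [mul_comm]

theorem IsTest.isWeakPartial {φ : E3 → ℝ} (hφ : IsTest φ) (i : Fin 3) :
    IsWeakPartial i hφ.toL2 (hφ.partial_isTest i).toL2 := by
  rw [isWeakPartial_iff one_pos, hφ.toL2_eq 1, hφ.toL2_partial_eq one_pos,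
    mult_comm (isSymbol_rSym 1) (isSymbol_dSym_mul_rSym one_pos i)]

theorem IsTest.besselMul_ae {α : ℝ} (hα : 0 < α) {φ ψ : E3 → ℝ} (hφ : IsTest φ) (hψ : IsTest ψ)
    {a b : L2 ℝ} (ha : mult (sSym α) a = hφ.toL2) (hb : mult (sSym α) b = hψ.toL2) :
    besselMul hα a b =ᵐ[volume] fun x => φ x * ψ x := by
  have h1 := coeFn_besselMul hα a b
  rw [ha, hb] at h1
  filter_upwards [h1, hφ.coeFn_toL2, hψ.coeFn_toL2] with x h1 h2 h3
  rw [h1, h2, h3]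

/-- The classical product rule for φψ, expressed through preimages under `mult (sSym α)` and
smoothed by `rSym`. In this form both sides come from bounded bilinear maps and the rule extends by
density. -/
theorem IsTest.leibniz {α : ℝ} (hα : 0 < α) (i : Fin 3) {φ ψ : E3 → ℝ} (hφ : IsTest φ)
    (hψ : IsTest ψ) {c d c' d' : L2 ℝ} (hc : mult (sSym α) c = hφ.toL2)
    (hd : mult (sSym α) d = hψ.toL2) (hc' : mult (sSym α) c' = (hφ.partial_isTest i).toL2)
    (hd' : mult (sSym α) d' = (hψ.partial_isTest i).toL2) :
    mult (rSym α) (besselMul hα c' d + besselMul hα c d')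
      = mult (fun ξ => dSym i ξ * rSym α ξ) (besselMul hα c d) := by
  have h := (isWeakPartial_iff hα).1 ((hφ.mul hψ).isWeakPartial i)
  have e1 : besselMul hα c d = (hφ.mul hψ).toL2 := by
    ext1
    filter_upwards [hφ.besselMul_ae hα hψ hc hd, (hφ.mul hψ).coeFn_toL2] with x h1 h2
    rw [h1, h2]
  have e2 : besselMul hα c' d + besselMul hα c d' = ((hφ.mul hψ).partial_isTest i).toL2 := by
    ext1
    filter_upwards [Lp.coeFn_add (besselMul hα c' d) (besselMul hα c d'),
      (hφ.partial_isTest i).besselMul_ae hα hψ hc' hd,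
      hφ.besselMul_ae hα (hψ.partial_isTest i) hc hd',
      ((hφ.mul hψ).partial_isTest i).coeFn_toL2] with x h1 h2 h3 h4
    rw [h1, Pi.add_apply, h2, h3, h4]
    have hd1 : DifferentiableAt ℝ φ x := (hφ.1.differentiable (by simp)) x
    have hd2 : DifferentiableAt ℝ ψ x := (hψ.1.differentiable (by simp)) x
    simp only [pderiv3]
    rw [fderiv_fun_mul hd1 hd2, add_apply, smul_apply, smul_apply, smul_eq_mul, smul_eq_mul]
    ring
  rw [e1, e2, h]

/-- The Leibniz rule. -/
theorem isWeakPartial_besselMul {α : ℝ} (hα : 0 < α) (i : Fin 3) (c d : L2 ℝ) :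
    IsWeakPartial i (besselMul hα (mult (sSym α) c) (mult (sSym α) d))
      (besselMul hα (mult (fun ξ => dSym i ξ * sSym α ξ) c) (mult (sSym α) d)
        + besselMul hα (mult (sSym α) c) (mult (fun ξ => dSym i ξ * sSym α ξ) d) : L2 ℝ) := by
  rw [isWeakPartial_iff hα]
  set S := mult (sSym α) with hS
  set D := mult (fun ξ => dSym i ξ * sSym α ξ) with hD
  set B : L2 ℝ →L[ℝ] L2 ℝ →L[ℝ] L2 ℝ := ((ContinuousLinearMap.compL ℝ (L2 ℝ) (L2 ℝ) (L2 ℝ)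
    (mult (rSym α))).comp ((besselMul hα).bilinearComp D S + (besselMul hα).bilinearComp S D))
    with hB
  set B' : L2 ℝ →L[ℝ] L2 ℝ →L[ℝ] L2 ℝ := ((ContinuousLinearMap.compL ℝ (L2 ℝ) (L2 ℝ) (L2 ℝ)
    (mult (fun ξ => dSym i ξ * rSym α ξ))).comp ((besselMul hα).bilinearComp S S)) with hB'
  refine ContinuousLinearMap.eq_of_dense₂ (B := B) (B' := B') (dense_helm α) (dense_helm α)
    ?_ c d
  rintro _ ⟨φ, hφ, rfl⟩ _ ⟨ψ, hψ, rfl⟩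
  have e2 : ∀ {φ : E3 → ℝ} (hφ : IsTest φ),
      S (D (hφ.helm α).toL2) = (hφ.partial_isTest i).toL2 := fun {φ} hφ => by
    rw [hS, hD, mult_comm (isSymbol_sSym α) (isSymbol_dSym_mul_sSym hα i),
      mult_dSym_mult_sSym hα, ← hφ.toL2_partial_eq hα]
  exact hφ.leibniz hα i hψ ((mult_sSym_sSym α _).trans (hφ.toL2_eq α).symm)
    ((mult_sSym_sSym α _).trans (hψ.toL2_eq α).symm) (e2 hφ) (e2 hψ)

/-- Transport by a divergence free field is skew-symmetric. -/
theorem sum_inner_besselMul_eq_zero {α : ℝ} (hα : 0 < α) {a : V3} (ha : a ∈ solenoidal α)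
    (c : L2 ℝ) :
    ∑ j, inner ℝ (besselMul hα (a j) c) (mult (fun ξ => dSym j ξ * sSym α ξ) c) = 0 := by
  have hc : IsClosed {c : L2 ℝ |
      ∑ j, inner ℝ (besselMul hα (a j) c) (mult (fun ξ => dSym j ξ * sSym α ξ) c) = 0} := by
    refine isClosed_eq (continuous_finsetSum _ fun j _ => ?_) continuous_const
    exact ((besselMul hα (a j)).continuous).inner (mult _).continuous
  refine hc.closure_subset_iff.2 ?_ (dense_image_mult (isSymbol_sSym α)
    (Eventually.of_forall (sSym_ne_zero α)) (dense_helm α) c)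
  rintro _ ⟨_, ⟨φ, hφ, rfl⟩, rfl⟩
  -- For the field v = (1 - α²Δ)^{-1/2} a, (v · ∇φ)φ = v · ∇(φ²/2): the cancellation is the
  -- divergence condition tested with φ²/2.
  have h := isDivFree_besselField hα ha _ ((hφ.mul hφ).smul (1 / 2))
  have e : ∀ j, inner ℝ (besselMul hα (a j) (mult (sSym α) (hφ.helm α).toL2))
      (mult (fun ξ => dSym j ξ * sSym α ξ) (mult (sSym α) (hφ.helm α).toL2))
      = ∫ x, pderiv3 j (fun x => 1 / 2 * (φ x * φ x)) x * besselField α a x j := fun j => by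
    rw [inner_besselMul]
    have e2 : mult (fun ξ => dSym j ξ * sSym α ξ) (mult (sSym α) (hφ.helm α).toL2)
        = (hφ.partial_isTest j).toL2 := by
      rw [mult_dSym_mult_sSym hα, ← hφ.toL2_partial_eq hα]
    rw [e2, mult_sSym_sSym, ← hφ.toL2_eq]
    have hb := coeFn_comp j (besselField α a)
    rw [comp_besselField] at hb
    refine integral_congr_ae ?_
    filter_upwards [hφ.coeFn_toL2, (hφ.partial_isTest j).coeFn_toL2, hb] with x h1 h2 h3
    rw [h1, h2, h3]
    have hd : DifferentiableAt ℝ φ x := (hφ.1.differentiable (by simp)) x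
    simp only [pderiv3]
    rw [fderiv_const_mul (hd.fun_mul hd), fderiv_fun_mul hd hd]
    simp
    ring
  change ∑ j, _ = (0 : ℝ)
  simp only [e]
  rw [← integral_finsetSum]
  · exact h
  · intro j _
    simpa using (EuclideanSpace.proj (𝕜 := ℝ) j).integrable_comp
      ((((hφ.mul hφ).smul (1 / 2)).partial_isTest j).integrable_smul (besselField α a))

/-! ### Weak continuity of the product -/

theorem tendsto_of_approx {ι : Type*} {l : Filter ι} {f : ι → ℝ} {f₀ : ℝ}
    (h : ∀ ε > 0, ∃ (g : ι → ℝ) (g₀ : ℝ), (∀ᶠ i in l, |f i - g i| ≤ ε) ∧ |f₀ - g₀| ≤ ε ∧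
      Tendsto g l (𝓝 g₀)) : Tendsto f l (𝓝 f₀) := by
  rw [Metric.tendsto_nhds]
  intro ε hε
  obtain ⟨g, g₀, h1, h2, h3⟩ := h (ε / 4) (by positivity)
  filter_upwards [h1, Metric.tendsto_nhds.1 h3 (ε / 4) (by positivity)] with i hi h4
  rw [Real.dist_eq] at h4 ⊢
  rw [abs_le] at hi h2
  rw [abs_lt] at h4 ⊢
  constructor <;> linarith

/-- Boundedness makes the error of replacing y by a nearby element of the dense set uniform along
the filter. -/
theorem tendsto_inner_of_dense {ι H : Type*} [NormedAddCommGroup H] [InnerProductSpace ℝ H]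
    {l : Filter ι} {x : ι → H} {x₀ : H} {R : ℝ} (hx : ∀ᶠ i in l, ‖x i‖ ≤ R) {s : Set H}
    (hs : Dense s)
    (h : ∀ y ∈ s, Tendsto (fun i => inner ℝ (x i) y) l (𝓝 (inner ℝ x₀ y))) (y : H) :
    Tendsto (fun i => inner ℝ (x i) y) l (𝓝 (inner ℝ x₀ y)) := by
  refine tendsto_of_approx fun ε hε => ?_
  have hpos : 0 < ε / (max R ‖x₀‖ + 1) := by
    have : 0 ≤ max R ‖x₀‖ := (norm_nonneg x₀).trans (le_max_right _ _)
    positivity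
  obtain ⟨z, hz, hyz⟩ := hs.exists_dist_lt y hpos
  have key : ∀ w : H, ‖w‖ ≤ max R ‖x₀‖ → |inner ℝ w y - inner ℝ w z| ≤ ε := fun w hw => by
    rw [← inner_sub_right]
    refine (abs_real_inner_le_norm _ _).trans ?_
    rw [← dist_eq_norm]
    have h0 := norm_nonneg w
    calc ‖w‖ * dist y z ≤ (max R ‖x₀‖ + 1) * (ε / (max R ‖x₀‖ + 1)) := by
          gcongr
          linarith
      _ = ε := by
          have : max R ‖x₀‖ + 1 ≠ 0 := by linarith
          field_simp
  refine ⟨fun i => inner ℝ (x i) z, inner ℝ x₀ z, ?_, key _ (le_max_right _ _), h z hz⟩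
  filter_upwards [hx] with i hi
  exact key _ (hi.trans (le_max_left _ _))

/-- Norm continuity of x ↦ ℓ x makes x ↦ ℓ x (v i) equicontinuous for bounded v, and a finite cover
of K makes the convergence uniform. This is how weak convergence becomes locally uniform
convergence. -/
theorem eventually_forall_compact {ι X E : Type*} [TopologicalSpace X] [NormedAddCommGroup E]
    [NormedSpace ℝ E] {l : Filter ι} {K : Set X} (hK : IsCompact K) {ℓ : X → E →L[ℝ] ℝ}
    (hℓ : ContinuousOn ℓ K) {v : ι → E} {v₀ : E} {R : ℝ} (hv : ∀ᶠ i in l, ‖v i - v₀‖ ≤ R)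
    (h : ∀ x ∈ K, Tendsto (fun i => ℓ x (v i)) l (𝓝 (ℓ x v₀))) {ε : ℝ} (hε : 0 < ε) :
    ∀ᶠ i in l, ∀ x ∈ K, |ℓ x (v i) - ℓ x v₀| < ε := by
  refine hK.induction_on (p := fun s => ∀ᶠ i in l, ∀ x ∈ s, |ℓ x (v i) - ℓ x v₀| < ε)
    (by simp) (fun s t hst ht => ht.mono fun i hi x hx => hi x (hst hx))
    (fun s t hs ht => ?_) (fun x hx => ?_)
  · filter_upwards [hs, ht] with i h1 h2 x hx
    exact hx.elim (h1 x) (h2 x)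
  · have hδ : 0 < ε / (2 * (|R| + 1)) := by positivity
    refine ⟨{y | ‖ℓ y - ℓ x‖ < ε / (2 * (|R| + 1))}, ?_, ?_⟩
    · have := (Metric.tendsto_nhds.1 (hℓ x hx)) _ hδ
      simp only [dist_eq_norm] at this
      exact this
    · filter_upwards [hv, (Metric.tendsto_nhds.1 (h x hx)) (ε / 2) (by positivity)] with i h1 h2 y hy
      have e1 : |(ℓ y - ℓ x) (v i - v₀)| ≤ ε / 2 := by
        refine ((ℓ y - ℓ x).le_opNorm _).trans ?_
        calc ‖ℓ y - ℓ x‖ * ‖v i - v₀‖ ≤ ε / (2 * (|R| + 1)) * (|R| + 1) := by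
              refine mul_le_mul (le_of_lt hy) (h1.trans ((le_abs_self R).trans (by linarith)))
                (norm_nonneg _) hδ.le
          _ = ε / 2 := by
              field_simp
      have e2 : ℓ y (v i) - ℓ y v₀ = (ℓ x (v i) - ℓ x v₀) + (ℓ y - ℓ x) (v i - v₀) := by
        simp only [sub_apply, map_sub]
        ring
      rw [Real.dist_eq] at h2
      rw [e2]
      exact (abs_add_le _ _).trans_lt (by linarith)

/-! ### Band-limited fields and their evaluation at points. -/

/-- The symbol `(1 + α²|2πξ|²)^{-1/2}` cut off at frequency `M`. -/
def sCut (α M : ℝ) (ξ : E3) : ℂ := (Metric.closedBall (0 : E3) M).indicator (sSym α) ξ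

theorem norm_sCut_le (α M : ℝ) (ξ : E3) : ‖sCut α M ξ‖ ≤ 1 :=
  (norm_indicator_le_norm_self _ _).trans (norm_sSym_le α ξ)

theorem isSymbol_sCut (α M : ℝ) : IsSymbol (sCut α M) := by
  refine ⟨(isSymbol_sSym α).measurable.indicator Metric.isClosed_closedBall.measurableSet,
    ⟨1, norm_sCut_le α M⟩, fun ξ => ?_⟩
  unfold sCut
  by_cases h : ξ ∈ Metric.closedBall (0 : E3) M
  · have h' : -ξ ∈ Metric.closedBall (0 : E3) M := by simpa using h
    rw [indicator_of_mem h, indicator_of_mem h', (isSymbol_sSym α).hermitian]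
  · have h' : -ξ ∉ Metric.closedBall (0 : E3) M := by simpa using h
    rw [indicator_of_notMem h, indicator_of_notMem h', map_zero]

theorem memLp_sCut (α M : ℝ) : MemLp (sCut α M) 2 volume := by
  unfold sCut
  rw [memLp_indicator_iff_restrict Metric.isClosed_closedBall.measurableSet]
  have : IsFiniteMeasure ((volume : Measure E3).restrict (Metric.closedBall 0 M)) :=
    ⟨by
      rw [Measure.restrict_apply_univ]
      exact measure_closedBall_lt_top⟩
  exact MemLp.of_bound (isSymbol_sSym α).measurable.aestronglyMeasurable 1
    (Eventually.of_forall (norm_sSym_le α))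

theorem memLp_evalKer {m : E3 → ℂ} (hm : MemLp m 2 volume) (x : E3) :
    MemLp (fun ξ => Real.fourierChar (-inner ℝ ξ x) • conj (m ξ)) 2 volume := by
  refine hm.star.of_le ?_ (Eventually.of_forall fun ξ => ?_)
  · refine AEStronglyMeasurable.smul (Continuous.aestronglyMeasurable ?_) hm.star.1
    fun_prop
  · rw [Circle.norm_smul]
    simp

/-- The kernel of the evaluation at `x` after multiplication by a square integrable symbol. -/
def evalKer {m : E3 → ℂ} (hm : MemLp m 2 volume) (x : E3) : CL2 := (memLp_evalKer hm x).toLp _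

/-- Evaluation of `mult m a` at a point, for a square integrable symbol `m`. -/
def evalMult {m : E3 → ℂ} (hm : MemLp m 2 volume) (x : E3) : L2 ℝ →L[ℝ] ℝ :=
  Complex.reCLM ∘L ((innerSL ℂ (evalKer hm x)).restrictScalars ℝ) ∘L ft

theorem evalMult_apply {m : E3 → ℂ} (hm : MemLp m 2 volume) (x : E3) (a : L2 ℝ) :
    evalMult hm x a = (∫ ξ, Real.fourierChar (inner ℝ ξ x) • (m ξ * ft a ξ)).re := by
  change (inner ℂ (evalKer hm x) (ft a)).re = _
  rw [L2.inner_def]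
  congr 1
  refine integral_congr_ae ?_
  filter_upwards [(memLp_evalKer hm x).coeFn_toLp] with ξ h
  have h' : evalKer hm x ξ = Real.fourierChar (-inner ℝ ξ x) • conj (m ξ) := h
  rw [h']
  simp only [Circle.smul_def, RCLike.inner_apply, smul_eq_mul, map_mul, Complex.conj_conj,
    AddChar.map_neg_eq_inv, Circle.coe_inv_eq_conj]
  ring

theorem norm_fourierChar_sub_le (a b : ℝ) :
    ‖(Real.fourierChar a : ℂ) - Real.fourierChar b‖ ≤ 2 * Real.pi * |a - b| := by
  have h := Convex.norm_image_sub_le_of_norm_hasDerivWithin_le (s := univ) (C := 2 * Real.pi)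
    (fun x _ => (Real.hasDerivAt_fourierChar x).hasDerivWithinAt) (fun x _ => ?_) convex_univ
    (mem_univ b) (mem_univ a)
  · simpa using h
  · simp [abs_of_pos Real.pi_pos, Circle.norm_coe]

/-- On the ball of radius M the characters are Lipschitz in x with constant 2πM, uniformly in ξ, so
the kernels depend on x continuously in the L² norm. -/
theorem continuous_evalKer {m : E3 → ℂ} (hm : MemLp m 2 volume) {M : ℝ}
    (hM : ∀ ξ, M < ‖ξ‖ → m ξ = 0) : Continuous (evalKer hm) := by
  have hL : ∀ x y, ‖evalKer hm x - evalKer hm y‖ ≤ (2 * Real.pi * M * ‖x - y‖) * ‖hm.toLp m‖ := by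
    intro x y
    refine Lp.norm_le_mul_norm_of_ae_le_mul ?_
    filter_upwards [Lp.coeFn_sub (evalKer hm x) (evalKer hm y), (memLp_evalKer hm x).coeFn_toLp,
      (memLp_evalKer hm y).coeFn_toLp, hm.coeFn_toLp] with ξ h1 h2 h3 h4
    have h2' : evalKer hm x ξ = Real.fourierChar (-inner ℝ ξ x) • conj (m ξ) := h2
    have h3' : evalKer hm y ξ = Real.fourierChar (-inner ℝ ξ y) • conj (m ξ) := h3
    rw [h1, Pi.sub_apply, h2', h3', h4, Circle.smul_def, Circle.smul_def, ← sub_smul, norm_smul]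
    rw [RCLike.norm_conj]
    by_cases hξ : M < ‖ξ‖
    · simp [hM ξ hξ]
    · refine mul_le_mul_of_nonneg_right ?_ (norm_nonneg _)
      refine (norm_fourierChar_sub_le _ _).trans ?_
      rw [mul_assoc (2 * Real.pi)]
      refine mul_le_mul_of_nonneg_left ?_ (by positivity)
      have e : -inner ℝ ξ x - -inner ℝ ξ y = - inner ℝ ξ (x - y) := by
        rw [inner_sub_right]; ring
      rw [e, abs_neg]
      exact (abs_real_inner_le_norm _ _).trans
        (mul_le_mul_of_nonneg_right (not_lt.1 hξ) (norm_nonneg _))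
  rw [continuous_iff_continuousAt]
  intro x
  rw [ContinuousAt, tendsto_iff_norm_sub_tendsto_zero]
  refine squeeze_zero (fun _ => norm_nonneg _) (fun y => hL y x) ?_
  have : Continuous fun y => (2 * Real.pi * M * ‖y - x‖) * ‖hm.toLp m‖ := by fun_prop
  simpa using this.tendsto x

theorem continuous_evalMult {m : E3 → ℂ} (hm : MemLp m 2 volume) {M : ℝ}
    (hM : ∀ ξ, M < ‖ξ‖ → m ξ = 0) : Continuous (evalMult hm) := by
  have h := continuous_evalKer hm hM
  have h2 : Continuous fun x => (innerSL ℂ (evalKer hm x)) := (innerSL ℂ).continuous.comp h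
  have h3 : Continuous fun x => (innerSL ℂ (evalKer hm x)).restrictScalars ℝ :=
    (ContinuousLinearMap.restrictScalarsL ℂ CL2 ℂ ℝ ℝ).continuous.comp h2
  exact continuous_const.clm_comp (h3.clm_comp continuous_const)

/-- Pair with a test function, use Plancherel and exchange the integrals; Fubini is available
because m and `ft a` are both in L², so their product is integrable. -/
theorem coeFn_mult_eq_evalMult {m : E3 → ℂ} (hs : IsSymbol m) (hm : MemLp m 2 volume) {M : ℝ}
    (hM : ∀ ξ, M < ‖ξ‖ → m ξ = 0) (a : L2 ℝ) :
    mult m a =ᵐ[volume] fun x => evalMult hm x a := by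
  have hc : Continuous fun x => evalMult hm x a :=
    (continuous_evalMult hm hM).clm_apply continuous_const
  refine ae_eq_of_integral_contDiff_smul_eq ((Lp.memLp (mult m a)).locallyIntegrable (by norm_num))
    hc.locallyIntegrable fun φ h1 h2 => ?_
  have hφ : IsTest φ := ⟨h1, h2⟩
  have hint : Integrable φ := h1.continuous.integrable_of_hasCompactSupport h2
  have hint2 : Integrable fun ξ => m ξ * ft a ξ := by
    exact hm.integrable_mul (Lp.memLp (ft a))
  have e1 : ∫ x, φ x • mult m a x = (inner ℂ (ft hφ.toL2) (ft (mult m a))).re := by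
    rw [inner_ft, Complex.ofReal_re, hφ.inner_toL2]
    simp
  have hF : Integrable (fun z : E3 × E3 => Real.fourierChar (inner ℝ z.2 z.1) •
      ((φ z.1 : ℂ) * (m z.2 * ft a z.2))) (volume.prod volume) := by
    have := (hint.ofReal (𝕜 := ℂ)).mul_prod hint2
    refine this.mono ?_ (Eventually.of_forall fun z => ?_)
    · refine AEStronglyMeasurable.smul (Continuous.aestronglyMeasurable ?_) this.1
      fun_prop
    · rw [Circle.norm_smul]
      rfl
  have e2 : inner ℂ (ft hφ.toL2) (ft (mult m a)) =
      ∫ ξ, ∫ x, Real.fourierChar (inner ℝ ξ x) • ((φ x : ℂ) * (m ξ * ft a ξ)) := by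
    rw [L2.inner_def]
    refine integral_congr_ae ?_
    have h4 := (𝓕 hφ.toSchwartz).coeFn_toLp 2 volume
    rw [← hφ.ft_toL2] at h4
    filter_upwards [h4, ft_mult hs a] with ξ h5 h6
    rw [h5, h6, SchwartzMap.fourier_coe, Real.fourier_eq]
    simp only [RCLike.inner_apply]
    rw [← integral_conj, mul_comm, ← integral_mul_const]
    refine integral_congr_ae (Eventually.of_forall fun x => ?_)
    simp only [hφ.toSchwartz_apply, Circle.smul_def, smul_eq_mul, map_mul, Complex.conj_ofReal,
      AddChar.map_neg_eq_inv, Circle.coe_inv_eq_conj, Complex.conj_conj, real_inner_comm x ξ]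
    ring
  have e3 := integral_integral_swap (f := fun ξ x => Real.fourierChar (inner ℝ ξ x) •
    ((φ x : ℂ) * (m ξ * ft a ξ))) hF.swap
  rw [e1, e2, e3]
  have hI : Integrable fun x => ∫ ξ, Real.fourierChar (inner ℝ ξ x) •
    ((φ x : ℂ) * (m ξ * ft a ξ)) := hF.integral_prod_left
  refine (Complex.reCLM.integral_comp_comm hI).symm.trans ?_
  refine integral_congr_ae (Eventually.of_forall fun x => ?_)
  simp only [Complex.reCLM_apply, evalMult_apply, smul_eq_mul]
  rw [← Complex.re_ofReal_mul, ← integral_const_mul]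
  congr 1
  refine integral_congr_ae (Eventually.of_forall fun ξ => ?_)
  simp only [Circle.smul_def, smul_eq_mul]
  ring

theorem abs_integral_mul_mul_le {χ : E3 → ℝ} {C : ℝ} (hC : ∀ x, |χ x| ≤ C) (u v : L2 ℝ) :
    |∫ x, χ x * (u x * v x)| ≤ C * (‖u‖ * ‖v‖) := by
  have h0 : 0 ≤ C := (abs_nonneg _).trans (hC 0)
  have h1 : Integrable fun x => |u x| * |v x| :=
    ((Lp.memLp u).integrable_mul (Lp.memLp v)).norm.congr
      (Eventually.of_forall fun x => by simp)
  calc |∫ x, χ x * (u x * v x)| ≤ ∫ x, C * (|u x| * |v x|) := by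
        rw [← Real.norm_eq_abs]
        refine norm_integral_le_of_norm_le (h1.const_mul C) (Eventually.of_forall fun x => ?_)
        rw [Real.norm_eq_abs, abs_mul, abs_mul]
        exact mul_le_mul_of_nonneg_right (hC x) (by positivity)
    _ = C * inner ℝ (|u| : L2 ℝ) |v| := by
        rw [integral_const_mul, L2.inner_def]
        congr 1
        refine integral_congr_ae ?_
        filter_upwards [Lp.coeFn_abs u, Lp.coeFn_abs v] with x h1 h2
        rw [h1, h2]
        simp [mul_comm]
    _ ≤ C * (‖u‖ * ‖v‖) := by
        refine mul_le_mul_of_nonneg_left ?_ h0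
        simpa only [norm_abs_eq_norm] using real_inner_le_norm (|u| : L2 ℝ) |v|

theorem integrable_mul_mul {χ : E3 → ℝ} (hχ : IsTest χ) (u v : L2 ℝ) :
    Integrable fun x => χ x * (u x * v x) := by
  obtain ⟨C, hC⟩ := hχ.1.continuous.bounded_above_of_compact_support hχ.2
  exact ((Lp.memLp u).integrable_mul (Lp.memLp v)).bdd_mul
    hχ.1.continuous.aestronglyMeasurable (Eventually.of_forall hC)

theorem exists_norm_sub_sCut_le {α : ℝ} (hα : 0 < α) {δ : ℝ} (hδ : 0 < δ) :
    ∃ M : ℝ, ∀ a : L2 ℝ, ‖mult (sSym α) a - mult (sCut α M) a‖ ≤ δ * ‖a‖ := by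
  -- Beyond this frequency ‖sSym α ξ‖² ≤ (α‖ξ‖)⁻² ≤ δ².
  refine ⟨(δ * α)⁻¹, fun a => ?_⟩
  rw [← mult_sub (isSymbol_sSym α) (isSymbol_sCut α _)]
  refine norm_mult_le ((isSymbol_sSym α).sub (isSymbol_sCut α _)) (fun ξ => ?_) a
  unfold sCut
  by_cases h : ξ ∈ Metric.closedBall (0 : E3) (δ * α)⁻¹
  · rw [indicator_of_mem h, sub_self, norm_zero]
    exact hδ.le
  · rw [indicator_of_notMem h, sub_zero]
    refine (pow_le_pow_iff_left₀ (norm_nonneg _) hδ.le two_ne_zero).1 ?_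
    rw [norm_sSym_sq]
    refine inv_le_of_inv_le₀ (by positivity) ?_
    have h1 : (δ * α)⁻¹ < ‖ξ‖ := by simpa using h
    have h2 : ((δ * α)⁻¹) ^ 2 ≤ ‖ξ‖ ^ 2 := pow_le_pow_left₀ (by positivity) h1.le 2
    have h3 : (δ ^ 2)⁻¹ = α ^ 2 * ((δ * α)⁻¹) ^ 2 := by
      field_simp
    have h4 : 1 ≤ (2 * Real.pi) ^ 2 := by
      nlinarith [Real.pi_gt_three]
    rw [h3, lam]
    have h5 : ‖ξ‖ ^ 2 ≤ (2 * Real.pi) ^ 2 * ‖ξ‖ ^ 2 := le_mul_of_one_le_left (by positivity) h4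
    have h6 := mul_le_mul_of_nonneg_left (h2.trans h5) (sq_nonneg α)
    linarith

section WeakContinuity

variable {ι : Type*} {l : Filter ι} {a b : ι → L2 ℝ} {a₀ b₀ : L2 ℝ} {R : ℝ}

/-- Plays the part of Rellich's theorem. After the cutoff the value at x is a continuous functional
that is norm continuous in x, so weak convergence is uniform on the support of χ and the products
converge there. -/
theorem tendsto_integral_sCut {α M : ℝ} (ha : ∀ᶠ i in l, ‖a i‖ ≤ R) (hb : ∀ᶠ i in l, ‖b i‖ ≤ R)
    (ha₀ : ‖a₀‖ ≤ R) (hb₀ : ‖b₀‖ ≤ R)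
    (hat : ∀ φ, Tendsto (fun i => inner ℝ (a i) φ) l (𝓝 (inner ℝ a₀ φ)))
    (hbt : ∀ φ, Tendsto (fun i => inner ℝ (b i) φ) l (𝓝 (inner ℝ b₀ φ)))
    {χ : E3 → ℝ} (hχ : IsTest χ) :
    Tendsto (fun i => ∫ x, χ x * (mult (sCut α M) (a i) x * mult (sCut α M) (b i) x)) l
      (𝓝 (∫ x, χ x * (mult (sCut α M) a₀ x * mult (sCut α M) b₀ x))) := by
  have hM : ∀ ξ : E3, M < ‖ξ‖ → sCut α M ξ = 0 := fun ξ h =>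
    indicator_of_notMem (by simpa using h) _
  set ℓ := evalMult (memLp_sCut α M) with hℓ
  have hcont : Continuous ℓ := continuous_evalMult _ hM
  have hR : 0 ≤ R := (norm_nonneg _).trans ha₀
  have key : ∀ u v : L2 ℝ, ∫ x, χ x * (mult (sCut α M) u x * mult (sCut α M) v x) =
      ∫ x, χ x * (ℓ x u * ℓ x v) := fun u v => by
    refine integral_congr_ae ?_
    filter_upwards [coeFn_mult_eq_evalMult (isSymbol_sCut α M) (memLp_sCut α M) hM u,
      coeFn_mult_eq_evalMult (isSymbol_sCut α M) (memLp_sCut α M) hM v] with x h1 h2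
    rw [h1, h2]
  have hint : ∀ u v : L2 ℝ, Integrable fun x => χ x * (ℓ x u * ℓ x v) := fun u v =>
    (hχ.1.continuous.mul ((hcont.clm_apply continuous_const).mul
      (hcont.clm_apply continuous_const))).integrable_of_hasCompactSupport hχ.2.mul_right
  simp only [key]
  obtain ⟨L, hL⟩ := hχ.2.exists_bound_of_continuousOn hcont.continuousOn
  have hw : ∀ {u : ι → L2 ℝ} {u₀ : L2 ℝ},
      (∀ φ, Tendsto (fun i => inner ℝ (u i) φ) l (𝓝 (inner ℝ u₀ φ))) → ∀ x,
      Tendsto (fun i => ℓ x (u i)) l (𝓝 (ℓ x u₀)) := fun {u u₀} h x => by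
    have h2 := h ((InnerProductSpace.toDual ℝ _).symm (ℓ x))
    have e : ∀ v : L2 ℝ, inner ℝ v ((InnerProductSpace.toDual ℝ (L2 ℝ)).symm (ℓ x)) = ℓ x v :=
      fun v => by rw [real_inner_comm, InnerProductSpace.toDual_symm_apply]
    simpa only [e] using h2
  have hd : ∀ {u : ι → L2 ℝ} {u₀ : L2 ℝ}, (∀ᶠ i in l, ‖u i‖ ≤ R) → ‖u₀‖ ≤ R →
      ∀ᶠ i in l, ‖u i - u₀‖ ≤ R + R := fun h h0 => by
    filter_upwards [h] with i hi
    exact (norm_sub_le _ _).trans (add_le_add hi h0)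
  rw [Metric.tendsto_nhds]
  intro ε hε
  have hχi : Integrable fun x => |χ x| :=
    (hχ.1.continuous.integrable_of_hasCompactSupport hχ.2).abs
  set I := ∫ x, |χ x| with hI
  have hI0 : 0 ≤ I := integral_nonneg fun _ => abs_nonneg _
  have hδ : 0 < ε / (2 * (|L| * R + 1) * (I + 1)) := by positivity
  set δ := ε / (2 * (|L| * R + 1) * (I + 1)) with hδe
  filter_upwards [ha, hb, eventually_forall_compact hχ.2 hcont.continuousOn (hd ha ha₀)
    (fun x _ => hw hat x) hδ, eventually_forall_compact hχ.2 hcont.continuousOn (hd hb hb₀)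
    (fun x _ => hw hbt x) hδ] with i h1 h2 h3 h4
  have hLx : ∀ x ∈ tsupport χ, ∀ u : L2 ℝ, ‖u‖ ≤ R → |ℓ x u| ≤ |L| * R := fun x hx u hu =>
    ((ℓ x).le_opNorm u).trans
      (mul_le_mul ((hL x hx).trans (le_abs_self L)) hu (norm_nonneg _) (abs_nonneg _))
  rw [Real.dist_eq, ← integral_sub (hint _ _) (hint _ _)]
  have hb : ‖∫ x, (χ x * (ℓ x (a i) * ℓ x (b i)) - χ x * (ℓ x a₀ * ℓ x b₀))‖ ≤
      ∫ x, |χ x| * (2 * (|L| * R) * δ) := by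
    refine norm_integral_le_of_norm_le (hχi.mul_const _) (Eventually.of_forall fun x => ?_)
    rw [← mul_sub, norm_mul, Real.norm_eq_abs, Real.norm_eq_abs]
    by_cases hx : x ∈ tsupport χ
    · refine mul_le_mul_of_nonneg_left ?_ (abs_nonneg _)
      have e : ℓ x (a i) * ℓ x (b i) - ℓ x a₀ * ℓ x b₀ =
        (ℓ x (a i) - ℓ x a₀) * ℓ x (b i) + ℓ x a₀ * (ℓ x (b i) - ℓ x b₀) := by ring
      rw [e]
      refine (abs_add_le _ _).trans ?_
      rw [abs_mul, abs_mul]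
      have e1 := mul_le_mul (h3 x hx).le (hLx x hx _ h2) (abs_nonneg _) hδ.le
      have e2 := mul_le_mul (hLx x hx _ ha₀) (h4 x hx).le (abs_nonneg _) (by positivity)
      linarith
    · simp [image_eq_zero_of_notMem_tsupport hx]
  refine hb.trans_lt ?_
  rw [integral_mul_const, ← hI, hδe]
  have : 2 * (|L| * R) < 2 * (|L| * R + 1) := by linarith
  calc I * (2 * (|L| * R) * (ε / (2 * (|L| * R + 1) * (I + 1))))
      = ε * ((2 * (|L| * R)) / (2 * (|L| * R + 1))) * (I / (I + 1)) := by field_simp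
    _ ≤ ε * ((2 * (|L| * R)) / (2 * (|L| * R + 1))) * 1 := by
        refine mul_le_mul_of_nonneg_left ?_ (by positivity)
        rw [div_le_one (by positivity)]
        linarith
    _ < ε := by
        rw [mul_one]
        refine mul_lt_of_lt_one_right hε ?_
        rwa [div_lt_one (by positivity)]

/-- The product of two weakly convergent bounded families converges weakly. -/
theorem tendsto_inner_besselMul {α : ℝ} (hα : 0 < α) (ha : ∀ᶠ i in l, ‖a i‖ ≤ R)
    (hb : ∀ᶠ i in l, ‖b i‖ ≤ R)
    (hat : ∀ φ, Tendsto (fun i => inner ℝ (a i) φ) l (𝓝 (inner ℝ a₀ φ)))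
    (hbt : ∀ φ, Tendsto (fun i => inner ℝ (b i) φ) l (𝓝 (inner ℝ b₀ φ))) (K : L2 ℝ) :
    Tendsto (fun i => inner ℝ (besselMul hα (a i) (b i)) K) l
      (𝓝 (inner ℝ (besselMul hα a₀ b₀) K)) := by
  set R' := max R (max ‖a₀‖ ‖b₀‖) with hR'
  have hR'0 : 0 ≤ R' := (norm_nonneg a₀).trans ((le_max_left _ _).trans (le_max_right _ _))
  replace ha : ∀ᶠ i in l, ‖a i‖ ≤ R' := ha.mono fun i h => h.trans (le_max_left _ _)
  replace hb : ∀ᶠ i in l, ‖b i‖ ≤ R' := hb.mono fun i h => h.trans (le_max_left _ _)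
  have ha₀ : ‖a₀‖ ≤ R' := (le_max_left _ _).trans (le_max_right _ _)
  have hb₀ : ‖b₀‖ ≤ R' := (le_max_right _ _).trans (le_max_right _ _)
  have hQ : ∀ᶠ i in l, ‖besselMul hα (a i) (b i)‖ ≤ ‖besselMul hα‖ * R' * R' := by
    filter_upwards [ha, hb] with i h1 h2
    refine ((besselMul hα).le_opNorm₂ _ _).trans ?_
    gcongr
  -- The products stay bounded in L², so it suffices to test with compactly supported functions.
  refine tendsto_inner_of_dense hQ dense_test ?_ K
  rintro _ ⟨χ, hχ, rfl⟩
  have key : ∀ u v : L2 ℝ, inner ℝ (besselMul hα u v) hχ.toL2 =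
      ∫ x, χ x * (mult (sSym α) u x * mult (sSym α) v x) := fun u v => by
    rw [real_inner_comm, hχ.inner_toL2]
    refine integral_congr_ae ?_
    filter_upwards [coeFn_besselMul hα u v] with x h
    rw [h]
  simp only [key]
  obtain ⟨C, hC⟩ := hχ.1.continuous.bounded_above_of_compact_support hχ.2
  have hC0 : 0 ≤ C := (norm_nonneg _).trans (hC 0)
  refine tendsto_of_approx fun ε hε => ?_
  -- The discarded high frequencies contribute at most ε, uniformly over the ball of radius R'; the
  -- two terms of the product difference account for the factor 2 in the denominator.
  obtain ⟨M, hM⟩ := exists_norm_sub_sCut_le hα (δ := ε / (2 * C * R' * R' + 1)) (by positivity)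
  set δ := ε / (2 * C * R' * R' + 1) with hδ
  have hδ0 : 0 < δ := by positivity
  have hdiff : ∀ u v : L2 ℝ, ‖u‖ ≤ R' → ‖v‖ ≤ R' →
      |(∫ x, χ x * (mult (sSym α) u x * mult (sSym α) v x)) -
        ∫ x, χ x * (mult (sCut α M) u x * mult (sCut α M) v x)| ≤ ε := fun u v hu hv => by
    have e : (∫ x, χ x * (mult (sSym α) u x * mult (sSym α) v x)) -
        ∫ x, χ x * (mult (sCut α M) u x * mult (sCut α M) v x) =
        (∫ x, χ x * ((mult (sSym α) u - mult (sCut α M) u : L2 ℝ) x * mult (sSym α) v x)) +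
        ∫ x, χ x * (mult (sCut α M) u x * (mult (sSym α) v - mult (sCut α M) v : L2 ℝ) x) := by
      rw [← integral_sub (integrable_mul_mul hχ _ _) (integrable_mul_mul hχ _ _),
        ← integral_add (integrable_mul_mul hχ _ _) (integrable_mul_mul hχ _ _)]
      refine integral_congr_ae ?_
      filter_upwards [Lp.coeFn_sub (mult (sSym α) u) (mult (sCut α M) u),
        Lp.coeFn_sub (mult (sSym α) v) (mult (sCut α M) v)] with x h1 h2
      rw [h1, h2, Pi.sub_apply, Pi.sub_apply]
      ring
    rw [e]
    refine (abs_add_le _ _).trans ?_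
    have f1 := abs_integral_mul_mul_le hC (mult (sSym α) u - mult (sCut α M) u) (mult (sSym α) v)
    have f2 := abs_integral_mul_mul_le hC (mult (sCut α M) u) (mult (sSym α) v - mult (sCut α M) v)
    have g1 : ‖mult (sSym α) v‖ ≤ R' :=
      (norm_mult_le (isSymbol_sSym α) (norm_sSym_le α) v).trans (by linarith)
    have g2 : ‖mult (sCut α M) u‖ ≤ R' :=
      (norm_mult_le (isSymbol_sCut α M) (norm_sCut_le α M) u).trans (by linarith)
    have g3 : ‖mult (sSym α) u - mult (sCut α M) u‖ ≤ δ * R' := (hM u).trans (by gcongr)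
    have g4 : ‖mult (sSym α) v - mult (sCut α M) v‖ ≤ δ * R' := (hM v).trans (by gcongr)
    have k1 := mul_le_mul_of_nonneg_left (mul_le_mul g3 g1 (norm_nonneg _) (by positivity)) hC0
    have k2 := mul_le_mul_of_nonneg_left (mul_le_mul g2 g4 (norm_nonneg _) (by positivity)) hC0
    have k3 : C * (δ * R' * R') + C * (R' * (δ * R')) ≤ ε := by
      have : (2 * C * R' * R' + 1) * δ = ε := by
        rw [hδ]
        field_simp
      nlinarith
    linarith
  refine ⟨_, _, ?_, hdiff _ _ ha₀ hb₀, tendsto_integral_sCut ha hb ha₀ hb₀ hat hbt hχ⟩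
  filter_upwards [ha, hb] with i h1 h2
  exact hdiff _ _ h1 h2

end WeakContinuity

/-! ### Weak limits in Hilbert spaces -/

section Hilbert

variable {X : Type*} [NormedAddCommGroup X] [InnerProductSpace ℝ X]

/-- Banach–Alaoglu for the Riesz functionals. An ultrafilter replaces extraction of a subsequence,
so separability plays no role. -/
theorem exists_weak_limit [CompleteSpace X] {ι : Type*} (𝒰 : Ultrafilter ι) {y : ι → X} {R : ℝ}
    (hy : ∀ᶠ i in 𝒰, ‖y i‖ ≤ R) :
    ∃ y₀ : X, ‖y₀‖ ≤ R ∧ ∀ φ, Tendsto (fun i => inner ℝ (y i) φ) 𝒰 (𝓝 (inner ℝ y₀ φ)) := by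
  let D : ι → WeakDual ℝ X := fun i =>
    StrongDual.toWeakDual (InnerProductSpace.toDual ℝ X (y i))
  have hc := WeakDual.isCompact_closedBall (𝕜 := ℝ) (0 : StrongDual ℝ X) R
  have hm : ↑(𝒰.map D) ≤ 𝓟 ((WeakDual.toStrongDual : WeakDual ℝ X → StrongDual ℝ X) ⁻¹'
      Metric.closedBall 0 R) := by
    rw [le_principal_iff]
    rw [Ultrafilter.coe_map, mem_map]
    filter_upwards [hy] with i hi
    change dist ((InnerProductSpace.toDual ℝ X (y i))) 0 ≤ R
    rw [dist_zero_right, LinearIsometryEquiv.norm_map]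
    exact hi
  obtain ⟨z, hz, hlim⟩ := hc.ultrafilter_le_nhds (𝒰.map D) hm
  refine ⟨(InnerProductSpace.toDual ℝ X).symm (WeakDual.toStrongDual z), ?_, fun φ => ?_⟩
  · rw [LinearIsometryEquiv.norm_map]
    simpa using hz
  · rw [InnerProductSpace.toDual_symm_apply]
    exact ((WeakDual.eval_continuous φ).tendsto z).comp hlim

/-- Expand ‖y - y₀‖² = ‖y‖² - 2⟨y, y₀⟩ + ‖y₀‖². -/
theorem tendsto_of_weak_of_norm {ι : Type*} {l : Filter ι} {y : ι → X} {y₀ : X}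
    (hw : ∀ φ, Tendsto (fun i => inner ℝ (y i) φ) l (𝓝 (inner ℝ y₀ φ)))
    (hn : ∀ ε > 0, ∀ᶠ i in l, ‖y i‖ ^ 2 ≤ ‖y₀‖ ^ 2 + ε) : Tendsto y l (𝓝 y₀) := by
  rw [Metric.tendsto_nhds]
  intro ε hε
  have h2 : 0 < ε ^ 2 / 4 := by positivity
  filter_upwards [hn _ h2, Metric.tendsto_nhds.1 (hw y₀) _ h2] with i h3 h4
  rw [Real.dist_eq, real_inner_self_eq_norm_sq, abs_lt] at h4
  rw [dist_eq_norm]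
  refine (pow_lt_pow_iff_left₀ (norm_nonneg _) hε.le two_ne_zero).1 ?_
  rw [norm_sub_sq_real]
  linarith [h4.1]

/-- For g merely bounded and measurable the primitive is Lipschitz, so its squared norm is
absolutely continuous and is the integral of its almost everywhere derivative. Solutions without
continuity in time need this form. -/
theorem norm_sq_integral_eq [CompleteSpace X] {g : ℝ → X} {C t : ℝ} (ht : 0 ≤ t)
    (hg : AEStronglyMeasurable g (volume.restrict (Ioc 0 t)))
    (hC : ∀ᵐ s ∂volume.restrict (Ioc 0 t), ‖g s‖ ≤ C) :
    ‖∫ s in (0 : ℝ)..t, g s‖ ^ 2 = 2 * ∫ s in (0 : ℝ)..t, inner ℝ (g s) (∫ r in (0 : ℝ)..s, g r) := by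
  have hfin : IsFiniteMeasure (volume.restrict (Ioc 0 t)) := ⟨by simp⟩
  have hint : IntervalIntegrable g volume 0 t := by
    rw [intervalIntegrable_iff_integrableOn_Ioc_of_le ht]
    exact Integrable.of_bound hg C hC
  set G : ℝ → X := fun s => ∫ r in (0 : ℝ)..s, g r with hG
  have hsub : ∀ a ∈ Icc 0 t, ∀ b ∈ Icc 0 t, ‖G a - G b‖ ≤ |C| * |a - b| := fun a ha b hb => by
    have e : G a - G b = ∫ r in b..a, g r := by
      refine intervalIntegral.integral_interval_sub_left (hint.mono_set ?_) (hint.mono_set ?_)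
      · rw [uIcc_of_le ha.1, uIcc_of_le ht]; exact Icc_subset_Icc_right ha.2
      · rw [uIcc_of_le hb.1, uIcc_of_le ht]; exact Icc_subset_Icc_right hb.2
    rw [e]
    refine intervalIntegral.norm_integral_le_of_norm_le_const_ae ?_
    have h1 := (ae_restrict_iff' measurableSet_Ioc).1 hC
    filter_upwards [h1] with s hs hsm
    refine (hs ?_).trans (le_abs_self C)
    rw [mem_uIoc] at hsm
    rcases hsm with h | h
    · exact ⟨hb.1.trans_lt h.1, h.2.trans ha.2⟩
    · exact ⟨ha.1.trans_lt h.1, h.2.trans hb.2⟩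
  have hGb : ∀ a ∈ Icc 0 t, ‖G a‖ ≤ |C| * t := fun a ha => by
    have := hsub a ha 0 ⟨le_rfl, ht⟩
    simp only [hG, intervalIntegral.integral_same, sub_zero] at this
    rw [abs_of_nonneg ha.1] at this
    exact this.trans (mul_le_mul_of_nonneg_left ha.2 (abs_nonneg _))
  have hL : LipschitzOnWith (Real.toNNReal (2 * (|C| * t) * |C|)) (fun s => ‖G s‖ ^ 2)
      (uIcc 0 t) := by
    refine LipschitzOnWith.of_dist_le_mul fun a ha b hb => ?_
    rw [uIcc_of_le ht] at ha hb
    rw [Real.coe_toNNReal _ (by positivity), Real.dist_eq, Real.dist_eq]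
    have e : ‖G a‖ ^ 2 - ‖G b‖ ^ 2 = (‖G a‖ + ‖G b‖) * (‖G a‖ - ‖G b‖) := by ring
    rw [e, abs_mul, abs_of_nonneg (by positivity : 0 ≤ ‖G a‖ + ‖G b‖), mul_assoc (2 * (|C| * t))]
    refine mul_le_mul ?_ ((abs_norm_sub_norm_le _ _).trans (hsub a ha b hb)) (abs_nonneg _)
      (by positivity)
    linarith [hGb a ha, hGb b hb]
  have h1 := hL.absolutelyContinuousOnInterval.integral_deriv_eq_sub
  have h0 : G 0 = 0 := by simp [hG]
  simp only [h0, norm_zero] at h1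
  have h2 : ∫ s in (0 : ℝ)..t, deriv (fun s => ‖G s‖ ^ 2) s =
      ∫ s in (0 : ℝ)..t, 2 * inner ℝ (g s) (G s) := by
    refine intervalIntegral.integral_congr_ae ?_
    filter_upwards [hint.ae_hasDerivAt_integral] with s hs hsm
    have hs' := hs (uIoc_subset_uIcc hsm) 0 left_mem_uIcc
    have := hs'.norm_sq
    rw [this.deriv, real_inner_comm]
  rw [intervalIntegral.integral_const_mul] at h2
  rw [← h2, h1]
  simp [hG]

end Hilbert

/-! ### Existence of global attractors -/

/-- Any ultrafilter finer than `comap g 𝒱 ⊓ F` does it; this filter is proper by the push-pull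
formula. It lets limit points be described by ultrafilters on times and initial data. -/
theorem exists_ultrafilter_map_eq {ι X : Type*} {F : Filter ι} {g : ι → X} {𝒱 : Ultrafilter X}
    (h : ↑𝒱 ≤ F.map g) : ∃ 𝒰 : Ultrafilter ι, ↑𝒰 ≤ F ∧ 𝒰.map g = 𝒱 := by
  have hne : (comap g 𝒱 ⊓ F).NeBot := by
    rw [← map_neBot_iff g, inf_comm, Filter.push_pull]
    rw [inf_eq_right.2 h]
    exact 𝒱.neBot
  refine ⟨Ultrafilter.of (comap g 𝒱 ⊓ F), (Ultrafilter.of_le _).trans inf_le_right, ?_⟩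
  refine Ultrafilter.coe_le_coe.1 ?_
  rw [Ultrafilter.coe_map]
  exact (map_mono ((Ultrafilter.of_le _).trans inf_le_left)).trans map_comap_le

/-- The attractor is the omega-limit set of B₀: the cluster points of S(t)x as t → ∞ with x in B₀.
The hypothesis `hcpt` says that every ultrafilter finer than the image filter F converges, and the
three properties follow from this. -/
theorem exists_isGlobalAttractor {X : Type*} [MetricSpace X] [CompleteSpace X] (S : ℝ → X → X)
    (hadd : ∀ s t, 0 ≤ s → 0 ≤ t → ∀ x, S (s + t) x = S s (S t x))
    (hcont : ∀ t, 0 ≤ t → Continuous (S t)) (B₀ : Set X)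
    (habs : ∀ B : Set X, Bornology.IsBounded B → ∃ T : ℝ, 0 < T ∧ ∀ x ∈ B, S T x ∈ B₀)
    (hcpt : ∀ 𝒰 : Ultrafilter (ℝ × X), ↑𝒰 ≤ (atTop ×ˢ 𝓟 B₀ : Filter (ℝ × X)) →
      ∃ x, Tendsto (fun p : ℝ × X => S p.1 p.2) 𝒰 (𝓝 x)) :
    ∃ A : Set X, IsGlobalAttractor S A := by
  set E : Filter (ℝ × X) := atTop ×ˢ 𝓟 B₀ with hE
  set F : Filter X := E.map fun p => S p.1 p.2 with hF
  have hconv : ∀ 𝒱 : Ultrafilter X, (𝒱 : Filter X) ≤ F → ∃ x, (𝒱 : Filter X) ≤ 𝓝 x := fun 𝒱 h => by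
    obtain ⟨𝒰, h1, rfl⟩ := exists_ultrafilter_map_eq h
    exact hcpt 𝒰 h1
  have hshift : ∀ t : ℝ, Tendsto (fun p : ℝ × X => (p.1 + t, p.2)) E E := fun t =>
    (tendsto_atTop_add_const_right _ t tendsto_fst).prodMk tendsto_snd
  have hEpos : ∀ t : ℝ, ∀ᶠ p in E, t ≤ p.1 := fun t => tendsto_fst.eventually (eventually_ge_atTop t)
  set A : Set X := {x | ClusterPt x F} with hA
  have hAiff : ∀ x, x ∈ A ↔ ∃ 𝒱 : Ultrafilter X, (𝒱 : Filter X) ≤ F ∧ (𝒱 : Filter X) ≤ 𝓝 x := fun x => by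
    rw [hA, mem_ofPred_eq, clusterPt_iff_ultrafilter]
  have hclosed : IsClosed A := isClosed_setOfPred_clusterPt
  refine ⟨A, ?_, ?_, ?_⟩
  · refine isCompact_iff_totallyBounded_isComplete.2 ⟨?_, hclosed.isComplete⟩
    rw [Metric.totallyBounded_iff]
    intro ε hε
    -- If no finite union of ε/2-balls belongs to F, an ultrafilter finer than F avoids every
    -- ε/2-ball, which contradicts its convergence.
    by_cases hex : ∃ t : Set X, t.Finite ∧ (⋃ y ∈ t, Metric.ball y (ε / 2)) ∈ F
    · obtain ⟨t, ht, htF⟩ := hex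
      refine ⟨t, ht, fun x hx => ?_⟩
      have h1 : x ∈ closure (⋃ y ∈ t, Metric.ball y (ε / 2)) :=
        (hx.mono (le_principal_iff.2 htF)).mem_closure
      rw [ht.closure_biUnion] at h1
      simp only [mem_iUnion] at h1 ⊢
      obtain ⟨y, hy, hxy⟩ := h1
      refine ⟨y, hy, ?_⟩
      have := Metric.closure_ball_subset_closedBall hxy
      rw [Metric.mem_closedBall] at this
      rw [Metric.mem_ball]
      linarith
    · exfalso
      push Not at hex
      have hdir : Directed (· ≥ ·) fun t : {t : Set X // t.Finite} =>
          𝓟 (⋃ y ∈ t.1, Metric.ball y (ε / 2))ᶜ := fun s t =>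
        ⟨⟨s.1 ∪ t.1, s.2.union t.2⟩, by
          simp only [ge_iff_le, le_principal_iff, mem_principal, compl_subset_compl]
          exact biUnion_subset_biUnion_left subset_union_left, by
          simp only [ge_iff_le, le_principal_iff, mem_principal, compl_subset_compl]
          exact biUnion_subset_biUnion_left subset_union_right⟩
      set F' : Filter X := F ⊓ ⨅ t : {t : Set X // t.Finite},
        𝓟 (⋃ y ∈ t.1, Metric.ball y (ε / 2))ᶜ with hF'
      have hne : F'.NeBot := by
        rw [← forall_mem_nonempty_iff_neBot]
        intro s hs
        rw [mem_inf_iff] at hs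
        obtain ⟨s1, h1, s2, h2, rfl⟩ := hs
        have : Nonempty {t : Set X // t.Finite} := ⟨⟨∅, finite_empty⟩⟩
        rw [mem_iInf_of_directed hdir] at h2
        obtain ⟨t, ht⟩ := h2
        rw [mem_principal] at ht
        by_contra hemp
        refine hex t.1 t.2 (mem_of_superset h1 fun x hx => ?_)
        by_contra hxn
        exact hemp ⟨x, hx, ht hxn⟩
      obtain ⟨x, hx⟩ := hconv (Ultrafilter.of F') ((Ultrafilter.of_le _).trans inf_le_left)
      have h1 := hx (Metric.ball_mem_nhds x (half_pos hε))
      have h3 : F' ≤ 𝓟 (⋃ y ∈ ({x} : Set X), Metric.ball y (ε / 2))ᶜ :=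
        inf_le_right.trans (iInf_le (fun t : {t : Set X // t.Finite} =>
          𝓟 (⋃ y ∈ t.1, Metric.ball y (ε / 2))ᶜ) ⟨{x}, finite_singleton x⟩)
      have h2 := le_principal_iff.1 ((Ultrafilter.of_le F').trans h3)
      obtain ⟨z, hz1, hz2⟩ := (Ultrafilter.neBot _).nonempty_of_mem (inter_mem h1 h2)
      simp only [biUnion_singleton] at hz2
      exact hz2 hz1
  · intro t ht
    apply Subset.antisymm
    -- Applying S t only shifts the time variable forward, and such a shift respects the filter E.
    · rintro _ ⟨x, hx, rfl⟩
      rw [hAiff] at hx ⊢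
      obtain ⟨𝒱, h1, h2⟩ := hx
      refine ⟨𝒱.map (S t), ?_, ((hcont t ht).tendsto x).mono_left h2⟩
      rw [Ultrafilter.coe_map]
      refine (map_mono h1).trans ?_
      rw [hF, map_map]
      have : (S t ∘ fun p : ℝ × X => S p.1 p.2) =ᶠ[E]
          ((fun p : ℝ × X => S p.1 p.2) ∘ fun p => (p.1 + t, p.2)) := by
        filter_upwards [hEpos 0] with p hp
        simp only [Function.comp]
        rw [add_comm, hadd t p.1 ht hp]
      rw [map_congr this, ← map_map]
      exact map_mono (hshift t)
    -- Shift time back by t: the earlier states converge to some y in A, and continuity of S t gives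
    -- S t y = x.
    · intro x hx
      rw [hAiff] at hx
      obtain ⟨𝒱, h1, h2⟩ := hx
      obtain ⟨𝒰, h3, rfl⟩ := exists_ultrafilter_map_eq h1
      have h4 : ↑(𝒰.map fun p : ℝ × X => (p.1 + (-t), p.2)) ≤ E :=
        (map_mono h3).trans (hshift (-t))
      have h5 : ↑((𝒰.map fun p : ℝ × X => (p.1 + (-t), p.2)).map fun p : ℝ × X => S p.1 p.2) ≤ F :=
        map_mono h4
      obtain ⟨y, hy⟩ := hconv _ h5
      refine ⟨y, (hAiff y).2 ⟨_, h5, hy⟩, ?_⟩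
      have h6 : Tendsto (fun p : ℝ × X => S t (S (p.1 + (-t)) p.2)) 𝒰 (𝓝 (S t y)) :=
        ((hcont t ht).tendsto y).comp hy
      have h7 : Tendsto (fun p : ℝ × X => S p.1 p.2) 𝒰 (𝓝 x) := h2
      refine tendsto_nhds_unique (h6.congr' ?_) h7
      filter_upwards [h3 (hEpos t)] with p hp
      rw [← hadd t _ ht (by linarith [show t ≤ p.1 from hp])]
      congr 1
      ring
  · intro B hB V hV
    -- Otherwise an ultrafilter finer than F would live off V, although its limit lies in A and V is
    -- a neighborhood of A.
    have hev : ∀ᶠ p in E, S p.1 p.2 ∈ V := by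
      by_contra hcon
      have hne : (F ⊓ 𝓟 Vᶜ).NeBot := by
        rw [← frequently_mem_iff_neBot, hF, frequently_map]
        exact not_eventually.1 hcon
      obtain ⟨x, hx⟩ := hconv (Ultrafilter.of (F ⊓ 𝓟 Vᶜ)) ((Ultrafilter.of_le _).trans inf_le_left)
      have hxA : x ∈ A := (hAiff x).2 ⟨_, (Ultrafilter.of_le _).trans inf_le_left, hx⟩
      have h1 : V ∈ 𝓝 x := mem_nhdsSet_iff_forall.1 hV x hxA
      have h2 : Vᶜ ∈ (Ultrafilter.of (F ⊓ 𝓟 Vᶜ) : Filter X) :=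
        ((Ultrafilter.of_le _).trans inf_le_right) (mem_principal_self _)
      obtain ⟨z, hz1, hz2⟩ := (Ultrafilter.neBot _).nonempty_of_mem (inter_mem (hx h1) h2)
      exact hz2 hz1
    obtain ⟨T₀, hT₀, habs₀⟩ := habs B hB
    rw [hE, eventually_prod_principal_iff] at hev
    obtain ⟨T₁, hT₁⟩ := eventually_atTop.1 hev
    -- At time T₀ the set B has entered B₀, and after a further time T₁ the orbits of B₀ stay in V.
    refine ⟨T₀ + max T₁ 0, by have := le_max_right T₁ 0; linarith, fun t ht => ?_⟩
    rintro _ ⟨x, hx, rfl⟩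
    have h1 := le_max_left T₁ 0
    have h2 := le_max_right T₁ 0
    have e : t = (t - T₀) + T₀ := by ring
    rw [e, hadd _ _ (by linarith) hT₀.le]
    exact hT₁ (t - T₀) (by linarith) _ (habs₀ x hx)

/-! ### Mild solutions of semilinear equations -/

section Mild

variable {X : Type*} [NormedAddCommGroup X] [NormedSpace ℝ X]

/-- Strong continuity and the uniform bound on the norms give joint continuity. -/
theorem continuous_clm_uncurry {T : ℝ → X →L[ℝ] X} (hT : ∀ t, ‖T t‖ ≤ 1)
    (hTc : ∀ x, Continuous fun t => T t x) : Continuous fun p : ℝ × X => T p.1 p.2 := by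
  rw [continuous_iff_continuousAt]
  rintro ⟨t₀, x₀⟩
  have h1 : Tendsto (fun p : ℝ × X => T p.1 x₀) (𝓝 (t₀, x₀)) (𝓝 (T t₀ x₀)) :=
    ((hTc x₀).comp continuous_fst).tendsto (t₀, x₀)
  have h2 : Tendsto (fun p : ℝ × X => T p.1 (p.2 - x₀)) (𝓝 (t₀, x₀)) (𝓝 0) := by
    have h3 : Tendsto (fun p : ℝ × X => ‖p.2 - x₀‖) (𝓝 (t₀, x₀)) (𝓝 0) := by
      have : Continuous fun p : ℝ × X => ‖p.2 - x₀‖ := by fun_prop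
      simpa using this.tendsto (t₀, x₀)
    refine squeeze_zero_norm (fun p => ?_) h3
    simpa using (T p.1).le_of_opNorm_le (hT p.1) (p.2 - x₀)
  have h4 := h1.add h2
  rw [add_zero] at h4
  refine h4.congr fun p => ?_
  rw [map_sub]
  abel

/-- Since e^{-λt} ∫₀ᵗ e^{λs} ds ≤ 1/λ, the exponential weight gains a factor 1/λ; this is what makes
the Duhamel map contract on the whole half-line. -/
theorem norm_weighted_integral_le {T : ℝ → X →L[ℝ] X} (hT : ∀ t, ‖T t‖ ≤ 1) {lm C t : ℝ}
    (hlm : 0 < lm) (hC : 0 ≤ C) (ht : 0 ≤ t) {h : ℝ → X}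
    (hh : ∀ s, 0 ≤ s → ‖h s‖ ≤ C * Real.exp (lm * s)) :
    ‖∫ s in (0 : ℝ)..t, Real.exp (-lm * t) • T (t - s) (h s)‖ ≤ C / lm := by
  have hc : Continuous fun s : ℝ => Real.exp (-lm * t) * (C * Real.exp (lm * s)) := by fun_prop
  have h1 : ‖∫ s in (0 : ℝ)..t, Real.exp (-lm * t) • T (t - s) (h s)‖ ≤
      ∫ s in (0 : ℝ)..t, Real.exp (-lm * t) * (C * Real.exp (lm * s)) := by
    refine intervalIntegral.norm_integral_le_of_norm_le ht (Eventually.of_forall fun s hs => ?_)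
      (hc.intervalIntegrable _ _)
    rw [norm_smul, Real.norm_eq_abs, Real.abs_exp]
    refine mul_le_mul_of_nonneg_left ?_ (Real.exp_pos _).le
    have := (T (t - s)).le_of_opNorm_le (hT _) (h s)
    rw [one_mul] at this
    exact this.trans (hh s hs.1.le)
  refine h1.trans ?_
  have h2 : ∀ s : ℝ, HasDerivAt (fun s => Real.exp (-lm * t) * (C * (Real.exp (lm * s) / lm)))
      (Real.exp (-lm * t) * (C * Real.exp (lm * s))) s := fun s => by
    have h3 := ((((hasDerivAt_id s).const_mul lm).exp.div_const lm).const_mul C).const_mul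
      (Real.exp (-lm * t))
    refine h3.congr_deriv ?_
    simp only [id, mul_one]
    field_simp
  rw [intervalIntegral.integral_eq_sub_of_hasDerivAt (fun s _ => h2 s) (hc.intervalIntegrable _ _)]
  have h3 : Real.exp (-lm * t) * (C * (Real.exp (lm * t) / lm)) = C / lm := by
    have : Real.exp (-lm * t) * Real.exp (lm * t) = 1 := by
      rw [← Real.exp_add]; simp
    rw [← mul_div_assoc, ← mul_div_assoc, mul_left_comm, this, mul_one]
  rw [h3]
  have : 0 ≤ Real.exp (-lm * t) * (C * (Real.exp (lm * 0) / lm)) := by positivity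
  linarith

variable [CompleteSpace X]

/-- Global mild solutions of a semilinear equation with Lipschitz nonlinearity. -/
theorem exists_mild {T : ℝ → X →L[ℝ] X} (hT : ∀ t, ‖T t‖ ≤ 1)
    (hTc : ∀ x, Continuous fun t => T t x) {F : X → X} {L : ℝ≥0} (hF : LipschitzWith L F) :
    ∃ (Φ : X → ℝ → X) (lm : ℝ), (∀ x, Continuous (Φ x)) ∧
      (∀ x t, 0 ≤ t → Φ x t = T t x + ∫ s in (0 : ℝ)..t, T (t - s) (F (Φ x s))) ∧
      ∀ x y t, 0 ≤ t → ‖Φ x t - Φ y t‖ ≤ 2 * Real.exp (lm * t) * ‖x - y‖ := by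
  -- The Duhamel map then has Lipschitz constant L / lm ≤ 1/2; the summand 1 keeps lm positive when
  -- L = 0.
  set lm : ℝ := 2 * L + 1 with hlm
  have hlm0 : 0 < lm := by positivity
  have hjoint := continuous_clm_uncurry hT hTc
  have hgrow : ∀ (v : ℝ →ᵇ X) (s : ℝ), ‖F (Real.exp (lm * s) • v s)‖ ≤
      ‖F 0‖ + L * (Real.exp (lm * s) * ‖v‖) := fun v s => by
    have h1 := hF.dist_le_mul (Real.exp (lm * s) • v s) 0
    rw [dist_eq_norm, dist_zero_right, norm_smul, Real.norm_eq_abs, Real.abs_exp] at h1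
    have h2 : (L : ℝ) * (Real.exp (lm * s) * ‖v s‖) ≤ L * (Real.exp (lm * s) * ‖v‖) := by
      gcongr
      exact v.norm_coe_le_norm s
    have h3 := norm_le_norm_add_norm_sub' (F (Real.exp (lm * s) • v s)) (F 0)
    linarith
  have hFc : ∀ v : ℝ →ᵇ X, Continuous fun s => F (Real.exp (lm * s) • v s) := fun v =>
    hF.continuous.comp ((by fun_prop : Continuous fun s => Real.exp (lm * s)).smul v.continuous)
  -- The unknown v is the solution multiplied by e^{-lm t}, hence bounded; `max t 0` freezes it at
  -- negative times, so that the Banach space of bounded continuous functions on ℝ can be used.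
  let Ψ₀ : X → (ℝ →ᵇ X) → ℝ → X := fun x v t => Real.exp (-lm * max t 0) • T (max t 0) x +
    ∫ s in (0 : ℝ)..(max t 0), Real.exp (-lm * max t 0) • T (max t 0 - s)
      (F (Real.exp (lm * s) • v s))
  have hcont : ∀ x v, Continuous (Ψ₀ x v) := fun x v => by
    refine Continuous.add (Continuous.smul (by fun_prop)
      ((hTc x).comp (by fun_prop : Continuous fun t : ℝ => max t 0))) ?_
    refine intervalIntegral.continuous_parametric_intervalIntegral_of_continuous ?_
      (by fun_prop : Continuous fun t : ℝ => max t 0)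
    refine Continuous.smul (by fun_prop) ?_
    exact hjoint.comp (Continuous.prodMk (by fun_prop) ((hFc v).comp continuous_snd))
  have hbd : ∀ x v t, ‖Ψ₀ x v t‖ ≤ ‖x‖ + (‖F 0‖ + L * ‖v‖) / lm := fun x v t => by
    have h0 : (0 : ℝ) ≤ max t 0 := le_max_right _ _
    refine (norm_add_le _ _).trans (add_le_add ?_ ?_)
    · rw [norm_smul, Real.norm_eq_abs, Real.abs_exp]
      have h1 := (T (max t 0)).le_of_opNorm_le (hT _) x
      have h2 : Real.exp (-lm * max t 0) ≤ 1 := by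
        rw [Real.exp_le_one_iff]
        have : 0 ≤ lm * max t 0 := by positivity
        linarith
      calc _ ≤ 1 * (1 * ‖x‖) := mul_le_mul h2 h1 (norm_nonneg _) zero_le_one
        _ = ‖x‖ := by ring
    · refine norm_weighted_integral_le hT hlm0 (by positivity) h0 fun s hs => ?_
      refine (hgrow v s).trans ?_
      have h1 : 1 ≤ Real.exp (lm * s) := Real.one_le_exp (by positivity)
      have h2 : ‖F 0‖ * 1 ≤ ‖F 0‖ * Real.exp (lm * s) := by gcongr
      calc ‖F 0‖ + L * (Real.exp (lm * s) * ‖v‖) ≤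
          ‖F 0‖ * Real.exp (lm * s) + L * (Real.exp (lm * s) * ‖v‖) := by linarith
        _ = _ := by ring
  let Ψ : X → (ℝ →ᵇ X) → (ℝ →ᵇ X) := fun x v =>
    BoundedContinuousFunction.ofNormedAddCommGroup (Ψ₀ x v) (hcont x v) _ (hbd x v)
  have hsub : ∀ x v w t, ‖Ψ₀ x v t - Ψ₀ x w t‖ ≤ (L * ‖v - w‖) / lm := fun x v w t => by
    have h0 : (0 : ℝ) ≤ max t 0 := le_max_right _ _
    have hi : ∀ v : ℝ →ᵇ X, IntervalIntegrable (fun s => Real.exp (-lm * max t 0) •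
        T (max t 0 - s) (F (Real.exp (lm * s) • v s))) volume 0 (max t 0) := fun v => by
      refine Continuous.intervalIntegrable (continuous_const.smul ?_) _ _
      exact hjoint.comp (Continuous.prodMk (by fun_prop) (hFc v))
    have e : Ψ₀ x v t - Ψ₀ x w t = ∫ s in (0 : ℝ)..(max t 0), Real.exp (-lm * max t 0) •
        T (max t 0 - s) (F (Real.exp (lm * s) • v s) - F (Real.exp (lm * s) • w s)) := by
      simp only [map_sub, smul_sub]
      rw [intervalIntegral.integral_sub (hi v) (hi w)]
      simp only [Ψ₀]
      abel
    rw [e]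
    refine norm_weighted_integral_le hT hlm0 (by positivity) h0 fun s hs => ?_
    have h1 := hF.dist_le_mul (Real.exp (lm * s) • v s) (Real.exp (lm * s) • w s)
    rw [dist_eq_norm, dist_eq_norm, ← smul_sub, norm_smul, Real.norm_eq_abs, Real.abs_exp] at h1
    refine h1.trans ?_
    have h2 : ‖v s - w s‖ ≤ ‖v - w‖ := (v - w).norm_coe_le_norm s
    calc (L : ℝ) * (Real.exp (lm * s) * ‖v s - w s‖) ≤ L * (Real.exp (lm * s) * ‖v - w‖) := by
          gcongr
      _ = _ := by ring
  have hKhalf : ((1 / 2 : ℝ≥0) : ℝ) = 1 / 2 := by norm_num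
  have hcontr : ∀ x, ContractingWith (1 / 2) (Ψ x) := fun x => by
    refine ⟨by rw [← NNReal.coe_lt_coe, hKhalf]; norm_num, LipschitzWith.of_dist_le_mul fun v w => ?_⟩
    rw [hKhalf, BoundedContinuousFunction.dist_le (by positivity)]
    intro t
    rw [dist_eq_norm, dist_eq_norm]
    refine (hsub x v w t).trans ?_
    rw [div_le_iff₀ hlm0, hlm]
    have := norm_nonneg (v - w)
    nlinarith
  let φ : X → (ℝ →ᵇ X) := fun x => ContractingWith.fixedPoint (Ψ x) (hcontr x)
  have hφ : ∀ x t, φ x t = Ψ₀ x (φ x) t := fun x t => by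
    have h := (hcontr x).fixedPoint_isFixedPt
    exact (congrArg (fun v : ℝ →ᵇ X => v t) h).symm
  refine ⟨fun x t => Real.exp (lm * t) • φ x t, lm, fun x => ?_, fun x t ht => ?_,
    fun x y t ht => ?_⟩
  · exact (by fun_prop : Continuous fun s => Real.exp (lm * s)).smul (φ x).continuous
  · have h1 : Real.exp (lm * t) * Real.exp (-lm * t) = 1 := by
      rw [← Real.exp_add]; simp
    beta_reduce
    rw [hφ x t]
    simp only [Ψ₀, max_eq_left ht]
    rw [intervalIntegral.integral_smul, smul_add, smul_smul, smul_smul, h1, one_smul, one_smul]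
  -- The fixed point of a 1/2-contraction moves by at most 1/(1 - 1/2) = 2 times the perturbation of
  -- the map.
  · have h1 : dist (φ x) (φ y) ≤ ‖x - y‖ / (1 - ((1 / 2 : ℝ≥0) : ℝ)) := by
      refine (hcontr x).fixedPoint_lipschitz_in_map (hcontr y) fun v => ?_
      rw [BoundedContinuousFunction.dist_le (norm_nonneg _)]
      intro t
      have h0 : (0 : ℝ) ≤ max t 0 := le_max_right _ _
      have e : Ψ x v t - Ψ y v t = Real.exp (-lm * max t 0) • T (max t 0) (x - y) := by
        change Ψ₀ x v t - Ψ₀ y v t = _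
        simp only [Ψ₀, map_sub, smul_sub]
        abel
      rw [dist_eq_norm, e, norm_smul, Real.norm_eq_abs, Real.abs_exp]
      have h1 := (T (max t 0)).le_of_opNorm_le (hT _) (x - y)
      have h2 : Real.exp (-lm * max t 0) ≤ 1 := by
        rw [Real.exp_le_one_iff]
        have : 0 ≤ lm * max t 0 := by positivity
        linarith
      calc _ ≤ 1 * (1 * ‖x - y‖) := mul_le_mul h2 h1 (norm_nonneg _) zero_le_one
        _ = ‖x - y‖ := by ring
    rw [hKhalf] at h1
    rw [← smul_sub, norm_smul, Real.norm_eq_abs, Real.abs_exp]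
    have h2 : ‖φ x t - φ y t‖ ≤ dist (φ x) (φ y) := by
      rw [← dist_eq_norm]
      exact BoundedContinuousFunction.dist_coe_le_dist t
    calc Real.exp (lm * t) * ‖φ x t - φ y t‖ ≤ Real.exp (lm * t) * (2 * ‖x - y‖) := by
          gcongr
          refine (h2.trans h1).trans (le_of_eq ?_)
          ring
      _ = _ := by ring

end Mild

/-! ### Truncation -/

/-- Radial projection onto the ball of radius `R`. -/
def radial {X : Type*} [NormedAddCommGroup X] [NormedSpace ℝ X] (R : ℝ) (u : X) : X :=
  (R / max R ‖u‖) • u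

section Radial

variable {X : Type*} [NormedAddCommGroup X] [NormedSpace ℝ X] {R : ℝ}

theorem radial_of_norm_le (hR : 0 < R) {u : X} (hu : ‖u‖ ≤ R) : radial R u = u := by
  rw [radial, max_eq_left hu, div_self hR.ne', one_smul]

theorem norm_radial_le (hR : 0 < R) (u : X) : ‖radial R u‖ ≤ R := by
  have hm : 0 < max R ‖u‖ := hR.trans_le (le_max_left _ _)
  rw [radial, norm_smul, Real.norm_of_nonneg (by positivity), div_mul_eq_mul_div, div_le_iff₀ hm]
  exact mul_le_mul_of_nonneg_left (le_max_right _ _) hR.le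

/-- The difference splits into a change of the vector and a change of the scaling factor, each at
most ‖u - v‖; this works in any normed space. -/
theorem norm_radial_sub_le (hR : 0 < R) (u v : X) : ‖radial R u - radial R v‖ ≤ 2 * ‖u - v‖ := by
  have hm : 0 < max R ‖u‖ := hR.trans_le (le_max_left _ _)
  have hn : 0 < max R ‖v‖ := hR.trans_le (le_max_left _ _)
  have e : radial R u - radial R v =
      (R / max R ‖u‖) • (u - v) + (R / max R ‖u‖ - R / max R ‖v‖) • v := by
    rw [radial, radial, smul_sub, sub_smul]
    abel
  have h1 : R / max R ‖u‖ ≤ 1 := by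
    rw [div_le_one hm]; exact le_max_left _ _
  have h2 : |max R ‖v‖ - max R ‖u‖| ≤ ‖u - v‖ := by
    refine (abs_max_sub_max_le_max R ‖v‖ R ‖u‖).trans ?_
    rw [sub_self, abs_zero]
    refine max_le (norm_nonneg _) ?_
    rw [norm_sub_rev]
    exact abs_norm_sub_norm_le _ _
  have h3 : |R / max R ‖u‖ - R / max R ‖v‖| * ‖v‖ ≤ ‖u - v‖ := by
    have e2 : R / max R ‖u‖ - R / max R ‖v‖ =
        (R / max R ‖u‖) * ((max R ‖v‖ - max R ‖u‖) / max R ‖v‖) := by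
      field_simp
    rw [e2, abs_mul, abs_of_pos (div_pos hR hm), abs_div, abs_of_pos hn]
    have h4 : ‖v‖ / max R ‖v‖ ≤ 1 := by
      rw [div_le_one hn]; exact le_max_right _ _
    calc R / max R ‖u‖ * (|max R ‖v‖ - max R ‖u‖| / max R ‖v‖) * ‖v‖
        = R / max R ‖u‖ * |max R ‖v‖ - max R ‖u‖| * (‖v‖ / max R ‖v‖) := by ring
      _ ≤ 1 * ‖u - v‖ * 1 := by gcongr
      _ = ‖u - v‖ := by ring
  rw [e]
  refine (norm_add_le _ _).trans ?_
  rw [norm_smul, norm_smul, Real.norm_of_nonneg (div_pos hR hm).le, Real.norm_eq_abs]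
  have h5 : R / max R ‖u‖ * ‖u - v‖ ≤ 1 * ‖u - v‖ := by gcongr
  linarith

theorem norm_bilinear_sub_le (B : X →L[ℝ] X →L[ℝ] X) {u v : X} (hu : ‖u‖ ≤ R) (hv : ‖v‖ ≤ R) :
    ‖B u u - B v v‖ ≤ 2 * ‖B‖ * R * ‖u - v‖ := by
  have hR : 0 ≤ R := (norm_nonneg _).trans hu
  have e : B u u - B v v = B (u - v) u + B v (u - v) := by
    rw [map_sub, map_sub]
    simp
  rw [e]
  refine (norm_add_le _ _).trans ?_
  have h1 := B.le_opNorm₂ (u - v) u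
  have h2 := B.le_opNorm₂ v (u - v)
  have h3 : ‖B‖ * ‖u - v‖ * ‖u‖ ≤ ‖B‖ * ‖u - v‖ * R := by gcongr
  have h4 : ‖B‖ * ‖v‖ * ‖u - v‖ ≤ ‖B‖ * R * ‖u - v‖ := by gcongr
  linarith

theorem lipschitzWith_truncation (hR : 0 < R) (f : X) (B : X →L[ℝ] X →L[ℝ] X) :
    LipschitzWith (Real.toNNReal (4 * ‖B‖ * R)) fun u => f - B (radial R u) (radial R u) := by
  refine LipschitzWith.of_dist_le_mul fun u v => ?_
  rw [Real.coe_toNNReal _ (by positivity), dist_eq_norm, dist_eq_norm, sub_sub_sub_cancel_left,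
    norm_sub_rev]
  refine (norm_bilinear_sub_le B (norm_radial_le hR u) (norm_radial_le hR v)).trans ?_
  have h := norm_radial_sub_le hR u v
  calc 2 * ‖B‖ * R * ‖radial R u - radial R v‖ ≤ 2 * ‖B‖ * R * (2 * ‖u - v‖) := by gcongr
    _ = _ := by ring

end Radial

/-! ### Damped evolution equations with a skew bilinear nonlinearity -/

/-- Data for the abstract equation `u' = -A u + f - B(u, u)` in a Hilbert space. The operator `A`
is described by its bounded spectral truncations `A N = A P N` and the groups
`G N t = exp(-t A) P N`; `T` is the semigroup generated by `-A`, extended to negative times. -/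
structure DampedSystem (X : Type*) [NormedAddCommGroup X] [InnerProductSpace ℝ X] where
  β : ℝ
  f : X
  T : ℝ → X →L[ℝ] X
  P : ℕ → X →L[ℝ] X
  A : ℕ → X →L[ℝ] X
  G : ℕ → ℝ → X →L[ℝ] X
  B : X →L[ℝ] X →L[ℝ] X
  β_pos : 0 < β
  norm_T_le : ∀ t, ‖T t‖ ≤ 1
  continuous_T : ∀ x, Continuous fun t => T t x
  T_zero : ∀ x, T 0 x = x
  P_T : ∀ N t, 0 ≤ t → ∀ x, P N (T t x) = G N t x
  G_zero : ∀ N x, G N 0 x = P N x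
  G_add : ∀ N s t x, G N (s + t) x = G N s (G N t x)
  hasDerivAt_G : ∀ N t, HasDerivAt (G N) (-(A N ∘L G N t)) t
  inner_P : ∀ N x y, inner ℝ (P N x) y = inner ℝ x (P N y)
  P_P : ∀ N x, P N (P N x) = P N x
  norm_P_le : ∀ N x, ‖P N x‖ ≤ ‖x‖
  tendsto_P : ∀ x, Tendsto (fun N => P N x) atTop (𝓝 x)
  A_P : ∀ N x, A N (P N x) = A N x
  inner_A : ∀ N x y, inner ℝ (A N x) y = inner ℝ x (A N y)
  le_inner_A : ∀ N x, β * ‖P N x‖ ^ 2 ≤ inner ℝ (A N x) x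
  inner_A_mono : ∀ x, Monotone fun N => inner ℝ (A N x) x - β * ‖P N x‖ ^ 2
  inner_B : ∀ x, inner ℝ (B x x) x = 0
  tendsto_B : ∀ (l : Filter X) (R : ℝ) (x₀ : X), (∀ᶠ x in l, ‖x‖ ≤ R) →
    (∀ φ, Tendsto (fun x => inner ℝ x φ) l (𝓝 (inner ℝ x₀ φ))) →
    ∀ φ, Tendsto (fun x => inner ℝ (B x x) φ) l (𝓝 (inner ℝ (B x₀ x₀) φ))

namespace DampedSystem

variable {X : Type*} [NormedAddCommGroup X] [InnerProductSpace ℝ X] (D : DampedSystem X)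

/-- The nonlinear forcing `f - B(u, u)`. -/
def force (u : X) : X := D.f - D.B u u

theorem continuous_force : Continuous D.force := by
  unfold force
  fun_prop

theorem inner_force (u : X) : inner ℝ (D.force u) u = inner ℝ D.f u := by
  rw [force, inner_sub_left, D.inner_B, sub_zero]

theorem norm_force_sub_le {R : ℝ} {u v : X} (hu : ‖u‖ ≤ R) (hv : ‖v‖ ≤ R) :
    ‖D.force u - D.force v‖ ≤ 2 * ‖D.B‖ * R * ‖u - v‖ := by
  rw [force, force, sub_sub_sub_cancel_left, norm_sub_rev]
  exact norm_bilinear_sub_le D.B hu hv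

theorem norm_force_le {R : ℝ} {u : X} (hu : ‖u‖ ≤ R) :
    ‖D.force u‖ ≤ ‖D.f‖ + ‖D.B‖ * R * R := by
  have hR : 0 ≤ R := (norm_nonneg _).trans hu
  refine (norm_sub_le _ _).trans (add_le_add le_rfl ((D.B.le_opNorm₂ u u).trans ?_))
  gcongr

theorem P_A (N : ℕ) (x : X) : D.P N (D.A N x) = D.A N x := by
  refine ext_inner_right ℝ fun y => ?_
  rw [D.inner_P, D.inner_A, D.A_P, ← D.inner_A]

theorem inner_P_self (N : ℕ) (x : X) : inner ℝ (D.P N x) x = ‖D.P N x‖ ^ 2 := by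
  rw [← D.P_P, D.inner_P, real_inner_self_eq_norm_sq, D.P_P]

/-- The equation `u' = -A u + h` with initial datum `x`, in spectrally truncated form. -/
def IsLinearSol (x : X) (u h : ℝ → X) : Prop :=
  ∀ N t, 0 ≤ t → D.P N (u t) = D.P N x + ∫ s in (0 : ℝ)..t, (D.P N (h s) - D.A N (u s))

/-! ### The truncated linear equation, a priori bounds and uniqueness. -/

section Complete

variable [CompleteSpace X]

/-- A mild solution need not be differentiable. Its truncation, however, is G N t applied to P N x +
∫ G N (-s) h(s) ds, because the truncated semigroup extends to a norm differentiable group; this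
expression can be differentiated. -/
theorem isLinearSol_of_mild {x : X} {u h : ℝ → X} (hh : Continuous h)
    (hmild : ∀ t, 0 ≤ t → u t = D.T t x + ∫ s in (0 : ℝ)..t, D.T (t - s) (h s)) :
    D.IsLinearSol x u h := by
  intro N t ht
  have hG : Continuous (D.G N) :=
    continuous_iff_continuousAt.2 fun t => (D.hasDerivAt_G N t).continuousAt
  have hg : Continuous fun s => D.G N (-s) (h s) := (hG.comp continuous_neg).clm_apply hh
  set y : ℝ → X := fun t => D.P N x + ∫ s in (0 : ℝ)..t, D.G N (-s) (h s) with hy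
  have hy' : ∀ t, HasDerivAt y (D.G N (-t) (h t)) t := fun t =>
    (hg.integral_hasStrictDerivAt 0 t).hasDerivAt.const_add _
  set z : ℝ → X := fun t => D.G N t (y t) with hz
  have hz' : ∀ t, HasDerivAt z (D.P N (h t) - D.A N (z t)) t := fun t => by
    refine ((D.hasDerivAt_G N t).clm_apply (hy' t)).congr_deriv ?_
    rw [← D.G_add, add_neg_cancel, D.G_zero]
    simp only [neg_apply, ContinuousLinearMap.comp_apply, hz]
    abel
  have hzc : Continuous z := continuous_iff_continuousAt.2 fun t => (hz' t).continuousAt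
  have hTj := continuous_clm_uncurry D.norm_T_le D.continuous_T
  have hzu : ∀ t, 0 ≤ t → z t = D.P N (u t) := fun t ht => by
    have hi : IntervalIntegrable (fun s => D.T (t - s) (h s)) volume 0 t :=
      (hTj.comp (Continuous.prodMk (by fun_prop) hh)).intervalIntegrable _ _
    rw [hmild t ht, map_add, D.P_T N t ht, hz, hy]
    beta_reduce
    rw [map_add, ← D.G_zero, ← D.G_add, add_zero,
      ← ContinuousLinearMap.intervalIntegral_comp_comm _ (hg.intervalIntegrable _ _),
      ← ContinuousLinearMap.intervalIntegral_comp_comm _ hi]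
    congr 1
    refine intervalIntegral.integral_congr fun s hs => ?_
    rw [uIcc_of_le ht] at hs
    rw [← D.G_add, D.P_T N _ (by linarith [hs.2]), sub_eq_add_neg]
  have hcont : Continuous fun s => D.P N (h s) - D.A N (z s) := by fun_prop
  have hftc := intervalIntegral.integral_eq_sub_of_hasDerivAt (fun s _ => hz' s)
    (hcont.intervalIntegrable 0 t)
  have h0 : z 0 = D.P N x := by
    simp only [hz, hy, intervalIntegral.integral_same, add_zero]
    rw [D.G_zero, D.P_P]
  rw [← hzu t ht, ← h0]
  rw [eq_sub_iff_add_eq, add_comm] at hftc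
  rw [← hftc]
  congr 1
  refine intervalIntegral.integral_congr fun s hs => ?_
  rw [uIcc_of_le ht] at hs
  rw [hzu s hs.1, D.A_P]

/-- Each truncation solves an ordinary differential equation, so the weighted energy can be
differentiated. The rate γ stays free: β serves for the a priori bound and 2β for compactness. -/
theorem IsLinearSol.energy_eq {D : DampedSystem X} {x : X} {u h : ℝ → X}
    (H : D.IsLinearSol x u h) (hu : Continuous u) (hh : Continuous h) (γ : ℝ) (N : ℕ) {t : ℝ}
    (ht : 0 ≤ t) :
    Real.exp (γ * t) * ‖D.P N (u t)‖ ^ 2 = ‖D.P N x‖ ^ 2 + ∫ s in (0 : ℝ)..t,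
      Real.exp (γ * s) * (γ * ‖D.P N (u s)‖ ^ 2 - 2 * inner ℝ (D.A N (u s)) (u s) +
        2 * inner ℝ (h s) (D.P N (u s))) := by
  have hg : Continuous fun s => D.P N (h s) - D.A N (u s) := by fun_prop
  set z : ℝ → X := fun t => D.P N x + ∫ s in (0 : ℝ)..t, (D.P N (h s) - D.A N (u s)) with hz
  have hz' : ∀ t, HasDerivAt z (D.P N (h t) - D.A N (u t)) t := fun t =>
    (hg.integral_hasStrictDerivAt 0 t).hasDerivAt.const_add _
  have hzc : Continuous z := continuous_iff_continuousAt.2 fun t => (hz' t).continuousAt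
  have hE : ∀ t, HasDerivAt (fun t => Real.exp (γ * t) * ‖z t‖ ^ 2)
      (Real.exp (γ * t) * (γ * ‖z t‖ ^ 2 + 2 * inner ℝ (z t) (D.P N (h t) - D.A N (u t)))) t :=
    fun t => by
      refine ((((hasDerivAt_id t).const_mul γ).exp).mul (hz' t).norm_sq).congr_deriv ?_
      simp only [id, mul_one]
      ring
  have hcont : Continuous fun t => Real.exp (γ * t) * (γ * ‖z t‖ ^ 2 +
      2 * inner ℝ (z t) (D.P N (h t) - D.A N (u t))) := by fun_prop
  have hftc := intervalIntegral.integral_eq_sub_of_hasDerivAt (fun s _ => hE s)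
    (hcont.intervalIntegrable 0 t)
  have hzt : ∀ s, 0 ≤ s → z s = D.P N (u s) := fun s hs => (H N s hs).symm
  have hz0 : z 0 = D.P N x := by simp [hz]
  rw [hzt t ht, hz0, mul_zero, Real.exp_zero, one_mul] at hftc
  rw [← sub_eq_iff_eq_add', ← hftc]
  refine intervalIntegral.integral_congr fun s hs => ?_
  rw [uIcc_of_le ht] at hs
  have e1 : inner ℝ (D.P N (u s)) (D.P N (h s)) = inner ℝ (h s) (D.P N (u s)) := by
    rw [D.inner_P, D.P_P, ← D.inner_P, real_inner_comm]
  have e2 : inner ℝ (D.P N (u s)) (D.A N (u s)) = inner ℝ (D.A N (u s)) (u s) := by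
    rw [D.inner_P, D.P_A, real_inner_comm]
  rw [hzt s hs.1, inner_sub_right, e1, e2]
  ring

/-- With weight e^{βt} half of the dissipation 2β‖P N u‖² absorbs the weight and half absorbs the
force by Young's inequality. The truncation is removed before `hf` is used, since the cancellation
it expresses is given for u and not for P N u. The form of `hf` also covers the radially truncated
force. -/
theorem IsLinearSol.norm_sq_le {D : DampedSystem X} {x : X} {u h : ℝ → X}
    (H : D.IsLinearSol x u h) (hu : Continuous u) (hh : Continuous h)
    (hf : ∀ s, 0 ≤ s → inner ℝ (h s) (u s) = inner ℝ D.f (u s)) {t : ℝ} (ht : 0 ≤ t) :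
    ‖u t‖ ^ 2 ≤ Real.exp (-D.β * t) * ‖x‖ ^ 2 + ‖D.f‖ ^ 2 / D.β ^ 2 := by
  have hβ := D.β_pos
  have h1 : ∀ N, Real.exp (D.β * t) * ‖D.P N (u t)‖ ^ 2 ≤ ‖x‖ ^ 2 + ∫ s in (0 : ℝ)..t,
      Real.exp (D.β * s) * (-D.β * ‖D.P N (u s)‖ ^ 2 + 2 * inner ℝ (h s) (D.P N (u s))) := by
    intro N
    rw [H.energy_eq hu hh D.β N ht]
    refine add_le_add (pow_le_pow_left₀ (norm_nonneg _) (D.norm_P_le N x) 2) ?_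
    refine intervalIntegral.integral_mono_on ht (Continuous.intervalIntegrable (by fun_prop) _ _)
      (Continuous.intervalIntegrable (by fun_prop) _ _) fun s _ => ?_
    refine mul_le_mul_of_nonneg_left ?_ (Real.exp_pos _).le
    linarith [D.le_inner_A N (u s)]
  have h2 : Tendsto (fun N => Real.exp (D.β * t) * ‖D.P N (u t)‖ ^ 2) atTop
      (𝓝 (Real.exp (D.β * t) * ‖u t‖ ^ 2)) := ((D.tendsto_P (u t)).norm.pow 2).const_mul _
  have h3 : Tendsto (fun N => ∫ s in (0 : ℝ)..t, Real.exp (D.β * s) *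
      (-D.β * ‖D.P N (u s)‖ ^ 2 + 2 * inner ℝ (h s) (D.P N (u s)))) atTop
      (𝓝 (∫ s in (0 : ℝ)..t, Real.exp (D.β * s) *
        (-D.β * ‖u s‖ ^ 2 + 2 * inner ℝ (h s) (u s)))) := by
    refine intervalIntegral.tendsto_integral_filter_of_dominated_convergence
      (fun s => Real.exp (D.β * s) * (D.β * ‖u s‖ ^ 2 + 2 * (‖h s‖ * ‖u s‖)))
      (Eventually.of_forall fun N => Continuous.aestronglyMeasurable (by fun_prop))
      (Eventually.of_forall fun N => Eventually.of_forall fun s _ => ?_)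
      (Continuous.intervalIntegrable (by fun_prop) _ _) (Eventually.of_forall fun s _ => ?_)
    · rw [norm_mul, Real.norm_eq_abs, Real.abs_exp]
      refine mul_le_mul_of_nonneg_left ?_ (Real.exp_pos _).le
      refine (norm_add_le _ _).trans (add_le_add ?_ ?_)
      · rw [norm_mul, norm_neg, Real.norm_of_nonneg hβ.le, norm_pow, norm_norm]
        have := D.norm_P_le N (u s)
        gcongr
      · rw [norm_mul, Real.norm_ofNat]
        have h4 : ‖inner ℝ (h s) (D.P N (u s))‖ ≤ ‖h s‖ * ‖u s‖ :=
          (norm_inner_le_norm _ _).trans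
            (mul_le_mul_of_nonneg_left (D.norm_P_le N _) (norm_nonneg _))
        linarith
    · exact ((((D.tendsto_P (u s)).norm.pow 2).const_mul _).add
        (((tendsto_const_nhds (x := h s)).inner (D.tendsto_P (u s))).const_mul _)).const_mul _
  have h4 := le_of_tendsto_of_tendsto' h2 (h3.const_add _) h1
  have h5 : ∫ s in (0 : ℝ)..t, Real.exp (D.β * s) *
        (-D.β * ‖u s‖ ^ 2 + 2 * inner ℝ (h s) (u s)) ≤
      ∫ s in (0 : ℝ)..t, Real.exp (D.β * s) * (‖D.f‖ ^ 2 / D.β) := by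
    refine intervalIntegral.integral_mono_on ht (Continuous.intervalIntegrable (by fun_prop) _ _)
      (Continuous.intervalIntegrable (by fun_prop) _ _) fun s hs => ?_
    refine mul_le_mul_of_nonneg_left ?_ (Real.exp_pos _).le
    rw [hf s hs.1]
    have h6 := real_inner_le_norm D.f (u s)
    have h7 : 2 * (‖D.f‖ * ‖u s‖) ≤ ‖D.f‖ ^ 2 / D.β + D.β * ‖u s‖ ^ 2 := by
      have : ‖D.f‖ ^ 2 / D.β + D.β * ‖u s‖ ^ 2 - 2 * (‖D.f‖ * ‖u s‖) =
          (‖D.f‖ - D.β * ‖u s‖) ^ 2 / D.β := by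
        field_simp
        ring
      have h8 : 0 ≤ (‖D.f‖ - D.β * ‖u s‖) ^ 2 / D.β := by positivity
      linarith
    linarith
  have h6 : ∫ s in (0 : ℝ)..t, Real.exp (D.β * s) * (‖D.f‖ ^ 2 / D.β) =
      (Real.exp (D.β * t) - 1) * (‖D.f‖ ^ 2 / D.β ^ 2) := by
    have h7 : ∀ s : ℝ, HasDerivAt (fun s => Real.exp (D.β * s) * (‖D.f‖ ^ 2 / D.β ^ 2))
        (Real.exp (D.β * s) * (‖D.f‖ ^ 2 / D.β)) s := fun s => by
      refine ((((hasDerivAt_id s).const_mul D.β).exp).mul_const _).congr_deriv ?_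
      simp only [id, mul_one]
      field_simp
    rw [intervalIntegral.integral_eq_sub_of_hasDerivAt (fun s _ => h7 s)
      (Continuous.intervalIntegrable (by fun_prop) _ _)]
    simp only [mul_zero, Real.exp_zero]
    ring
  rw [h6] at h5
  have h7 : 0 ≤ ‖D.f‖ ^ 2 / D.β ^ 2 := by positivity
  have h8 : Real.exp (D.β * t) * ‖u t‖ ^ 2 ≤ ‖x‖ ^ 2 +
      Real.exp (D.β * t) * (‖D.f‖ ^ 2 / D.β ^ 2) := by linarith
  have h9 : Real.exp (-D.β * t) * Real.exp (D.β * t) = 1 := by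
    rw [← Real.exp_add]; simp
  have h10 := mul_le_mul_of_nonneg_left h8 (Real.exp_pos (-D.β * t)).le
  rw [mul_add, ← mul_assoc, ← mul_assoc, h9, one_mul, one_mul] at h10
  exact h10

/-- A bounded measurable solution of `u' = -A u + f - B(u, u)`, `u(0) = x`, for almost every
time. -/
structure IsAESol (x : X) (u : ℝ → X) : Prop where
  aestronglyMeasurable : AEStronglyMeasurable u (volume.restrict (Ioi 0))
  bounded : ∃ R, ∀ᵐ t ∂volume.restrict (Ioi (0 : ℝ)), ‖u t‖ ≤ R
  eqn : ∀ N, ∀ᵐ t ∂volume.restrict (Ioi (0 : ℝ)),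
    D.P N (u t) = D.P N x + ∫ s in (0 : ℝ)..t, (D.P N (D.force (u s)) - D.A N (u s))

/-- Grönwall for a function that is only measurable: its primitive Y is continuous and satisfies the
same inequality, so the differential form of Grönwall applies to the primitive Z of Y. -/
theorem eq_zero_of_le_integral {y : ℝ → ℝ} {C L : ℝ} (hy : AEStronglyMeasurable y
    (volume.restrict (Ioi 0))) (hy0 : ∀ t, 0 ≤ y t)
    (hyC : ∀ᵐ t ∂volume.restrict (Ioi (0 : ℝ)), y t ≤ C)
    (h : ∀ᵐ t ∂volume.restrict (Ioi (0 : ℝ)), y t ≤ L * ∫ s in (0 : ℝ)..t, y s) :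
    ∀ᵐ t ∂volume.restrict (Ioi (0 : ℝ)), y t = 0 := by
  have hint : ∀ t, 0 ≤ t → IntervalIntegrable y volume 0 t := fun t ht => by
    rw [intervalIntegrable_iff_integrableOn_Ioc_of_le ht]
    have hle : volume.restrict (Ioc 0 t) ≤ volume.restrict (Ioi (0 : ℝ)) :=
      Measure.restrict_mono Ioc_subset_Ioi_self le_rfl
    have : IsFiniteMeasure (volume.restrict (Ioc 0 t)) := ⟨by simp⟩
    refine Integrable.of_bound (hy.mono_measure hle) C ?_
    filter_upwards [ae_mono hle hyC] with s hs
    rwa [Real.norm_of_nonneg (hy0 s)]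
  set Y : ℝ → ℝ := fun t => ∫ s in (0 : ℝ)..t, y s with hY
  have hYc : ∀ T, 0 ≤ T → ContinuousOn Y (Icc 0 T) := fun T hT => by
    have := intervalIntegral.continuousOn_primitive_interval' (hint T hT) left_mem_uIcc
    rwa [uIcc_of_le hT] at this
  have hY0 : ∀ t, 0 ≤ t → 0 ≤ Y t := fun t ht => intervalIntegral.integral_nonneg ht fun s _ => hy0 s
  have hYint : ∀ t, 0 ≤ t → Y t ≤ L * ∫ s in (0 : ℝ)..t, Y s := fun t ht => by
    rw [← intervalIntegral.integral_const_mul]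
    have hle : volume.restrict (Icc 0 t) ≤ volume.restrict (Ici (0 : ℝ)) :=
      Measure.restrict_mono Icc_subset_Ici_self le_rfl
    have hci : IntervalIntegrable Y volume 0 t :=
      ContinuousOn.intervalIntegrable (by rw [uIcc_of_le ht]; exact hYc t ht)
    refine intervalIntegral.integral_mono_ae_restrict ht (hint t ht) (hci.const_mul L) ?_
    refine ae_mono hle ?_
    rw [← restrict_Ioi_eq_restrict_Ici]
    exact h
  have hYzero : ∀ T, 0 ≤ T → Y T = 0 := fun T hT => by
    -- Clamping the argument to [0, T] makes the integrand continuous on ℝ, hence Z differentiable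
    -- everywhere.
    set Z : ℝ → ℝ := fun t => ∫ s in (0 : ℝ)..t, Y (min s T ⊔ 0) with hZ
    have hYcc : Continuous fun s => Y (min s T ⊔ 0) := by
      refine (hYc T hT).comp_continuous (by fun_prop) fun s => ⟨le_max_right _ _, ?_⟩
      exact max_le (min_le_right _ _) hT
    have hcl : ∀ s ∈ Icc 0 T, min s T ⊔ 0 = s := fun s hs => by
      rw [min_eq_left hs.2, max_eq_left hs.1]
    have hZY : ∀ t ∈ Icc 0 T, Z t = ∫ s in (0 : ℝ)..t, Y s := fun t ht => by
      refine intervalIntegral.integral_congr fun s hs => ?_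
      rw [uIcc_of_le ht.1] at hs
      rw [hcl s ⟨hs.1, hs.2.trans ht.2⟩]
    have hZ' : ∀ t, HasDerivAt Z (Y (min t T ⊔ 0)) t := fun t =>
      (hYcc.integral_hasStrictDerivAt 0 t).hasDerivAt
    have hZn : ∀ t ∈ Icc 0 T, 0 ≤ Z t := fun t ht => by
      rw [hZY t ht]
      exact intervalIntegral.integral_nonneg ht.1 fun s hs => hY0 s hs.1
    have hgr := norm_le_gronwallBound_of_norm_deriv_right_le (f := Z) (δ := 0) (K := L) (ε := 0)
      (a := 0) (b := T) (fun t _ => (hZ' t).continuousAt.continuousWithinAt)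
      (fun t _ => (hZ' t).hasDerivWithinAt) (by simp [hZ]) (fun t ht => by
        have ht' : t ∈ Icc 0 T := Ico_subset_Icc_self ht
        rw [hcl t ht', Real.norm_of_nonneg (hY0 t ht.1), Real.norm_of_nonneg (hZn t ht'), add_zero,
          hZY t ht']
        exact hYint t ht.1) T ⟨hT, le_rfl⟩
    rw [gronwallBound_ε0_δ0] at hgr
    have hz : Z T = 0 := norm_le_zero_iff.1 hgr
    rw [hZY T ⟨hT, le_rfl⟩] at hz
    have := hYint T hT
    rw [hz, mul_zero] at this
    exact le_antisymm this (hY0 T hT)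
  filter_upwards [h, ae_restrict_mem measurableSet_Ioi] with t ht htm
  have : Y t = 0 := hYzero t (le_of_lt htm)
  rw [show ∫ s in (0 : ℝ)..t, y s = 0 from this, mul_zero] at ht
  exact le_antisymm ht (hy0 t)

/-- The truncated difference is the primitive of a bounded measurable function, so
`norm_sq_integral_eq` gives its energy. The A-term has a good sign, the force is Lipschitz on the
common ball, and after N → ∞ Grönwall concludes. -/
theorem IsAESol.unique {D : DampedSystem X} {x : X} {u v : ℝ → X} (hu : D.IsAESol x u)
    (hv : D.IsAESol x v) : ∀ᵐ t ∂volume.restrict (Ioi (0 : ℝ)), u t = v t := by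
  obtain ⟨Ru, hRu⟩ := hu.bounded
  obtain ⟨Rv, hRv⟩ := hv.bounded
  set R := max (max Ru Rv) 0 with hR
  have hR0 : 0 ≤ R := le_max_right _ _
  replace hRu : ∀ᵐ t ∂volume.restrict (Ioi (0 : ℝ)), ‖u t‖ ≤ R := hRu.mono fun t h =>
    h.trans ((le_max_left _ _).trans (le_max_left _ _))
  replace hRv : ∀ᵐ t ∂volume.restrict (Ioi (0 : ℝ)), ‖v t‖ ≤ R := hRv.mono fun t h =>
    h.trans ((le_max_right _ _).trans (le_max_left _ _))
  set L := 2 * ‖D.B‖ * R with hL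
  have hL0 : 0 ≤ L := by positivity
  have hFm : ∀ {u : ℝ → X}, AEStronglyMeasurable u (volume.restrict (Ioi 0)) → ∀ N,
      AEStronglyMeasurable (fun s => D.P N (D.force (u s)) - D.A N (u s))
        (volume.restrict (Ioi 0)) := fun {u} h N => by
    have h1 : Continuous fun y => D.P N (D.force y) - D.A N y := by
      have := D.continuous_force
      fun_prop
    exact h1.comp_aestronglyMeasurable h
  have hFb : ∀ N, ∀ y : X, ‖y‖ ≤ R → ‖D.P N (D.force y) - D.A N y‖ ≤
      (‖D.f‖ + ‖D.B‖ * R * R) + ‖D.A N‖ * R := fun N y hy => by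
    refine (norm_sub_le _ _).trans (add_le_add ((D.norm_P_le N _).trans (D.norm_force_le hy)) ?_)
    exact (D.A N).le_of_opNorm_le_of_le le_rfl hy
  have key : ∀ᵐ t ∂volume.restrict (Ioi (0 : ℝ)),
      ‖u t - v t‖ ^ 2 ≤ (2 * L) * ∫ s in (0 : ℝ)..t, ‖u s - v s‖ ^ 2 := by
    filter_upwards [ae_all_iff.2 hu.eqn, ae_all_iff.2 hv.eqn, ae_restrict_mem measurableSet_Ioi]
      with t h1 h2 htm
    have ht : 0 ≤ t := le_of_lt htm
    have hle : volume.restrict (Ioc 0 t) ≤ volume.restrict (Ioi (0 : ℝ)) :=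
      Measure.restrict_mono Ioc_subset_Ioi_self le_rfl
    have hfin : IsFiniteMeasure (volume.restrict (Ioc 0 t)) := ⟨by simp⟩
    have hbu := ae_mono hle hRu
    have hbv := ae_mono hle hRv
    have hN : ∀ N, ‖D.P N (u t - v t)‖ ^ 2 ≤ (2 * L) * ∫ s in (0 : ℝ)..t, ‖u s - v s‖ ^ 2 := by
      intro N
      set g : ℝ → X := fun s => (D.P N (D.force (u s)) - D.A N (u s)) -
        (D.P N (D.force (v s)) - D.A N (v s)) with hg
      have hgm : AEStronglyMeasurable g (volume.restrict (Ioc 0 t)) :=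
        ((hFm hu.1 N).sub (hFm hv.1 N)).mono_measure hle
      have hgb : ∀ᵐ s ∂volume.restrict (Ioc 0 t), ‖g s‖ ≤
          2 * ((‖D.f‖ + ‖D.B‖ * R * R) + ‖D.A N‖ * R) := by
        filter_upwards [hbu, hbv] with s h3 h4
        refine (norm_sub_le _ _).trans ?_
        linarith [hFb N _ h3, hFb N _ h4]
      have hi : ∀ {u : ℝ → X}, AEStronglyMeasurable u (volume.restrict (Ioi 0)) →
          (∀ᵐ t ∂volume.restrict (Ioc 0 t), ‖u t‖ ≤ R) → ∀ r, r ∈ Ioc 0 t →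
          IntervalIntegrable (fun s => D.P N (D.force (u s)) - D.A N (u s)) volume 0 r :=
        fun {u} hm hb r hr => by
        have hle' : volume.restrict (Ioc 0 r) ≤ volume.restrict (Ioc 0 t) :=
          Measure.restrict_mono (Ioc_subset_Ioc_right hr.2) le_rfl
        rw [intervalIntegrable_iff_integrableOn_Ioc_of_le hr.1.le]
        have : IsFiniteMeasure (volume.restrict (Ioc 0 r)) := ⟨by simp⟩
        refine Integrable.of_bound ((hFm hm N).mono_measure (hle'.trans hle))
          ((‖D.f‖ + ‖D.B‖ * R * R) + ‖D.A N‖ * R) ?_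
        filter_upwards [ae_mono hle' hb] with s hs
        exact hFb N _ hs
      have hPw : ∀ r ∈ Ioc 0 t, D.P N (u r) = D.P N x + ∫ s in (0 : ℝ)..r,
          (D.P N (D.force (u s)) - D.A N (u s)) → D.P N (v r) = D.P N x + ∫ s in (0 : ℝ)..r,
          (D.P N (D.force (v s)) - D.A N (v s)) →
          D.P N (u r - v r) = ∫ s in (0 : ℝ)..r, g s := fun r hr h3 h4 => by
        rw [map_sub, h3, h4, hg, intervalIntegral.integral_sub (hi hu.1 hbu r hr) (hi hv.1 hbv r hr)]
        abel
      rw [hPw t ⟨htm, le_rfl⟩ (h1 N) (h2 N), norm_sq_integral_eq ht hgm hgb, mul_assoc]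
      refine mul_le_mul_of_nonneg_left ?_ zero_le_two
      rw [← intervalIntegral.integral_const_mul, intervalIntegral.integral_of_le ht,
        intervalIntegral.integral_of_le ht]
      have hmw : AEStronglyMeasurable (fun s => ‖u s - v s‖ ^ 2) (volume.restrict (Ioc 0 t)) :=
        (((hu.1.sub hv.1).mono_measure hle).norm.pow 2)
      have hgw : ∀ᵐ s ∂volume.restrict (Ioc 0 t),
          inner ℝ (g s) (∫ r in (0 : ℝ)..s, g r) = inner ℝ (g s) (D.P N (u s - v s)) := by
        filter_upwards [ae_mono hle (hu.eqn N), ae_mono hle (hv.eqn N),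
          ae_restrict_mem measurableSet_Ioc] with s h3 h4 hs
        rw [hPw s hs h3 h4]
      rw [integral_congr_ae hgw]
      refine integral_mono_ae ?_ ?_ ?_
      · refine Integrable.of_bound (C := 2 * ((‖D.f‖ + ‖D.B‖ * R * R) + ‖D.A N‖ * R) * (2 * R))
          (hgm.inner ((D.P N).continuous.comp_aestronglyMeasurable
            ((hu.1.sub hv.1).mono_measure hle))) ?_
        filter_upwards [hgb, hbu, hbv] with s h3 h4 h5
        have h6 : ‖D.P N (u s - v s)‖ ≤ 2 * R :=
          (D.norm_P_le N _).trans ((norm_sub_le _ _).trans (by linarith))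
        exact (norm_inner_le_norm _ _).trans
          (mul_le_mul h3 h6 (norm_nonneg _) ((norm_nonneg _).trans h3))
      · refine (Integrable.of_bound (C := (2 * R) ^ 2) hmw ?_).const_mul L
        filter_upwards [hbu, hbv] with s h4 h5
        rw [norm_pow, norm_norm]
        exact pow_le_pow_left₀ (norm_nonneg _) ((norm_sub_le _ _).trans (by linarith)) 2
      · filter_upwards [hbu, hbv] with s h4 h5
        have e : g s = D.P N (D.force (u s) - D.force (v s)) - D.A N (u s - v s) := by
          simp only [hg, map_sub]
          abel
        have h6 : 0 ≤ inner ℝ (D.A N (u s - v s)) (u s - v s) := by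
          have := D.le_inner_A N (u s - v s)
          have h7 := D.β_pos
          exact le_trans (by positivity) this
        -- Moving P N onto A N leaves ⟨A N w, w⟩ for w = u s - v s; it is nonnegative and can be
        -- dropped.
        rw [e, inner_sub_left, D.inner_P, D.P_P, ← D.inner_P N (D.A N _), D.P_A]
        have h7 : inner ℝ (D.force (u s) - D.force (v s)) (D.P N (u s - v s)) ≤
            (L * ‖u s - v s‖) * ‖u s - v s‖ :=
          (real_inner_le_norm _ _).trans (mul_le_mul (D.norm_force_sub_le h4 h5) (D.norm_P_le N _)
            (norm_nonneg _) (by positivity))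
        nlinarith
    refine le_of_tendsto' ((D.tendsto_P (u t - v t)).norm.pow 2) hN
  have hz := eq_zero_of_le_integral (y := fun t => ‖u t - v t‖ ^ 2) (C := (2 * R) ^ 2)
    ((hu.1.sub hv.1).norm.pow 2) (fun t => by positivity) (by
      filter_upwards [hRu, hRv] with t h1 h2
      refine pow_le_pow_left₀ (norm_nonneg _) ((norm_sub_le _ _).trans (by linarith)) 2)
    key
  filter_upwards [hz] with t ht
  rw [← sub_eq_zero, ← norm_eq_zero]
  exact pow_eq_zero_iff two_ne_zero |>.1 ht

end Complete

end DampedSystem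

namespace DampedSystem

variable {X : Type*} [NormedAddCommGroup X] [InnerProductSpace ℝ X] (D : DampedSystem X)
  [CompleteSpace X]

/-! ### The solution semigroup -/

/-- Mild solutions of `u' = -A u + f - B(u, u)`, `u(0) = x`. -/
structure IsMild (x : X) (u : ℝ → X) : Prop where
  continuous : Continuous u
  eqn : ∀ t, 0 ≤ t → u t = D.T t x + ∫ s in (0 : ℝ)..t, D.T (t - s) (D.force (u s))

variable {D}

theorem IsMild.isLinearSol {x : X} {u : ℝ → X} (H : D.IsMild x u) :
    D.IsLinearSol x u fun s => D.force (u s) :=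
  D.isLinearSol_of_mild (D.continuous_force.comp H.continuous) H.eqn

theorem IsMild.norm_sq_le {x : X} {u : ℝ → X} (H : D.IsMild x u) {t : ℝ} (ht : 0 ≤ t) :
    ‖u t‖ ^ 2 ≤ Real.exp (-D.β * t) * ‖x‖ ^ 2 + ‖D.f‖ ^ 2 / D.β ^ 2 :=
  H.isLinearSol.norm_sq_le H.continuous (D.continuous_force.comp H.continuous)
    (fun _ _ => D.inner_force _) ht

theorem norm_le_of_norm_sq_le {x y : X} {r t : ℝ} (hx : ‖x‖ ≤ r) (ht : 0 ≤ t)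
    (h : ‖y‖ ^ 2 ≤ Real.exp (-D.β * t) * ‖x‖ ^ 2 + ‖D.f‖ ^ 2 / D.β ^ 2) :
    ‖y‖ ≤ r + ‖D.f‖ / D.β := by
  have hβ := D.β_pos
  have hr : 0 ≤ r := (norm_nonneg _).trans hx
  refine (pow_le_pow_iff_left₀ (norm_nonneg _) (by positivity) two_ne_zero).1 ?_
  have h1 : Real.exp (-D.β * t) ≤ 1 := by
    rw [Real.exp_le_one_iff]
    have : 0 ≤ D.β * t := by positivity
    linarith
  have h2 : Real.exp (-D.β * t) * ‖x‖ ^ 2 ≤ 1 * r ^ 2 := by gcongr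
  have h3 : 0 ≤ r * (‖D.f‖ / D.β) := by positivity
  rw [← div_pow] at h
  nlinarith

theorem IsMild.norm_le {x : X} {u : ℝ → X} (H : D.IsMild x u) {r t : ℝ} (hx : ‖x‖ ≤ r)
    (ht : 0 ≤ t) : ‖u t‖ ≤ r + ‖D.f‖ / D.β :=
  norm_le_of_norm_sq_le hx ht (H.norm_sq_le ht)

theorem isAESol_of_isLinearSol {x : X} {u : ℝ → X} {R : ℝ} (hu : ContinuousOn u (Ici 0))
    (hR : ∀ t, 0 ≤ t → ‖u t‖ ≤ R) (H : D.IsLinearSol x u fun s => D.force (u s)) :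
    D.IsAESol x u := by
  refine ⟨(hu.mono Ioi_subset_Ici_self).aestronglyMeasurable measurableSet_Ioi, ⟨R, ?_⟩,
    fun N => ?_⟩
  · filter_upwards [ae_restrict_mem measurableSet_Ioi] with t ht
    exact hR t (le_of_lt ht)
  · filter_upwards [ae_restrict_mem measurableSet_Ioi] with t ht
    exact H N t (le_of_lt ht)

theorem IsMild.isAESol {x : X} {u : ℝ → X} (H : D.IsMild x u) : D.IsAESol x u :=
  isAESol_of_isLinearSol H.continuous.continuousOn (fun _ ht => H.norm_le le_rfl ht) H.isLinearSol

theorem eq_of_ae_eq {Z : Type*} [TopologicalSpace Z] [T2Space Z] {u v : ℝ → Z}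
    (hu : ContinuousOn u (Ici 0)) (hv : ContinuousOn v (Ici 0))
    (h : ∀ᵐ t ∂volume.restrict (Ioi (0 : ℝ)), u t = v t) {t : ℝ} (ht : 0 ≤ t) : u t = v t := by
  rw [restrict_Ioi_eq_restrict_Ici] at h
  exact Measure.eqOn_of_ae_eq h hu hv (by rw [interior_Ici, closure_Ioi]) ht

theorem IsMild.unique {x : X} {u v : ℝ → X} (hu : D.IsMild x u) (hv : D.IsMild x v) {t : ℝ}
    (ht : 0 ≤ t) : u t = v t :=
  eq_of_ae_eq hu.continuous.continuousOn hv.continuous.continuousOn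
    (hu.isAESol.unique hv.isAESol) ht

variable (D)

/-- The radially projected force is globally Lipschitz. Its nonlinear part is still orthogonal to
the solution, because the projection is a positive multiple of it. So the a priori bound holds for
the modified equation, keeps the solution in the ball, and the projection is never felt. One map Φ
for all small data gives Lipschitz dependence as well. -/
theorem exists_isMild_of_norm_le (r : ℝ) : ∃ (Φ : X → ℝ → X) (lm : ℝ),
    (∀ x, ‖x‖ ≤ r → D.IsMild x (Φ x)) ∧
    ∀ x y t, 0 ≤ t → ‖Φ x t - Φ y t‖ ≤ 2 * Real.exp (lm * t) * ‖x - y‖ := by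
  have hβ := D.β_pos
  -- Above the a priori bound r + ‖f‖/β; the absolute value and the 1 make R positive for every r.
  set R := |r| + ‖D.f‖ / D.β + 1 with hR
  have hR0 : 0 < R := by positivity
  obtain ⟨Φ, lm, h1, h2, h3⟩ := exists_mild D.norm_T_le D.continuous_T
    (lipschitzWith_truncation hR0 D.f D.B)
  refine ⟨Φ, lm, fun x hx => ⟨h1 x, fun t ht => ?_⟩, h3⟩
  have hF : Continuous fun s => D.f - D.B (radial R (Φ x s)) (radial R (Φ x s)) :=
    (lipschitzWith_truncation hR0 D.f D.B).continuous.comp (h1 x)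
  have hlin := D.isLinearSol_of_mild hF (h2 x)
  have hbd : ∀ s, 0 ≤ s → ‖Φ x s‖ ≤ R := fun s hs => by
    have := norm_le_of_norm_sq_le hx hs (hlin.norm_sq_le (h1 x) hF (fun s _ => ?_) hs)
    · have h4 := le_abs_self r
      linarith
    · rw [inner_sub_left]
      have : inner ℝ (D.B (radial R (Φ x s)) (radial R (Φ x s))) (Φ x s) = 0 := by
        set c := R / max R ‖Φ x s‖ with hc
        have hc0 : c ≠ 0 := by
          have : 0 < max R ‖Φ x s‖ := hR0.trans_le (le_max_left _ _)
          positivity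
        have h5 := D.inner_B (radial R (Φ x s))
        nth_rewrite 3 [radial] at h5
        rw [inner_smul_right] at h5
        exact (mul_eq_zero.1 h5).resolve_left hc0
      rw [this, sub_zero]
  rw [h2 x t ht]
  congr 1
  refine intervalIntegral.integral_congr fun s hs => ?_
  rw [uIcc_of_le ht] at hs
  simp only [force, radial_of_norm_le hR0 (hbd s hs.1)]

theorem exists_isMild (x : X) : ∃ u, D.IsMild x u := by
  obtain ⟨Φ, lm, h, -⟩ := D.exists_isMild_of_norm_le ‖x‖
  exact ⟨Φ x, h x le_rfl⟩

/-- The solution semigroup. -/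
def sol (t : ℝ) (x : X) : X := (D.exists_isMild x).choose t

theorem isMild_sol (x : X) : D.IsMild x fun t => D.sol t x := (D.exists_isMild x).choose_spec

theorem continuous_sol (x : X) : Continuous fun t => D.sol t x := (D.isMild_sol x).continuous

theorem norm_sol_sq_le (x : X) {t : ℝ} (ht : 0 ≤ t) :
    ‖D.sol t x‖ ^ 2 ≤ Real.exp (-D.β * t) * ‖x‖ ^ 2 + ‖D.f‖ ^ 2 / D.β ^ 2 :=
  (D.isMild_sol x).norm_sq_le ht

theorem norm_sol_le {x : X} {r t : ℝ} (hx : ‖x‖ ≤ r) (ht : 0 ≤ t) :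
    ‖D.sol t x‖ ≤ r + ‖D.f‖ / D.β :=
  (D.isMild_sol x).norm_le hx ht

theorem sol_zero (x : X) : D.sol 0 x = x := by
  have h := (D.isMild_sol x).eqn 0 le_rfl
  simpa [D.T_zero] using h

variable {D} in
theorem IsAESol.eq_sol {x : X} {u : ℝ → X} (hu : D.IsAESol x u) :
    ∀ᵐ t ∂volume.restrict (Ioi (0 : ℝ)), u t = D.sol t x :=
  hu.unique (D.isMild_sol x).isAESol

/-- The shifted trajectory solves the truncated equations with datum `D.sol t x`, and uniqueness
identifies it. -/
theorem sol_add {s t : ℝ} (hs : 0 ≤ s) (ht : 0 ≤ t) (x : X) :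
    D.sol (s + t) x = D.sol s (D.sol t x) := by
  have hc : Continuous fun s => D.sol (s + t) x :=
    (D.continuous_sol x).comp (by fun_prop : Continuous fun s : ℝ => s + t)
  have hlin : D.IsLinearSol (D.sol t x) (fun s => D.sol (s + t) x)
      fun s => D.force (D.sol (s + t) x) := by
    intro N s hs
    have h1 := (D.isMild_sol x).isLinearSol N (s + t) (by positivity)
    have h2 := (D.isMild_sol x).isLinearSol N t ht
    have hg : Continuous fun s => D.P N (D.force (D.sol s x)) - D.A N (D.sol s x) := by
      have := D.continuous_sol x
      have := D.continuous_force
      fun_prop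
    have h3 := intervalIntegral.integral_comp_add_right (a := 0) (b := s)
      (fun s => D.P N (D.force (D.sol s x)) - D.A N (D.sol s x)) t
    rw [h3, h1, h2, zero_add, add_assoc, intervalIntegral.integral_add_adjacent_intervals
      (hg.intervalIntegrable _ _) (hg.intervalIntegrable _ _)]
  have hae : D.IsAESol (D.sol t x) fun s => D.sol (s + t) x :=
    isAESol_of_isLinearSol hc.continuousOn
      (fun s hs => D.norm_sol_le le_rfl (add_nonneg hs ht)) hlin
  exact eq_of_ae_eq hc.continuousOn (D.continuous_sol _).continuousOn hae.eq_sol hs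

theorem continuous_sol_right {t : ℝ} (ht : 0 ≤ t) : Continuous (D.sol t) := by
  rw [continuous_iff_continuousAt]
  intro x
  obtain ⟨Φ, lm, h1, h2⟩ := D.exists_isMild_of_norm_le (‖x‖ + 1)
  have heq : ∀ y, ‖y‖ ≤ ‖x‖ + 1 → D.sol t y = Φ y t := fun y hy =>
    (D.isMild_sol y).unique (h1 y hy) ht
  have hev : ∀ᶠ y in 𝓝 x, ‖D.sol t y - D.sol t x‖ ≤ 2 * Real.exp (lm * t) * ‖y - x‖ := by
    filter_upwards [Metric.ball_mem_nhds x one_pos] with y hy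
    rw [Metric.mem_ball, dist_eq_norm] at hy
    have hy' : ‖y‖ ≤ ‖x‖ + 1 := by
      have := norm_le_norm_add_norm_sub' y x
      linarith
    rw [heq y hy', heq x (by linarith)]
    exact h2 y x t ht
  rw [ContinuousAt, tendsto_iff_norm_sub_tendsto_zero]
  refine squeeze_zero' (Eventually.of_forall fun _ => norm_nonneg _) hev ?_
  have : Continuous fun y => 2 * Real.exp (lm * t) * ‖y - x‖ := by fun_prop
  simpa using this.tendsto x

/-- A ball absorbing all bounded sets. -/
theorem exists_norm_sol_le {s : Set X} (hs : Bornology.IsBounded s) :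
    ∃ T : ℝ, 0 < T ∧ ∀ x ∈ s, ‖D.sol T x‖ ≤ ‖D.f‖ / D.β + 1 := by
  have hβ := D.β_pos
  obtain ⟨r, hr⟩ := hs.exists_norm_le
  have h1 : Tendsto (fun t => Real.exp (-D.β * t) * r ^ 2) atTop (𝓝 (0 * r ^ 2)) := by
    refine Tendsto.mul_const _ (Real.tendsto_exp_atBot.comp ?_)
    exact tendsto_id.const_mul_atTop_of_neg (by linarith)
  rw [zero_mul] at h1
  obtain ⟨T, h2, h3⟩ := ((h1.eventually (ge_mem_nhds one_pos)).and (eventually_gt_atTop 0)).exists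
  refine ⟨T, h3, fun x hx => ?_⟩
  refine (pow_le_pow_iff_left₀ (norm_nonneg _) (by positivity) two_ne_zero).1 ?_
  have h4 := D.norm_sol_sq_le x h3.le
  have h5 : ‖x‖ ^ 2 ≤ r ^ 2 := pow_le_pow_left₀ (norm_nonneg _) (hr x hx) 2
  have h6 := mul_le_mul_of_nonneg_left h5 (Real.exp_pos (-D.β * T)).le
  rw [← div_pow] at h4
  have h7 : 0 ≤ ‖D.f‖ / D.β := by positivity
  nlinarith

end DampedSystem

/-! ### Weak continuity of the semigroup -/

/-- Pointwise convergence of an equicontinuous family on a compact set is uniform. -/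
theorem eventually_forall_of_equicontinuous {ι K : Type*} [TopologicalSpace K] {s : Set K}
    (hs : IsCompact s) {l : Filter ι} [l.NeBot] {g : ι → K → ℝ} {g₀ : K → ℝ}
    (heq : ∀ x ∈ s, ∀ ε > 0, ∀ᶠ y in 𝓝[s] x, ∀ i, |g i y - g i x| ≤ ε)
    (hlim : ∀ x ∈ s, Tendsto (fun i => g i x) l (𝓝 (g₀ x))) :
    ContinuousOn g₀ s ∧ ∀ ε > 0, ∀ᶠ i in l, ∀ x ∈ s, |g i x - g₀ x| ≤ ε := by
  have h0 : ∀ x ∈ s, ∀ ε > 0, ∀ᶠ y in 𝓝[s] x, |g₀ y - g₀ x| ≤ ε := fun x hx ε hε => by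
    filter_upwards [heq x hx ε hε, self_mem_nhdsWithin] with y hy hys
    exact le_of_tendsto ((hlim y hys).sub (hlim x hx)).abs (Eventually.of_forall hy)
  refine ⟨fun x hx => ?_, fun ε hε => ?_⟩
  · rw [ContinuousWithinAt, Metric.tendsto_nhds]
    intro ε hε
    filter_upwards [h0 x hx (ε / 2) (by positivity)] with y hy
    rw [Real.dist_eq]
    linarith
  · refine hs.induction_on (p := fun t => ∀ᶠ i in l, ∀ x ∈ t, |g i x - g₀ x| ≤ ε)
      (by simp) (fun s t hst ht => ht.mono fun i hi x hx => hi x (hst hx))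
      (fun s t hs ht => ?_) (fun x hx => ?_)
    · filter_upwards [hs, ht] with i h1 h2 x hx
      exact hx.elim (h1 x) (h2 x)
    · refine ⟨_, (heq x hx (ε / 3) (by positivity)).and (h0 x hx (ε / 3) (by positivity)), ?_⟩
      filter_upwards [Metric.tendsto_nhds.1 (hlim x hx) (ε / 3) (by positivity)] with i hi y hy
      rw [Real.dist_eq] at hi
      have h1 := hy.1 i
      have h2 := hy.2
      rw [abs_le] at h1 h2 ⊢
      rw [abs_lt] at hi
      constructor <;> linarith

/-- Functions of time and state which are weakly continuous on bounded sets. -/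
def WeaklyContinuous {X : Type*} [NormedAddCommGroup X] [InnerProductSpace ℝ X]
    (b : ℝ → X → ℝ) : Prop :=
  ∀ (l : Filter (ℝ × X)) (R s₀ : ℝ) (y₀ : X), (∀ᶠ p in l, ‖p.2‖ ≤ R) →
    Tendsto Prod.fst l (𝓝 s₀) → (∀ φ, Tendsto (fun p => inner ℝ p.2 φ) l (𝓝 (inner ℝ y₀ φ))) →
    Tendsto (fun p => b p.1 p.2) l (𝓝 (b s₀ y₀))

theorem WeaklyContinuous.tendsto_comp {X : Type*} [NormedAddCommGroup X] [InnerProductSpace ℝ X]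
    {b : ℝ → X → ℝ} (hb : WeaklyContinuous b) {ι : Type*} {l : Filter ι} {σ : ι → ℝ} {y : ι → X}
    {R s₀ : ℝ} {y₀ : X} (hR : ∀ᶠ i in l, ‖y i‖ ≤ R) (hσ : Tendsto σ l (𝓝 s₀))
    (hy : ∀ φ, Tendsto (fun i => inner ℝ (y i) φ) l (𝓝 (inner ℝ y₀ φ))) :
    Tendsto (fun i => b (σ i) (y i)) l (𝓝 (b s₀ y₀)) :=
  hb (l.map fun i => (σ i, y i)) R s₀ y₀ hR hσ hy

theorem integral_inner_left {X : Type*} [NormedAddCommGroup X] [InnerProductSpace ℝ X]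
    [CompleteSpace X] {g : ℝ → X} {a b : ℝ} (hg : IntervalIntegrable g volume a b) (φ : X) :
    inner ℝ (∫ s in a..b, g s) φ = ∫ s in a..b, inner ℝ (g s) φ := by
  have h := ContinuousLinearMap.intervalIntegral_comp_comm (innerSL ℝ φ) hg
  simp only [innerSL_apply_apply] at h
  rw [real_inner_comm, ← h]
  exact intervalIntegral.integral_congr fun s _ => real_inner_comm _ _

namespace DampedSystem

variable {X : Type*} [NormedAddCommGroup X] [InnerProductSpace ℝ X] (D : DampedSystem X)

theorem weaklyContinuous_inner {ψ : ℝ → X} (hψ : Continuous ψ) :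
    WeaklyContinuous fun s y => inner ℝ y (ψ s) := by
  intro l R s₀ y₀ hR hs hy
  have h1 : Tendsto (fun p : ℝ × X => ψ p.1) l (𝓝 (ψ s₀)) := (hψ.tendsto s₀).comp hs
  have h2 : Tendsto (fun p : ℝ × X => inner ℝ p.2 (ψ p.1 - ψ s₀)) l (𝓝 0) := by
    have h3 : Tendsto (fun p : ℝ × X => |R| * ‖ψ p.1 - ψ s₀‖) l (𝓝 0) := by
      simpa using ((h1.sub_const (ψ s₀)).norm.const_mul |R|)
    refine squeeze_zero_norm' ?_ h3
    filter_upwards [hR] with p hp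
    refine (norm_inner_le_norm _ _).trans ?_
    gcongr
    exact hp.trans (le_abs_self R)
  have h4 := h2.add (hy (ψ s₀))
  rw [zero_add] at h4
  refine h4.congr fun p => ?_
  rw [inner_sub_right]
  ring

/-- The symmetric bounded operators P N and A N move onto φ, so only the weak continuity of B
remains to be used. -/
theorem weaklyContinuous_rhs (N : ℕ) (φ : X) :
    WeaklyContinuous fun _ y => inner ℝ (D.P N (D.force y) - D.A N y) φ := by
  intro l R s₀ y₀ hR hs hy
  have h1 := D.tendsto_B (l.map Prod.snd) R y₀ hR (fun φ => hy φ) (D.P N φ)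
  have h2 : Tendsto (fun p : ℝ × X => inner ℝ (D.B p.2 p.2) (D.P N φ)) l
      (𝓝 (inner ℝ (D.B y₀ y₀) (D.P N φ))) := h1
  have h3 := (h2.const_sub (inner ℝ D.f (D.P N φ))).sub (hy (D.A N φ))
  have e : ∀ y, inner ℝ (D.P N (D.force y) - D.A N y) φ =
      inner ℝ D.f (D.P N φ) - inner ℝ (D.B y y) (D.P N φ) - inner ℝ y (D.A N φ) := fun y => by
    rw [inner_sub_left, D.inner_P, D.inner_A, force, inner_sub_left]
  simpa only [e] using h3

theorem eq_of_inner_P_eq {a b : X} (h : ∀ N φ, inner ℝ a (D.P N φ) = inner ℝ b (D.P N φ)) :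
    a = b := by
  refine ext_inner_right ℝ fun φ => ?_
  have h1 := (tendsto_const_nhds (x := a)).inner (𝕜 := ℝ) (D.tendsto_P φ)
  have h2 := (tendsto_const_nhds (x := b)).inner (𝕜 := ℝ) (D.tendsto_P φ)
  exact tendsto_nhds_unique h1 (h2.congr fun N => (h N φ).symm)

variable [CompleteSpace X]

section Family

variable {ι : Type*} {u : ι → ℝ → X} {R : ℝ}

/-- Equicontinuity in time, uniform over the family. Along an ultrafilter the states at the moving
time and at s₀ have weak limits, which coincide because each P N of the difference tends to zero; a
weakly continuous b cannot separate them. -/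
theorem tendsto_sub_of_lipschitz (hR : ∀ i s, 0 ≤ s → ‖u i s‖ ≤ R)
    (hL : ∀ N, ∃ C, ∀ i s s', 0 ≤ s → 0 ≤ s' → ‖D.P N (u i s - u i s')‖ ≤ C * |s - s'|)
    {b : ℝ → X → ℝ} (hb : WeaklyContinuous b) {s₀ : ℝ} (hs₀ : 0 ≤ s₀) :
    Tendsto (fun p : ℝ × ι => b p.1 (u p.2 p.1) - b s₀ (u p.2 s₀)) (𝓝[Ici 0] s₀ ×ˢ ⊤) (𝓝 0) := by
  rw [tendsto_iff_ultrafilter]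
  intro 𝒱 h𝒱
  have hfst : Tendsto Prod.fst (𝒱 : Filter (ℝ × ι)) (𝓝[Ici 0] s₀) := tendsto_fst.mono_left h𝒱
  have hfst' : Tendsto Prod.fst (𝒱 : Filter (ℝ × ι)) (𝓝 s₀) :=
    hfst.mono_right nhdsWithin_le_nhds
  have hpos : ∀ᶠ p in (𝒱 : Filter (ℝ × ι)), (0 : ℝ) ≤ p.1 := hfst.eventually self_mem_nhdsWithin
  have hb1 : ∀ᶠ p in (𝒱 : Filter (ℝ × ι)), ‖u p.2 p.1‖ ≤ R := hpos.mono fun p hp => hR _ _ hp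
  have hb2 : ∀ᶠ p in (𝒱 : Filter (ℝ × ι)), ‖u p.2 s₀‖ ≤ R :=
    Eventually.of_forall fun p => hR _ _ hs₀
  obtain ⟨a, -, ha⟩ := exists_weak_limit 𝒱 hb1
  obtain ⟨c, -, hc⟩ := exists_weak_limit 𝒱 hb2
  have hac : a = c := by
    refine D.eq_of_inner_P_eq fun N φ => ?_
    obtain ⟨C, hC⟩ := hL N
    have h1 := (ha (D.P N φ)).sub (hc (D.P N φ))
    have h2 : Tendsto (fun p : ℝ × ι => inner ℝ (u p.2 p.1) (D.P N φ) -
        inner ℝ (u p.2 s₀) (D.P N φ)) 𝒱 (𝓝 0) := by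
      have h3 : Tendsto (fun p : ℝ × ι => C * |p.1 - s₀| * ‖φ‖) 𝒱 (𝓝 0) := by
        simpa using ((hfst'.sub_const s₀).abs.const_mul C).mul_const ‖φ‖
      refine squeeze_zero_norm' ?_ h3
      filter_upwards [hpos] with p hp
      rw [← inner_sub_left, ← D.inner_P]
      exact (norm_inner_le_norm _ _).trans
        (mul_le_mul_of_nonneg_right (hC _ _ _ hp hs₀) (norm_nonneg _))
    exact sub_eq_zero.1 (tendsto_nhds_unique h1 h2)
  have h1 : Tendsto (fun p : ℝ × ι => b p.1 (u p.2 p.1)) 𝒱 (𝓝 (b s₀ a)) :=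
    hb.tendsto_comp hb1 hfst' ha
  have h2 : Tendsto (fun p : ℝ × ι => b s₀ (u p.2 s₀)) 𝒱 (𝓝 (b s₀ c)) :=
    hb.tendsto_comp hb2 tendsto_const_nhds hc
  have h3 := h1.sub h2
  rwa [hac, sub_self] at h3

/-- Equicontinuity upgrades pointwise convergence to uniform convergence on [0, t]. Dominated
convergence is avoided, as the filter need not be countably generated. -/
theorem tendsto_integral_of_weak {𝒰 : Filter ι} [𝒰.NeBot] (hR : ∀ i s, 0 ≤ s → ‖u i s‖ ≤ R)
    (hL : ∀ N, ∃ C, ∀ i s s', 0 ≤ s → 0 ≤ s' → ‖D.P N (u i s - u i s')‖ ≤ C * |s - s'|)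
    (hc : ∀ i, ContinuousOn (u i) (Ici 0)) {w : ℝ → X}
    (hw : ∀ s, 0 ≤ s → ∀ φ, Tendsto (fun i => inner ℝ (u i s) φ) 𝒰 (𝓝 (inner ℝ (w s) φ)))
    {b : ℝ → X → ℝ} (hb : WeaklyContinuous b) {t : ℝ} (ht : 0 ≤ t) :
    Tendsto (fun i => ∫ s in (0 : ℝ)..t, b s (u i s)) 𝒰 (𝓝 (∫ s in (0 : ℝ)..t, b s (w s))) := by
  have hmono : ∀ x, 𝓝[Icc 0 t] x ≤ 𝓝[Ici (0 : ℝ)] x := fun x => nhdsWithin_mono x Icc_subset_Ici_self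
  obtain ⟨h1, h2⟩ := eventually_forall_of_equicontinuous (isCompact_Icc (a := 0) (b := t))
    (l := 𝒰) (g := fun i s => b s (u i s)) (g₀ := fun s => b s (w s)) (fun x hx ε hε => by
      have h3 := Metric.tendsto_nhds.1 (D.tendsto_sub_of_lipschitz hR hL hb hx.1) ε hε
      rw [← principal_univ, eventually_prod_principal_iff] at h3
      filter_upwards [hmono x h3] with y hy i
      have := hy i (mem_univ i)
      rw [dist_zero_right, Real.norm_eq_abs] at this
      exact this.le)
    (fun x hx => hb.tendsto_comp (Eventually.of_forall fun i => hR i x hx.1) tendsto_const_nhds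
      (hw x hx.1))
  have hi : ∀ i, IntervalIntegrable (fun s => b s (u i s)) volume 0 t := fun i => by
    refine ContinuousOn.intervalIntegrable fun x hx => ?_
    rw [uIcc_of_le ht] at hx ⊢
    have hux : Tendsto (u i) (𝓝[Icc 0 t] x) (𝓝 (u i x)) := ((hc i) x hx.1).mono_left (hmono x)
    refine hb.tendsto_comp (R := R) ?_ (tendsto_id.mono_left nhdsWithin_le_nhds)
      fun φ => hux.inner tendsto_const_nhds
    filter_upwards [self_mem_nhdsWithin] with s hs
    exact hR i s hs.1
  have hi0 : IntervalIntegrable (fun s => b s (w s)) volume 0 t :=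
    ContinuousOn.intervalIntegrable (by rwa [uIcc_of_le ht])
  rw [Metric.tendsto_nhds]
  intro ε hε
  filter_upwards [h2 (ε / (2 * (t + 1))) (by positivity)] with i h3
  rw [dist_eq_norm, ← intervalIntegral.integral_sub (hi i) hi0]
  have h4 : ‖∫ s in (0 : ℝ)..t, (b s (u i s) - b s (w s))‖ ≤ ε / (2 * (t + 1)) * |t - 0| := by
    refine intervalIntegral.norm_integral_le_of_norm_le_const fun s hs => ?_
    rw [uIoc_of_le ht] at hs
    exact h3 s (Ioc_subset_Icc_self hs)
  refine h4.trans_lt ?_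
  rw [sub_zero, abs_of_nonneg ht]
  calc ε / (2 * (t + 1)) * t = ε * (t / (2 * (t + 1))) := by ring
    _ < ε := by
      refine mul_lt_of_lt_one_right hε ?_
      rw [div_lt_one (by positivity)]
      linarith

end Family

/-- The truncated equation has a bounded right-hand side, with a bound depending only on N and the
ball of initial data. -/
theorem norm_P_sol_sub_le (N : ℕ) (r : ℝ) : ∃ C, ∀ x : X, ‖x‖ ≤ r → ∀ s s', 0 ≤ s → 0 ≤ s' →
    ‖D.P N (D.sol s x - D.sol s' x)‖ ≤ C * |s - s'| := by
  set R := r + ‖D.f‖ / D.β with hR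
  refine ⟨(‖D.f‖ + ‖D.B‖ * R * R) + ‖D.A N‖ * R, fun x hx s s' hs hs' => ?_⟩
  have hc : Continuous fun s => D.P N (D.force (D.sol s x)) - D.A N (D.sol s x) := by
    have := D.continuous_sol x
    have := D.continuous_force
    fun_prop
  rw [map_sub, (D.isMild_sol x).isLinearSol N s hs, (D.isMild_sol x).isLinearSol N s' hs',
    add_sub_add_left_eq_sub, intervalIntegral.integral_interval_sub_left
      (hc.intervalIntegrable _ _) (hc.intervalIntegrable _ _)]
  refine intervalIntegral.norm_integral_le_of_norm_le_const fun r hr => ?_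
  have hr0 : 0 ≤ r := by
    rw [mem_uIoc] at hr
    rcases hr with h | h <;> linarith [h.1]
  have hb := D.norm_sol_le hx hr0
  refine (norm_sub_le _ _).trans (add_le_add ((D.norm_P_le N _).trans (D.norm_force_le hb)) ?_)
  exact (D.A N).le_of_opNorm_le_of_le le_rfl hb

/-- The semigroup is weakly continuous on bounded sets. -/
theorem tendsto_inner_sol {ι : Type*} (𝒰 : Ultrafilter ι) {x : ι → X} {x₀ : X} {r : ℝ}
    (hx : ∀ i, ‖x i‖ ≤ r)
    (hw : ∀ φ, Tendsto (fun i => inner ℝ (x i) φ) 𝒰 (𝓝 (inner ℝ x₀ φ))) {t : ℝ} (ht : 0 ≤ t)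
    (φ : X) : Tendsto (fun i => inner ℝ (D.sol t (x i)) φ) 𝒰 (𝓝 (inner ℝ (D.sol t x₀) φ)) := by
  set R := r + ‖D.f‖ / D.β with hR
  have hbd : ∀ i s, 0 ≤ s → ‖D.sol s (x i)‖ ≤ R := fun i s hs => D.norm_sol_le (hx i) hs
  have hL : ∀ N, ∃ C, ∀ i s s', 0 ≤ s → 0 ≤ s' →
      ‖D.P N (D.sol s (x i) - D.sol s' (x i))‖ ≤ C * |s - s'| := fun N => by
    obtain ⟨C, hC⟩ := D.norm_P_sol_sub_le N r
    exact ⟨C, fun i => hC _ (hx i)⟩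
  -- A weak limit is chosen at each time; the tested truncated equations pass to the limit, so w
  -- solves the equation with datum x₀ and uniqueness identifies it.
  have hex : ∀ s : ℝ, ∃ y : X, 0 ≤ s → ‖y‖ ≤ R ∧
      ∀ φ, Tendsto (fun i => inner ℝ (D.sol s (x i)) φ) 𝒰 (𝓝 (inner ℝ y φ)) := fun s => by
    by_cases hs : 0 ≤ s
    · obtain ⟨y, hy⟩ := exists_weak_limit 𝒰 (Eventually.of_forall fun i => hbd i s hs)
      exact ⟨y, fun _ => hy⟩
    · exact ⟨0, fun h => absurd h hs⟩
  choose w hw' using hex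
  have hwR : ∀ s, 0 ≤ s → ‖w s‖ ≤ R := fun s hs => (hw' s hs).1
  have hwl : ∀ s, 0 ≤ s → ∀ φ, Tendsto (fun i => inner ℝ (D.sol s (x i)) φ) 𝒰
      (𝓝 (inner ℝ (w s) φ)) := fun s hs => (hw' s hs).2
  -- Lipschitz bounds for truncations survive weak limits. They give measurability of w, which is
  -- the pointwise limit of P N w.
  have hwL : ∀ N, ContinuousOn (fun s => D.P N (w s)) (Ici 0) := fun N => by
    obtain ⟨C, hC⟩ := hL N
    have hlip : ∀ s ∈ Ici (0 : ℝ), ∀ s' ∈ Ici (0 : ℝ),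
        ‖D.P N (w s) - D.P N (w s')‖ ≤ C * |s - s'| := fun s hs s' hs' => by
      by_contra! hlt
      set z := D.P N (w s) - D.P N (w s') with hz
      have h1 : Tendsto (fun i => inner ℝ (D.P N (D.sol s (x i) - D.sol s' (x i))) z) 𝒰
          (𝓝 (inner ℝ z z)) := by
        have h2 := (hwl s hs (D.P N z)).sub (hwl s' hs' (D.P N z))
        simp only [← inner_sub_left, ← D.inner_P] at h2
        simp only [map_sub]
        exact h2
      have h2 := le_of_tendsto h1 (Eventually.of_forall fun i => (real_inner_le_norm _ _).trans
        (mul_le_mul_of_nonneg_right (hC i s s' hs hs') (norm_nonneg _)))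
      rw [real_inner_self_eq_norm_sq] at h2
      have h3 : 0 ≤ C * |s - s'| := by
        obtain ⟨i, -⟩ := 𝒰.neBot.nonempty_of_mem univ_mem
        exact (norm_nonneg _).trans (hC i s s' hs hs')
      nlinarith
    refine LipschitzOnWith.continuousOn (K := Real.toNNReal C)
      (LipschitzOnWith.of_dist_le_mul fun s hs s' hs' => ?_)
    rw [dist_eq_norm, Real.dist_eq]
    exact (hlip s hs s' hs').trans
      (mul_le_mul_of_nonneg_right (Real.le_coe_toNNReal C) (abs_nonneg _))
  have hwm : AEStronglyMeasurable w (volume.restrict (Ioi 0)) :=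
    aestronglyMeasurable_of_tendsto_ae atTop
      (fun N => ((hwL N).mono Ioi_subset_Ici_self).aestronglyMeasurable measurableSet_Ioi)
      (Eventually.of_forall fun s => D.tendsto_P (w s))
  have hlin : D.IsLinearSol x₀ w fun s => D.force (w s) := by
    intro N t ht
    refine ext_inner_right ℝ fun φ => ?_
    have hi : IntervalIntegrable (fun s => D.P N (D.force (w s)) - D.A N (w s)) volume 0 t := by
      rw [intervalIntegrable_iff_integrableOn_Ioc_of_le ht]
      have : IsFiniteMeasure (volume.restrict (Ioc 0 t)) := ⟨by simp⟩
      have hcont : Continuous fun y => D.P N (D.force y) - D.A N y := by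
        have := D.continuous_force
        fun_prop
      refine Integrable.of_bound (hcont.comp_aestronglyMeasurable (hwm.mono_measure
        (Measure.restrict_mono Ioc_subset_Ioi_self le_rfl)))
        ((‖D.f‖ + ‖D.B‖ * R * R) + ‖D.A N‖ * R) ?_
      filter_upwards [ae_restrict_mem measurableSet_Ioc] with s hs
      refine (norm_sub_le _ _).trans (add_le_add ((D.norm_P_le N _).trans
        (D.norm_force_le (hwR s hs.1.le))) ?_)
      exact (D.A N).le_of_opNorm_le_of_le le_rfl (hwR s hs.1.le)
    have h1 := D.tendsto_integral_of_weak hbd hL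
      (fun i => (D.continuous_sol (x i)).continuousOn) hwl (D.weaklyContinuous_rhs N φ) ht
    have h2 := hw (D.P N φ)
    have h3 := hwl t ht (D.P N φ)
    rw [← D.inner_P] at h2
    simp only [← D.inner_P] at h2 h3
    have h4 : ∀ i, inner ℝ (D.P N (D.sol t (x i))) φ = inner ℝ (D.P N (x i)) φ +
        ∫ s in (0 : ℝ)..t, inner ℝ (D.P N (D.force (D.sol s (x i))) - D.A N (D.sol s (x i))) φ :=
      fun i => by
        have hc : Continuous fun s => D.P N (D.force (D.sol s (x i))) - D.A N (D.sol s (x i)) := by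
          have := D.continuous_sol (x i)
          have := D.continuous_force
          fun_prop
        rw [(D.isMild_sol (x i)).isLinearSol N t ht, inner_add_left,
          integral_inner_left (hc.intervalIntegrable _ _)]
    rw [inner_add_left, integral_inner_left hi]
    exact tendsto_nhds_unique h3 ((h2.add h1).congr fun i => (h4 i).symm)
  have hae : D.IsAESol x₀ w := by
    refine ⟨hwm, ⟨R, ?_⟩, fun N => ?_⟩
    · filter_upwards [ae_restrict_mem measurableSet_Ioi] with s hs
      exact hwR s (le_of_lt hs)
    · filter_upwards [ae_restrict_mem measurableSet_Ioi] with s hs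
      exact hlin N s (le_of_lt hs)
  -- The identification holds for almost every time; continuity of every truncation upgrades it to
  -- all times.
  have hwt : w t = D.sol t x₀ := by
    refine D.eq_of_inner_P_eq fun N φ => ?_
    have h1 : D.P N (w t) = D.P N (D.sol t x₀) :=
      eq_of_ae_eq (hwL N) ((D.P N).continuous.comp (D.continuous_sol x₀)).continuousOn
        (hae.eq_sol.mono fun s hs => congrArg (D.P N) hs) ht
    rw [← D.inner_P, ← D.inner_P, h1]
  rw [← hwt]
  exact hwl t ht φ

end DampedSystem

namespace DampedSystem

variable {X : Type*} [NormedAddCommGroup X] [InnerProductSpace ℝ X] (D : DampedSystem X)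

/-! ### Asymptotic compactness -/

/-- The dissipation form `⟪A u, u⟫ - β‖u‖²`, spectrally truncated. -/
def diss (N : ℕ) (x : X) : ℝ := inner ℝ (D.A N x) x - D.β * ‖D.P N x‖ ^ 2

theorem diss_eq_inner (N : ℕ) (x : X) :
    D.diss N x = inner ℝ x (D.A N x - D.β • D.P N x) := by
  rw [diss, inner_sub_right, inner_smul_right, ← D.inner_P, D.inner_P_self, ← D.inner_A]

theorem diss_nonneg (N : ℕ) (x : X) : 0 ≤ D.diss N x := sub_nonneg.2 (D.le_inner_A N x)

theorem diss_mono (x : X) : Monotone fun N => D.diss N x := D.inner_A_mono x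

theorem continuous_diss (N : ℕ) : Continuous (D.diss N) := by
  unfold diss
  fun_prop

/-- A nonnegative quadratic form lies above its tangent at y: expand `diss N (x - y) ≥ 0`. The
minorant is affine in x, which yields weak lower semicontinuity of the dissipation. -/
theorem le_diss (N : ℕ) (x y : X) :
    2 * inner ℝ x (D.A N y - D.β • D.P N y) - D.diss N y ≤ D.diss N x := by
  have h := D.diss_nonneg N (x - y)
  have h1 : inner ℝ y (D.A N x - D.β • D.P N x) = inner ℝ x (D.A N y - D.β • D.P N y) := by
    rw [inner_sub_right, inner_sub_right, inner_smul_right, inner_smul_right, ← D.inner_A,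
      ← D.inner_P, real_inner_comm x, real_inner_comm x]
  rw [diss_eq_inner] at h
  rw [diss_eq_inner, diss_eq_inner]
  have h2 : D.A N (x - y) - D.β • D.P N (x - y) =
      (D.A N x - D.β • D.P N x) - (D.A N y - D.β • D.P N y) := by
    rw [map_sub, map_sub, smul_sub]
    abel
  rw [h2] at h
  generalize D.A N x - D.β • D.P N x = a at h h1 ⊢
  generalize D.A N y - D.β • D.P N y = c at h h1 ⊢
  rw [inner_sub_left, inner_sub_right, inner_sub_right, h1] at h
  linarith

/-- Orthogonality of B(u, u) to u is available only in the limit of the truncations, where the whole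
force reduces to f. -/
theorem tendsto_integral_force {u : ℝ → X} (hu : Continuous u) (γ t : ℝ) :
    Tendsto (fun N => ∫ s in (0 : ℝ)..t, Real.exp (γ * s) * inner ℝ (D.force (u s)) (D.P N (u s)))
      atTop (𝓝 (∫ s in (0 : ℝ)..t, Real.exp (γ * s) * inner ℝ D.f (u s))) := by
  have hF : Continuous fun s => D.force (u s) := D.continuous_force.comp hu
  refine intervalIntegral.tendsto_integral_filter_of_dominated_convergence
    (fun s => Real.exp (γ * s) * (‖D.force (u s)‖ * ‖u s‖))
    (Eventually.of_forall fun N => Continuous.aestronglyMeasurable (by fun_prop))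
    (Eventually.of_forall fun N => Eventually.of_forall fun s _ => ?_)
    (Continuous.intervalIntegrable (by fun_prop) _ _) (Eventually.of_forall fun s _ => ?_)
  · rw [norm_mul, Real.norm_eq_abs, Real.abs_exp]
    refine mul_le_mul_of_nonneg_left ?_ (Real.exp_pos _).le
    exact (norm_inner_le_norm _ _).trans
      (mul_le_mul_of_nonneg_left (D.norm_P_le N _) (norm_nonneg _))
  · rw [← D.inner_force]
    exact ((tendsto_const_nhds (x := D.force (u s))).inner (D.tendsto_P (u s))).const_mul _

variable [CompleteSpace X]

/-- The rate 2β cancels exactly the part β‖P N u‖² of ⟨A N u, u⟩ and leaves the dissipation form. -/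
theorem energy_eq_sol (x : X) (N : ℕ) {t : ℝ} (ht : 0 ≤ t) :
    Real.exp (2 * D.β * t) * ‖D.P N (D.sol t x)‖ ^ 2 = ‖D.P N x‖ ^ 2 -
      2 * (∫ s in (0 : ℝ)..t, Real.exp (2 * D.β * s) * D.diss N (D.sol s x)) +
      2 * ∫ s in (0 : ℝ)..t, Real.exp (2 * D.β * s) *
        inner ℝ (D.force (D.sol s x)) (D.P N (D.sol s x)) := by
  have hu := D.continuous_sol x
  have hF : Continuous fun s => D.force (D.sol s x) := D.continuous_force.comp hu
  have hd := (D.continuous_diss N).comp hu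
  have h := (D.isMild_sol x).isLinearSol.energy_eq hu hF (2 * D.β) N ht
  have c1 : Continuous fun s => 2 * (Real.exp (2 * D.β * s) * D.diss N (D.sol s x)) :=
    continuous_const.mul ((by fun_prop : Continuous fun s => Real.exp (2 * D.β * s)).mul hd)
  have c2 : Continuous fun s => 2 * (Real.exp (2 * D.β * s) *
      inner ℝ (D.force (D.sol s x)) (D.P N (D.sol s x))) := by fun_prop
  rw [h, ← intervalIntegral.integral_const_mul, ← intervalIntegral.integral_const_mul,
    sub_add, ← intervalIntegral.integral_sub (c1.intervalIntegrable _ _)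
      (c2.intervalIntegrable _ _), sub_eq_add_neg, ← intervalIntegral.integral_neg]
  congr 1
  refine intervalIntegral.integral_congr fun s _ => ?_
  simp only [diss]
  ring

/-- Let the truncation M of the energy balance tend to infinity while keeping the dissipation at
level N, which is smaller by monotonicity. -/
theorem energy_le_sol (x : X) (N : ℕ) {t : ℝ} (ht : 0 ≤ t) :
    Real.exp (2 * D.β * t) * ‖D.sol t x‖ ^ 2 ≤ ‖x‖ ^ 2 -
      2 * (∫ s in (0 : ℝ)..t, Real.exp (2 * D.β * s) * D.diss N (D.sol s x)) +
      2 * ∫ s in (0 : ℝ)..t, Real.exp (2 * D.β * s) * inner ℝ D.f (D.sol s x) := by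
  have hu := D.continuous_sol x
  have h1 : Tendsto (fun M => Real.exp (2 * D.β * t) * ‖D.P M (D.sol t x)‖ ^ 2) atTop
      (𝓝 (Real.exp (2 * D.β * t) * ‖D.sol t x‖ ^ 2)) :=
    ((D.tendsto_P (D.sol t x)).norm.pow 2).const_mul _
  have h2 := ((D.tendsto_integral_force hu (2 * D.β) t).const_mul 2).const_add (‖x‖ ^ 2 -
      2 * (∫ s in (0 : ℝ)..t, Real.exp (2 * D.β * s) * D.diss N (D.sol s x)))
  refine le_of_tendsto_of_tendsto h1 h2 ?_
  filter_upwards [eventually_ge_atTop N] with M hM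
  rw [D.energy_eq_sol x M ht]
  have h3 := pow_le_pow_left₀ (norm_nonneg _) (D.norm_P_le M x) 2
  have h4 : ∫ s in (0 : ℝ)..t, Real.exp (2 * D.β * s) * D.diss N (D.sol s x) ≤
      ∫ s in (0 : ℝ)..t, Real.exp (2 * D.β * s) * D.diss M (D.sol s x) := by
    have hd : ∀ N, Continuous fun s => Real.exp (2 * D.β * s) * D.diss N (D.sol s x) := fun N => by
      have := (D.continuous_diss N).comp hu
      exact (by fun_prop : Continuous fun s : ℝ => Real.exp (2 * D.β * s)).mul this
    refine intervalIntegral.integral_mono_on ht ((hd N).intervalIntegrable _ _)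
      ((hd M).intervalIntegrable _ _) fun s _ => ?_
    exact mul_le_mul_of_nonneg_left (D.diss_mono _ hM) (Real.exp_pos _).le
  linarith

/-- The core of the energy method. The forcing integrals converge by weak continuity and the
dissipation is bounded below by its tangent at the limit trajectory, so the energy exceeds that of
the limit only by the initial term R², which does not carry the exponential weight. -/
theorem eventually_energy_le {ι : Type*} (𝒰 : Ultrafilter ι) {x : ι → X} {x₀ : X} {R : ℝ}
    (hx : ∀ i, ‖x i‖ ≤ R)
    (hw : ∀ φ, Tendsto (fun i => inner ℝ (x i) φ) 𝒰 (𝓝 (inner ℝ x₀ φ))) {t : ℝ} (ht : 0 ≤ t)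
    {ε : ℝ} (hε : 0 < ε) :
    ∀ᶠ i in 𝒰, Real.exp (2 * D.β * t) * ‖D.sol t (x i)‖ ^ 2 ≤
      R ^ 2 + Real.exp (2 * D.β * t) * ‖D.sol t x₀‖ ^ 2 + ε := by
  set e : ℝ → ℝ := fun s => Real.exp (2 * D.β * s) with he
  have hec : Continuous e := by fun_prop
  have hu₀ := D.continuous_sol x₀
  have hbd : ∀ i s, 0 ≤ s → ‖D.sol s (x i)‖ ≤ R + ‖D.f‖ / D.β := fun i s hs =>
    D.norm_sol_le (hx i) hs
  have hL : ∀ N, ∃ C, ∀ i s s', 0 ≤ s → 0 ≤ s' →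
      ‖D.P N (D.sol s (x i) - D.sol s' (x i))‖ ≤ C * |s - s'| := fun N => by
    obtain ⟨C, hC⟩ := D.norm_P_sol_sub_le N R
    exact ⟨C, fun i => hC _ (hx i)⟩
  have hlim : ∀ {ψ : ℝ → X}, Continuous ψ →
      Tendsto (fun i => ∫ s in (0 : ℝ)..t, inner ℝ (D.sol s (x i)) (ψ s)) 𝒰
        (𝓝 (∫ s in (0 : ℝ)..t, inner ℝ (D.sol s x₀) (ψ s))) := fun hψ =>
    D.tendsto_integral_of_weak hbd hL (fun i => (D.continuous_sol (x i)).continuousOn)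
      (fun s hs => D.tendsto_inner_sol 𝒰 hx hw hs) (weaklyContinuous_inner hψ) ht
  -- A single truncation level, fixed by the limit trajectory alone, is used for the whole family.
  obtain ⟨N, hN⟩ := ((Metric.tendsto_nhds.1 (D.tendsto_integral_force hu₀ (2 * D.β) t) (ε / 4)
    (by positivity))).exists
  rw [Real.dist_eq, abs_lt] at hN
  set ψ : ℝ → X := fun s => e s • (D.A N (D.sol s x₀) - D.β • D.P N (D.sol s x₀)) with hψ
  have hψc : Continuous ψ := by fun_prop
  have h1 := hlim (ψ := fun s => e s • D.f) (by fun_prop)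
  have h2 := hlim hψc
  have h3 := D.energy_eq_sol x₀ N ht
  have h4 : ∫ s in (0 : ℝ)..t, inner ℝ (D.sol s x₀) (ψ s) =
      ∫ s in (0 : ℝ)..t, e s * D.diss N (D.sol s x₀) :=
    intervalIntegral.integral_congr fun s _ => by
      simp only [hψ, inner_smul_right, ← diss_eq_inner]
  have h5 : ∀ y, ∫ s in (0 : ℝ)..t, inner ℝ (D.sol s y) (e s • D.f) =
      ∫ s in (0 : ℝ)..t, e s * inner ℝ D.f (D.sol s y) := fun y =>
    intervalIntegral.integral_congr fun s _ => by
      simp only [inner_smul_right, real_inner_comm]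
  -- The errors add up to ε: 2 · ε/8 from the force, 4 · ε/16 from the tangent functional and 2 ·
  -- ε/4 from the truncation level.
  filter_upwards [Metric.tendsto_nhds.1 h1 (ε / 8) (by positivity),
    Metric.tendsto_nhds.1 h2 (ε / 16) (by positivity)] with i h6 h7
  rw [Real.dist_eq, abs_lt, h5, h5] at h6
  rw [Real.dist_eq, abs_lt, h4] at h7
  have h8 := D.energy_le_sol (x i) N ht
  have hui := D.continuous_sol (x i)
  have h9 : 2 * (∫ s in (0 : ℝ)..t, inner ℝ (D.sol s (x i)) (ψ s)) -
      ∫ s in (0 : ℝ)..t, e s * D.diss N (D.sol s x₀) ≤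
      ∫ s in (0 : ℝ)..t, e s * D.diss N (D.sol s (x i)) := by
    have c1 : Continuous fun s => e s * D.diss N (D.sol s x₀) :=
      hec.mul ((D.continuous_diss N).comp hu₀)
    have c2 : Continuous fun s => e s * D.diss N (D.sol s (x i)) :=
      hec.mul ((D.continuous_diss N).comp hui)
    have c3 : Continuous fun s => 2 * inner ℝ (D.sol s (x i)) (ψ s) := by fun_prop
    rw [← intervalIntegral.integral_const_mul,
      ← intervalIntegral.integral_sub (c3.intervalIntegrable _ _) (c1.intervalIntegrable _ _)]
    refine intervalIntegral.integral_mono_on ht ((c3.sub c1).intervalIntegrable _ _)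
      (c2.intervalIntegrable _ _) fun s _ => ?_
    have h10 := mul_le_mul_of_nonneg_left (D.le_diss N (D.sol s (x i)) (D.sol s x₀))
      (Real.exp_pos (2 * D.β * s)).le
    simp only [hψ, inner_smul_right]
    calc _ = e s * (2 * inner ℝ (D.sol s (x i)) (D.A N (D.sol s x₀) - D.β • D.P N (D.sol s x₀)) -
          D.diss N (D.sol s x₀)) := by ring
      _ ≤ _ := h10
  have h11 : Real.exp (2 * D.β * t) * ‖D.P N (D.sol t x₀)‖ ^ 2 ≤
      Real.exp (2 * D.β * t) * ‖D.sol t x₀‖ ^ 2 :=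
    mul_le_mul_of_nonneg_left (pow_le_pow_left₀ (norm_nonneg _) (D.norm_P_le N _) 2)
      (Real.exp_pos _).le
  have h12 := pow_le_pow_left₀ (norm_nonneg _) (hx i) 2
  have h13 := sq_nonneg ‖D.P N x₀‖
  have e1 : ∀ g : ℝ → ℝ, ∫ s in (0 : ℝ)..t, Real.exp (2 * D.β * s) * g s =
    ∫ s in (0 : ℝ)..t, e s * g s := fun g => rfl
  rw [e1] at h8 h3 hN
  rw [e1] at h8 h3 hN
  linarith [h6.1, h6.2, h7.1, h7.2, hN.1, hN.2]

/-- Look back by a time k: the states at time p.1 - k have a weak limit y₀, and S(k) maps it to the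
weak limit w by weak continuity. The energy comparison over the last k units of time, divided by
e^{2βk}, bounds the squared norms by ‖w‖² plus (R² + 1)e^{-2βk}. Weak convergence together with
convergence of norms is strong convergence. -/
theorem exists_tendsto_sol (r : ℝ) (𝒰 : Ultrafilter (ℝ × X))
    (h𝒰 : (𝒰 : Filter (ℝ × X)) ≤ atTop ×ˢ 𝓟 (Metric.closedBall 0 r)) :
    ∃ x, Tendsto (fun p : ℝ × X => D.sol p.1 p.2) 𝒰 (𝓝 x) := by
  have hβ := D.β_pos
  have hfst : Tendsto Prod.fst (𝒰 : Filter (ℝ × X)) atTop := tendsto_fst.mono_left h𝒰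
  have hsnd : ∀ᶠ p in (𝒰 : Filter (ℝ × X)), ‖p.2‖ ≤ r := by
    have : Tendsto Prod.snd (𝒰 : Filter (ℝ × X)) (𝓟 (Metric.closedBall 0 r)) :=
      tendsto_snd.mono_left h𝒰
    filter_upwards [tendsto_principal.1 this] with p hp
    simpa using hp
  set R := |r| + ‖D.f‖ / D.β with hR
  have hR0 : 0 ≤ R := by positivity
  have hbd : ∀ p : ℝ × X, 0 ≤ p.1 → ‖p.2‖ ≤ r → ‖D.sol p.1 p.2‖ ≤ R := fun p h1 h2 =>
    D.norm_sol_le (h2.trans (le_abs_self r)) h1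
  obtain ⟨w, -, hw⟩ := exists_weak_limit 𝒰 (y := fun p : ℝ × X => D.sol p.1 p.2) (R := R) (by
    filter_upwards [hsnd, hfst.eventually (eventually_ge_atTop 0)] with p h1 h2
    exact hbd p h2 h1)
  refine ⟨w, tendsto_of_weak_of_norm hw fun ε hε => ?_⟩
  -- The look-back time makes the unmatched initial energy R², plus the error 1 allowed below, at
  -- most ε after damping.
  obtain ⟨k, hk0, hk⟩ : ∃ k : ℝ, 0 ≤ k ∧ R ^ 2 + 1 ≤ Real.exp (2 * D.β * k) * ε := by
    have h1 : Tendsto (fun k => Real.exp (2 * D.β * k) * ε) atTop atTop :=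
      (Real.tendsto_exp_atTop.comp (tendsto_id.const_mul_atTop (by positivity))).atTop_mul_const hε
    obtain ⟨k, h2, h3⟩ := ((h1.eventually (eventually_ge_atTop (R ^ 2 + 1))).and
      (eventually_ge_atTop 0)).exists
    exact ⟨k, h3, h2⟩
  classical
  -- The default 0 keeps y bounded for every p; along the ultrafilter the first case eventually
  -- holds.
  set y : ℝ × X → X := fun p => if 0 ≤ p.1 - k ∧ ‖p.2‖ ≤ r then D.sol (p.1 - k) p.2 else 0 with hy
  have hyR : ∀ p, ‖y p‖ ≤ R := fun p => by
    simp only [hy]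
    split_ifs with h
    · exact hbd (p.1 - k, p.2) h.1 h.2
    · simpa using hR0
  obtain ⟨y₀, -, hy₀⟩ := exists_weak_limit 𝒰 (Eventually.of_forall hyR)
  have hev : ∀ᶠ p in (𝒰 : Filter (ℝ × X)), D.sol k (y p) = D.sol p.1 p.2 := by
    filter_upwards [hsnd, hfst.eventually (eventually_ge_atTop k)] with p h1 h2
    have h3 : 0 ≤ p.1 - k := sub_nonneg.2 h2
    simp only [hy]
    rw [if_pos ⟨h3, h1⟩, ← D.sol_add hk0 h3, add_sub_cancel]
  have hwk : D.sol k y₀ = w := by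
    refine ext_inner_right ℝ fun φ => ?_
    exact tendsto_nhds_unique ((D.tendsto_inner_sol 𝒰 hyR hy₀ hk0 φ).congr'
      (hev.mono fun p hp => by rw [hp])) (hw φ)
  filter_upwards [hev, D.eventually_energy_le 𝒰 hyR hy₀ hk0 one_pos] with p h1 h2
  rw [h1, hwk] at h2
  have h3 := Real.exp_pos (2 * D.β * k)
  refine le_of_mul_le_mul_left ?_ h3
  linarith

theorem exists_isGlobalAttractor_sol : ∃ A : Set X, IsGlobalAttractor D.sol A := by
  refine exists_isGlobalAttractor D.sol (fun s t hs ht x => D.sol_add hs ht x)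
    (fun t ht => D.continuous_sol_right ht) (Metric.closedBall 0 (‖D.f‖ / D.β + 1)) (fun B hB => ?_)
    (fun 𝒰 h => D.exists_tendsto_sol _ 𝒰 h)
  obtain ⟨T, h1, h2⟩ := D.exists_norm_sol_le hB
  exact ⟨T, h1, fun x hx => by simpa using h2 x hx⟩

end DampedSystem

/-! ### Frequency cutoffs -/

/-- The real symbol `g` cut off at frequency `N`. -/
def cutSym (N : ℕ) (g : E3 → ℝ) (ξ : E3) : ℂ :=
  (((Metric.closedBall (0 : E3) N).indicator g ξ : ℝ) : ℂ)

section Cut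

variable {N : ℕ} {g h : E3 → ℝ}

theorem cutSym_of_mem {ξ : E3} (hξ : ‖ξ‖ ≤ N) : cutSym N g ξ = g ξ := by
  rw [cutSym, indicator_of_mem (by simpa using hξ)]

theorem cutSym_of_notMem {ξ : E3} (hξ : ¬‖ξ‖ ≤ N) : cutSym N g ξ = 0 := by
  rw [cutSym, indicator_of_notMem (by simpa using hξ), Complex.ofReal_zero]

theorem conj_cutSym (ξ : E3) : conj (cutSym N g ξ) = cutSym N g ξ := Complex.conj_ofReal _

theorem cutSym_mul (ξ : E3) : cutSym N g ξ * cutSym N h ξ = cutSym N (fun ξ => g ξ * h ξ) ξ := by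
  by_cases hξ : ‖ξ‖ ≤ N
  · simp only [cutSym_of_mem hξ, Complex.ofReal_mul]
  · simp only [cutSym_of_notMem hξ, mul_zero]

theorem norm_cutSym_le {C : ℝ} (hC : 0 ≤ C) (h : ∀ ξ, ‖ξ‖ ≤ N → |g ξ| ≤ C) (ξ : E3) :
    ‖cutSym N g ξ‖ ≤ C := by
  by_cases hξ : ‖ξ‖ ≤ N
  · rw [cutSym_of_mem hξ, Complex.norm_real]
    exact h ξ hξ
  · rw [cutSym_of_notMem hξ, norm_zero]
    exact hC

theorem isSymbol_cutSym (N : ℕ) (hg : Continuous g) (he : ∀ ξ, g (-ξ) = g ξ) :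
    IsSymbol (cutSym N g) := by
  obtain ⟨C, hC⟩ := (isCompact_closedBall (0 : E3) N).exists_bound_of_continuousOn hg.continuousOn
  refine IsSymbol.ofReal (C := |C|) (hg.measurable.indicator Metric.isClosed_closedBall.measurableSet)
    (fun ξ => ?_) fun ξ => ?_
  · by_cases hξ : ξ ∈ Metric.closedBall (0 : E3) N
    · rw [indicator_of_mem hξ]
      exact (hC ξ hξ).trans (le_abs_self C)
    · rw [indicator_of_notMem hξ, abs_zero]
      exact abs_nonneg C
  · by_cases hξ : ξ ∈ Metric.closedBall (0 : E3) N
    · rw [indicator_of_mem hξ, indicator_of_mem (by simpa using hξ), he]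
    · rw [indicator_of_notMem hξ, indicator_of_notMem (by simpa using hξ)]

theorem tendsto_cutSym (g : E3 → ℝ) (ξ : E3) :
    Tendsto (fun N : ℕ => cutSym N g ξ) atTop (𝓝 (g ξ : ℂ)) := by
  refine tendsto_const_nhds.congr' ?_
  filter_upwards [eventually_ge_atTop ⌈‖ξ‖⌉₊] with N hN
  rw [cutSym_of_mem (Nat.ceil_le.1 hN)]

end Cut

/-! ### Multipliers on solenoidal fields -/

/-- Componentwise multiplier. -/
def multV (m : E3 → ℂ) : V3 →L[ℝ] V3 :=
  (PiLp.continuousLinearEquiv 2 ℝ (fun _ : Fin 3 => L2 ℝ)).symm.toContinuousLinearMap ∘L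
    ContinuousLinearMap.pi fun k => mult m ∘L PiLp.proj (𝕜 := ℝ) 2 (fun _ : Fin 3 => L2 ℝ) k

@[simp]
theorem multV_apply (m : E3 → ℂ) (a : V3) (k : Fin 3) : multV m a k = mult m (a k) := rfl

theorem multV_mem {α : ℝ} (hα : 0 < α) {m : E3 → ℂ} (hm : IsSymbol m) {a : V3}
    (ha : a ∈ solenoidal α) : multV m a ∈ solenoidal α := by
  rw [mem_solenoidal] at ha ⊢
  simp only [multV_apply, mult_comm (isSymbol_dSym_mul_sSym hα _) hm]
  rw [← map_sum, ha, map_zero]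

/-- The multiplier `m` acting on solenoidal fields. -/
def multY {α : ℝ} (hα : 0 < α) {m : E3 → ℂ} (hm : IsSymbol m) :
    solenoidal α →L[ℝ] solenoidal α :=
  (multV m ∘L (solenoidal α).subtypeL).codRestrict (solenoidal α) fun a => multV_mem hα hm a.2

section MultY

variable {α : ℝ} (hα : 0 < α) {m n : E3 → ℂ} (hm : IsSymbol m) (hn : IsSymbol n)

@[simp]
theorem multY_apply (a : solenoidal α) (k : Fin 3) : (multY hα hm a).1 k = mult m (a.1 k) := rfl

theorem solenoidal_ext {a b : solenoidal α} (h : ∀ k, a.1 k = b.1 k) : a = b :=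
  Subtype.ext (PiLp.ext h)

theorem inner_solenoidal (a b : solenoidal α) : inner ℝ a b = ∑ k, inner ℝ (a.1 k) (b.1 k) := rfl

theorem norm_sq_solenoidal (a : solenoidal α) : ‖a‖ ^ 2 = ∑ k, ‖a.1 k‖ ^ 2 :=
  PiLp.norm_sq_eq_of_L2 _ a.1

theorem norm_multY_le {C : ℝ} (hC : ∀ ξ, ‖m ξ‖ ≤ C) (a : solenoidal α) :
    ‖multY hα hm a‖ ≤ C * ‖a‖ := by
  have h0 : 0 ≤ C := (norm_nonneg _).trans (hC 0)
  refine (pow_le_pow_iff_left₀ (norm_nonneg _) (by positivity) two_ne_zero).1 ?_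
  rw [mul_pow, norm_sq_solenoidal, norm_sq_solenoidal, Finset.mul_sum]
  refine Finset.sum_le_sum fun k _ => ?_
  rw [← mul_pow]
  exact pow_le_pow_left₀ (norm_nonneg _) (norm_mult_le hm hC _) 2

theorem inner_multY (hr : ∀ ξ, conj (m ξ) = m ξ) (a b : solenoidal α) :
    inner ℝ (multY hα hm a) b = inner ℝ a (multY hα hm b) := by
  rw [inner_solenoidal, inner_solenoidal]
  exact Finset.sum_congr rfl fun k _ => inner_mult_of_real hm hr _ _

theorem multY_multY {p : E3 → ℂ} (hp : IsSymbol p) (h : ∀ ξ, m ξ * n ξ = p ξ) (a : solenoidal α) :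
    multY hα hm (multY hα hn a) = multY hα hp a := by
  refine solenoidal_ext fun k => ?_
  rw [multY_apply, multY_apply, multY_apply, mult_mult hm hn, funext h]

theorem tendsto_solenoidal {ι : Type*} {l : Filter ι} {a : ι → solenoidal α} {b : solenoidal α}
    (h : ∀ k, Tendsto (fun i => (a i).1 k) l (𝓝 (b.1 k))) : Tendsto a l (𝓝 b) := by
  rw [tendsto_subtype_rng]
  exact ((PiLp.continuous_toLp 2 (fun _ : Fin 3 => L2 ℝ)).tendsto _).comp (tendsto_pi_nhds.2 h)

end MultY

/-! ### The transport term -/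

/-- The operator `a ↦ (∑ⱼ ∂ⱼ (1 - α²Δ)^{-1/2} Qᵢⱼ)ᵢ` on matrix fields. -/
def divBessel (α : ℝ) : (Fin 3 → Fin 3 → L2 ℝ) →L[ℝ] V3 :=
  (PiLp.continuousLinearEquiv 2 ℝ (fun _ : Fin 3 => L2 ℝ)).symm.toContinuousLinearMap ∘L
    ContinuousLinearMap.pi fun i => ∑ j, mult (fun ξ => dSym j ξ * sSym α ξ) ∘L
      ContinuousLinearMap.proj (R := ℝ) (φ := fun _ : Fin 3 => L2 ℝ) j ∘L
      ContinuousLinearMap.proj (R := ℝ) (φ := fun _ : Fin 3 => Fin 3 → L2 ℝ) i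

theorem divBessel_apply (α : ℝ) (Q : Fin 3 → Fin 3 → L2 ℝ) (i : Fin 3) :
    divBessel α Q i = ∑ j, mult (fun ξ => dSym j ξ * sSym α ξ) (Q i j) := by
  change (∑ j, mult (fun ξ => dSym j ξ * sSym α ξ) ∘L
      ContinuousLinearMap.proj (R := ℝ) (φ := fun _ : Fin 3 => L2 ℝ) j ∘L
      ContinuousLinearMap.proj (R := ℝ) (φ := fun _ : Fin 3 => Fin 3 → L2 ℝ) i) Q = _
  rw [sum_apply]
  rfl

/-- The transport term `(a, b) ↦ div (u ⊗ v)` for `u = (1 - α²Δ)^{-1/2} a`,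
`v = (1 - α²Δ)^{-1/2} b`, smoothed by `(1 - α²Δ)^{-1/2}`. -/
def transport {α : ℝ} (hα : 0 < α) (a b : V3) : V3 :=
  divBessel α fun i j => besselMul hα (a i) (b j)

theorem inner_transport {α : ℝ} (hα : 0 < α) (a b c : V3) : inner ℝ (transport hα a b) c =
    -∑ i, ∑ j, inner ℝ (besselMul hα (a i) (b j)) (mult (fun ξ => dSym j ξ * sSym α ξ) (c i)) := by
  rw [PiLp.inner_apply, ← Finset.sum_neg_distrib]
  refine Finset.sum_congr rfl fun i _ => ?_
  rw [transport, divBessel_apply, sum_inner, ← Finset.sum_neg_distrib]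
  refine Finset.sum_congr rfl fun j _ => ?_
  rw [inner_mult_left (isSymbol_dSym_mul_sSym hα j), ← inner_neg_right,
    ← mult_neg (isSymbol_dSym_mul_sSym hα j)]
  simp only [map_mul, conj_dSym, conj_sSym, neg_mul]

/-- The bilinear term on solenoidal fields: Leray projection of the transport term. -/
def bilin {α : ℝ} (hα : 0 < α) : solenoidal α →L[ℝ] solenoidal α →L[ℝ] solenoidal α :=
  LinearMap.mkContinuous₂
    (LinearMap.mk₂ ℝ (fun a b => (solenoidal α).orthogonalProjectionOnto (transport hα a.1 b.1))
      (fun a a' b => by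
        rw [← map_add, transport, transport, transport, ← map_add]
        congr 2
        funext i j
        simp)
      (fun c a b => by
        rw [← map_smul, transport, transport, ← map_smul]
        congr 2
        funext i j
        simp)
      (fun a b b' => by
        rw [← map_add, transport, transport, transport, ← map_add]
        congr 2
        funext i j
        simp)
      (fun c a b => by
        rw [← map_smul, transport, transport, ← map_smul]
        congr 2
        funext i j
        simp))
    (‖divBessel α‖ * ‖besselMul hα‖) fun a b => by
      have h1 : ‖fun i j => besselMul hα (a.1 i) (b.1 j)‖ ≤ ‖besselMul hα‖ * ‖a‖ * ‖b‖ := by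
        rw [pi_norm_le_iff_of_nonneg (by positivity)]
        intro i
        rw [pi_norm_le_iff_of_nonneg (by positivity)]
        intro j
        refine ((besselMul hα).le_opNorm₂ _ _).trans ?_
        have h2 : ‖a.1 i‖ ≤ ‖a‖ := PiLp.norm_apply_le a.1 i
        have h3 : ‖b.1 j‖ ≤ ‖b‖ := PiLp.norm_apply_le b.1 j
        gcongr
      change ‖(solenoidal α).orthogonalProjectionOnto (transport hα a.1 b.1)‖ ≤ _
      refine ((solenoidal α).norm_orthogonalProjectionOnto_apply_le _).trans ?_
      refine ((divBessel α).le_opNorm _).trans ?_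
      calc ‖divBessel α‖ * ‖fun i j => besselMul hα (a.1 i) (b.1 j)‖
          ≤ ‖divBessel α‖ * (‖besselMul hα‖ * ‖a‖ * ‖b‖) := by gcongr
        _ = _ := by ring

theorem bilin_apply {α : ℝ} (hα : 0 < α) (a b : solenoidal α) :
    bilin hα a b = (solenoidal α).orthogonalProjectionOnto (transport hα a.1 b.1) := rfl

theorem inner_bilin {α : ℝ} (hα : 0 < α) (a b c : solenoidal α) : inner ℝ (bilin hα a b) c =
    -∑ i, ∑ j, inner ℝ (besselMul hα (a.1 i) (b.1 j))
      (mult (fun ξ => dSym j ξ * sSym α ξ) (c.1 i)) := by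
  rw [bilin_apply, ← inner_transport,
    Submodule.inner_orthogonalProjectionOnto_eq_of_mem_right]

/-- Each component of the field is transported by the field itself, and transport by a divergence
free field is skew on every component. -/
theorem inner_bilin_self {α : ℝ} (hα : 0 < α) (a : solenoidal α) :
    inner ℝ (bilin hα a a) a = 0 := by
  rw [inner_bilin, neg_eq_zero]
  refine Finset.sum_eq_zero fun i _ => ?_
  simp only [besselMul_comm hα (a.1 i)]
  exact sum_inner_besselMul_eq_zero hα a.2 (a.1 i)

/-- The derivative falls on the fixed field φ, leaving products of components tested against fixed
L² functions. -/
theorem tendsto_inner_bilin {α : ℝ} (hα : 0 < α) (l : Filter (solenoidal α)) (R : ℝ)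
    (a₀ : solenoidal α) (hR : ∀ᶠ a in l, ‖a‖ ≤ R)
    (h : ∀ φ, Tendsto (fun a => inner ℝ a φ) l (𝓝 (inner ℝ a₀ φ))) (φ : solenoidal α) :
    Tendsto (fun a => inner ℝ (bilin hα a a) φ) l (𝓝 (inner ℝ (bilin hα a₀ a₀) φ)) := by
  simp only [inner_bilin]
  have hR' : ∀ k, ∀ᶠ a in l, ‖a.1 k‖ ≤ R := fun k =>
    hR.mono fun a ha => (PiLp.norm_apply_le a.1 k).trans ha
  have hw : ∀ k ψ, Tendsto (fun a : solenoidal α => inner ℝ (a.1 k) ψ) l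
      (𝓝 (inner ℝ (a₀.1 k) ψ)) := fun k ψ => by
    -- Weak convergence is assumed only against solenoidal fields; projecting the one-component
    -- field represents the pairing with ψ by such a field.
    set Ψ : V3 := PiLp.single 2 k ψ with hΨ
    have e : ∀ a : solenoidal α, inner ℝ (a.1 k) ψ =
        inner ℝ a ((solenoidal α).orthogonalProjectionOnto Ψ) := fun a => by
      rw [Submodule.inner_orthogonalProjectionOnto_eq_of_mem_left, hΨ,
        PiLp.inner_apply, Finset.sum_eq_single k]
      · simp
      · intro j _ hj
        simp [hj]
      · simp
    simp only [e]
    exact h _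
  exact (tendsto_finsetSum _ fun i _ => tendsto_finsetSum _ fun j _ =>
    tendsto_inner_besselMul hα (hR' i) (hR' j) (hw i) (hw j) _).neg

/-! ### The Bardina system as an abstract damped system -/

/-- The symbol of `β - νΔ`. -/
def dampSym (β ν : ℝ) (ξ : E3) : ℝ := β + ν * lam ξ

section DampSym

variable {β ν : ℝ}

theorem continuous_dampSym (β ν : ℝ) : Continuous (dampSym β ν) :=
  continuous_const.add (continuous_const.mul continuous_lam)

theorem dampSym_neg (β ν : ℝ) (ξ : E3) : dampSym β ν (-ξ) = dampSym β ν ξ := by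
  rw [dampSym, dampSym, lam_neg]

theorem dampSym_nonneg (hβ : 0 ≤ β) (hν : 0 ≤ ν) (ξ : E3) : 0 ≤ dampSym β ν ξ := by
  have := lam_nonneg ξ
  unfold dampSym
  positivity

/-- The symbol of the semigroup `exp(-t(β - νΔ))`, with negative times replaced by zero. -/
def heatSym (β ν t : ℝ) (ξ : E3) : ℂ := ((Real.exp (-(max t 0 * dampSym β ν ξ)) : ℝ) : ℂ)

theorem norm_heatSym_le (hβ : 0 ≤ β) (hν : 0 ≤ ν) (t : ℝ) (ξ : E3) : ‖heatSym β ν t ξ‖ ≤ 1 := by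
  have h1 := dampSym_nonneg hβ hν ξ
  have h2 : 0 ≤ max t 0 := le_max_right _ _
  rw [heatSym, Complex.norm_real, Real.norm_eq_abs, Real.abs_exp, Real.exp_le_one_iff]
  have : 0 ≤ max t 0 * dampSym β ν ξ := by positivity
  linarith

theorem isSymbol_heatSym (hβ : 0 ≤ β) (hν : 0 ≤ ν) (t : ℝ) : IsSymbol (heatSym β ν t) :=
  IsSymbol.ofReal (C := 1) (Real.continuous_exp.comp
    ((continuous_dampSym β ν).const_mul _).neg).measurable
    (fun ξ => by
      rw [← Real.norm_eq_abs, ← Complex.norm_real]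
      exact norm_heatSym_le hβ hν t ξ)
    fun ξ => by rw [dampSym_neg]

theorem isSymbol_cutOne (N : ℕ) : IsSymbol (cutSym N fun _ => 1) :=
  isSymbol_cutSym N continuous_const fun _ => rfl

theorem isSymbol_cutDamp (β ν : ℝ) (N : ℕ) : IsSymbol (cutSym N (dampSym β ν)) :=
  isSymbol_cutSym N (continuous_dampSym β ν) (dampSym_neg β ν)

theorem isSymbol_cutExp (β ν : ℝ) (N : ℕ) (t : ℝ) :
    IsSymbol (cutSym N fun ξ => Real.exp (-(t * dampSym β ν ξ))) :=
  isSymbol_cutSym N (Real.continuous_exp.comp ((continuous_dampSym β ν).const_mul _).neg)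
    fun ξ => by rw [dampSym_neg]

theorem isSymbol_cutSqrt (ν : ℝ) (N : ℕ) : IsSymbol (cutSym N fun ξ => √(ν * lam ξ)) :=
  isSymbol_cutSym N (continuous_lam.const_mul ν).sqrt fun ξ => by rw [lam_neg]

theorem norm_cutOne_le (N : ℕ) (ξ : E3) : ‖cutSym N (fun _ => 1) ξ‖ ≤ 1 :=
  norm_cutSym_le zero_le_one (fun _ _ => by simp) ξ

end DampSym

section System

variable {α β ν : ℝ} (hα : 0 < α)

theorem tendsto_multY_cutOne (a : solenoidal α) :
    Tendsto (fun N => multY hα (isSymbol_cutOne N) a) atTop (𝓝 a) := by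
  refine tendsto_solenoidal fun k => ?_
  simp only [multY_apply]
  have h := tendsto_mult (l := atTop) isSymbol_cutOne (m := fun _ => 1)
    (by simpa using IsSymbol.const 1) (C := 1) (Eventually.of_forall norm_cutOne_le)
    (fun ξ => by simpa using tendsto_cutSym (fun _ => 1) ξ) (a.1 k)
  rwa [mult_one] at h

theorem multY_cutDamp (hν : 0 ≤ ν) (N : ℕ) (a : solenoidal α) :
    multY hα (isSymbol_cutDamp β ν N) a = β • multY hα (isSymbol_cutOne N) a +
      multY hα (isSymbol_cutSqrt ν N) (multY hα (isSymbol_cutSqrt ν N) a) := by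
  refine solenoidal_ext fun k => ?_
  change mult _ (a.1 k) = β • mult _ (a.1 k) + mult _ (mult _ (a.1 k))
  rw [mult_mult (isSymbol_cutSqrt ν N) (isSymbol_cutSqrt ν N),
    ← mult_const_mul β (isSymbol_cutOne N), ← mult_add ((isSymbol_cutOne N).const_mul β)
      ((isSymbol_cutSqrt ν N).mul (isSymbol_cutSqrt ν N))]
  congr 2
  funext ξ
  by_cases hξ : ‖ξ‖ ≤ N
  · simp only [cutSym_of_mem hξ, dampSym]
    have h0 : 0 ≤ ν * lam ξ := mul_nonneg hν (lam_nonneg ξ)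
    rw [← Complex.ofReal_mul (√(ν * lam ξ)), Real.mul_self_sqrt h0]
    push_cast
    ring
  · simp only [cutSym_of_notMem hξ, mul_zero, add_zero]

/-- Write the symbol as β + √(νλ)². Coercivity and monotonicity of the dissipation in N can both be
read off this sum of squares. -/
theorem inner_multY_cutDamp (hν : 0 ≤ ν) (N : ℕ) (a : solenoidal α) :
    inner ℝ (multY hα (isSymbol_cutDamp β ν N) a) a =
      β * ‖multY hα (isSymbol_cutOne N) a‖ ^ 2 + ‖multY hα (isSymbol_cutSqrt ν N) a‖ ^ 2 := by
  have e : inner ℝ (β • multY hα (isSymbol_cutOne N) a) a =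
      β * inner ℝ (multY hα (isSymbol_cutOne N) a) a :=
    real_inner_smul_left (F := solenoidal α) _ _ _
  rw [multY_cutDamp hα hν, inner_add_left, e,
    inner_multY hα (isSymbol_cutSqrt ν N) conj_cutSym, real_inner_self_eq_norm_sq,
    ← real_inner_self_eq_norm_sq (multY hα (isSymbol_cutOne N) a),
    inner_multY hα (isSymbol_cutOne N) conj_cutSym a (multY hα (isSymbol_cutOne N) a),
    multY_multY hα (isSymbol_cutOne N) (isSymbol_cutOne N) (isSymbol_cutOne N)
      (fun ξ => by rw [cutSym_mul]; simp), real_inner_comm a]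

/-- Below frequency N the generator is bounded, so the second-order remainder of the exponential is
O(h²) uniformly in ξ, hence in operator norm. -/
theorem hasDerivAt_multY_cutExp (hβ : 0 ≤ β) (hν : 0 ≤ ν) (N : ℕ) (t : ℝ) :
    HasDerivAt (fun t => multY hα (isSymbol_cutExp β ν N t))
      (-(multY hα (isSymbol_cutDamp β ν N) ∘L multY hα (isSymbol_cutExp β ν N t))) t := by
  obtain ⟨K, hK⟩ := (isCompact_closedBall (0 : E3) N).exists_bound_of_continuousOn
    (continuous_dampSym β ν).continuousOn
  have hK' : ∀ ξ : E3, ‖ξ‖ ≤ N → dampSym β ν ξ ≤ |K| := fun ξ hξ =>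
    (le_abs_self _).trans ((hK ξ (by simpa using hξ)).trans (le_abs_self K))
  refine (hasDerivAt_iff_isLittleO_nhds_zero (𝕜 := ℝ)
    (F := solenoidal α →L[ℝ] solenoidal α)).2 ?_
  have hbig : (fun h : ℝ => multY hα (isSymbol_cutExp β ν N (t + h)) -
      multY hα (isSymbol_cutExp β ν N t) -
      h • -(multY hα (isSymbol_cutDamp β ν N) ∘L multY hα (isSymbol_cutExp β ν N t)))
      =O[𝓝 0] fun h : ℝ => h ^ 2 := by
    refine Asymptotics.IsBigO.of_bound (Real.exp (|t| * |K|) * |K| ^ 2) ?_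
    have hsmall : ∀ᶠ h : ℝ in 𝓝 0, |h| * |K| ≤ 1 := by
      have : Tendsto (fun h : ℝ => |h| * |K|) (𝓝 0) (𝓝 (|0| * |K|)) :=
        (by fun_prop : Continuous fun h : ℝ => |h| * |K|).tendsto 0
      rw [abs_zero, zero_mul] at this
      exact this.eventually (ge_mem_nhds one_pos)
    filter_upwards [hsmall] with h hh
    have hs1 := isSymbol_cutExp β ν N (t + h)
    have hs2 := isSymbol_cutExp β ν N t
    have hs3 := (isSymbol_cutDamp β ν N).mul hs2
    have hs := (hs1.sub hs2).add (hs3.const_mul h)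
    have hb : ∀ ξ, ‖cutSym N (fun ξ => Real.exp (-((t + h) * dampSym β ν ξ))) ξ -
        cutSym N (fun ξ => Real.exp (-(t * dampSym β ν ξ))) ξ + (h : ℂ) * (cutSym N (dampSym β ν) ξ *
          cutSym N (fun ξ => Real.exp (-(t * dampSym β ν ξ))) ξ)‖ ≤
        Real.exp (|t| * |K|) * |K| ^ 2 * ‖h ^ 2‖ := fun ξ => by
      by_cases hξ : ‖ξ‖ ≤ N
      · simp only [cutSym_of_mem hξ]
        have ha0 := dampSym_nonneg hβ hν ξ
        have haK := hK' ξ hξ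
        set A := dampSym β ν ξ with hA
        have e : (((Real.exp (-((t + h) * A)) : ℝ) : ℂ) - ((Real.exp (-(t * A)) : ℝ) : ℂ) +
            (h : ℂ) * ((A : ℂ) * ((Real.exp (-(t * A)) : ℝ) : ℂ))) =
            ((Real.exp (-(t * A)) * (Real.exp (-(h * A)) - 1 - (-(h * A))) : ℝ) : ℂ) := by
          have : Real.exp (-((t + h) * A)) = Real.exp (-(t * A)) * Real.exp (-(h * A)) := by
            rw [← Real.exp_add]
            congr 1
            ring
          rw [this]
          push_cast
          ring
        rw [e, Complex.norm_real, norm_mul, Real.norm_eq_abs, Real.abs_exp]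
        have h1 : ‖-(h * A)‖ ≤ |h| * |K| := by
          rw [norm_neg, norm_mul, Real.norm_eq_abs, Real.norm_eq_abs, abs_of_nonneg ha0]
          exact mul_le_mul_of_nonneg_left haK (abs_nonneg _)
        have h2 := Real.norm_exp_sub_one_sub_id_le (h1.trans hh)
        have h3 : ‖-(h * A)‖ ^ 2 ≤ (|h| * |K|) ^ 2 := pow_le_pow_left₀ (norm_nonneg _) h1 2
        have h4 : Real.exp (-(t * A)) ≤ Real.exp (|t| * |K|) := by
          refine Real.exp_le_exp.2 ?_
          calc -(t * A) ≤ |t * A| := neg_le_abs _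
            _ = |t| * A := by rw [abs_mul, abs_of_nonneg ha0]
            _ ≤ |t| * |K| := mul_le_mul_of_nonneg_left haK (abs_nonneg _)
        calc _ ≤ Real.exp (|t| * |K|) * (|h| * |K|) ^ 2 :=
              mul_le_mul h4 (h2.trans h3) (norm_nonneg _) (Real.exp_pos _).le
          _ = _ := by
              rw [norm_pow, Real.norm_eq_abs]
              ring
      · simp only [cutSym_of_notMem hξ, sub_zero, mul_zero, add_zero, norm_zero]
        positivity
    refine ContinuousLinearMap.opNorm_le_bound _ (by positivity) fun a => ?_
    refine le_trans (le_of_eq ?_) (norm_multY_le hα hs hb a)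
    congr 1
    refine solenoidal_ext fun k => ?_
    change mult _ (a.1 k) - mult _ (a.1 k) - h • -(mult _ (mult _ (a.1 k))) = mult _ (a.1 k)
    rw [mult_add (hs1.sub hs2) (hs3.const_mul h), mult_sub hs1 hs2, mult_const_mul h hs3,
      mult_mult (isSymbol_cutDamp β ν N) hs2, smul_neg, sub_neg_eq_add]
  refine hbig.trans_isLittleO ?_
  simpa using Asymptotics.isLittleO_pow_pow (𝕜 := ℝ) (one_lt_two : (1 : ℕ) < 2)

/-- The Navier-Stokes-Bardina equations for `a = (1 - α²Δ)^{1/2} u`. -/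
def bardinaSystem (hβ : 0 < β) (hν : 0 < ν) (f : solenoidal α) : DampedSystem (solenoidal α) where
  β := β
  f := f
  T t := multY hα (isSymbol_heatSym hβ.le hν.le t)
  P N := multY hα (isSymbol_cutOne N)
  A N := multY hα (isSymbol_cutDamp β ν N)
  G N t := multY hα (isSymbol_cutExp β ν N t)
  B := bilin hα
  β_pos := hβ
  norm_T_le t := ContinuousLinearMap.opNorm_le_bound _ zero_le_one
    (norm_multY_le hα _ (norm_heatSym_le hβ.le hν.le t))
  continuous_T a := by
    refine continuous_iff_continuousAt.2 fun t => tendsto_solenoidal fun k => ?_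
    refine tendsto_mult (fun t => isSymbol_heatSym hβ.le hν.le t) (isSymbol_heatSym hβ.le hν.le t)
      (Eventually.of_forall (norm_heatSym_le hβ.le hν.le)) (fun ξ => ?_) _
    have : Continuous fun t => heatSym β ν t ξ := by
      unfold heatSym
      fun_prop
    exact this.tendsto t
  T_zero a := by
    refine solenoidal_ext fun k => ?_
    rw [multY_apply]
    have : heatSym β ν 0 = fun _ => 1 := by
      funext ξ
      simp [heatSym]
    rw [this, mult_one]
  P_T N t ht a := by
    refine multY_multY hα _ _ _ (fun ξ => ?_) a
    by_cases hξ : ‖ξ‖ ≤ N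
    · simp only [cutSym_of_mem hξ, heatSym, max_eq_left ht, Complex.ofReal_one, one_mul]
    · simp only [cutSym_of_notMem hξ, zero_mul]
  G_zero N a := by
    simp only [zero_mul, neg_zero, Real.exp_zero]
  G_add N s t a := by
    refine (multY_multY hα _ _ _ (fun ξ => ?_) a).symm
    rw [cutSym_mul]
    congr 1
    funext η
    rw [← Real.exp_add]
    congr 1
    ring
  hasDerivAt_G N t := hasDerivAt_multY_cutExp hα hβ.le hν.le N t
  inner_P N a b := inner_multY hα _ conj_cutSym a b
  P_P N a := multY_multY hα _ _ _ (fun ξ => by rw [cutSym_mul]; simp) a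
  norm_P_le N a := by simpa using norm_multY_le hα (isSymbol_cutOne N) (norm_cutOne_le N) a
  tendsto_P a := tendsto_multY_cutOne hα a
  A_P N a := multY_multY hα _ _ _ (fun ξ => by rw [cutSym_mul]; simp) a
  inner_A N a b := inner_multY hα _ conj_cutSym a b
  le_inner_A N a := by
    rw [inner_multY_cutDamp hα hν.le]
    exact le_add_of_nonneg_right (sq_nonneg _)
  inner_A_mono a := by
    intro N M hNM
    simp only [inner_multY_cutDamp hα hν.le, add_sub_cancel_left, norm_sq_solenoidal, multY_apply]
    refine Finset.sum_le_sum fun k _ => pow_le_pow_left₀ (norm_nonneg _) ?_ 2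
    rw [← one_mul ‖mult (cutSym M _) _‖]
    refine norm_mult_le_mul (isSymbol_cutSqrt ν N) (isSymbol_cutSqrt ν M) zero_le_one (fun ξ => ?_) _
    by_cases hξ : ‖ξ‖ ≤ N
    · rw [cutSym_of_mem hξ, cutSym_of_mem (hξ.trans (Nat.cast_le.2 hNM)), one_mul]
    · rw [cutSym_of_notMem hξ, norm_zero, one_mul]
      exact norm_nonneg _
  inner_B a := inner_bilin_self hα a
  tendsto_B l R a₀ hR h φ := tendsto_inner_bilin hα l R a₀ hR h φ

theorem diss_bardinaSystem (hβ : 0 < β) (hν : 0 < ν) (f : solenoidal α) (N : ℕ)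
    (a : solenoidal α) :
    (bardinaSystem hα hβ hν f).diss N a = ‖multY hα (isSymbol_cutSqrt ν N) a‖ ^ 2 := by
  change inner ℝ (multY hα (isSymbol_cutDamp β ν N) a) a -
    β * ‖multY hα (isSymbol_cutOne N) a‖ ^ 2 = _
  rw [inner_multY_cutDamp hα hν.le, add_sub_cancel_left]

end System

/-! ### The pressure -/

section Pressure

variable {α : ℝ} (hα : 0 < α)

/-- The symbol of `∂ₖ∂ⱼ(-Δ)⁻¹`. -/
def rieszSym (k j : Fin 3) (ξ : E3) : ℂ := dSym k ξ * dSym j ξ / (lam ξ : ℂ)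

/-- Where λ vanishes so do the derivative symbols, so the convention for division by zero does no
harm. -/
theorem rieszSym_mul_lam (k j : Fin 3) (ξ : E3) :
    rieszSym k j ξ * (lam ξ : ℂ) = dSym k ξ * dSym j ξ := by
  by_cases h : lam ξ = 0
  · have h1 : ‖dSym k ξ‖ ^ 2 ≤ 0 := h ▸ norm_dSym_sq_le k ξ
    have h2 : dSym k ξ = 0 := by
      rw [← norm_eq_zero]
      exact pow_eq_zero_iff two_ne_zero |>.1 (le_antisymm h1 (sq_nonneg _))
    rw [h, h2]
    simp
  · rw [rieszSym, div_mul_cancel₀]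
    exact_mod_cast h

theorem isSymbol_rieszSym (k j : Fin 3) : IsSymbol (rieszSym k j) := by
  refine ⟨((continuous_dSym k).mul (continuous_dSym j)).measurable.div
    (Complex.measurable_ofReal.comp continuous_lam.measurable), ⟨1, fun ξ => ?_⟩, fun ξ => ?_⟩
  · rw [rieszSym, norm_div, norm_mul, Complex.norm_real, Real.norm_of_nonneg (lam_nonneg ξ)]
    refine div_le_one_of_le₀ ?_ (lam_nonneg ξ)
    have h1 := norm_dSym_sq_le k ξ
    have h2 := norm_dSym_sq_le j ξ
    nlinarith [sq_nonneg (‖dSym k ξ‖ - ‖dSym j ξ‖)]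
  · rw [rieszSym, rieszSym, dSym_neg, dSym_neg, lam_neg, map_div₀, map_mul, Complex.conj_ofReal]

/-- The pressure before smoothing. -/
def pres (a : V3) : L2 ℝ := ∑ k, ∑ j, mult (rieszSym k j) (besselMul hα (a k) (a j))

theorem sum_inner_dSym_eq_zero (hα : 0 < α) (g : L2 ℝ) {c : V3} (hc : c ∈ solenoidal α) :
    ∑ k, inner ℝ (mult (fun ξ => dSym k ξ * sSym α ξ) g) (c k) = 0 := by
  have e : ∀ k, inner ℝ (mult (fun ξ => dSym k ξ * sSym α ξ) g) (c k) =
      -inner ℝ g (mult (fun ξ => dSym k ξ * sSym α ξ) (c k)) := fun k => by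
    rw [inner_mult_left (isSymbol_dSym_mul_sSym hα k), ← inner_neg_right,
      ← mult_neg (isSymbol_dSym_mul_sSym hα k)]
    simp only [map_mul, conj_dSym, conj_sSym, neg_mul]
  simp only [e]
  rw [Finset.sum_neg_distrib, ← inner_sum, mem_solenoidal.1 hc, inner_zero_right, neg_zero]

/-- Explicit Leray projection: taking the divergence, Σ dᵢ² = -λ cancels the Riesz denominators
against the double divergence of the products, so the corrected field is solenoidal; the correction
is a gradient, orthogonal to solenoidal fields. This singles out the pressure. -/
theorem coe_bilin (a : solenoidal α) (k : Fin 3) : (bilin hα a a).1 k =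
    transport hα a.1 a.1 k + mult (fun ξ => dSym k ξ * sSym α ξ) (pres hα a.1) := by
  set v : V3 := WithLp.toLp 2 fun k => transport hα a.1 a.1 k +
    mult (fun ξ => dSym k ξ * sSym α ξ) (pres hα a.1) with hv
  have hs := fun k => isSymbol_dSym_mul_sSym hα k
  have hmem : v ∈ solenoidal α := by
    rw [mem_solenoidal]
    simp only [hv, map_add, Finset.sum_add_distrib]
    have e1 : ∑ i, mult (fun ξ => dSym i ξ * sSym α ξ) (transport hα a.1 a.1 i) =
        ∑ i, ∑ j, mult (fun ξ => (dSym i ξ * sSym α ξ) * (dSym j ξ * sSym α ξ))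
          (besselMul hα (a.1 i) (a.1 j)) :=
      Finset.sum_congr rfl fun i _ => by
        rw [transport, divBessel_apply, map_sum]
        exact Finset.sum_congr rfl fun j _ => mult_mult (hs i) (hs j) _
    have e2 : ∑ i, mult (fun ξ => dSym i ξ * sSym α ξ) (mult (fun ξ => dSym i ξ * sSym α ξ)
        (pres hα a.1)) = ∑ i, ∑ j, mult (fun ξ => -((dSym i ξ * sSym α ξ) * (dSym j ξ * sSym α ξ)))
          (besselMul hα (a.1 i) (a.1 j)) := by
      have h1 : ∑ i, mult (fun ξ => dSym i ξ * sSym α ξ) (mult (fun ξ => dSym i ξ * sSym α ξ)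
          (pres hα a.1)) = mult (fun ξ => ∑ i, (dSym i ξ * sSym α ξ) * (dSym i ξ * sSym α ξ))
            (pres hα a.1) := by
        rw [mult_sum _ fun i => (hs i).mul (hs i)]
        exact Finset.sum_congr rfl fun i _ => mult_mult (hs i) (hs i) _
      have hsum := IsSymbol.sum Finset.univ fun i => (hs i).mul (hs i)
      rw [h1, pres, map_sum]
      refine Finset.sum_congr rfl fun i _ => ?_
      rw [map_sum]
      refine Finset.sum_congr rfl fun j _ => ?_
      rw [mult_mult hsum (isSymbol_rieszSym i j)]
      congr 2
      funext ξ
      have h2 : ∑ i, (dSym i ξ * sSym α ξ) * (dSym i ξ * sSym α ξ) =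
          -(lam ξ : ℂ) * (sSym α ξ * sSym α ξ) := by
        rw [← sum_dSym_sq, Finset.sum_mul]
        exact Finset.sum_congr rfl fun i _ => by ring
      rw [h2]
      linear_combination (-(sSym α ξ * sSym α ξ)) * rieszSym_mul_lam i j ξ
    rw [e1, e2, ← Finset.sum_add_distrib]
    refine Finset.sum_eq_zero fun i _ => ?_
    rw [← Finset.sum_add_distrib]
    refine Finset.sum_eq_zero fun j _ => ?_
    rw [mult_neg ((hs i).mul (hs j)), add_neg_cancel]
  have h := Submodule.eq_starProjection_of_mem_of_inner_eq_zero
    (K := solenoidal α) (u := transport hα a.1 a.1) hmem fun c hc => by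
      rw [inner_sub_left, PiLp.inner_apply, PiLp.inner_apply, ← Finset.sum_sub_distrib]
      simp only [hv, inner_add_left, sub_add_cancel_left]
      rw [Finset.sum_neg_distrib, sum_inner_dSym_eq_zero hα _ hc, neg_zero]
  rw [bilin_apply, ← Submodule.starProjection_apply, h]

end Pressure

/-! ### The residual of the momentum equation -/

section Residual

variable {α β ν : ℝ} (hα : 0 < α)

theorem multV_multV {m n p : E3 → ℂ} (hm : IsSymbol m) (hn : IsSymbol n)
    (h : ∀ ξ, m ξ * n ξ = p ξ) (a : V3) : multV m (multV n a) = multV p a := by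
  refine PiLp.ext fun k => ?_
  rw [multV_apply, multV_apply, multV_apply, mult_mult hm hn, funext h]

/-- The gradient of a function, smoothed by `(1 - α²Δ)⁻¹`. -/
def gradV (α : ℝ) : L2 ℝ →L[ℝ] V3 :=
  (PiLp.continuousLinearEquiv 2 ℝ (fun _ : Fin 3 => L2 ℝ)).symm.toContinuousLinearMap ∘L
    ContinuousLinearMap.pi fun k => mult fun ξ => dSym k ξ * rSym α ξ

theorem gradV_apply (α : ℝ) (p : L2 ℝ) (k : Fin 3) :
    gradV α p k = mult (fun ξ => dSym k ξ * rSym α ξ) p := rfl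

theorem isSymbol_rs (α : ℝ) : IsSymbol fun ξ => rSym α ξ * sSym α ξ :=
  (isSymbol_rSym α).mul (isSymbol_sSym α)

theorem isSymbol_lam_rs (hα : 0 < α) : IsSymbol fun ξ => (lam ξ : ℂ) * rSym α ξ * sSym α ξ :=
  (isSymbol_lam_mul_rSym hα).mul (isSymbol_sSym α)

/-- The spatial part `div ((u ⊗ u)_α) - νΔu + ∇p - f + βu` of the momentum equation for
`u = (1 - α²Δ)^{-1/2} a`, smoothed by `(1 - α²Δ)⁻¹`. -/
def bardinaResidual (β ν : ℝ) (f a : V3) (p : L2 ℝ) : V3 :=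
  multV (fun ξ => rSym α ξ * sSym α ξ) (transport hα a a + β • a - f) +
    ν • multV (fun ξ => (lam ξ : ℂ) * rSym α ξ * sSym α ξ) a + gradV α p

/-- The inverse of the symbol `r s`. -/
def invSym (α : ℝ) (ξ : E3) : ℝ := (1 + α ^ 2 * lam ξ) * √(1 + α ^ 2 * lam ξ)

theorem invSqrt_mul_sSym (α : ℝ) (ξ : E3) : ((√(1 + α ^ 2 * lam ξ) : ℝ) : ℂ) * sSym α ξ = 1 := by
  have h := one_add_pos α ξ
  rw [sSym, ← Complex.ofReal_mul, ← Real.sqrt_mul h.le, mul_inv_cancel₀ h.ne', Real.sqrt_one,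
    Complex.ofReal_one]

theorem invSym_mul (α : ℝ) (ξ : E3) : (invSym α ξ : ℂ) * (rSym α ξ * sSym α ξ) = 1 := by
  have h1 := invSqrt_mul_sSym α ξ
  have h2 := rSym_mul α ξ
  rw [invSym]
  push_cast
  linear_combination (((√(1 + α ^ 2 * lam ξ) : ℝ) : ℂ) * sSym α ξ) * h2 + h1

theorem continuous_one_add (α : ℝ) : Continuous fun ξ => 1 + α ^ 2 * lam ξ :=
  continuous_const.add (continuous_lam.const_mul _)

theorem isSymbol_cutInv (α : ℝ) (N : ℕ) : IsSymbol (cutSym N (invSym α)) :=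
  isSymbol_cutSym N ((continuous_one_add α).mul (continuous_one_add α).sqrt)
    fun ξ => by rw [invSym, invSym, lam_neg]

theorem isSymbol_cutOneAdd (α : ℝ) (N : ℕ) : IsSymbol (cutSym N fun ξ => 1 + α ^ 2 * lam ξ) :=
  isSymbol_cutSym N (continuous_one_add α) fun ξ => by rw [lam_neg]

theorem isSymbol_cutLam (N : ℕ) : IsSymbol (cutSym N lam) :=
  isSymbol_cutSym N continuous_lam lam_neg

theorem multV_cutDamp (β ν : ℝ) (N : ℕ) (a : V3) : multV (cutSym N (dampSym β ν)) a =
    β • multV (cutSym N fun _ => 1) a + ν • multV (cutSym N lam) a := by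
  refine PiLp.ext fun k => ?_
  change mult _ (a k) = β • mult _ (a k) + ν • mult _ (a k)
  rw [← mult_const_mul β (isSymbol_cutOne N), ← mult_const_mul ν (isSymbol_cutLam N),
    ← mult_add ((isSymbol_cutOne N).const_mul β) ((isSymbol_cutLam N).const_mul ν)]
  congr 2
  funext ξ
  by_cases hξ : ‖ξ‖ ≤ N
  · simp only [cutSym_of_mem hξ, dampSym]
    push_cast
    ring
  · simp only [cutSym_of_notMem hξ, mul_zero, add_zero]

theorem multV_cutInv_residual (f a : V3) (p : L2 ℝ) (N : ℕ) :
    multV (cutSym N (invSym α)) (bardinaResidual hα β ν f a p) =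
      multV (cutSym N fun _ => 1) (transport hα a a - f) + multV (cutSym N (dampSym β ν)) a +
        multV (cutSym N (invSym α)) (gradV α p) := by
  rw [bardinaResidual, map_add, map_add, map_smul, multV_multV (isSymbol_cutInv α N) (isSymbol_rs α)
    (p := cutSym N fun _ => 1) (fun ξ => ?_), multV_multV (isSymbol_cutInv α N)
    (isSymbol_lam_rs hα) (p := cutSym N lam) (fun ξ => ?_), multV_cutDamp]
  · simp only [map_add, map_sub, map_smul]
    abel
  · by_cases hξ : ‖ξ‖ ≤ N
    · simp only [cutSym_of_mem hξ]
      linear_combination (lam ξ : ℂ) * invSym_mul α ξ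
    · simp only [cutSym_of_notMem hξ, zero_mul]
  · by_cases hξ : ‖ξ‖ ≤ N
    · simp only [cutSym_of_mem hξ, Complex.ofReal_one]
      exact invSym_mul α ξ
    · simp only [cutSym_of_notMem hξ, zero_mul]

theorem multV_cutInv_gradV (hα : 0 < α) (p : L2 ℝ) (N : ℕ) (k : Fin 3) :
    multV (cutSym N (invSym α)) (gradV α p) k =
      mult (fun ξ => dSym k ξ * sSym α ξ) (mult (cutSym N fun ξ => 1 + α ^ 2 * lam ξ) p) := by
  rw [multV_apply, gradV_apply, mult_mult (isSymbol_cutInv α N) (isSymbol_dSym_mul_rSym hα k),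
    mult_mult (isSymbol_dSym_mul_sSym hα k) (isSymbol_cutOneAdd α N)]
  congr 2
  funext ξ
  by_cases hξ : ‖ξ‖ ≤ N
  · simp only [cutSym_of_mem hξ]
    have h1 := invSym_mul α ξ
    have h2 := sSym_mul_self α ξ
    have h3 := rSym_mul α ξ
    have h4 := sSym_ne_zero α ξ
    refine mul_right_cancel₀ h4 ?_
    push_cast
    linear_combination dSym k ξ * h1 - dSym k ξ * (1 + (α : ℂ) ^ 2 * (lam ξ : ℂ)) * h2 -
      dSym k ξ * h3
  · simp only [cutSym_of_notMem hξ, zero_mul, mul_zero]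

/-- Below frequency N the smoothing can be inverted, and the Leray projection annihilates the
gradient of any pressure. A weak solution therefore yields the abstract truncated equation whatever
its pressure is. -/
theorem orthogonalProjection_residual (hβ : 0 < β) (hν : 0 < ν) (f a : solenoidal α) (p : L2 ℝ)
    (N : ℕ) : (solenoidal α).orthogonalProjectionOnto
        (multV (cutSym N (invSym α)) (bardinaResidual hα β ν f.1 a.1 p)) =
      (bardinaSystem hα hβ hν f).A N a -
        (bardinaSystem hα hβ hν f).P N ((bardinaSystem hα hβ hν f).force a) := by
  have hgrad : (solenoidal α).orthogonalProjectionOnto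
      (multV (cutSym N (invSym α)) (gradV α p)) = 0 := by
    refine ext_inner_right ℝ fun c => ?_
    rw [Submodule.inner_orthogonalProjectionOnto_eq_of_mem_right, inner_zero_left,
      PiLp.inner_apply]
    simp only [multV_cutInv_gradV hα]
    exact sum_inner_dSym_eq_zero hα _ c.2
  have hone : ∀ h : V3, (solenoidal α).orthogonalProjectionOnto (multV (cutSym N fun _ => 1) h) =
      multY hα (isSymbol_cutOne N) ((solenoidal α).orthogonalProjectionOnto h) := fun h => by
    refine ext_inner_right ℝ fun c => ?_
    rw [Submodule.inner_orthogonalProjectionOnto_eq_of_mem_right,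
      inner_multY hα (isSymbol_cutOne N) conj_cutSym,
      Submodule.inner_orthogonalProjectionOnto_eq_of_mem_right, PiLp.inner_apply, PiLp.inner_apply]
    exact Finset.sum_congr rfl fun k _ => inner_mult_of_real (isSymbol_cutOne N) conj_cutSym _ _
  have hmem : (solenoidal α).orthogonalProjectionOnto (multV (cutSym N (dampSym β ν)) a.1) =
      multY hα (isSymbol_cutDamp β ν N) a :=
    Submodule.orthogonalProjectionOnto_mem_subspace_eq_self
      (multY hα (isSymbol_cutDamp β ν N) a)
  have hf : (solenoidal α).orthogonalProjectionOnto f.1 = f :=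
    Submodule.orthogonalProjectionOnto_mem_subspace_eq_self f
  rw [multV_cutInv_residual, map_add, map_add, hgrad, hone, hmem, map_sub, hf, ← bilin_apply]
  change _ = multY hα (isSymbol_cutDamp β ν N) a -
    multY hα (isSymbol_cutOne N) (f - bilin hα a a)
  simp only [map_sub]
  abel

theorem gradV_pressure (a : V3) (k : Fin 3) : gradV α (mult (rSym α) (pres hα a)) k =
    mult (fun ξ => rSym α ξ * sSym α ξ) (mult (fun ξ => dSym k ξ * sSym α ξ) (pres hα a)) := by
  rw [gradV_apply, mult_mult (isSymbol_dSym_mul_rSym hα k) (isSymbol_rSym α),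
    mult_mult (isSymbol_rs α) (isSymbol_dSym_mul_sSym hα k)]
  congr 2
  funext ξ
  linear_combination (-(dSym k ξ * rSym α ξ)) * sSym_mul_self α ξ

/-- For the explicit pressure the gradient supplies exactly what the Leray projection removes from
the transport term, so the abstract equation returns the full momentum balance. -/
theorem residual_pressure (hβ : 0 < β) (hν : 0 < ν) (f a : solenoidal α) (N : ℕ) :
    multV (cutSym N fun _ => 1) (bardinaResidual hα β ν f.1 a.1 (mult (rSym α) (pres hα a.1))) =
      multV (fun ξ => rSym α ξ * sSym α ξ) ((bardinaSystem hα hβ hν f).A N a -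
        (bardinaSystem hα hβ hν f).P N ((bardinaSystem hα hβ hν f).force a)).1 := by
  have h1 : bardinaResidual hα β ν f.1 a.1 (mult (rSym α) (pres hα a.1)) =
      multV (fun ξ => rSym α ξ * sSym α ξ) ((bilin hα a a).1 + β • a.1 - f.1) +
        ν • multV (fun ξ => (lam ξ : ℂ) * rSym α ξ * sSym α ξ) a.1 := by
    have h2 : (bilin hα a a).1 = transport hα a.1 a.1 + WithLp.toLp 2 fun k =>
        mult (fun ξ => dSym k ξ * sSym α ξ) (pres hα a.1) := PiLp.ext fun k => coe_bilin hα a k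
    have h3 : gradV α (mult (rSym α) (pres hα a.1)) = multV (fun ξ => rSym α ξ * sSym α ξ)
        (WithLp.toLp 2 fun k => mult (fun ξ => dSym k ξ * sSym α ξ) (pres hα a.1)) :=
      PiLp.ext fun k => gradV_pressure hα a.1 k
    rw [bardinaResidual, h3, h2]
    simp only [map_add, map_sub]
    abel
  have h4 : ((bardinaSystem hα hβ hν f).A N a -
        (bardinaSystem hα hβ hν f).P N ((bardinaSystem hα hβ hν f).force a)).1 =
      multV (cutSym N (dampSym β ν)) a.1 -
        multV (cutSym N fun _ => 1) (f.1 - (bilin hα a a).1) := rfl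
  have hcomm : ∀ h, multV (cutSym N fun _ => 1) (multV (fun ξ => rSym α ξ * sSym α ξ) h) =
      multV (fun ξ => rSym α ξ * sSym α ξ) (multV (cutSym N fun _ => 1) h) := fun h => by
    rw [multV_multV (isSymbol_cutOne N) (isSymbol_rs α) (fun _ => rfl),
      multV_multV (isSymbol_rs α) (isSymbol_cutOne N) (fun _ => mul_comm _ _)]
  have hlam : multV (cutSym N fun _ => 1)
      (multV (fun ξ => (lam ξ : ℂ) * rSym α ξ * sSym α ξ) a.1) =
      multV (fun ξ => rSym α ξ * sSym α ξ) (multV (cutSym N lam) a.1) := by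
    rw [multV_multV (isSymbol_cutOne N) (isSymbol_lam_rs hα) (fun _ => rfl),
      multV_multV (isSymbol_rs α) (isSymbol_cutLam N) (fun ξ => ?_)]
    by_cases hξ : ‖ξ‖ ≤ N
    · simp only [cutSym_of_mem hξ]
      push_cast
      ring
    · simp only [cutSym_of_notMem hξ, zero_mul, mul_zero]
  rw [h1, h4, map_add, map_smul, hcomm, hlam, multV_cutDamp]
  simp only [map_add, map_sub, map_smul]
  abel

end Residual

/-! ### Spatial test fields -/

theorem L2.integrable_mul (g h : L2 ℝ) : Integrable (fun x => g x * h x) volume := by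
  simpa [mul_comm] using L2.integrable_inner (𝕜 := ℝ) g h

theorem L2.integral_mul (g h : L2 ℝ) : ∫ x, g x * h x = inner ℝ g h := by
  rw [L2.inner_def]
  exact integral_congr_ae (Eventually.of_forall fun x => by simp [mul_comm])

section TestFields

variable {ψ : E3 → E3}

theorem IsTest.component (hψ : IsTest ψ) (k : Fin 3) : IsTest fun x => ψ x k :=
  ⟨(EuclideanSpace.proj (𝕜 := ℝ) k).contDiff.comp hψ.1,
    hψ.2.comp_left (g := fun v : E3 => v k) rfl⟩

theorem pderiv3_component (hψ : IsTest ψ) (j k : Fin 3) (x : E3) :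
    pderiv3 j ψ x k = pderiv3 j (fun y => ψ y k) x := by
  have h := (EuclideanSpace.proj (𝕜 := ℝ) k).hasFDerivAt.comp x
    (hψ.1.differentiable (by simp) x).hasFDerivAt
  have h' : fderiv ℝ (fun y => ψ y k) x = (EuclideanSpace.proj (𝕜 := ℝ) k) ∘L fderiv ℝ ψ x :=
    h.fderiv
  rw [pderiv3, pderiv3, h']
  rfl

theorem laplacian_component (hψ : IsTest ψ) (k : Fin 3) (x : E3) :
    Laplacian.laplacian ψ x k = Laplacian.laplacian (fun y => ψ y k) x := by
  have h := (hψ.1.of_le two_le_infty).contDiffAt (x := x) |>.laplacian_CLM_comp_left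
    (l := EuclideanSpace.proj (𝕜 := ℝ) k)
  exact h.symm

/-- The field `ψ` as an element of `L²`. -/
def IsTest.toV3 (hψ : IsTest ψ) : V3 := WithLp.toLp 2 fun k => (hψ.component k).toL2

/-- The field `ψ - α²Δψ` as an element of `L²`. -/
def IsTest.helmV (α : ℝ) (hψ : IsTest ψ) : V3 :=
  WithLp.toLp 2 fun k => ((hψ.component k).helm α).toL2

theorem IsTest.toV3_eq (α : ℝ) (hψ : IsTest ψ) : hψ.toV3 = multV (rSym α) (hψ.helmV α) :=
  PiLp.ext fun k => (hψ.component k).toL2_eq α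

theorem inner_multV_of_real {m : E3 → ℂ} (hm : IsSymbol m) (hr : ∀ ξ, conj (m ξ) = m ξ)
    (a b : V3) : inner ℝ (multV m a) b = inner ℝ a (multV m b) := by
  rw [PiLp.inner_apply, PiLp.inner_apply]
  exact Finset.sum_congr rfl fun k _ => inner_mult_of_real hm hr _ _

theorem inner_multV_helmV (α : ℝ) (hψ : IsTest ψ) (b : V3) :
    inner ℝ (multV (fun ξ => rSym α ξ * sSym α ξ) b) (hψ.helmV α) =
      ∑ i, inner ℝ (mult (sSym α) (b i)) (hψ.component i).toL2 := by
  rw [PiLp.inner_apply]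
  refine Finset.sum_congr rfl fun i _ => ?_
  rw [(hψ.component i).toL2_eq α, multV_apply, ← mult_mult (isSymbol_rSym α) (isSymbol_sSym α),
    inner_mult_of_real (isSymbol_rSym α) (conj_rSym α)]
  rfl

theorem besselField_ae (α : ℝ) (b : V3) (i : Fin 3) :
    (fun x => besselField α b x i) =ᵐ[volume] mult (sSym α) (b i) := by
  rw [← comp_besselField]
  exact (coeFn_comp i _).symm

theorem inner_E3 (v w : E3) : inner ℝ v w = ∑ i, v i * w i := by
  rw [PiLp.inner_apply]
  exact Finset.sum_congr rfl fun i _ => by simp [mul_comm]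

theorem integral_inner_besselField (α : ℝ) (hψ : IsTest ψ) (b : V3) :
    ∫ x, inner ℝ (besselField α b x) (ψ x) =
      inner ℝ (multV (fun ξ => rSym α ξ * sSym α ξ) b) (hψ.helmV α) := by
  rw [inner_multV_helmV]
  have h : (fun x => inner ℝ (besselField α b x) (ψ x)) =ᵐ[volume] fun x =>
      ∑ i, mult (sSym α) (b i) x * (hψ.component i).toL2 x := by
    filter_upwards [ae_all_iff.2 (besselField_ae α b),
      ae_all_iff.2 fun i => (hψ.component i).coeFn_toL2] with x h1 h2
    simp only [inner_E3, h1, h2]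
  rw [integral_congr_ae h, integral_finsetSum _ fun i _ => L2.integrable_mul _ _]
  simp only [L2.integral_mul]

variable {α : ℝ} (hα : 0 < α) (β ν : ℝ) (f a : V3) (p : L2 ℝ)

/-- Each derivative of the test field is a symmetric or skew multiplier of `helmV`, and is moved
onto the unknown term by term. -/
theorem inner_bardinaResidual (hψ : IsTest ψ) :
    inner ℝ (bardinaResidual hα β ν f a p) (hψ.helmV α) =
      -∑ i, ∑ j, inner ℝ (mult (rSym α) (besselMul hα (a i) (a j)))
          ((hψ.component i).partial_isTest j).toL2
        - ν * ∑ i, inner ℝ (mult (sSym α) (a i)) (hψ.component i).laplacian.toL2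
        - ∑ i, inner ℝ p ((hψ.component i).partial_isTest i).toL2
        - ∑ i, inner ℝ (mult (sSym α) (f i)) (hψ.component i).toL2
        + β * ∑ i, inner ℝ (mult (sSym α) (a i)) (hψ.component i).toL2 := by
  have hr := isSymbol_rSym α
  have hs := isSymbol_sSym α
  have hrs : ∀ ξ, conj (rSym α ξ * sSym α ξ) = rSym α ξ * sSym α ξ := fun ξ => by
    rw [map_mul, conj_rSym, conj_sSym]
  have e0 := inner_multV_helmV α hψ
  have e1 : inner ℝ (multV (fun ξ => rSym α ξ * sSym α ξ) (transport hα a a)) (hψ.helmV α) =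
      -∑ i, ∑ j, inner ℝ (mult (rSym α) (besselMul hα (a i) (a j)))
          ((hψ.component i).partial_isTest j).toL2 := by
    rw [inner_multV_of_real (isSymbol_rs α) hrs, inner_transport]
    congr 1
    refine Finset.sum_congr rfl fun i _ => Finset.sum_congr rfl fun j _ => ?_
    rw [(hψ.component i).toL2_partial_eq hα, inner_mult_of_real hr (conj_rSym α),
      mult_mult hr (isSymbol_dSym_mul_rSym hα j), multV_apply,
      mult_mult (isSymbol_dSym_mul_sSym hα j) (isSymbol_rs α)]
    congr 2
    refine congrArg mult (funext fun ξ => ?_)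
    linear_combination (dSym j ξ * rSym α ξ) * sSym_mul_self α ξ
  have e2 : inner ℝ (multV (fun ξ => (lam ξ : ℂ) * rSym α ξ * sSym α ξ) a) (hψ.helmV α) =
      -∑ i, inner ℝ (mult (sSym α) (a i)) (hψ.component i).laplacian.toL2 := by
    rw [PiLp.inner_apply, ← Finset.sum_neg_distrib]
    refine Finset.sum_congr rfl fun i _ => ?_
    rw [(hψ.component i).toL2_laplacian_eq hα, inner_neg_right, neg_neg, multV_apply,
      ← mult_mult (isSymbol_lam_mul_rSym hα) hs, inner_mult_of_real (isSymbol_lam_mul_rSym hα)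
        fun ξ => by rw [map_mul, conj_rSym, Complex.conj_ofReal]]
    rfl
  have e3 : inner ℝ (gradV α p) (hψ.helmV α) =
      -∑ i, inner ℝ p ((hψ.component i).partial_isTest i).toL2 := by
    rw [PiLp.inner_apply, ← Finset.sum_neg_distrib]
    refine Finset.sum_congr rfl fun i _ => ?_
    rw [(hψ.component i).toL2_partial_eq hα, gradV_apply, inner_mult_dSym_mul_rSym hα]
    rfl
  rw [bardinaResidual, inner_add_left, inner_add_left, map_sub, map_add, inner_sub_left,
    inner_add_left, map_smul, real_inner_smul_left, real_inner_smul_left, e1, e0, e0, e2, e3]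
  ring

theorem integral_space {ψ' : E3 → E3} (hψ : IsTest ψ) (hψ' : IsTest ψ') :
    ∫ x, (- inner ℝ (besselField α a x) (ψ' x)
        - ∑ i, ∑ j, helmholtzFilter α (fun y => besselField α a y i * besselField α a y j) x
            * pderiv3 j ψ x i
        - ν * inner ℝ (besselField α a x) (Laplacian.laplacian ψ x)
        - p x * ∑ i, pderiv3 i ψ x i
        - inner ℝ (besselField α f x) (ψ x)
        + β * inner ℝ (besselField α a x) (ψ x)) =
      -inner ℝ (multV (fun ξ => rSym α ξ * sSym α ξ) a) (hψ'.helmV α) +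
        inner ℝ (bardinaResidual hα β ν f a p) (hψ.helmV α) := by
  have hfield := besselField_ae α
  have hQ : ∀ i j, helmholtzFilter α (fun y => besselField α a y i * besselField α a y j) =
      mult (rSym α) (besselMul hα (a i) (a j)) := fun i j => by
    refine helmholtzFilter_eq ?_
    filter_upwards [hfield a i, hfield a j, coeFn_besselMul hα (a i) (a j)] with x h1 h2 h3
    rw [h1, h2, h3]
  have hL : ∀ i, ⇑(hψ.component i).laplacian.toL2 =ᵐ[volume]
      fun x => Laplacian.laplacian (fun y => ψ y i) x := fun i => IsTest.coeFn_toL2 _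
  have e0 := inner_multV_helmV α hψ' a
  have hI := fun g h : L2 ℝ => L2.integrable_mul g h
  have i1 : Integrable (fun x => ∑ i, mult (sSym α) (a i) x * (hψ'.component i).toL2 x) :=
    integrable_finsetSum _ fun i _ => hI _ _
  have i2 : Integrable (fun x => ∑ i, ∑ j, mult (rSym α) (besselMul hα (a i) (a j)) x *
      ((hψ.component i).partial_isTest j).toL2 x) :=
    integrable_finsetSum _ fun i _ => integrable_finsetSum _ fun j _ => hI _ _
  have i3 : Integrable (fun x => ∑ i, mult (sSym α) (a i) x * (hψ.component i).laplacian.toL2 x) :=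
    integrable_finsetSum _ fun i _ => hI _ _
  have i4 : Integrable (fun x => ∑ i, p x * ((hψ.component i).partial_isTest i).toL2 x) :=
    integrable_finsetSum _ fun i _ => hI _ _
  have i5 : ∀ b : V3, Integrable (fun x => ∑ i, mult (sSym α) (b i) x * (hψ.component i).toL2 x) :=
    fun b => integrable_finsetSum _ fun i _ => hI _ _
  rw [inner_bardinaResidual, e0]
  have hcongr : (fun x => (- inner ℝ (besselField α a x) (ψ' x)
        - ∑ i, ∑ j, helmholtzFilter α (fun y => besselField α a y i * besselField α a y j) x
            * pderiv3 j ψ x i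
        - ν * inner ℝ (besselField α a x) (Laplacian.laplacian ψ x)
        - p x * ∑ i, pderiv3 i ψ x i
        - inner ℝ (besselField α f x) (ψ x)
        + β * inner ℝ (besselField α a x) (ψ x))) =ᵐ[volume] fun x =>
      -(∑ i, mult (sSym α) (a i) x * (hψ'.component i).toL2 x)
        - (∑ i, ∑ j, mult (rSym α) (besselMul hα (a i) (a j)) x *
          ((hψ.component i).partial_isTest j).toL2 x)
        - ν * (∑ i, mult (sSym α) (a i) x * (hψ.component i).laplacian.toL2 x)
        - (∑ i, p x * ((hψ.component i).partial_isTest i).toL2 x)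
        - (∑ i, mult (sSym α) (f i) x * (hψ.component i).toL2 x)
        + β * (∑ i, mult (sSym α) (a i) x * (hψ.component i).toL2 x) := by
    filter_upwards [ae_all_iff.2 (hfield a), ae_all_iff.2 (hfield f), ae_all_iff.2 hL,
      ae_all_iff.2 fun i => ae_all_iff.2 fun j => ((hψ.component i).partial_isTest j).coeFn_toL2,
      ae_all_iff.2 fun i => (hψ.component i).coeFn_toL2,
      ae_all_iff.2 fun i => (hψ'.component i).coeFn_toL2] with x h1 h2 h3 h4 h5 h6
    simp only [inner_E3, hQ, h1, h2, h3, h4, h5, h6, pderiv3_component hψ, laplacian_component hψ,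
      Finset.mul_sum]
  rw [integral_congr_ae hcongr, integral_add, integral_sub, integral_sub, integral_sub,
    integral_sub, integral_neg, integral_const_mul, integral_const_mul,
    integral_finsetSum _ fun i _ => hI _ _, integral_finsetSum _ fun i _ =>
      integrable_finsetSum _ fun j _ => hI _ _, integral_finsetSum _ fun i _ => hI _ _,
    integral_finsetSum _ fun i _ => hI _ _, integral_finsetSum _ fun i _ => hI _ _,
    integral_finsetSum _ fun i _ => hI _ _]
  · simp only [integral_finsetSum _ fun j _ => hI _ _, L2.integral_mul]
    ring
  · exact i1.neg
  · exact i2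
  · exact i1.neg.sub i2
  · exact i3.const_mul ν
  · exact (i1.neg.sub i2).sub (i3.const_mul ν)
  · exact i4
  · exact ((i1.neg.sub i2).sub (i3.const_mul ν)).sub i4
  · exact i5 f
  · exact (((i1.neg.sub i2).sub (i3.const_mul ν)).sub i4).sub (i5 f)
  · exact (i5 a).const_mul β

end TestFields

/-! ### Time slices of test fields -/

section Slices

variable {F : Type*} [NormedAddCommGroup F] [NormedSpace ℝ F] {φ : ℝ × E3 → F}

theorem IsTest.slice (hφ : IsTest φ) (t : ℝ) : IsTest fun x => φ (t, x) := by
  refine ⟨hφ.1.comp (contDiff_prodMk_right t), ?_⟩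
  refine HasCompactSupport.intro (hφ.2.isCompact.image continuous_snd) fun x hx => ?_
  by_contra h
  exact hx ⟨(t, x), subset_tsupport _ h, rfl⟩

theorem IsTest.timeDeriv (hφ : IsTest φ) : IsTest fun z => fderiv ℝ φ z (1, 0) :=
  ⟨(hφ.1.fderiv_right (m := ∞) (by simp)).clm_apply contDiff_const, hφ.2.fderiv_apply ℝ _⟩

theorem IsTest.hasDerivAt_time (hφ : IsTest φ) (t : ℝ) (x : E3) :
    HasDerivAt (fun s => φ (s, x)) (fderiv ℝ φ (t, x) (1, 0)) t := by
  have h1 : HasDerivAt (fun s : ℝ => (s, x)) ((1 : ℝ), (0 : E3)) t :=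
    (hasDerivAt_id t).prodMk (hasDerivAt_const t x)
  exact (hφ.1.differentiable (by simp) (t, x)).hasFDerivAt.comp_hasDerivAt t h1

end Slices

/-- Pairing with `helmV` puts the whole weak formulation into L². The equivalence serves twice: weak
solutions are mapped to the abstract system, and mild solutions are shown to be weak ones. -/
theorem weakEquation_iff {α : ℝ} (hα : 0 < α) (β ν : ℝ) (f u₀ : energySpace α)
    (u : ℝ → energySpace α) (p : ℝ → L2 ℝ) {φ : ℝ × E3 → E3} (hφ : IsTest φ) :
    (∫ t in Ioi (0 : ℝ), ∫ x,
      (- inner ℝ (vField (u t) x) (deriv (fun s => φ (s, x)) t)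
        - ∑ i, ∑ j, helmholtzFilter α (fun y => vField (u t) y i * vField (u t) y j) x
            * pderiv3 j (fun y => φ (t, y)) x i
        - ν * inner ℝ (vField (u t) x) (Laplacian.laplacian (fun y => φ (t, y)) x)
        - p t x * ∑ i, pderiv3 i (fun y => φ (t, y)) x i
        - inner ℝ (vField f x) (φ (t, x))
        + β * inner ℝ (vField (u t) x) (φ (t, x)))
      = ∫ x, inner ℝ (vField u₀ x) (φ (0, x))) ↔
    ∫ t in Ioi (0 : ℝ),
      (-inner ℝ (multV (fun ξ => rSym α ξ * sSym α ξ) ((toEnergy hα).symm (u t)).1)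
          ((hφ.timeDeriv.slice t).helmV α) +
        inner ℝ (bardinaResidual hα β ν ((toEnergy hα).symm f).1 ((toEnergy hα).symm (u t)).1 (p t))
          ((hφ.slice t).helmV α)) =
      inner ℝ (multV (fun ξ => rSym α ξ * sSym α ξ) ((toEnergy hα).symm u₀).1)
        ((hφ.slice 0).helmV α) := by
  have hv : ∀ w : energySpace α, vField w = besselField α ((toEnergy hα).symm w).1 := fun w => by
    rw [← vField_toEnergy hα, LinearIsometryEquiv.apply_symm_apply]
  rw [← integral_inner_besselField, ← hv]
  refine Eq.congr_left ?_
  refine integral_congr_ae (Eventually.of_forall fun t => ?_)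
  dsimp only
  rw [← integral_space hα β ν _ _ (p t) (hφ.slice t) (hφ.timeDeriv.slice t), ← hv, ← hv]
  simp only [(hφ.hasDerivAt_time t _).deriv]

/-! ### Weak formulations of evolution equations in Hilbert space -/

section WeakEvolution

variable {X : Type*} [NormedAddCommGroup X] [InnerProductSpace ℝ X] [CompleteSpace X]

/-- Tested against a fixed vector this is integration by parts for scalar absolutely continuous
functions, which only needs h integrable. -/
theorem integral_deriv_smul_primitive {θ : ℝ → ℝ} (hθ : ContDiff ℝ ∞ θ) {h : ℝ → X} {M : ℝ}
    (hh : IntervalIntegrable h volume 0 M) :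
    ∫ t in (0 : ℝ)..M, deriv θ t • (∫ s in (0 : ℝ)..t, h s) =
      θ M • (∫ s in (0 : ℝ)..M, h s) - ∫ t in (0 : ℝ)..M, θ t • h t := by
  have hθ' : Continuous (deriv θ) := hθ.continuous_deriv (by simp)
  have hprim : ContinuousOn (fun t => ∫ s in (0 : ℝ)..t, h s) (uIcc 0 M) :=
    intervalIntegral.continuousOn_primitive_interval' hh left_mem_uIcc
  have i1 : IntervalIntegrable (fun t => deriv θ t • (∫ s in (0 : ℝ)..t, h s)) volume 0 M :=
    (hθ'.continuousOn.smul hprim).intervalIntegrable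
  have i2 : IntervalIntegrable (fun t => θ t • h t) volume 0 M :=
    hh.continuousOn_smul hθ.continuous.continuousOn
  have hsub : ∀ t ∈ uIcc 0 M, IntervalIntegrable h volume 0 t := fun t ht =>
    hh.mono_set (uIcc_subset_uIcc left_mem_uIcc ht)
  refine ext_inner_right ℝ fun c => ?_
  have hc : IntervalIntegrable (fun t => inner ℝ (h t) c) volume 0 M :=
    ⟨hh.1.inner_const c, hh.2.inner_const c⟩
  have key := (hθ.contDiffOn.of_le (by simp)).absolutelyContinuousOnInterval (a := 0) (b := M)
    |>.integral_deriv_mul_eq_sub (hc.absolutelyContinuousOnInterval_intervalIntegral left_mem_uIcc)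
  rw [intervalIntegral.integral_same, mul_zero, sub_zero] at key
  have e1 : ∫ t in (0 : ℝ)..M, (deriv θ t * (∫ s in (0 : ℝ)..t, inner ℝ (h s) c) +
      θ t * deriv (fun t => ∫ s in (0 : ℝ)..t, inner ℝ (h s) c) t) =
      ∫ t in (0 : ℝ)..M, (inner ℝ (deriv θ t • (∫ s in (0 : ℝ)..t, h s)) c +
        inner ℝ (θ t • h t) c) := by
    refine intervalIntegral.integral_congr_ae ?_
    filter_upwards [hc.ae_hasDerivAt_integral] with t ht htm
    have htm' := uIoc_subset_uIcc htm
    rw [(ht htm' 0 left_mem_uIcc).deriv, real_inner_smul_left, real_inner_smul_left,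
      integral_inner_left (hsub t htm')]
  have j1 : IntervalIntegrable (fun t => inner ℝ (deriv θ t • (∫ s in (0 : ℝ)..t, h s)) c)
      volume 0 M := ⟨i1.1.inner_const c, i1.2.inner_const c⟩
  have j2 : IntervalIntegrable (fun t => inner ℝ (θ t • h t) c) volume 0 M :=
    ⟨i2.1.inner_const c, i2.2.inner_const c⟩
  rw [e1, intervalIntegral.integral_add j1 j2, ← integral_inner_left i1, ← integral_inner_left i2,
    ← integral_inner_left hh] at key
  rw [inner_sub_left, real_inner_smul_left, ← key]
  ring

/-- A du Bois-Reymond argument with initial datum: the difference d of the two sides is tested with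
χ supported in positive times, using a primitive of χ as test function in the hypothesis. -/
theorem ae_eq_of_weak_evolution {g h : ℝ → X} {g₀ : X} (hg : ∀ T, IntegrableOn g (Ioc 0 T))
    (hh : ∀ T, IntegrableOn h (Ioc 0 T))
    (H : ∀ θ : ℝ → ℝ, IsTest θ →
      ∫ t in Ioi (0 : ℝ), (-(deriv θ t • g t) + θ t • h t) = θ 0 • g₀) :
    ∀ᵐ t ∂volume.restrict (Ioi (0 : ℝ)), g t = g₀ - ∫ s in (0 : ℝ)..t, h s := by
  have hint : ∀ {k : ℝ → X} (_ : ∀ T, IntegrableOn k (Ioc 0 T)) {T : ℝ}, 0 ≤ T →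
      IntervalIntegrable k volume 0 T := fun hk T hT =>
    (intervalIntegrable_iff_integrableOn_Ioc_of_le hT).2 (hk T)
  have hprim : ∀ T, 0 ≤ T → ContinuousOn (fun t => ∫ s in (0 : ℝ)..t, h s) (Icc 0 T) :=
    fun T hT => by
      have := intervalIntegral.continuousOn_primitive_interval' (hint hh hT) left_mem_uIcc
      rwa [uIcc_of_le hT] at this
  set d : ℝ → X := fun t => g t - g₀ + ∫ s in (0 : ℝ)..t, h s with hd
  have hdI : ∀ T, 0 ≤ T → IntervalIntegrable d volume 0 T := fun T hT =>
    ((hint hg hT).sub intervalIntegrable_const).add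
      (ContinuousOn.intervalIntegrable (by rw [uIcc_of_le hT]; exact hprim T hT))
  have hloc : LocallyIntegrableOn d (Ioi 0) volume := by
    rw [locallyIntegrableOn_iff isOpen_Ioi.isLocallyClosed]
    intro k hk hkc
    obtain ⟨T, hT⟩ := hkc.bddAbove
    have h1 := (intervalIntegrable_iff_integrableOn_Ioc_of_le (le_max_right T 0)).1
      (hdI (max T 0) (le_max_right _ _))
    exact h1.mono_set fun t ht => ⟨hk ht, (hT ht).trans (le_max_left _ _)⟩
  have hzero := isOpen_Ioi.ae_eq_zero_of_integral_contDiff_smul_eq_zero hloc fun χ hχ hχc hχs => by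
    obtain ⟨M', hM'⟩ := hχc.isCompact.bddAbove
    set M := max M' 0 with hM
    have hM0 : 0 ≤ M := le_max_right _ _
    have hχM : ∀ t, M < t → χ t = 0 := fun t ht => by
      by_contra hne
      exact absurd (hM' (subset_tsupport _ hne)) (not_le.2 (lt_of_le_of_lt (le_max_left _ _) ht))
    have hχ0 : ∀ t, t ≤ 0 → χ t = 0 := fun t ht => by
      by_contra hne
      exact absurd (hχs (subset_tsupport _ hne)) (not_lt.2 ht)
    -- Based at M, this primitive vanishes for large times, and at zero it equals -∫χ. The datum g₀
    -- enters because test functions need not vanish at t = 0.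
    set θ₁ : ℝ → ℝ := fun t => ∫ s in M..t, χ s with hθ₁
    have hθ₁' : ∀ t, HasDerivAt θ₁ (χ t) t := fun t =>
      (hχ.continuous.integral_hasStrictDerivAt M t).hasDerivAt
    have hθ₁s : ContDiff ℝ ∞ θ₁ := contDiff_infty_iff_deriv.2
      ⟨fun t => (hθ₁' t).differentiableAt, by rwa [funext fun t => (hθ₁' t).deriv]⟩
    have hθ₁M : ∀ t, M ≤ t → θ₁ t = 0 := fun t ht => by
      rw [hθ₁]
      refine intervalIntegral.integral_zero_ae (Eventually.of_forall fun s hs => ?_)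
      rw [uIoc_of_le ht] at hs
      exact hχM s hs.1
    -- Gives compact support towards negative times without changing anything for t ≥ 0.
    set κ : ℝ → ℝ := fun t => Real.smoothTransition (t + 1) with hκ
    have hκs : ContDiff ℝ ∞ κ := Real.smoothTransition.contDiff.comp (by fun_prop)
    have hκ1 : ∀ t, 0 ≤ t → κ t = 1 := fun t ht => Real.smoothTransition.one_of_one_le (by linarith)
    have hθ : IsTest fun t => κ t * θ₁ t := by
      refine ⟨hκs.mul hθ₁s, HasCompactSupport.intro (isCompact_Icc (a := -1) (b := M)) fun t ht => ?_⟩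
      rw [mem_Icc, not_and_or, not_le, not_le] at ht
      rcases ht with ht | ht
      · rw [hκ]
        simp only
        rw [Real.smoothTransition.zero_of_nonpos (by linarith), zero_mul]
      · rw [hθ₁M t ht.le, mul_zero]
    have hθd : ∀ t, 0 < t → deriv (fun t => κ t * θ₁ t) t = χ t := fun t ht => by
      have : (fun t => κ t * θ₁ t) =ᶠ[𝓝 t] θ₁ := by
        filter_upwards [lt_mem_nhds ht] with s hs
        rw [hκ1 s hs.le, one_mul]
      rw [this.deriv_eq, (hθ₁' t).deriv]
    have hH := H _ hθ
    have e1 : ∫ t in Ioi (0 : ℝ), (-(deriv (fun t => κ t * θ₁ t) t • g t) +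
        (κ t * θ₁ t) • h t) = ∫ t in (0 : ℝ)..M, (-(χ t • g t) + θ₁ t • h t) := by
      rw [intervalIntegral.integral_of_le hM0,
        ← setIntegral_eq_of_subset_of_forall_sdiff_eq_zero measurableSet_Ioi Ioc_subset_Ioi_self]
      · refine setIntegral_congr_fun measurableSet_Ioi fun t ht => ?_
        rw [hθd t ht, hκ1 t (le_of_lt ht), one_mul]
      · intro t ht
        have htM : M < t := by
          by_contra hc
          exact ht.2 ⟨ht.1, not_lt.1 hc⟩
        rw [hχM t htM, hθ₁M t htM.le, zero_smul, zero_smul, neg_zero, add_zero]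
    have e2 : ∫ t, χ t • d t = ∫ t in (0 : ℝ)..M, χ t • d t := by
      rw [intervalIntegral.integral_of_le hM0, setIntegral_eq_integral_of_forall_compl_eq_zero]
      intro t ht
      rw [mem_Ioc, not_and_or, not_lt, not_le] at ht
      rcases ht with ht | ht
      · rw [hχ0 t ht, zero_smul]
      · rw [hχM t ht, zero_smul]
    have i1 : IntervalIntegrable (fun t => χ t • g t) volume 0 M :=
      (hint hg hM0).continuousOn_smul hχ.continuous.continuousOn
    have i2 : IntervalIntegrable (fun t => θ₁ t • h t) volume 0 M :=
      (hint hh hM0).continuousOn_smul hθ₁s.continuous.continuousOn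
    have i3 : IntervalIntegrable (fun t => χ t • (∫ s in (0 : ℝ)..t, h s)) volume 0 M :=
      (hχ.continuous.continuousOn.smul (by rw [uIcc_of_le hM0]; exact hprim M hM0)).intervalIntegrable
    have i4 : IntervalIntegrable (fun t => χ t • g₀) volume 0 M :=
      (hχ.continuous.smul continuous_const).intervalIntegrable _ _
    have hparts := integral_deriv_smul_primitive hθ₁s (hint hh hM0)
    rw [funext fun t => (hθ₁' t).deriv, hθ₁M M le_rfl, zero_smul, zero_sub] at hparts
    have hχint : ∫ t in (0 : ℝ)..M, χ t = -θ₁ 0 := by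
      rw [hθ₁, intervalIntegral.integral_symm]
    rw [e1, hκ1 0 le_rfl, one_mul,
      intervalIntegral.integral_add (f := fun t => -(χ t • g t)) i1.neg i2,
      intervalIntegral.integral_neg] at hH
    rw [e2]
    simp only [hd, smul_add, smul_sub]
    rw [intervalIntegral.integral_add (i1.sub i4) i3, intervalIntegral.integral_sub i1 i4, hparts,
      intervalIntegral.integral_smul_const, hχint, neg_smul, ← hH]
    abel
  rw [ae_restrict_iff' measurableSet_Ioi]
  filter_upwards [hzero] with t ht htm
  rw [eq_sub_iff_add_eq, ← sub_eq_zero]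
  exact (by simp only [hd]; abel : _ = d t).trans (ht htm)

end WeakEvolution

/-! ### Separated test fields -/

section Separated

variable {α : ℝ}

theorem multV_rSym_injective (α : ℝ) : Function.Injective (multV (rSym α)) := fun _ _ h =>
  PiLp.ext fun k => mult_rSym_injective α (congrArg (fun v : V3 => v k) h)

theorem IsTest.toL2_helm_eq_zero {η : E3 → ℝ} (hη : IsTest η) (h : ∀ x, η x = 0) :
    (hη.helm α).toL2 = 0 := by
  refine mult_rSym_injective α ?_
  rw [← hη.toL2_eq α, map_zero]
  refine Lp.ext ?_
  filter_upwards [hη.coeFn_toL2, Lp.coeFn_zero ℝ 2 (volume : Measure E3)] with x h1 h2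
  rw [h1, h2, h, Pi.zero_apply]

theorem IsTest.single {η : E3 → ℝ} (hη : IsTest η) (k : Fin 3) :
    IsTest fun x => η x • EuclideanSpace.single k (1 : ℝ) :=
  ⟨hη.1.smul contDiff_const, hη.2.smul_right⟩

theorem IsTest.toL2_congr {η η' : E3 → ℝ} (hη : IsTest η) (hη' : IsTest η') (h : η = η') :
    hη.toL2 = hη'.toL2 := by
  subst h
  rfl

theorem eq_zero_of_inner_helmV {v : V3} (α : ℝ)
    (h : ∀ (ψ : E3 → E3) (hψ : IsTest ψ), inner ℝ v (hψ.helmV α) = 0) : v = 0 := by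
  refine PiLp.ext fun k => ext_inner_helm α fun η hη => ?_
  have h1 := h _ (hη.single k)
  rw [PiLp.inner_apply, Finset.sum_eq_single k (fun i _ hik => ?_) (by simp)] at h1
  · have h2 : (((hη.single k).component k).helm α).toL2 = (hη.helm α).toL2 :=
      IsTest.toL2_congr _ _ (by congr 1; funext x; simp)
    rw [real_inner_comm, ← h2, PiLp.zero_apply, inner_zero_right]
    exact h1
  · have h2 : (((hη.single k).component i).helm α).toL2 = 0 :=
      IsTest.toL2_helm_eq_zero ((hη.single k).component i) fun x => by simp [hik]
    change inner ℝ (v i) (((hη.single k).component i).helm α).toL2 = 0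
    rw [h2, inner_zero_right]

/-- Checked after applying the injective smoothing `rSym`, where only values and no derivatives of
the fields occur. -/
theorem IsTest.helmV_eq_smul {ψ ψ' : E3 → E3} (hψ : IsTest ψ) (hψ' : IsTest ψ') (c : ℝ)
    (h : ∀ x, ψ' x = c • ψ x) : hψ'.helmV α = c • hψ.helmV α := by
  refine multV_rSym_injective α ?_
  rw [map_smul, ← IsTest.toV3_eq, ← IsTest.toV3_eq]
  refine PiLp.ext fun k => Lp.ext ?_
  filter_upwards [(hψ'.component k).coeFn_toL2, (hψ.component k).coeFn_toL2,
    Lp.coeFn_smul c (hψ.component k).toL2] with x h1 h2 h3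
  change (hψ'.component k).toL2 x = (c • (hψ.component k).toL2) x
  rw [h1, h3, Pi.smul_apply, h2, h, PiLp.smul_apply]

theorem IsTest.separated {θ : ℝ → ℝ} {ψ : E3 → E3} (hθ : IsTest θ) (hψ : IsTest ψ) :
    IsTest fun z : ℝ × E3 => θ z.1 • ψ z.2 := by
  refine ⟨(hθ.1.comp contDiff_fst).smul (hψ.1.comp contDiff_snd),
    HasCompactSupport.intro (hθ.2.isCompact.prod hψ.2.isCompact) fun z hz => ?_⟩
  rw [mem_prod, not_and_or] at hz
  rcases hz with hz | hz
  · rw [image_eq_zero_of_notMem_tsupport hz, zero_smul]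
  · rw [image_eq_zero_of_notMem_tsupport hz, smul_zero]

end Separated

/-! ### Integrability in time -/

theorem IsTest.integrable_smul_time {F : Type*} [NormedAddCommGroup F] [NormedSpace ℝ F]
    {θ : ℝ → ℝ} (hθ : Continuous θ) (hc : HasCompactSupport θ) {k : ℝ → F}
    (hk : ∀ T, IntegrableOn k (Ioc 0 T)) : IntegrableOn (fun t => θ t • k t) (Ioi 0) := by
  obtain ⟨M, hM⟩ := hc.isCompact.bddAbove
  have h1 : IntegrableOn (fun t => θ t • k t) (Ioc 0 M) := by
    obtain ⟨C, hC⟩ := hθ.bounded_above_of_compact_support hc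
    exact (hk M).bdd_smul C hθ.aestronglyMeasurable (Eventually.of_forall hC)
  refine h1.of_forall_sdiff_eq_zero measurableSet_Ioi fun t ht => ?_
  rw [image_eq_zero_of_notMem_tsupport (f := θ) fun hmem => ht.2 ⟨ht.1, hM hmem⟩, zero_smul]

section ResidualBounds

variable {α : ℝ} (hα : 0 < α) (β ν : ℝ) (f : V3)

theorem continuous_transport : Continuous fun a : V3 => transport hα a a := by
  unfold transport
  refine (divBessel α).continuous.comp (continuous_pi fun i => continuous_pi fun j => ?_)
  fun_prop

theorem norm_transport_le (a : V3) :
    ‖transport hα a a‖ ≤ ‖divBessel α‖ * (‖besselMul hα‖ * ‖a‖ * ‖a‖) := by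
  have h1 : ‖fun i j => besselMul hα (a i) (a j)‖ ≤ ‖besselMul hα‖ * ‖a‖ * ‖a‖ := by
    rw [pi_norm_le_iff_of_nonneg (by positivity)]
    intro i
    rw [pi_norm_le_iff_of_nonneg (by positivity)]
    intro j
    refine ((besselMul hα).le_opNorm₂ _ _).trans ?_
    have h2 : ‖a i‖ ≤ ‖a‖ := PiLp.norm_apply_le a i
    have h3 : ‖a j‖ ≤ ‖a‖ := PiLp.norm_apply_le a j
    gcongr
  exact ((divBessel α).le_opNorm _).trans (by gcongr)

theorem bardinaResidual_eq (a : V3) (p : L2 ℝ) :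
    bardinaResidual hα β ν f a p = bardinaResidual hα β ν f a 0 + gradV α p := by
  rw [bardinaResidual, bardinaResidual, map_zero, add_zero]

theorem continuous_bardinaResidual : Continuous fun a => bardinaResidual hα β ν f a 0 := by
  unfold bardinaResidual
  exact ((((multV fun ξ => rSym α ξ * sSym α ξ).continuous.comp
    (((continuous_transport hα).add (continuous_id.const_smul β)).sub continuous_const)).add
    ((multV fun ξ => (lam ξ : ℂ) * rSym α ξ * sSym α ξ).continuous.const_smul ν))).add
    continuous_const

theorem exists_norm_bardinaResidual_le (R : ℝ) :
    ∃ C, ∀ a : V3, ‖a‖ ≤ R → ‖bardinaResidual hα β ν f a 0‖ ≤ C := by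
  obtain ⟨K, hK⟩ : ∃ K, ∀ v, ‖multV (fun ξ => rSym α ξ * sSym α ξ) v‖ ≤ K * ‖v‖ :=
    ⟨_, fun v => (multV fun ξ => rSym α ξ * sSym α ξ).le_opNorm v⟩
  obtain ⟨M, hM⟩ : ∃ M, ∀ v, ‖multV (fun ξ => (lam ξ : ℂ) * rSym α ξ * sSym α ξ) v‖ ≤ M * ‖v‖ :=
    ⟨_, fun v => (multV fun ξ => (lam ξ : ℂ) * rSym α ξ * sSym α ξ).le_opNorm v⟩
  refine ⟨|K| * (‖divBessel α‖ * (‖besselMul hα‖ * R * R) + |β| * R + ‖f‖) +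
    |ν| * (|M| * R), fun a ha => ?_⟩
  have hR : 0 ≤ R := (norm_nonneg _).trans ha
  have h1 : ‖transport hα a a + β • a - f‖ ≤
      ‖divBessel α‖ * (‖besselMul hα‖ * R * R) + |β| * R + ‖f‖ := by
    refine (norm_sub_le _ _).trans (add_le_add ((norm_add_le _ _).trans (add_le_add ?_ ?_)) le_rfl)
    · refine (norm_transport_le hα a).trans (mul_le_mul_of_nonneg_left ?_ (norm_nonneg _))
      gcongr
    · rw [norm_smul, Real.norm_eq_abs]
      exact mul_le_mul_of_nonneg_left ha (abs_nonneg _)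
  have h2 := (hK (transport hα a a + β • a - f)).trans
    (mul_le_mul (le_abs_self K) h1 (norm_nonneg _) (abs_nonneg _))
  have h3 := (hM a).trans (mul_le_mul (le_abs_self M) ha (norm_nonneg _) (abs_nonneg _))
  rw [bardinaResidual, map_zero, add_zero]
  refine (norm_add_le _ _).trans (add_le_add h2 ?_)
  rw [norm_smul, Real.norm_eq_abs]
  exact mul_le_mul_of_nonneg_left h3 (abs_nonneg _)

theorem integrableOn_bardinaResidual {a : ℝ → solenoidal α} {p : ℝ → L2 ℝ} {R T : ℝ}
    (ham : AEStronglyMeasurable a (volume.restrict (Ioi 0)))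
    (hab : ∀ᵐ t ∂volume.restrict (Ioi (0 : ℝ)), ‖a t‖ ≤ R)
    (hp : MemLp p 2 (volume.restrict (Ioc 0 T))) :
    IntegrableOn (fun t => bardinaResidual hα β ν f (a t).1 (p t)) (Ioc 0 T) := by
  have hle : volume.restrict (Ioc 0 T) ≤ volume.restrict (Ioi (0 : ℝ)) :=
    Measure.restrict_mono Ioc_subset_Ioi_self le_rfl
  have : IsFiniteMeasure (volume.restrict (Ioc 0 T)) := ⟨by simp⟩
  obtain ⟨C, hC⟩ := exists_norm_bardinaResidual_le hα β ν f R
  have h1 : IntegrableOn (fun t => bardinaResidual hα β ν f (a t).1 0) (Ioc 0 T) := by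
    refine Integrable.of_bound (((continuous_bardinaResidual hα β ν f).comp
      continuous_subtype_val).comp_aestronglyMeasurable (ham.mono_measure hle)) C ?_
    filter_upwards [ae_mono hle hab] with t ht
    exact hC _ ht
  have h2 : IntegrableOn (fun t => gradV α (p t)) (Ioc 0 T) :=
    (gradV α).integrable_comp (hp.integrable (by norm_num))
  have h3 : (fun t => bardinaResidual hα β ν f (a t).1 (p t)) =
      fun t => bardinaResidual hα β ν f (a t).1 0 + gradV α (p t) :=
    funext fun t => bardinaResidual_eq hα β ν f _ _
  rw [h3]
  exact h1.add h2

end ResidualBounds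

/-! ### Weak solutions solve the abstract equation -/

section WeakToAbstract

variable {α β ν : ℝ} (hα : 0 < α) {f u₀ : energySpace α} {u : ℝ → energySpace α} {p : ℝ → L2 ℝ}

theorem IsWeakSolution.aestronglyMeasurable_symm (H : IsWeakSolution α β ν f u₀ u p) :
    AEStronglyMeasurable (fun t => (toEnergy hα).symm (u t)) (volume.restrict (Ioi 0)) :=
  (toEnergy hα).symm.continuous.comp_aestronglyMeasurable H.bounded.1

theorem IsWeakSolution.exists_bound_symm (H : IsWeakSolution α β ν f u₀ u p) :
    ∃ R, ∀ᵐ t ∂volume.restrict (Ioi (0 : ℝ)), ‖(toEnergy hα).symm (u t)‖ ≤ R := by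
  refine ⟨(eLpNorm u ∞ (volume.restrict (Ioi (0 : ℝ)))).toReal, ?_⟩
  have h := ae_le_eLpNormEssSup (f := u) (μ := volume.restrict (Ioi (0 : ℝ)))
  filter_upwards [h] with t ht
  rw [LinearIsometryEquiv.norm_map, eLpNorm_exponent_top, ← toReal_enorm]
  exact ENNReal.toReal_mono (by simpa using H.bounded.2.ne) ht

theorem IsWeakSolution.integrableOn_symm (H : IsWeakSolution α β ν f u₀ u p) (T : ℝ) :
    IntegrableOn (fun t => (toEnergy hα).symm (u t)) (Ioc 0 T) := by
  obtain ⟨R, hR⟩ := H.exists_bound_symm hα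
  have hle : volume.restrict (Ioc 0 T) ≤ volume.restrict (Ioi (0 : ℝ)) :=
    Measure.restrict_mono Ioc_subset_Ioi_self le_rfl
  have : IsFiniteMeasure (volume.restrict (Ioc 0 T)) := ⟨by simp⟩
  exact Integrable.of_bound ((H.aestronglyMeasurable_symm hα).mono_measure hle) R (ae_mono hle hR)

theorem IsWeakSolution.integrableOn_residual (H : IsWeakSolution α β ν f u₀ u p) (T : ℝ) :
    IntegrableOn (fun t => bardinaResidual hα β ν ((toEnergy hα).symm f).1
      ((toEnergy hα).symm (u t)).1 (p t)) (Ioc 0 T) := by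
  obtain ⟨R, hR⟩ := H.exists_bound_symm hα
  exact integrableOn_bardinaResidual hα β ν _ (H.aestronglyMeasurable_symm hα) hR (H.pressure.1 T)

theorem IsTest.integrableOn_weak {X : Type*} [NormedAddCommGroup X] [NormedSpace ℝ X] {θ : ℝ → ℝ}
    (hθ : IsTest θ) {g h : ℝ → X} (hg : ∀ T, IntegrableOn g (Ioc 0 T))
    (hh : ∀ T, IntegrableOn h (Ioc 0 T)) :
    IntegrableOn (fun t => -(deriv θ t • g t) + θ t • h t) (Ioi 0) :=
  (IsTest.integrable_smul_time (hθ.1.continuous_deriv (by simp)) hθ.2.deriv hg).neg.add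
    (IsTest.integrable_smul_time hθ.1.continuous hθ.2 hh)

theorem IsTest.inner_integral_weak {X : Type*} [NormedAddCommGroup X] [InnerProductSpace ℝ X]
    [CompleteSpace X] {θ : ℝ → ℝ} (hθ : IsTest θ) {g h : ℝ → X}
    (hg : ∀ T, IntegrableOn g (Ioc 0 T)) (hh : ∀ T, IntegrableOn h (Ioc 0 T)) (c : X) :
    inner ℝ (∫ t in Ioi (0 : ℝ), (-(deriv θ t • g t) + θ t • h t)) c =
      ∫ t in Ioi (0 : ℝ), (-inner ℝ (g t) (deriv θ t • c) + inner ℝ (h t) (θ t • c)) := by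
  rw [real_inner_comm, ← integral_inner (hθ.integrableOn_weak hg hh)]
  refine integral_congr_ae (Eventually.of_forall fun t => ?_)
  simp only [inner_add_right, inner_neg_right, real_inner_smul_right]
  rw [real_inner_comm c, real_inner_comm c]

theorem IsTest.slice_separated {θ : ℝ → ℝ} {ψ : E3 → E3} (hθ : IsTest θ) (hψ : IsTest ψ) (t : ℝ) :
    ((hθ.separated hψ).slice t).helmV α = θ t • hψ.helmV α :=
  hψ.helmV_eq_smul _ _ fun _ => rfl

theorem IsTest.timeDeriv_separated {θ : ℝ → ℝ} {ψ : E3 → E3} (hθ : IsTest θ) (hψ : IsTest ψ)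
    (t : ℝ) : ((hθ.separated hψ).timeDeriv.slice t).helmV α = deriv θ t • hψ.helmV α :=
  hψ.helmV_eq_smul _ _ fun x => by
    rw [← ((hθ.separated hψ).hasDerivAt_time t x).deriv]
    exact ((hθ.1.differentiable (by simp) t).hasDerivAt.smul_const (ψ x)).deriv

theorem IsWeakSolution.integrableOn_multV (H : IsWeakSolution α β ν f u₀ u p) (T : ℝ) :
    IntegrableOn (fun t => multV (fun ξ => rSym α ξ * sSym α ξ) ((toEnergy hα).symm (u t)).1)
      (Ioc 0 T) :=
  (multV (fun ξ => rSym α ξ * sSym α ξ) ∘L (solenoidal α).subtypeL).integrable_comp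
    (H.integrableOn_symm hα T)

theorem IsWeakSolution.weak_equation (H : IsWeakSolution α β ν f u₀ u p) {φ : ℝ × E3 → E3}
    (hφ : IsTest φ) : ∫ t in Ioi (0 : ℝ),
      (-inner ℝ (multV (fun ξ => rSym α ξ * sSym α ξ) ((toEnergy hα).symm (u t)).1)
          ((hφ.timeDeriv.slice t).helmV α) +
        inner ℝ (bardinaResidual hα β ν ((toEnergy hα).symm f).1 ((toEnergy hα).symm (u t)).1 (p t))
          ((hφ.slice t).helmV α)) =
      inner ℝ (multV (fun ξ => rSym α ξ * sSym α ξ) ((toEnergy hα).symm u₀).1)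
        ((hφ.slice 0).helmV α) :=
  (weakEquation_iff hα β ν f u₀ u p hφ).1 (H.equation φ hφ)

/-- Separated test fields θ(t)ψ(x) leave a vector in L² orthogonal to every `helmV`, and these are
numerous enough to make it zero. -/
theorem IsWeakSolution.integral_eq (H : IsWeakSolution α β ν f u₀ u p) {θ : ℝ → ℝ}
    (hθ : IsTest θ) :
    ∫ t in Ioi (0 : ℝ), (-(deriv θ t • multV (fun ξ => rSym α ξ * sSym α ξ)
        ((toEnergy hα).symm (u t)).1) + θ t • bardinaResidual hα β ν ((toEnergy hα).symm f).1
          ((toEnergy hα).symm (u t)).1 (p t)) =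
      θ 0 • multV (fun ξ => rSym α ξ * sSym α ξ) ((toEnergy hα).symm u₀).1 := by
  rw [← sub_eq_zero]
  refine eq_zero_of_inner_helmV α fun ψ hψ => ?_
  have h1 := H.weak_equation hα (hθ.separated hψ)
  simp only [hθ.slice_separated hψ, hθ.timeDeriv_separated hψ] at h1
  rw [inner_sub_left, hθ.inner_integral_weak (H.integrableOn_multV hα) (H.integrableOn_residual hα),
    h1, real_inner_smul_left, real_inner_smul_right, sub_self]

/-- The bounded operator L undoes the smoothing below frequency N and removes the pressure. It
carries the weak evolution equation to the truncated abstract one, to which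
`ae_eq_of_weak_evolution` applies. -/
theorem IsWeakSolution.isAESol (hβ : 0 < β) (hν : 0 < ν) (H : IsWeakSolution α β ν f u₀ u p) :
    (bardinaSystem hα hβ hν ((toEnergy hα).symm f)).IsAESol ((toEnergy hα).symm u₀)
      fun t => (toEnergy hα).symm (u t) := by
  refine ⟨H.aestronglyMeasurable_symm hα, H.exists_bound_symm hα, fun N => ?_⟩
  set D := bardinaSystem hα hβ hν ((toEnergy hα).symm f) with hD
  set L : V3 →L[ℝ] solenoidal α := (solenoidal α).orthogonalProjectionOnto ∘L
    multV (cutSym N (invSym α)) with hL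
  have hLW : ∀ a : solenoidal α, L (multV (fun ξ => rSym α ξ * sSym α ξ) a.1) = D.P N a :=
    fun a => by
      have h1 : multV (cutSym N (invSym α)) (multV (fun ξ => rSym α ξ * sSym α ξ) a.1) =
          (multY hα (isSymbol_cutOne N) a).1 := multV_multV (isSymbol_cutInv α N) (isSymbol_rs α)
        (p := cutSym N fun _ => 1) (fun ξ => by
          by_cases hξ : ‖ξ‖ ≤ N
          · simp only [cutSym_of_mem hξ, Complex.ofReal_one]
            exact invSym_mul α ξ
          · simp only [cutSym_of_notMem hξ, zero_mul]) _
      rw [hL, ContinuousLinearMap.comp_apply, h1]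
      exact Submodule.orthogonalProjectionOnto_mem_subspace_eq_self
        (multY hα (isSymbol_cutOne N) a)
  have hLZ : ∀ (a : solenoidal α) (q : L2 ℝ),
      L (bardinaResidual hα β ν ((toEnergy hα).symm f).1 a.1 q) = D.A N a - D.P N (D.force a) :=
    fun a q => orthogonalProjection_residual hα hβ hν _ a q N
  have hgi := H.integrableOn_multV hα
  have hhi := H.integrableOn_residual hα
  have hgi' : ∀ T, IntegrableOn (fun t => D.P N ((toEnergy hα).symm (u t))) (Ioc 0 T) := fun T =>
    (D.P N).integrable_comp (H.integrableOn_symm hα T)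
  have hhi' : ∀ T, IntegrableOn (fun t => D.A N ((toEnergy hα).symm (u t)) -
      D.P N (D.force ((toEnergy hα).symm (u t)))) (Ioc 0 T) := fun T => by
    have := L.integrable_comp (hhi T)
    simp only [hLZ] at this
    exact this
  have key := ae_eq_of_weak_evolution hgi' hhi' (g₀ := D.P N ((toEnergy hα).symm u₀))
    fun θ hθ => by
      have h1 := congrArg L (H.integral_eq hα hθ)
      rw [← L.integral_comp_comm (hθ.integrableOn_weak hgi hhi)] at h1
      simpa only [map_add, map_neg, map_smul, hLW, hLZ] using h1
  filter_upwards [key] with t ht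
  rw [ht, sub_eq_add_neg, ← intervalIntegral.integral_neg]
  simp only [neg_sub]

/-- Taking the smoothed divergence gives a multiplier with symbol -λr², which vanishes only at ξ =
0, a null set. -/
theorem gradV_injective (hα : 0 < α) : Function.Injective (gradV α) := by
  have hs := fun i => isSymbol_dSym_mul_rSym hα i
  have hsum := IsSymbol.sum Finset.univ fun i => (hs i).mul (hs i)
  have hne : ∀ᵐ ξ ∂(volume : Measure E3),
      ∑ i, (dSym i ξ * rSym α ξ) * (dSym i ξ * rSym α ξ) ≠ 0 := by
    filter_upwards [Measure.ae_ne volume (0 : E3)] with ξ hξ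
    have h1 : ∑ i, (dSym i ξ * rSym α ξ) * (dSym i ξ * rSym α ξ) =
        -(lam ξ : ℂ) * (rSym α ξ * rSym α ξ) := by
      rw [← sum_dSym_sq, Finset.sum_mul]
      exact Finset.sum_congr rfl fun i _ => by ring
    rw [h1]
    refine mul_ne_zero (neg_ne_zero.2 ?_) (mul_ne_zero (rSym_ne_zero α ξ) (rSym_ne_zero α ξ))
    rw [Ne, Complex.ofReal_eq_zero, lam]
    have := norm_pos_iff.2 hξ
    positivity
  refine (injective_iff_map_eq_zero _).2 fun p hp => mult_injective hsum hne ?_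
  rw [mult_sum _ fun i => (hs i).mul (hs i), map_zero]
  refine Finset.sum_eq_zero fun i _ => ?_
  have h1 : mult (fun ξ => dSym i ξ * rSym α ξ) p = 0 := congrArg (fun v : V3 => v i) hp
  rw [← mult_mult (hs i) (hs i), h1, map_zero]

/-- With equal velocities the two equations differ only by the gradient of the pressure difference,
which therefore vanishes for almost every time. -/
theorem IsWeakSolution.pressure_unique (hα : 0 < α) {u' : ℝ → energySpace α} {p' : ℝ → L2 ℝ}
    (H : IsWeakSolution α β ν f u₀ u p) (H' : IsWeakSolution α β ν f u₀ u' p')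
    (hu : ∀ᵐ t ∂volume.restrict (Ioi (0 : ℝ)), u t = u' t) :
    ∀ᵐ t ∂volume.restrict (Ioi (0 : ℝ)), p t = p' t := by
  have hpi : ∀ T, IntegrableOn (fun t => p t - p' t) (Ioc 0 T) := fun T => by
    have : IsFiniteMeasure (volume.restrict (Ioc 0 T)) := ⟨by simp⟩
    exact ((H.pressure.1 T).sub (H'.pressure.1 T)).integrable (by norm_num)
  have hgi : ∀ T, IntegrableOn (fun t => gradV α (p t - p' t)) (Ioc 0 T) := fun T =>
    (gradV α).integrable_comp (hpi T)
  have hloc : LocallyIntegrableOn (fun t => gradV α (p t - p' t)) (Ioi 0) volume := by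
    rw [locallyIntegrableOn_iff isOpen_Ioi.isLocallyClosed]
    intro k hk hkc
    obtain ⟨T, hT⟩ := hkc.bddAbove
    exact (hgi T).mono_set fun t ht => ⟨hk ht, hT ht⟩
  have hzero := isOpen_Ioi.ae_eq_zero_of_integral_contDiff_smul_eq_zero hloc
    fun θ hθ hθc hθs => by
      have h1 := H.integral_eq hα ⟨hθ, hθc⟩
      rw [← H'.integral_eq hα ⟨hθ, hθc⟩, ← sub_eq_zero, ← integral_sub
        (IsTest.integrableOn_weak ⟨hθ, hθc⟩ (H.integrableOn_multV hα) (H.integrableOn_residual hα))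
        (IsTest.integrableOn_weak ⟨hθ, hθc⟩ (H'.integrableOn_multV hα) (H'.integrableOn_residual hα))] at h1
      rw [← h1, ← setIntegral_eq_integral_of_forall_compl_eq_zero (s := Ioi 0) fun t ht => by
        rw [image_eq_zero_of_notMem_tsupport fun hm => ht (hθs hm), zero_smul]]
      refine integral_congr_ae ?_
      filter_upwards [hu] with t ht
      rw [ht, bardinaResidual_eq hα β ν _ _ (p t), bardinaResidual_eq hα β ν _ _ (p' t), map_sub]
      simp only [smul_add, smul_sub]
      abel
  rw [ae_restrict_iff' measurableSet_Ioi]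
  filter_upwards [hzero] with t ht htm
  exact sub_eq_zero.1 (gradV_injective hα ((ht htm).trans (map_zero _).symm))

end WeakToAbstract

/-! ### Time regularity of slices of test functions -/

theorem L2.norm_le_of_bound {g : L2 ℝ} {C : ℝ} (hC : 0 ≤ C) {K : Set E3} (hK : IsCompact K)
    (h : ∀ᵐ x ∂(volume : Measure E3), |g x| ≤ C) (h' : ∀ᵐ x ∂(volume : Measure E3), x ∉ K → g x = 0) :
    ‖g‖ ≤ C * √(volume.real K) := by
  have h1 : ‖g‖ ^ 2 ≤ C ^ 2 * volume.real K := by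
    rw [← real_inner_self_eq_norm_sq, ← L2.integral_mul,
      ← setIntegral_eq_integral_of_ae_compl_eq_zero (s := K)]
    · have h2 : ∫ _ in K, C ^ 2 = C ^ 2 * volume.real K := by
        rw [setIntegral_const, smul_eq_mul, mul_comm]
      rw [← h2]
      refine integral_mono_ae (L2.integrable_mul g g).integrableOn
        (integrableOn_const hK.measure_lt_top.ne) ?_
      filter_upwards [ae_restrict_of_ae h] with x hx
      rw [← sq, ← sq_abs]
      exact pow_le_pow_left₀ (abs_nonneg _) hx 2
    · filter_upwards [h'] with x hx hxK
      rw [hx hxK, zero_mul]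
  refine (pow_le_pow_iff_left₀ (norm_nonneg _) (by positivity) two_ne_zero).1 ?_
  rw [mul_pow, Real.sq_sqrt measureReal_nonneg]
  exact h1

section ScalarSlices

variable {Φ : ℝ × E3 → ℝ}

/-- The second-order Taylor remainder in time is at most C h² uniformly in x and lives on the
spatial projection of the support, a fixed compact set; so it is O(h²) in L². -/
theorem IsTest.hasDerivAt_toL2_slice (hΦ : IsTest Φ) (t : ℝ) :
    HasDerivAt (fun t => (hΦ.slice t).toL2) (hΦ.timeDeriv.slice t).toL2 t := by
  set K : Set E3 := Prod.snd '' tsupport Φ with hK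
  have hKc : IsCompact K := hΦ.2.isCompact.image continuous_snd
  have h0 : ∀ t x, x ∉ K → Φ (t, x) = 0 := fun t x hx => by
    by_contra h
    exact hx ⟨(t, x), subset_tsupport _ h, rfl⟩
  have h0' : ∀ t x, x ∉ K → fderiv ℝ Φ (t, x) (1, 0) = 0 := fun t x hx => by
    rw [← (hΦ.hasDerivAt_time t x).deriv, funext fun s => h0 s x hx, deriv_const]
  obtain ⟨C, hC⟩ := hΦ.timeDeriv.timeDeriv.1.continuous.bounded_above_of_compact_support
    hΦ.timeDeriv.timeDeriv.2
  have hC0 : 0 ≤ C := (norm_nonneg _).trans (hC 0)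
  have hlip : ∀ s x, ‖fderiv ℝ Φ (s, x) (1, 0) - fderiv ℝ Φ (t, x) (1, 0)‖ ≤ C * ‖s - t‖ :=
    fun s x => Convex.norm_image_sub_le_of_norm_hasDerivWithin_le
      (fun r _ => (hΦ.timeDeriv.hasDerivAt_time r x).hasDerivWithinAt) (fun r _ => hC (r, x))
      convex_univ (mem_univ t) (mem_univ s)
  have hquad : ∀ h x, ‖Φ (t + h, x) - Φ (t, x) - h * fderiv ℝ Φ (t, x) (1, 0)‖ ≤ C * ‖h‖ ^ 2 :=
    fun h x => by
      have hd : ∀ r, HasDerivAt (fun r => Φ (r, x) - r * fderiv ℝ Φ (t, x) (1, 0))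
          (fderiv ℝ Φ (r, x) (1, 0) - fderiv ℝ Φ (t, x) (1, 0)) r := fun r => by
        refine ((hΦ.hasDerivAt_time r x).fun_sub ((hasDerivAt_id r).mul_const
          (fderiv ℝ Φ (t, x) (1, 0)))).congr_deriv ?_
        rw [one_mul]
      have hm := Convex.norm_image_sub_le_of_norm_hasDerivWithin_le (s := uIcc t (t + h))
        (C := C * ‖h‖) (fun r _ => (hd r).hasDerivWithinAt) (fun r hr => (hlip r x).trans ?_)
        (convex_uIcc _ _) left_mem_uIcc right_mem_uIcc
      · have e : Φ (t + h, x) - Φ (t, x) - h * fderiv ℝ Φ (t, x) (1, 0) =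
            Φ (t + h, x) - (t + h) * fderiv ℝ Φ (t, x) (1, 0) -
              (Φ (t, x) - t * fderiv ℝ Φ (t, x) (1, 0)) := by ring
        rw [e]
        refine hm.trans (le_of_eq ?_)
        rw [add_sub_cancel_left]
        ring
      · refine mul_le_mul_of_nonneg_left ?_ hC0
        have := abs_sub_left_of_mem_uIcc hr
        rwa [add_sub_cancel_left] at this
  rw [hasDerivAt_iff_isLittleO_nhds_zero]
  have hbig : (fun h : ℝ => (hΦ.slice (t + h)).toL2 - (hΦ.slice t).toL2 -
      h • (hΦ.timeDeriv.slice t).toL2) =O[𝓝 0] fun h : ℝ => h ^ 2 := by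
    refine Asymptotics.IsBigO.of_bound (C * √(volume.real K)) (Eventually.of_forall fun h => ?_)
    have hae : ⇑((hΦ.slice (t + h)).toL2 - (hΦ.slice t).toL2 - h • (hΦ.timeDeriv.slice t).toL2)
        =ᵐ[volume] fun x => Φ (t + h, x) - Φ (t, x) - h * fderiv ℝ Φ (t, x) (1, 0) := by
      filter_upwards [Lp.coeFn_sub ((hΦ.slice (t + h)).toL2 - (hΦ.slice t).toL2)
        (h • (hΦ.timeDeriv.slice t).toL2), Lp.coeFn_sub (hΦ.slice (t + h)).toL2 (hΦ.slice t).toL2,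
        Lp.coeFn_smul h (hΦ.timeDeriv.slice t).toL2, (hΦ.slice (t + h)).coeFn_toL2,
        (hΦ.slice t).coeFn_toL2, (hΦ.timeDeriv.slice t).coeFn_toL2] with x h1 h2 h3 h4 h5 h6
      rw [h1, Pi.sub_apply, h2, Pi.sub_apply, h3, Pi.smul_apply, h4, h5, h6, smul_eq_mul]
    refine (L2.norm_le_of_bound (C := C * ‖h‖ ^ 2) (by positivity) hKc ?_ ?_).trans (le_of_eq ?_)
    · filter_upwards [hae] with x hx
      rw [hx]
      exact hquad h x
    · filter_upwards [hae] with x hx hxK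
      rw [hx, h0 _ x hxK, h0 _ x hxK, h0' _ x hxK]
      simp
    · rw [norm_pow]
      ring
  refine hbig.trans_isLittleO ?_
  simpa using Asymptotics.isLittleO_pow_pow (𝕜 := ℝ) (one_lt_two : (1 : ℕ) < 2)

theorem IsTest.spaceDeriv (hΦ : IsTest Φ) (i : Fin 3) :
    IsTest fun z => fderiv ℝ Φ z (0, EuclideanSpace.single i 1) :=
  ⟨(hΦ.1.fderiv_right (m := ∞) (by simp)).clm_apply contDiff_const, hΦ.2.fderiv_apply ℝ _⟩

theorem IsTest.pderiv3_slice (hΦ : IsTest Φ) (i : Fin 3) (t : ℝ) :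
    pderiv3 i (fun x => Φ (t, x)) = fun x => fderiv ℝ Φ (t, x) (0, EuclideanSpace.single i 1) := by
  funext x
  have h1 : HasFDerivAt (fun y : E3 => (t, y)) (ContinuousLinearMap.inr ℝ ℝ E3) x :=
    hasFDerivAt_prodMk_right t x
  have h2 := (hΦ.1.differentiable (by simp) (t, x)).hasFDerivAt.comp x h1
  have h3 : fderiv ℝ (fun y => Φ (t, y)) x = (fderiv ℝ Φ (t, x)) ∘L ContinuousLinearMap.inr ℝ ℝ E3 :=
    h2.fderiv
  rw [pderiv3, h3]
  simp

theorem IsTest.helmSlice (α : ℝ) (hΦ : IsTest Φ) : ∃ Ψ : ℝ × E3 → ℝ, IsTest Ψ ∧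
    ∀ t, _root_.helm α (fun x => Φ (t, x)) = fun x => Ψ (t, x) := by
  refine ⟨fun z => -(α ^ 2) * (∑ i, fderiv ℝ (fun z => fderiv ℝ Φ z
    (0, EuclideanSpace.single i 1)) z (0, EuclideanSpace.single i 1)) + Φ z, ⟨?_, ?_⟩, fun t => ?_⟩
  · exact (contDiff_const.mul (ContDiff.sum fun i _ =>
      ((hΦ.spaceDeriv i).spaceDeriv i).1)).add hΦ.1
  · refine HasCompactSupport.intro hΦ.2.isCompact fun z hz => ?_
    have h1 : ∀ i, fderiv ℝ (fun z => fderiv ℝ Φ z (0, EuclideanSpace.single i 1)) z = 0 :=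
      fun i => image_eq_zero_of_notMem_tsupport fun h =>
        hz (tsupport_fderiv_apply_subset ℝ _ (tsupport_fderiv_subset ℝ h))
    simp [h1, image_eq_zero_of_notMem_tsupport hz]
  · funext x
    rw [_root_.helm, laplacian_eq_sum_pderiv3 ((hΦ.slice t).1.of_le two_le_infty)]
    congr 2
    refine Finset.sum_congr rfl fun i _ => ?_
    rw [hΦ.pderiv3_slice, (hΦ.spaceDeriv i).pderiv3_slice]

end ScalarSlices

section VectorSlices

variable {φ : ℝ × E3 → E3}

theorem IsTest.componentTime (hφ : IsTest φ) (k : Fin 3) : IsTest fun z => φ z k :=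
  ⟨(EuclideanSpace.proj (𝕜 := ℝ) k).contDiff.comp hφ.1,
    hφ.2.comp_left (g := fun v : E3 => v k) rfl⟩

theorem V3.hasDerivAt {g : ℝ → V3} {g' : V3} {t : ℝ} (h : ∀ k, HasDerivAt (fun t => g t k) (g' k) t) :
    HasDerivAt g g' t :=
  (PiLp.continuousLinearEquiv 2 ℝ (fun _ : Fin 3 => L2 ℝ)).symm.toContinuousLinearMap.hasFDerivAt
    |>.comp_hasDerivAt t (hasDerivAt_pi.2 h)

theorem IsTest.hasDerivAt_toV3_slice (hφ : IsTest φ) (t : ℝ) :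
    HasDerivAt (fun t => (hφ.slice t).toV3) (hφ.timeDeriv.slice t).toV3 t := by
  refine V3.hasDerivAt fun k => ?_
  have h := (hφ.componentTime k).hasDerivAt_toL2_slice t
  refine h.congr_deriv (IsTest.toL2_congr _ ((hφ.timeDeriv.slice t).component k) (funext fun x => ?_))
  have h1 := (EuclideanSpace.proj (𝕜 := ℝ) k).hasFDerivAt.comp (t, x)
    (hφ.1.differentiable (by simp) (t, x)).hasFDerivAt
  have h2 : fderiv ℝ (fun z => φ z k) (t, x) = (EuclideanSpace.proj (𝕜 := ℝ) k) ∘L fderiv ℝ φ (t, x) :=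
    h1.fderiv
  rw [h2]
  rfl

/-- Differentiability holds because the Helmholtz operator maps slices to slices of another test
function. The derivative is identified after applying the injective `multV (rSym α)`, which avoids
commuting ∂ₜ with Δ. -/
theorem IsTest.hasDerivAt_helmV_slice (α : ℝ) (hφ : IsTest φ) (t : ℝ) :
    HasDerivAt (fun t => (hφ.slice t).helmV α) ((hφ.timeDeriv.slice t).helmV α) t := by
  choose Ψ hΨ hΨ' using fun k => (hφ.componentTime k).helmSlice α
  have h1 : HasDerivAt (fun t => (hφ.slice t).helmV α)
      (WithLp.toLp 2 fun k => ((hΨ k).timeDeriv.slice t).toL2) t := by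
    refine V3.hasDerivAt fun k => ?_
    refine ((hΨ k).hasDerivAt_toL2_slice t).congr_of_eventuallyEq
      (Eventually.of_forall fun t =>
        IsTest.toL2_congr (((hφ.slice t).component k).helm α) _ (hΨ' k t))
  have h2 := (multV (rSym α)).hasFDerivAt.comp_hasDerivAt t h1
  have h3 := hφ.hasDerivAt_toV3_slice t
  have h4 : (fun t => (hφ.slice t).toV3) = multV (rSym α) ∘ fun t => (hφ.slice t).helmV α :=
    funext fun t => IsTest.toV3_eq α _
  rw [h4] at h3
  have h5 := h2.unique h3
  rw [IsTest.toV3_eq α] at h5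
  exact h1.congr_deriv (multV_rSym_injective α h5)

theorem IsTest.continuous_helmV_slice (α : ℝ) (hφ : IsTest φ) :
    Continuous fun t => (hφ.slice t).helmV α :=
  continuous_iff_continuousAt.2 fun t => (hφ.hasDerivAt_helmV_slice α t).continuousAt

end VectorSlices

/-! ### Strong solutions satisfy the weak formulation -/

/-- The product rule for ⟨z, H⟩ on [0, M]; the boundary term at M vanishes by `h0`. -/
theorem integral_weak_of_primitive {X : Type*} [NormedAddCommGroup X] [InnerProductSpace ℝ X]
    [CompleteSpace X] {z k H H' : ℝ → X} {z₀ : X} (hk : Continuous k)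
    (hz : ∀ t, 0 ≤ t → z t = z₀ - ∫ s in (0 : ℝ)..t, k s)
    (hH : ∀ t, HasDerivAt H (H' t) t) (hH' : Continuous H') {M : ℝ} (hM : 0 ≤ M) (h0 : H M = 0) :
    ∫ t in (0 : ℝ)..M, (-inner ℝ (z t) (H' t) + inner ℝ (k t) (H t)) = inner ℝ z₀ (H 0) := by
  set y : ℝ → X := fun t => z₀ - ∫ s in (0 : ℝ)..t, k s with hy
  have hy' : ∀ t, HasDerivAt y (-k t) t := fun t =>
    (hk.integral_hasStrictDerivAt 0 t).hasDerivAt.const_sub _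
  have hyc : Continuous y := continuous_iff_continuousAt.2 fun t => (hy' t).continuousAt
  have hHc : Continuous H := continuous_iff_continuousAt.2 fun t => (hH t).continuousAt
  have hd : ∀ t, HasDerivAt (fun t => inner ℝ (y t) (H t))
      (inner ℝ (y t) (H' t) + inner ℝ (-k t) (H t)) t := fun t => (hy' t).inner ℝ (hH t)
  have hcont : Continuous fun t => inner ℝ (y t) (H' t) + inner ℝ (-k t) (H t) := by fun_prop
  have hftc := intervalIntegral.integral_eq_sub_of_hasDerivAt (fun t _ => hd t)
    (hcont.intervalIntegrable 0 M)
  rw [h0, inner_zero_right, zero_sub, show y 0 = z₀ by simp [hy]] at hftc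
  rw [← neg_eq_iff_eq_neg.2 hftc, ← intervalIntegral.integral_neg]
  refine intervalIntegral.integral_congr fun t ht => ?_
  rw [uIcc_of_le hM] at ht
  simp only [hz t ht.1, inner_neg_left, hy]
  ring

section StrongToWeak

variable {α β ν : ℝ} (hα : 0 < α) (hβ : 0 < β) (hν : 0 < ν)

theorem continuous_pres : Continuous fun a : V3 => pres hα a := by
  unfold pres
  fun_prop

theorem continuous_residual_pressure (f : V3) : Continuous fun a : V3 =>
    bardinaResidual hα β ν f a (mult (rSym α) (pres hα a)) := by
  have h : (fun a : V3 => bardinaResidual hα β ν f a (mult (rSym α) (pres hα a))) =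
      fun a => bardinaResidual hα β ν f a 0 + gradV α (mult (rSym α) (pres hα a)) :=
    funext fun a => bardinaResidual_eq hα β ν f _ _
  rw [h]
  exact (continuous_bardinaResidual hα β ν f).add
    ((gradV α).continuous.comp ((mult (rSym α)).continuous.comp (continuous_pres hα)))

theorem tendsto_multV_cutOne (a : V3) :
    Tendsto (fun N => multV (cutSym N fun _ => 1) a) atTop (𝓝 a) := by
  refine ((PiLp.continuous_toLp 2 (fun _ : Fin 3 => L2 ℝ)).tendsto _).comp
    (tendsto_pi_nhds.2 fun k => ?_)
  have h := tendsto_mult (l := atTop) isSymbol_cutOne (m := fun _ => 1)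
    (by simpa using IsSymbol.const 1) (C := 1) (Eventually.of_forall norm_cutOne_le)
    (fun ξ => by simpa using tendsto_cutSym (fun _ => 1) ξ) (a k)
  rwa [mult_one] at h

theorem norm_multV_le {m : E3 → ℂ} (hm : IsSymbol m) {C : ℝ} (hC : ∀ ξ, ‖m ξ‖ ≤ C) (a : V3) :
    ‖multV m a‖ ≤ C * ‖a‖ := by
  have h0 : 0 ≤ C := (norm_nonneg _).trans (hC 0)
  refine (pow_le_pow_iff_left₀ (norm_nonneg _) (by positivity) two_ne_zero).1 ?_
  rw [mul_pow, PiLp.norm_sq_eq_of_L2, PiLp.norm_sq_eq_of_L2, Finset.mul_sum]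
  refine Finset.sum_le_sum fun k _ => ?_
  rw [← mul_pow]
  exact pow_le_pow_left₀ (norm_nonneg _) (norm_mult_le hm hC _) 2

/-- Each frequency truncation of the smoothed equation holds in integrated form and can be
integrated by parts against the test field; dominated convergence then removes the truncation. -/
theorem sol_weak_equation (f x : solenoidal α) {φ : ℝ × E3 → E3} (hφ : IsTest φ) :
    ∫ t in Ioi (0 : ℝ),
      (-inner ℝ (multV (fun ξ => rSym α ξ * sSym α ξ) ((bardinaSystem hα hβ hν f).sol t x).1)
          ((hφ.timeDeriv.slice t).helmV α) +
        inner ℝ (bardinaResidual hα β ν f.1 ((bardinaSystem hα hβ hν f).sol t x).1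
          (mult (rSym α) (pres hα ((bardinaSystem hα hβ hν f).sol t x).1)))
          ((hφ.slice t).helmV α)) =
      inner ℝ (multV (fun ξ => rSym α ξ * sSym α ξ) x.1) ((hφ.slice 0).helmV α) := by
  set D := bardinaSystem hα hβ hν f with hD
  set W : ℝ → V3 := fun t => multV (fun ξ => rSym α ξ * sSym α ξ) (D.sol t x).1 with hW
  set Z : ℝ → V3 := fun t => bardinaResidual hα β ν f.1 (D.sol t x).1
    (mult (rSym α) (pres hα (D.sol t x).1)) with hZ
  set H : ℝ → V3 := fun t => (hφ.slice t).helmV α with hH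
  set H' : ℝ → V3 := fun t => (hφ.timeDeriv.slice t).helmV α with hH'
  have hac : Continuous fun t => (D.sol t x).1 :=
    continuous_subtype_val.comp (D.continuous_sol x)
  have hWc : Continuous W := (multV _).continuous.comp hac
  have hZc : Continuous Z := (continuous_residual_pressure hα f.1).comp hac
  have hHc : Continuous H := hφ.continuous_helmV_slice α
  have hHc' : Continuous H' := hφ.timeDeriv.continuous_helmV_slice α
  obtain ⟨M', hM'⟩ := (hφ.2.isCompact.image continuous_fst).bddAbove
  -- The 1 places M strictly after the support in time, so the test field and its time derivative
  -- vanish from M on.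
  set M := max M' 0 + 1 with hM
  have hM0 : 0 ≤ M := by positivity
  have hφM : ∀ t, M ≤ t → ∀ x, (t, x) ∉ tsupport φ := fun t ht x hx => by
    have h1 := hM' ⟨(t, x), hx, rfl⟩
    have h2 := le_max_left M' 0
    simp only at h1
    linarith
  have hHM : ∀ t, M ≤ t → H t = 0 := fun t ht => PiLp.ext fun k =>
    IsTest.toL2_helm_eq_zero ((hφ.slice t).component k) fun x => by
      rw [image_eq_zero_of_notMem_tsupport (hφM t ht x), PiLp.zero_apply]
  have hHM' : ∀ t, M ≤ t → H' t = 0 := fun t ht => PiLp.ext fun k =>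
    IsTest.toL2_helm_eq_zero ((hφ.timeDeriv.slice t).component k) fun x => by
      have : fderiv ℝ φ (t, x) = 0 := image_eq_zero_of_notMem_tsupport fun h =>
        hφM t ht x (tsupport_fderiv_subset ℝ h)
      rw [this]
      rfl
  have hN : ∀ N, ∫ t in (0 : ℝ)..M, (-inner ℝ (multV (cutSym N fun _ => 1) (W t)) (H' t) +
      inner ℝ (multV (cutSym N fun _ => 1) (Z t)) (H t)) =
      inner ℝ (multV (cutSym N fun _ => 1) (W 0)) (H 0) := fun N => by
    refine integral_weak_of_primitive ((multV _).continuous.comp hZc) (fun t ht => ?_)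
      (fun t => hφ.hasDerivAt_helmV_slice α t) hHc' hM0 (hHM M le_rfl)
    have hcomm : ∀ h, multV (cutSym N fun _ => 1) (multV (fun ξ => rSym α ξ * sSym α ξ) h) =
        multV (fun ξ => rSym α ξ * sSym α ξ) (multV (cutSym N fun _ => 1) h) := fun h => by
      rw [multV_multV (isSymbol_cutOne N) (isSymbol_rs α) (fun _ => rfl),
        multV_multV (isSymbol_rs α) (isSymbol_cutOne N) (fun _ => mul_comm _ _)]
    have hlin := (D.isMild_sol x).isLinearSol N t ht
    set L : solenoidal α →L[ℝ] V3 :=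
      multV (fun ξ => rSym α ξ * sSym α ξ) ∘L (solenoidal α).subtypeL with hL
    have hcont : Continuous fun s => D.P N (D.force (D.sol s x)) - D.A N (D.sol s x) := by
      have h1 := D.continuous_force
      have h2 := D.continuous_sol x
      fun_prop
    have h1 := congrArg L hlin
    rw [map_add, ← L.intervalIntegral_comp_comm (hcont.intervalIntegrable _ _)] at h1
    have e1 : multV (cutSym N fun _ => 1) (W t) = L (D.P N (D.sol t x)) := hcomm _
    have e2 : multV (cutSym N fun _ => 1) (W 0) = L (D.P N x) := by
      rw [hW]
      simp only
      rw [D.sol_zero]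
      exact hcomm _
    rw [e1, e2, h1, sub_eq_add_neg, ← intervalIntegral.integral_neg]
    congr 1
    refine intervalIntegral.integral_congr fun s _ => ?_
    have h2 : multV (cutSym N fun _ => 1) (Z s) =
        L (D.A N (D.sol s x) - D.P N (D.force (D.sol s x))) :=
      residual_pressure hα hβ hν f (D.sol s x) N
    beta_reduce
    rw [Function.comp_apply, h2, ← map_neg, neg_sub]
  have hlim : Tendsto (fun N : ℕ => ∫ t in (0 : ℝ)..M,
      (-inner ℝ (multV (cutSym N fun _ => 1) (W t)) (H' t) +
        inner ℝ (multV (cutSym N fun _ => 1) (Z t)) (H t))) atTop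
      (𝓝 (∫ t in (0 : ℝ)..M, (-inner ℝ (W t) (H' t) + inner ℝ (Z t) (H t)))) := by
    refine intervalIntegral.tendsto_integral_filter_of_dominated_convergence
      (fun t => ‖W t‖ * ‖H' t‖ + ‖Z t‖ * ‖H t‖)
      (Eventually.of_forall fun N => Continuous.aestronglyMeasurable ?_)
      (Eventually.of_forall fun N => Eventually.of_forall fun t _ => ?_)
      (Continuous.intervalIntegrable (by fun_prop) _ _) (Eventually.of_forall fun t _ => ?_)
    · exact (((multV _).continuous.comp hWc).inner hHc').neg.add
        (((multV _).continuous.comp hZc).inner hHc)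
    · have hb : ∀ v : V3, ‖multV (cutSym N fun _ => 1) v‖ ≤ ‖v‖ := fun v => by
        simpa using norm_multV_le (isSymbol_cutOne N) (norm_cutOne_le N) v
      refine (norm_add_le _ _).trans (add_le_add ?_ ?_)
      · rw [norm_neg]
        exact (norm_inner_le_norm _ _).trans (mul_le_mul_of_nonneg_right (hb _) (norm_nonneg _))
      · exact (norm_inner_le_norm _ _).trans (mul_le_mul_of_nonneg_right (hb _) (norm_nonneg _))
    · exact ((tendsto_multV_cutOne (W t)).inner tendsto_const_nhds).neg.add
        ((tendsto_multV_cutOne (Z t)).inner tendsto_const_nhds)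
  have hlim0 : Tendsto (fun N : ℕ => inner ℝ (multV (cutSym N fun _ => 1) (W 0)) (H 0)) atTop
      (𝓝 (inner ℝ (W 0) (H 0))) := (tendsto_multV_cutOne (W 0)).inner tendsto_const_nhds
  have hfin := tendsto_nhds_unique (hlim.congr hN) hlim0
  have hW0 : W 0 = multV (fun ξ => rSym α ξ * sSym α ξ) x.1 := by
    rw [hW]
    simp only
    rw [D.sol_zero]
  rw [← hW0, ← hfin, intervalIntegral.integral_of_le hM0]
  refine setIntegral_eq_of_subset_of_forall_sdiff_eq_zero measurableSet_Ioi Ioc_subset_Ioi_self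
    fun t ht => ?_
  have htM : M ≤ t := by
    by_contra hc
    exact ht.2 ⟨ht.1, (not_le.1 hc).le⟩
  change -inner ℝ (W t) (H' t) + inner ℝ (Z t) (H t) = 0
  rw [hHM t htM, hHM' t htM, inner_zero_right, inner_zero_right, neg_zero, add_zero]

end StrongToWeak

/-! ### Spatial regularity of solutions -/

section Smoothing

variable {α : ℝ}

/-- The operator `(1 - α²Δ)^{1/2}` cut off at frequency `N`. -/
def cutRoot (α : ℝ) (N : ℕ) : V3 →L[ℝ] V3 := multV (cutSym N fun ξ => √(1 + α ^ 2 * lam ξ))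

theorem isSymbol_cutRoot (α : ℝ) (N : ℕ) : IsSymbol (cutSym N fun ξ => √(1 + α ^ 2 * lam ξ)) :=
  isSymbol_cutSym N (continuous_one_add α).sqrt fun ξ => by rw [lam_neg]

theorem cutRoot_multV_sSym (N : ℕ) (c : V3) :
    cutRoot α N (multV (sSym α) c) = multV (cutSym N fun _ => 1) c :=
  multV_multV (isSymbol_cutRoot α N) (isSymbol_sSym α) (fun ξ => by
    by_cases hξ : ‖ξ‖ ≤ N
    · simp only [cutSym_of_mem hξ, Complex.ofReal_one]
      exact invSqrt_mul_sSym α ξ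
    · simp only [cutSym_of_notMem hξ, zero_mul]) c

theorem multV_sSym_cutRoot (N : ℕ) (a : V3) :
    multV (sSym α) (cutRoot α N a) = multV (cutSym N fun _ => 1) a := by
  rw [← cutRoot_multV_sSym, cutRoot, multV_multV (isSymbol_sSym α) (isSymbol_cutRoot α N)
    (fun _ => rfl), multV_multV (isSymbol_cutRoot α N) (isSymbol_sSym α) (fun _ => mul_comm _ _)]

/-- A weak limit of the bounded `cutRoot α N a` is the preimage. A bound for infinitely many N
suffices, which is what a finite lower limit provides. -/
theorem exists_multV_sSym_eq {a : V3} {C : ℝ} (h : ∃ᶠ N in atTop, ‖cutRoot α N a‖ ≤ C) :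
    ∃ c, multV (sSym α) c = a := by
  have : (atTop ⊓ 𝓟 {N : ℕ | ‖cutRoot α N a‖ ≤ C}).NeBot := frequently_mem_iff_neBot.1 h
  set 𝒰 := Ultrafilter.of (atTop ⊓ 𝓟 {N : ℕ | ‖cutRoot α N a‖ ≤ C}) with h𝒰
  have hle : (𝒰 : Filter ℕ) ≤ atTop ⊓ 𝓟 {N : ℕ | ‖cutRoot α N a‖ ≤ C} := Ultrafilter.of_le _
  obtain ⟨c, -, hc⟩ := exists_weak_limit 𝒰 (y := fun N => cutRoot α N a) (R := C)
    (hle (mem_inf_of_right (mem_principal_self _)))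
  refine ⟨c, ext_inner_right ℝ fun φ => ?_⟩
  rw [inner_multV_of_real (isSymbol_sSym α) (conj_sSym α)]
  refine tendsto_nhds_unique (hc _) ?_
  have h1 : Tendsto (fun N => inner ℝ (multV (cutSym N fun _ => 1) a) φ) 𝒰 (𝓝 (inner ℝ a φ)) :=
    ((tendsto_multV_cutOne a).mono_left (hle.trans inf_le_left)).inner tendsto_const_nhds
  refine h1.congr fun N => ?_
  rw [← multV_sSym_cutRoot, inner_multV_of_real (isSymbol_sSym α) (conj_sSym α)]

/-- Fatou makes the lower limit of ‖`cutRoot α N (a t)`‖² finite for almost every t, so a preimage c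
exists there. It is the strong limit of continuous functions, hence measurable, and the lower limit
equals its squared norm. -/
theorem exists_multV_sSym_memLp {a : ℝ → V3} (ha : Continuous a)
    (h : ∀ T, ∃ K, ∀ N, ∫ t in Ioc 0 T, ‖cutRoot α N (a t)‖ ^ 2 ≤ K) :
    ∃ c : ℝ → V3, (∀ T, MemLp c 2 (volume.restrict (Ioc 0 T))) ∧
      ∀ᵐ t ∂volume.restrict (Ioi (0 : ℝ)), multV (sSym α) (c t) = a t := by
  classical
  set c : ℝ → V3 := fun t => if h : ∃ c, multV (sSym α) c = a t then h.choose else 0 with hc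
  have hcs : ∀ t, (∃ c, multV (sSym α) c = a t) → multV (sSym α) (c t) = a t := fun t ht => by
    rw [hc]
    simp only [dif_pos ht]
    exact ht.choose_spec
  have hcont : ∀ N, Continuous fun t => cutRoot α N (a t) := fun N => (cutRoot α N).continuous.comp ha
  set G : ℕ → ℝ → ℝ≥0∞ := fun N t => ENNReal.ofReal (‖cutRoot α N (a t)‖ ^ 2) with hG
  have hGm : ∀ N, Measurable (G N) := fun N =>
    ENNReal.measurable_ofReal.comp ((hcont N).norm.pow 2).measurable
  have hfat : ∀ T, ∫⁻ t in Ioc 0 T, liminf (fun N => G N t) atTop < ⊤ := fun T => by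
    obtain ⟨K, hK⟩ := h T
    refine (lintegral_liminf_le hGm).trans_lt ?_
    refine lt_of_le_of_lt (b := ENNReal.ofReal K) ?_ ENNReal.ofReal_lt_top
    refine liminf_le_of_frequently_le' (Frequently.of_forall fun N => ?_)
    rw [hG]
    simp only
    rw [← ofReal_integral_eq_lintegral_ofReal]
    · exact ENNReal.ofReal_le_ofReal (hK N)
    · exact (((hcont N).norm.pow 2).integrableOn_Icc (a := 0) (b := T)).mono_set Ioc_subset_Icc_self
    · exact Eventually.of_forall fun t => sq_nonneg _
  have hex : ∀ T, ∀ᵐ t ∂volume.restrict (Ioc 0 T), ∃ c, multV (sSym α) c = a t := fun T => by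
    filter_upwards [ae_lt_top (Measurable.liminf hGm) (hfat T).ne] with t ht
    set L := liminf (fun N => G N t) atTop + 1 with hL
    have hLt : L < ⊤ := ENNReal.add_lt_top.2 ⟨ht, ENNReal.one_lt_top⟩
    have hfr : ∃ᶠ N in atTop, G N t < L :=
      frequently_lt_of_liminf_lt (by isBoundedDefault) (ENNReal.lt_add_right ht.ne one_ne_zero)
    refine exists_multV_sSym_eq (C := √L.toReal) (hfr.mono fun N hN => ?_)
    refine Real.le_sqrt_of_sq_le ?_
    have h1 := ENNReal.toReal_mono hLt.ne hN.le
    rwa [hG, ENNReal.toReal_ofReal (sq_nonneg _)] at h1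
  have hlim : ∀ t, (∃ c, multV (sSym α) c = a t) →
      Tendsto (fun N => cutRoot α N (a t)) atTop (𝓝 (c t)) := fun t ht => by
    rw [← hcs t ht]
    simp only [cutRoot_multV_sSym]
    exact tendsto_multV_cutOne _
  refine ⟨c, fun T => ?_, ?_⟩
  · have hm : AEStronglyMeasurable c (volume.restrict (Ioc 0 T)) :=
      aestronglyMeasurable_of_tendsto_ae atTop (fun N => (hcont N).aestronglyMeasurable)
        ((hex T).mono hlim)
    rw [memLp_two_iff_integrable_sq_norm hm]
    refine ⟨(hm.norm.pow 2), ?_⟩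
    refine lt_of_le_of_lt (lintegral_mono_ae ?_) (hfat T)
    filter_upwards [hex T] with t ht
    have h1 : Tendsto (fun N => G N t) atTop (𝓝 (ENNReal.ofReal (‖c t‖ ^ 2))) :=
      ENNReal.tendsto_ofReal ((hlim t ht).norm.pow 2)
    rw [h1.liminf_eq, ← ofReal_norm, norm_pow, norm_norm]
  · have h1 : ∀ n : ℕ, ∀ᵐ t ∂(volume : Measure ℝ), t ∈ Ioc (0 : ℝ) n →
        multV (sSym α) (c t) = a t := fun n =>
      (ae_restrict_iff' measurableSet_Ioc).1 ((hex n).mono hcs)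
    rw [ae_restrict_iff' measurableSet_Ioi]
    filter_upwards [ae_all_iff.2 h1] with t ht htm
    exact ht ⌈t⌉₊ ⟨htm, Nat.le_ceil t⟩

end Smoothing

section EnergyRegularity

variable {α β ν : ℝ} (hα : 0 < α) (hβ : 0 < β) (hν : 0 < ν)

theorem norm_sq_cutRoot (N : ℕ) (a : solenoidal α) : ‖cutRoot α N a.1‖ ^ 2 =
    ‖multY hα (isSymbol_cutOne N) a‖ ^ 2 + ‖multY hα (isSymbol_cutSqrt (α ^ 2) N) a‖ ^ 2 := by
  have h := inner_multY_cutDamp (β := 1) hα (sq_nonneg α) N a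
  rw [one_mul] at h
  have e : cutRoot α N a.1 = (multY hα (isSymbol_cutRoot α N) a).1 := rfl
  rw [← h, e, ← Submodule.coe_norm, ← real_inner_self_eq_norm_sq,
    inner_multY hα (isSymbol_cutRoot α N) conj_cutSym,
    multY_multY hα (isSymbol_cutRoot α N) (isSymbol_cutRoot α N) (isSymbol_cutDamp 1 (α ^ 2) N)
      (fun ξ => ?_), real_inner_comm]
  rw [cutSym_mul]
  congr 1
  funext η
  rw [Real.mul_self_sqrt (one_add_pos α η).le, dampSym]

theorem norm_sq_cutSqrt_le (hν : 0 < ν) (N : ℕ) (a : solenoidal α) :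
    ‖multY hα (isSymbol_cutSqrt (α ^ 2) N) a‖ ^ 2 ≤
      α ^ 2 / ν * ‖multY hα (isSymbol_cutSqrt ν N) a‖ ^ 2 := by
  have h0 : (0 : ℝ) ≤ α ^ 2 / ν := by positivity
  have hle : ∀ k, ‖mult (cutSym N fun ξ => √(α ^ 2 * lam ξ)) (a.1 k)‖ ≤
      √(α ^ 2 / ν) * ‖mult (cutSym N fun ξ => √(ν * lam ξ)) (a.1 k)‖ := fun k => by
    refine norm_mult_le_mul (isSymbol_cutSqrt (α ^ 2) N) (isSymbol_cutSqrt ν N) (Real.sqrt_nonneg _)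
      (fun ξ => ?_) _
    by_cases hξ : ‖ξ‖ ≤ N
    · rw [cutSym_of_mem hξ, cutSym_of_mem hξ, Complex.norm_real, Complex.norm_real,
        Real.norm_of_nonneg (Real.sqrt_nonneg _), Real.norm_of_nonneg (Real.sqrt_nonneg _),
        ← Real.sqrt_mul h0]
      refine le_of_eq (congrArg _ ?_)
      field_simp
    · rw [cutSym_of_notMem hξ, cutSym_of_notMem hξ, norm_zero, mul_zero]
  rw [norm_sq_solenoidal, norm_sq_solenoidal, Finset.mul_sum]
  refine Finset.sum_le_sum fun k _ => ?_
  refine (pow_le_pow_left₀ (norm_nonneg _) (hle k) 2).trans (le_of_eq ?_)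
  rw [mul_pow, Real.sq_sqrt h0]
  rfl

/-- The weight is at least one, and the right-hand side of the energy inequality does not depend on
N. -/
theorem DampedSystem.exists_integral_diss_le {X : Type*} [NormedAddCommGroup X]
    [InnerProductSpace ℝ X] [CompleteSpace X] (D : DampedSystem X) (x : X) {T : ℝ} (hT : 0 ≤ T) :
    ∃ K, ∀ N, ∫ t in (0 : ℝ)..T, D.diss N (D.sol t x) ≤ K := by
  refine ⟨(‖x‖ ^ 2 + 2 * ∫ s in (0 : ℝ)..T, Real.exp (2 * D.β * s) *
    inner ℝ D.f (D.sol s x)) / 2, fun N => ?_⟩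
  have h1 := D.energy_le_sol x N hT
  have h2 : 0 ≤ Real.exp (2 * D.β * T) * ‖D.sol T x‖ ^ 2 := by positivity
  have hc : Continuous fun t => D.diss N (D.sol t x) :=
    (D.continuous_diss N).comp (D.continuous_sol x)
  have h3 : ∫ t in (0 : ℝ)..T, D.diss N (D.sol t x) ≤
      ∫ t in (0 : ℝ)..T, Real.exp (2 * D.β * t) * D.diss N (D.sol t x) := by
    refine intervalIntegral.integral_mono_on hT (hc.intervalIntegrable _ _)
      (Continuous.intervalIntegrable (by fun_prop) _ _) fun t ht => ?_
    refine le_mul_of_one_le_left (D.diss_nonneg N _) (Real.one_le_exp ?_)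
    have := D.β_pos
    have := ht.1
    positivity
  linarith

/-- Up to the factor α²/ν the dissipation controls the α²λ part of 1 + α²λ, so its time integral
bounds a half power of 1 - α²Δ more than the energy does. -/
theorem exists_smoother_sol (f x : solenoidal α) : ∃ c : ℝ → V3,
    (∀ T, MemLp c 2 (volume.restrict (Ioc 0 T))) ∧ ∀ᵐ t ∂volume.restrict (Ioi (0 : ℝ)),
      multV (sSym α) (c t) = ((bardinaSystem hα hβ hν f).sol t x).1 := by
  set D := bardinaSystem hα hβ hν f with hD
  have hac := D.continuous_sol x
  refine exists_multV_sSym_memLp (continuous_subtype_val.comp hac) fun T => ?_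
  rcases lt_or_ge T 0 with hT | hT
  · refine ⟨0, fun N => ?_⟩
    rw [Ioc_eq_empty (not_lt.2 hT.le)]
    simp
  obtain ⟨K, hK⟩ := D.exists_integral_diss_le x hT
  refine ⟨(∫ t in (0 : ℝ)..T, ‖D.sol t x‖ ^ 2) + α ^ 2 / ν * K, fun N => ?_⟩
  have hdc : Continuous fun t => D.diss N (D.sol t x) := (D.continuous_diss N).comp hac
  rw [← intervalIntegral.integral_of_le hT]
  have h1 : ∫ t in (0 : ℝ)..T, ‖cutRoot α N (D.sol t x).1‖ ^ 2 ≤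
      ∫ t in (0 : ℝ)..T, (‖D.sol t x‖ ^ 2 + α ^ 2 / ν * D.diss N (D.sol t x)) := by
    refine intervalIntegral.integral_mono_on hT
      ((((cutRoot α N).continuous.comp (continuous_subtype_val.comp hac)).norm.pow
        2).intervalIntegrable _ _) (Continuous.intervalIntegrable (by fun_prop) _ _) fun t _ => ?_
    rw [norm_sq_cutRoot hα, hD, diss_bardinaSystem]
    refine add_le_add (pow_le_pow_left₀ (norm_nonneg _) ?_ 2) (norm_sq_cutSqrt_le hα hν N _)
    simpa using norm_multY_le hα (isSymbol_cutOne N) (norm_cutOne_le N) (D.sol t x)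
  refine h1.trans ?_
  rw [intervalIntegral.integral_add (f := fun t => ‖D.sol t x‖ ^ 2)
    ((hac.norm.pow 2).intervalIntegrable _ _)
    ((hdc.const_mul _).intervalIntegrable _ _), intervalIntegral.integral_const_mul]
  have : (0 : ℝ) ≤ α ^ 2 / ν := by positivity
  gcongr
  exact hK N

end EnergyRegularity

/-! ### Local Sobolev regularity of the velocity and the pressure -/

theorem Continuous.memLp_Ioc {F : Type*} [NormedAddCommGroup F] {g : ℝ → F} (hg : Continuous g)
    (q : ℝ≥0∞) (T : ℝ) : MemLp g q (volume.restrict (Ioc 0 T)) := by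
  obtain ⟨C, hC⟩ := (isCompact_Icc (a := (0 : ℝ)) (b := T)).exists_bound_of_continuousOn
    hg.continuousOn
  have : IsFiniteMeasure (volume.restrict (Ioc 0 T)) := ⟨by simp⟩
  refine MemLp.of_bound hg.aestronglyMeasurable C ?_
  filter_upwards [ae_restrict_mem measurableSet_Ioc] with t ht
  exact hC t (Ioc_subset_Icc_self ht)

section Sobolev

variable {α : ℝ} (hα : 0 < α)

/-- The field with components `∂ⱼ ∂ᵢ (1 - α²Δ)⁻¹ cₖ`. -/
def hessField (α : ℝ) (i j : Fin 3) : V3 →L[ℝ] L2 E3 :=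
  vec ∘L ContinuousLinearMap.pi fun k => mult (fun ξ => dSym j ξ * (dSym i ξ * rSym α ξ)) ∘L
    PiLp.proj (𝕜 := ℝ) 2 (fun _ : Fin 3 => L2 ℝ) k

theorem comp_hessField (i j k : Fin 3) (c : V3) : comp k (hessField α i j c) =
    mult (fun ξ => dSym j ξ * (dSym i ξ * rSym α ξ)) (c k) :=
  comp_vec k _

theorem isSymbol_hess (hα : 0 < α) (i j : Fin 3) :
    IsSymbol fun ξ => dSym j ξ * (dSym i ξ * rSym α ξ) := by
  have h := isSymbol_dSym_mul_dSym_mul_rSym hα j i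
  simpa only [mul_assoc] using h

theorem isWeakPartial_besselGrad (hα : 0 < α) (i j : Fin 3) {a c : V3}
    (h : multV (sSym α) c = a) : IsWeakPartial j (besselGrad α i a) (hessField α i j c) := by
  refine isWeakPartial_comp.2 fun k => ?_
  rw [comp_besselGrad, comp_hessField, ← h, multV_apply, mult_dSym_mult_sSym hα]
  exact isWeakPartial_mult hα (isSymbol_dSym_mul_rSym hα i) (isSymbol_hess hα i j) (c k)

/-- Since a = (1 - α²Δ)^{-1/2} c, the velocity is (1 - α²Δ)^{-1} c, and its second derivatives are
bounded multipliers of c. -/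
theorem memL2LocSobolev_besselField (hα : 0 < α) {a c : ℝ → V3} (ha : Continuous a)
    (hc : ∀ T, MemLp c 2 (volume.restrict (Ioc 0 T)))
    (h : ∀ᵐ t ∂volume.restrict (Ioi (0 : ℝ)), multV (sSym α) (c t) = a t) :
    MemL2LocSobolev 2 fun t => besselField α (a t) := by
  refine ⟨fun T => ((besselField α).continuous.comp ha).memLp_Ioc 2 T, fun i =>
    ⟨fun t => besselGrad α i (a t), Eventually.of_forall fun t =>
      isWeakPartial_besselField hα i (a t), fun T =>
      ((besselGrad α i).continuous.comp ha).memLp_Ioc 2 T, fun j =>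
      ⟨fun t => hessField α i j (c t), ?_, fun T => (hessField α i j).comp_memLp' (hc T)⟩⟩⟩
  filter_upwards [h] with t ht
  exact isWeakPartial_besselGrad hα i j ht

/-- The operator `Q ↦ ∑ₖⱼ ∂ₖ ∂ⱼ (-Δ)⁻¹ Qₖⱼ`. -/
def rieszSum : (Fin 3 → Fin 3 → L2 ℝ) →L[ℝ] L2 ℝ :=
  ∑ k, ∑ j, mult (rieszSym k j) ∘L
    ContinuousLinearMap.proj (R := ℝ) (φ := fun _ : Fin 3 => L2 ℝ) j ∘L
    ContinuousLinearMap.proj (R := ℝ) (φ := fun _ : Fin 3 => Fin 3 → L2 ℝ) k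

theorem rieszSum_apply (Q : Fin 3 → Fin 3 → L2 ℝ) :
    rieszSum Q = ∑ k, ∑ j, mult (rieszSym k j) (Q k j) := by
  simp [rieszSum, sum_apply]

theorem isWeakPartial_rieszSum (hα : 0 < α) {m : E3 → ℂ} (hm : IsSymbol m) (l : Fin 3)
    {Q G : Fin 3 → Fin 3 → L2 ℝ} (h : ∀ k j, IsWeakPartial l (Q k j) (G k j)) :
    IsWeakPartial l (mult m (rieszSum Q)) (mult m (rieszSum G)) := by
  rw [isWeakPartial_iff hα, mult_comm (isSymbol_rSym α) hm,
    mult_comm (isSymbol_dSym_mul_rSym hα l) hm, rieszSum_apply, rieszSum_apply]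
  congr 1
  simp only [map_sum]
  refine Finset.sum_congr rfl fun k _ => Finset.sum_congr rfl fun j _ => ?_
  rw [mult_comm (isSymbol_rSym α) (isSymbol_rieszSym k j),
    mult_comm (isSymbol_dSym_mul_rSym hα l) (isSymbol_rieszSym k j),
    (isWeakPartial_iff hα).1 (h k j)]

/-- The filter absorbs two derivatives. The third falls on a product of velocity components; by
Leibniz each term pairs a derivative controlled by c, square integrable in time, with a factor
bounded in time on [0, T]. -/
theorem memL2LocSobolev_pressure {a c : ℝ → V3} (ha : Continuous a)
    (hc : ∀ T, MemLp c 2 (volume.restrict (Ioc 0 T)))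
    (h : ∀ᵐ t ∂volume.restrict (Ioi (0 : ℝ)), multV (sSym α) (c t) = a t) :
    MemL2LocSobolev 3 fun t => mult (rSym α) (pres hα (a t)) := by
  have hπ : Continuous fun t => pres hα (a t) := (continuous_pres hα).comp ha
  have hm : ∀ m : E3 → ℂ, ∀ T,
      MemLp (fun t => mult m (pres hα (a t))) 2 (volume.restrict (Ioc 0 T)) := fun m T =>
    ((mult m).continuous.comp hπ).memLp_Ioc 2 T
  have hpres : ∀ t, pres hα (a t) = rieszSum fun k j => besselMul hα (a t k) (a t j) := fun t => by
    rw [rieszSum_apply, pres]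
  set G : Fin 3 → ℝ → Fin 3 → Fin 3 → L2 ℝ := fun l t k j =>
    besselMul hα (mult (fun ξ => dSym l ξ * sSym α ξ) (c t k)) (a t j) +
      besselMul hα (a t k) (mult (fun ξ => dSym l ξ * sSym α ξ) (c t j)) with hG
  have hGm : ∀ l T, MemLp (G l) 2 (volume.restrict (Ioc 0 T)) := fun l T => by
    have hcomp : ∀ k, MemLp (fun t => mult (fun ξ => dSym l ξ * sSym α ξ) (c t k)) 2
        (volume.restrict (Ioc 0 T)) := fun k =>
      (mult (fun ξ => dSym l ξ * sSym α ξ) ∘L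
        PiLp.proj (𝕜 := ℝ) 2 (fun _ : Fin 3 => L2 ℝ) k).comp_memLp' (hc T)
    have hacomp : ∀ k, MemLp (fun t => a t k) ⊤ (volume.restrict (Ioc 0 T)) := fun k =>
      ((PiLp.proj (𝕜 := ℝ) 2 (fun _ : Fin 3 => L2 ℝ) k).continuous.comp ha).memLp_Ioc ⊤ T
    refine MemLp.of_eval fun k => MemLp.of_eval fun j => ?_
    exact ((besselMul hα).memLp_of_bilin 2 (hcomp k) (hacomp j)).add
      ((besselMul hα).memLp_of_bilin 2 (hacomp k) (hcomp j))
  refine ⟨hm _, fun i => ⟨fun t => mult (fun ξ => dSym i ξ * rSym α ξ) (pres hα (a t)),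
    Eventually.of_forall fun t => isWeakPartial_mult hα (isSymbol_rSym α)
      (isSymbol_dSym_mul_rSym hα i) _, hm _, fun j =>
    ⟨fun t => mult (fun ξ => dSym j ξ * (dSym i ξ * rSym α ξ)) (pres hα (a t)),
    Eventually.of_forall fun t => isWeakPartial_mult hα (isSymbol_dSym_mul_rSym hα i)
      (isSymbol_hess hα i j) _, hm _, fun l =>
    ⟨fun t => mult (fun ξ => dSym j ξ * (dSym i ξ * rSym α ξ)) (rieszSum (G l t)), ?_,
      fun T => (mult _ ∘L rieszSum).comp_memLp' (hGm l T)⟩⟩⟩⟩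
  filter_upwards [h] with t ht
  rw [hpres]
  refine isWeakPartial_rieszSum hα (isSymbol_hess hα i j) l fun k j => ?_
  have h1 := isWeakPartial_besselMul hα l (c t k) (c t j)
  have h2 : ∀ k, mult (sSym α) (c t k) = a t k := fun k => congrArg (fun v : V3 => v k) ht
  rw [h2, h2] at h1
  exact h1

end Sobolev

/-! ### Existence of weak solutions and the semigroup -/

section Main

variable {α β ν : ℝ} (hα : 0 < α) (hβ : 0 < β) (hν : 0 < ν)

/-- The solution of the damped Navier-Stokes-Bardina equations. -/
def bardinaSol (f : energySpace α) (t : ℝ) (u₀ : energySpace α) : energySpace α :=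
  toEnergy hα ((bardinaSystem hα hβ hν ((toEnergy hα).symm f)).sol t ((toEnergy hα).symm u₀))

theorem symm_bardinaSol (f : energySpace α) (t : ℝ) (u₀ : energySpace α) :
    (toEnergy hα).symm (bardinaSol hα hβ hν f t u₀) =
      (bardinaSystem hα hβ hν ((toEnergy hα).symm f)).sol t ((toEnergy hα).symm u₀) :=
  (toEnergy hα).symm_apply_apply _

theorem continuous_bardinaSol (f u₀ : energySpace α) :
    Continuous fun t => bardinaSol hα hβ hν f t u₀ :=
  (toEnergy hα).continuous.comp (DampedSystem.continuous_sol _ _)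

theorem isWeakSolution_bardinaSol (f u₀ : energySpace α) :
    ∃ p, IsWeakSolution α β ν f u₀ (fun t => bardinaSol hα hβ hν f t u₀) p := by
  set D := bardinaSystem hα hβ hν ((toEnergy hα).symm f) with hD
  set x := (toEnergy hα).symm u₀ with hx
  have hac : Continuous fun t => (D.sol t x).1 := continuous_subtype_val.comp (D.continuous_sol x)
  obtain ⟨c, hc, hca⟩ := exists_smoother_sol hα hβ hν ((toEnergy hα).symm f) x
  refine ⟨fun t => mult (rSym α) (pres hα (D.sol t x).1), ?_, ?_, ?_, fun φ hφ => ?_⟩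
  · have : SecondCountableTopologyEither ℝ (energySpace α) := ⟨Or.inl inferInstance⟩
    refine memLp_top_of_bound
      ((continuous_bardinaSol hα hβ hν f u₀).aestronglyMeasurable) (‖x‖ + ‖D.f‖ / D.β) ?_
    filter_upwards [ae_restrict_mem measurableSet_Ioi] with t ht
    rw [bardinaSol, LinearIsometryEquiv.norm_map]
    exact D.norm_sol_le le_rfl (le_of_lt ht)
  · have h := memL2LocSobolev_besselField hα hac hc hca
    exact h
  · exact memL2LocSobolev_pressure hα hac hc hca
  · rw [weakEquation_iff hα β ν f u₀ (fun t => bardinaSol hα hβ hν f t u₀) _ hφ]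
    simp only [symm_bardinaSol]
    exact sol_weak_equation hα hβ hν ((toEnergy hα).symm f) x hφ

theorem IsWeakSolution.ae_eq_bardinaSol {f u₀ : energySpace α} {u : ℝ → energySpace α}
    {p : ℝ → L2 ℝ} (H : IsWeakSolution α β ν f u₀ u p) :
    ∀ᵐ t ∂volume.restrict (Ioi (0 : ℝ)), u t = bardinaSol hα hβ hν f t u₀ := by
  filter_upwards [(H.isAESol hα hβ hν).eq_sol] with t ht
  rw [bardinaSol, ← ht, LinearIsometryEquiv.apply_symm_apply]

/-- A continuous weak solution exists, so the choice in the definition of the semigroup is never the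
default value. -/
theorem bardinaSemigroup_spec (hα : 0 < α) (hβ : 0 < β) (hν : 0 < ν) (f u₀ : energySpace α) :
    ContinuousOn (fun t => bardinaSemigroup α β ν f t u₀) (Ici 0) ∧
      ∃ p, IsWeakSolution α β ν f u₀ (fun t => bardinaSemigroup α β ν f t u₀) p := by
  have h : ∃ u : ℝ → energySpace α, ContinuousOn u (Ici 0) ∧
      ∃ p : ℝ → L2 ℝ, IsWeakSolution α β ν f u₀ u p :=
    ⟨_, (continuous_bardinaSol hα hβ hν f u₀).continuousOn,
      isWeakSolution_bardinaSol hα hβ hν f u₀⟩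
  have e : (fun t => bardinaSemigroup α β ν f t u₀) = h.choose := funext fun t => by
    rw [bardinaSemigroup, dif_pos h]
  rw [e]
  exact h.choose_spec

/-- Two weak solutions continuous on [0, ∞) agree almost everywhere, hence everywhere there, so the
chosen solution is independent of the choice for t ≥ 0. -/
theorem bardinaSemigroup_eq (f u₀ : energySpace α) {t : ℝ} (ht : 0 ≤ t) :
    bardinaSemigroup α β ν f t u₀ = bardinaSol hα hβ hν f t u₀ := by
  obtain ⟨hc, p, hp⟩ := bardinaSemigroup_spec hα hβ hν f u₀
  exact DampedSystem.eq_of_ae_eq hc (continuous_bardinaSol hα hβ hν f u₀).continuousOn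
    (hp.ae_eq_bardinaSol hα hβ hν) ht

theorem isGlobalAttractor_image {X Y : Type*} [NormedAddCommGroup X] [NormedSpace ℝ X]
    [NormedAddCommGroup Y] [NormedSpace ℝ Y] (e : X ≃ₗᵢ[ℝ] Y) {S : ℝ → X → X} {S' : ℝ → Y → Y}
    (h : ∀ t, 0 ≤ t → ∀ y, S' t y = e (S t (e.symm y))) {A : Set X} (hA : IsGlobalAttractor S A) :
    IsGlobalAttractor S' (e '' A) := by
  refine ⟨hA.compact.image e.continuous, fun t ht => ?_, fun B hB V hV => ?_⟩
  · conv_rhs => rw [← hA.invariant t ht]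
    rw [image_image, image_image]
    refine image_congr fun x _ => ?_
    rw [h t ht, LinearIsometryEquiv.symm_apply_apply]
  · have hV' : e ⁻¹' V ∈ 𝓝ˢ A :=
      (e.continuous.tendsto_nhdsSet (mapsTo_image e A)) hV
    obtain ⟨T, hT, hTV⟩ := hA.attracts (e.symm '' B)
      (e.symm.lipschitz.isBounded_image hB) _ hV'
    refine ⟨T, hT, fun t ht => ?_⟩
    rintro _ ⟨y, hy, rfl⟩
    rw [h t (hT.trans ht).le]
    exact hTV t ht ⟨_, ⟨y, hy, rfl⟩, rfl⟩

end Main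

theorem mainTheorem3 (α β ν : ℝ) (hα : 0 < α) (hβ : 0 < β) (hν : 0 < ν) (f : energySpace α) :
    -- the semigroup is well defined: `t ↦ S(t) u₀` is the unique weak solution starting at `u₀`
    (∀ u₀ : energySpace α, ∃ p : ℝ → L2 ℝ,
      IsWeakSolution α β ν f u₀ (fun t => bardinaSemigroup α β ν f t u₀) p ∧
      ContinuousOn (fun t => bardinaSemigroup α β ν f t u₀) (Set.Ici 0) ∧
      ∀ (u' : ℝ → energySpace α) (p' : ℝ → L2 ℝ), IsWeakSolution α β ν f u₀ u' p' →
        ∀ᵐ t ∂(volume.restrict (Set.Ioi (0 : ℝ))),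
          u' t = bardinaSemigroup α β ν f t u₀ ∧ p' t = p t) ∧
    -- it is a semigroup
    (∀ u₀ : energySpace α, bardinaSemigroup α β ν f 0 u₀ = u₀) ∧
    (∀ s t : ℝ, 0 ≤ s → 0 ≤ t → ∀ u₀ : energySpace α,
      bardinaSemigroup α β ν f (s + t) u₀ =
        bardinaSemigroup α β ν f s (bardinaSemigroup α β ν f t u₀)) ∧
    -- it has a global attractor
    ∃ A : Set (energySpace α), IsGlobalAttractor (bardinaSemigroup α β ν f) A := by
  set D := bardinaSystem hα hβ hν ((toEnergy hα).symm f) with hD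
  refine ⟨fun u₀ => ?_, fun u₀ => ?_, fun s t hs ht u₀ => ?_, ?_⟩
  · obtain ⟨hc, p, hp⟩ := bardinaSemigroup_spec hα hβ hν f u₀
    refine ⟨p, hp, hc, fun u' p' hp' => ?_⟩
    have hu : ∀ᵐ t ∂volume.restrict (Ioi (0 : ℝ)), u' t = bardinaSemigroup α β ν f t u₀ := by
      filter_upwards [hp'.ae_eq_bardinaSol hα hβ hν, hp.ae_eq_bardinaSol hα hβ hν] with t h1 h2
      rw [h1, h2]
    exact hu.and (hp'.pressure_unique hα hp hu)
  · rw [bardinaSemigroup_eq hα hβ hν f u₀ le_rfl, bardinaSol, D.sol_zero,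
      LinearIsometryEquiv.apply_symm_apply]
  · rw [bardinaSemigroup_eq hα hβ hν f u₀ (add_nonneg hs ht),
      bardinaSemigroup_eq hα hβ hν f u₀ ht, bardinaSemigroup_eq hα hβ hν f _ hs, bardinaSol,
      bardinaSol, symm_bardinaSol, D.sol_add hs ht]
  · obtain ⟨A, hA⟩ := D.exists_isGlobalAttractor_sol
    exact ⟨_, isGlobalAttractor_image (S := D.sol)
      (S' := bardinaSemigroup α β ν f) (toEnergy hα) (fun t ht y => bardinaSemigroup_eq hα hβ hν f y ht) hA⟩

end
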